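/- **Conventions.** Colours are the elements of $Col=\{0_+,0_-,1,2,\dots\}$; we write $0=0_+$, and $0_\pm+1=1$. A *tangle* is a shaded planar tangle in the sense of Jones, up to planar isotopy: an external box $D_0$ and finitely many ordered internal boxes $D_1,\dots,D_b$, where a box of colour $n$ has $2n$ marked boundary points, disjoint strands (arcs joining the marked points in pairs, and closed loops), a $*$ in one white region at every box that has marked points, and a chequerboard shading; a box without marked points has colour $0_+$ or $0_-$ according as the region around its boundary is white or black. An $n$-tangle is a tangle whose external box has colour $n$. $W\circ(S_1,\dots,S_b)$ denotes substitution of tangles into the internal boxes of $W$, the boxes of the result being ordered lexicographically. We draw boxes with $*$ at the left and with their $2n$ points as $n$ top points and $n$ bottom points. A *template* $S\Rightarrow T$ is an ordered pair of tangles of the same colour. The *consequences* of a set of templates form the smallest set of templates that contains it, contains $T\Rightarrow T$ for every tangle $T$, contains $S\Rightarrow V$ whenever it contains $S\Rightarrow T$ and $T\Rightarrow V$, and contains $W\circ(S_1,\dots,S_b)\Rightarrow W\circ(T_1,\dots,T_b)$ whenever $W$ is a tangle with $b$ internal boxes and it contains $S_i\Rightarrow T_i$, of the colour of the $i$-th box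 of $W$, for all $i$. **Tangles.** - $1^n$: $n$ vertical strands, no internal box. $C^{0_\pm}$: the $0_\pm$-tangle consisting of one closed loop. - $I_n^m$ ($n\le m$): an $n$-box with vertical strands through it, and $m-n$ vertical strands added on its right; in $I_{0_-}^m$, $m\ge1$, the box lies immediately to the right of the first of $m$ vertical strands. - $ER_m^n$ ($n\le m$): an $m$-box whose last $m-n$ top and bottom points are joined around the right; in $ER_m^{0_-}$, $m\ge 1$, the first strand is closed around the left and the others around the right. - $M_{m,n}^p$ ($|m-n|\le p\le m+n$): $D_1$, of colour $m$, above $D_2$, of colour $n$. Counting clockwise from $*$, the last $m+n-p$ points of $D_1$ are joined to the first $m+n-p$ points of $D_2$ in reverse order; the other points of $D_1$ and $D_2$ are joined to the first $m-n+p$ and the last $n-m+p$ points of $D_0$ respectively. All $*$'s lie in the region of the external $*$. $M_{0_-,0_-}^{0_-}$ consists of two $0_-$-boxes in one black region. - $E^n$ ($n\ge2$): $n-2$ vertical strands and, to their right, an arc joining the last two top points and an arc joining the last two bottom points; no internal box. - $SH_n^{n+2}$: an $n$-box with two vertical strands added on its left. - $EL_n^n$ ($n\ge1$): an $n$-box whose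 first top and bottom points are joined around its left, its other points being joined vertically to the corresponding points of $D_0$, with a vertical strand added on the far left. Fix an integer $k\ge1$. For $n\in Col$ let $T^n$ be $ER_k^n$ if $n<k$; let $T^k=I_k^k$; and let $T^{n+1}=M_{k,n}^{n+1}\circ(I_k^k,T^n)$ for $n\ge k$ (so $T^n$ is a stack of $n-k+1$ boxes of colour $k$, consecutive ones joined by $k-1$ strands). **Basic templates.** - Modulus: $C^{0_\pm}\Rightarrow 1^{0_\pm}$ and $1^{0_\pm}\Rightarrow C^{0_\pm}$. - Jones projections: $I_n^k\circ E^n\Rightarrow I_k^k$ for $2\le n\le k$. - Multiplication: $M_{k,k}^k\Rightarrow I_k^k$. - Conditional expectation: $I_{k-1}^k\circ ER_k^{k-1}\Rightarrow I_k^k$. - Depth: $1^{k+1}\Rightarrow T^{k+1}$. - Shift: $SH_k^{k+2}\Rightarrow T^{k+2}$. **Theorem.** The following templates are all consequences of the basic templates. 1. $1^k\Rightarrow T^k$. 2. $I_k^{k+1}\Rightarrow T^{k+1}$. 3. For all $n\in Col$, $ER_{n+1}^n\circ T^{n+1}\Rightarrow T^n$. 4. For all $n\ge k$, $I_n^{n+1}\circ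 T^n\Rightarrow T^{n+1}$. 5. For all $n\ge k$, $I_k^n\Rightarrow T^n$ and $1^n\Rightarrow T^n$. 6. For all $n\ge k$, $M_{n,n}^n\circ(T^n,T^n)\Rightarrow T^n$. 7. $1^{0_\pm}\Rightarrow T^{0_\pm}$, and for all $n\ge2$, $E^n\Rightarrow T^n$. 8. For all $n\ge k$ and every Temperley–Lieb tangle $Q^n$ (an $n$-tangle without internal boxes), $Q^n\Rightarrow T^n$. 9. For all $n\ge k$, $SH_n^{n+2}\circ T^n\Rightarrow T^{n+2}$. 10. For all $n\ge1$, $EL_n^n\circ T^n\Rightarrow T^n$. 11. For all $n\in Col$, $I_n^{n+1}\circ T^n\Rightarrow T^{n+1}$. 12. For all $n\in Col$, $M_{n,n}^n\circ(T^n,T^n)\Rightarrow T^n$. -/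

import Mathlib

/-! Planar tangles, encoded combinatorially through their strands and regions; templates and their
consequences. -/

namespace Skein

/-- The colours `0₊ = box 0`, `0₋`, `1 = box 1`, `2 = box 2`, and so on. -/
inductive Col where
  | box (n : ℕ)
  | zeroMinus
deriving DecidableEq

namespace Col

/-- A box of colour `c` has `2 * c.size` marked points. -/
def size : Col → ℕ
  | box n => n
  | zeroMinus => 0

/-- `n ↦ n + 1`, where `0₋ + 1 = 1`. -/
def succ : Col → Col
  | box n => box (n + 1)
  | zeroMinus => box 1

/-- The number of segments into which the marked points divide the boundary of a box: a box
without marked points has one boundary segment. -/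
def segs (c : Col) : ℕ := max 1 (2 * c.size)

theorem segs_pos (c : Col) : 0 < c.segs := lt_of_lt_of_le one_pos (le_max_left _ _)

/-- Boundary segment number `j`, read cyclically. Segment `0` is the `*`-segment, and marked point
number `j` (`0 ≤ j < 2 * c.size`, clockwise from `*`) lies between segments `j` and `j + 1`. -/
def seg (c : Col) (j : ℕ) : Fin c.segs := ⟨j % c.segs, Nat.mod_lt _ c.segs_pos⟩

/-- The shading of the boundary segments: it alternates and is white at `*`, except that the only
segment of a `0₋`-box is black. -/
def segShaded : (c : Col) → Fin c.segs → Bool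
  | box _, s => decide (s.val % 2 = 1)
  | zeroMinus, _ => true

/-- The white segment next to a marked point. -/
def whiteSeg (c : Col) (p : Fin (2 * c.size)) : Fin c.segs :=
  c.seg (if p.val % 2 = 0 then p.val else p.val + 1)

/-- The black segment next to a marked point. -/
def blackSeg (c : Col) (p : Fin (2 * c.size)) : Fin c.segs :=
  c.seg (if p.val % 2 = 0 then p.val + 1 else p.val)

theorem shaded_whiteSeg (c : Col) (p : Fin (2 * c.size)) :
    c.segShaded (c.whiteSeg p) = false := by
  cases c with
  | zeroMinus => exact absurd p.isLt (by simp [size])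
  | box n =>
    have h := p.isLt
    simp only [size] at h
    simp only [segShaded, whiteSeg, seg, segs, size, decide_eq_false_iff_not]
    have h1 : max 1 (2 * n) = 2 * n := by omega
    rw [h1, Nat.mod_mod_of_dvd _ ⟨n, rfl⟩]
    split_ifs <;> omega

theorem shaded_blackSeg (c : Col) (p : Fin (2 * c.size)) :
    c.segShaded (c.blackSeg p) = true := by
  cases c with
  | zeroMinus => exact absurd p.isLt (by simp [size])
  | box n =>
    have h := p.isLt
    simp only [size] at h
    simp only [segShaded, blackSeg, seg, segs, size, decide_eq_true_eq]
    have h1 : max 1 (2 * n) = 2 * n := by omega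
    rw [h1, Nat.mod_mod_of_dvd _ ⟨n, rfl⟩]
    split_ifs <;> omega

end Col

/-! ### Strands and regions -/

/-- The strands and regions of a chequerboard shaded picture. Every strand has a white region on
one side and a black region on the other. (This is the dual graph of the picture.) -/
structure Net where
  Strand : Type
  Region : Type
  finStrand : Finite Strand
  finRegion : Finite Region
  shaded : Region → Bool
  white : Strand → Region
  black : Strand → Region
  shaded_white : ∀ x, shaded (white x) = false
  shaded_black : ∀ x, shaded (black x) = true

attribute [instance] Net.finStrand Net.finRegion

namespace Net

structure Hom (A B : Net) where
  strand : A.Strand → B.Strand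
  region : A.Region → B.Region
  shaded_region : ∀ r, B.shaded (region r) = A.shaded r
  white_strand : ∀ x, B.white (strand x) = region (A.white x)
  black_strand : ∀ x, B.black (strand x) = region (A.black x)

def Hom.comp {A B C : Net} (g : Hom B C) (f : Hom A B) : Hom A C where
  strand x := g.strand (f.strand x)
  region r := g.region (f.region r)
  shaded_region r := by rw [g.shaded_region, f.shaded_region]
  white_strand x := by rw [g.white_strand, f.white_strand]
  black_strand x := by rw [g.black_strand, f.black_strand]

/-- What is visible on the boundary of a box of colour `c`: a strand at every marked point and a
region at every segment. -/
def boundary (c : Col) : Net where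
  Strand := Fin (2 * c.size)
  Region := Fin c.segs
  finStrand := inferInstance
  finRegion := inferInstance
  shaded := c.segShaded
  white := c.whiteSeg
  black := c.blackSeg
  shaded_white := c.shaded_whiteSeg
  shaded_black := c.shaded_blackSeg

/-- The disjoint union of `A` and a finite family `B`. -/
def union (A : Net) {ι : Type} [Finite ι] (B : ι → Net) : Net where
  Strand := A.Strand ⊕ (Σ i, (B i).Strand)
  Region := A.Region ⊕ (Σ i, (B i).Region)
  finStrand := inferInstance
  finRegion := inferInstance
  shaded := Sum.elim A.shaded (fun r => (B r.1).shaded r.2)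
  white := Sum.map A.white (fun x => ⟨x.1, (B x.1).white x.2⟩)
  black := Sum.map A.black (fun x => ⟨x.1, (B x.1).black x.2⟩)
  shaded_white := by
    rintro (x | x)
    · exact A.shaded_white x
    · exact (B x.1).shaded_white x.2
  shaded_black := by
    rintro (x | x)
    · exact A.shaded_black x
    · exact (B x.1).shaded_black x.2

def inl (A : Net) {ι : Type} [Finite ι] (B : ι → Net) : Hom A (A.union B) where
  strand x := Sum.inl x
  region r := Sum.inl r
  shaded_region _ := rfl
  white_strand _ := rfl
  black_strand _ := rfl

def inr (A : Net) {ι : Type} [Finite ι] (B : ι → Net) (i : ι) : Hom (B i) (A.union B) where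
  strand x := Sum.inr ⟨i, x⟩
  region r := Sum.inr ⟨i, r⟩
  shaded_region _ := rfl
  white_strand _ := rfl
  black_strand _ := rfl

/-- The identifications of regions forced by identifying strands along `rs`, together with
those of `rr`. -/
def regionRel (A : Net) (rs : A.Strand → A.Strand → Prop) (rr : A.Region → A.Region → Prop)
    (r r' : A.Region) : Prop :=
  rr r r' ∨ ∃ x y, rs x y ∧
    ((r = A.white x ∧ r' = A.white y) ∨ (r = A.black x ∧ r' = A.black y))

/-- Identify strands along `rs` (and hence the regions on their sides) and regions along `rr`. -/
def quot (A : Net) (rs : A.Strand → A.Strand → Prop) (rr : A.Region → A.Region → Prop)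
    (h : ∀ r r', rr r r' → A.shaded r = A.shaded r') : Net where
  Strand := Quot rs
  Region := Quot (A.regionRel rs rr)
  finStrand := inferInstance
  finRegion := inferInstance
  shaded := Quot.lift A.shaded (by
    rintro r r' (hr | ⟨x, y, -, ⟨rfl, rfl⟩ | ⟨rfl, rfl⟩⟩)
    · exact h r r' hr
    · rw [A.shaded_white, A.shaded_white]
    · rw [A.shaded_black, A.shaded_black])
  white := Quot.lift (fun x => Quot.mk _ (A.white x))
    (fun x y hxy => Quot.sound (Or.inr ⟨x, y, hxy, Or.inl ⟨rfl, rfl⟩⟩))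
  black := Quot.lift (fun x => Quot.mk _ (A.black x))
    (fun x y hxy => Quot.sound (Or.inr ⟨x, y, hxy, Or.inr ⟨rfl, rfl⟩⟩))
  shaded_white := by
    rintro ⟨x⟩
    exact A.shaded_white x
  shaded_black := by
    rintro ⟨x⟩
    exact A.shaded_black x

def toQuot (A : Net) (rs : A.Strand → A.Strand → Prop) (rr : A.Region → A.Region → Prop)
    (h : ∀ r r', rr r r' → A.shaded r = A.shaded r') : Hom A (A.quot rs rr h) where
  strand x := Quot.mk _ x
  region r := Quot.mk _ r
  shaded_region _ := rfl
  white_strand _ := rfl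
  black_strand _ := rfl

end Net

/-! ### Diagrams and tangles -/

/-- A diagram of colour `c`: an external box of colour `c`, a finite ordered collection of internal
boxes, and the strands and regions, with the information which strand ends at which marked
point and which region lies at which boundary segment. Closed loops are the strands that
end at no marked point. A diagram need not be planar; see `Diagram.IsTangle`. -/
structure Diagram (c : Col) where
  Box : Type
  boxOrder : LinearOrder Box
  boxFinite : Finite Box
  boxCol : Box → Col
  net : Net
  out : Net.Hom (Net.boundary c) net
  inn : ∀ i : Box, Net.Hom (Net.boundary (boxCol i)) net

attribute [instance] Diagram.boxOrder Diagram.boxFinite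

namespace Diagram

/-- The marked points on the external box and on the internal boxes. -/
abbrev Mark {c : Col} (D : Diagram c) : Type :=
  Fin (2 * c.size) ⊕ (Σ i : D.Box, Fin (2 * (D.boxCol i).size))

/-- The strand that ends at a given marked point. -/
def strandAt {c : Col} (D : Diagram c) : D.Mark → D.net.Strand
  | Sum.inl p => D.out.strand p
  | Sum.inr p => (D.inn p.1).strand p.2

/-- A strand is directed so that the black region is on its left. `D.starts p` says that the strand
at `p` starts (rather than ends) at `p`. -/
def starts {c : Col} (D : Diagram c) : D.Mark → Prop
  | Sum.inl p => p.val % 2 = 0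
  | Sum.inr p => p.2.val % 2 = 1

/-- A diagram is a (planar) tangle if
* every strand is an arc that starts at one marked point and ends at one marked point,
  or is a closed loop and meets no marked point;
* the picture is connected: one can pass from any region to any other region by crossing strands;
* the picture lies on a sphere (the external box being the outside of the disc), that is, closed
  curves separate: whenever a set of strands `f` meets each box in an even number of
  points, the regions can be divided into two classes such that the strands with different classes
  on their two sides are exactly those of `f`. -/
structure IsTangle {c : Col} (D : Diagram c) : Prop where
  start_inj : ∀ p q, D.starts p → D.starts q → D.strandAt p = D.strandAt q → p = q
  end_inj : ∀ p q, ¬ D.starts p → ¬ D.starts q → D.strandAt p = D.strandAt q → p = q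
  start_iff_end : ∀ x, (∃ p, D.starts p ∧ D.strandAt p = x) ↔ ∃ p, ¬ D.starts p ∧ D.strandAt p = x
  connected : ∀ g : D.net.Region → ZMod 2, (∀ x, g (D.net.white x) = g (D.net.black x)) →
    ∀ r s, g r = g s
  jordan : ∀ f : D.net.Strand → ZMod 2,
    (∑ p : Fin (2 * c.size), f (D.out.strand p) = 0) →
    (∀ i, ∑ p : Fin (2 * (D.boxCol i).size), f ((D.inn i).strand p) = 0) →
    ∃ g : D.net.Region → ZMod 2, ∀ x, f x = g (D.net.white x) + g (D.net.black x)

/-- Planar isotopy. An isotopy class is determined by the ordered boxes with their colours and the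
incidences between marked points, boundary segments, strands and regions. -/
structure Isotopy {c : Col} (D D' : Diagram c) where
  box : D.Box ≃o D'.Box
  boxCol : ∀ i, D.boxCol i = D'.boxCol (box i)
  strand : D.net.Strand ≃ D'.net.Strand
  region : D.net.Region ≃ D'.net.Region
  shaded : ∀ r, D'.net.shaded (region r) = D.net.shaded r
  white : ∀ x, D'.net.white (strand x) = region (D.net.white x)
  black : ∀ x, D'.net.black (strand x) = region (D.net.black x)
  out_strand : ∀ p, strand (D.out.strand p) = D'.out.strand p
  out_region : ∀ s, region (D.out.region s) = D'.out.region s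
  inn_strand : ∀ i (p : Fin (2 * (D.boxCol i).size)), strand ((D.inn i).strand p) =
    (D'.inn (box i)).strand (Fin.cast (congrArg (fun d : Col => 2 * d.size) (boxCol i)) p)
  inn_region : ∀ i (s : Fin (D.boxCol i).segs), region ((D.inn i).region s) =
    (D'.inn (box i)).region (Fin.cast (congrArg Col.segs (boxCol i)) s)

/-- Substitution `W ∘ (S i)ᵢ` of diagrams into all internal boxes, the `*`'s matching: the strands
and the regions of `W` and of the `S i` are glued along the boundaries of the boxes of `W`.
The remaining boxes are ordered lexicographically. -/
def comp {c : Col} (W : Diagram c) (S : ∀ i : W.Box, Diagram (W.boxCol i)) : Diagram c where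
  Box := Σₗ i : W.Box, (S i).Box
  boxOrder := inferInstance
  boxFinite := inferInstanceAs (Finite (Σ i : W.Box, (S i).Box))
  boxCol j := (S (ofLex j).1).boxCol (ofLex j).2
  net := (W.net.union fun i => (S i).net).quot
    (fun x y => ∃ (i : W.Box) (p : Fin (2 * (W.boxCol i).size)),
      x = Sum.inl ((W.inn i).strand p) ∧ y = Sum.inr ⟨i, (S i).out.strand p⟩)
    (fun r r' => ∃ (i : W.Box) (s : Fin (W.boxCol i).segs),
      r = Sum.inl ((W.inn i).region s) ∧ r' = Sum.inr ⟨i, (S i).out.region s⟩)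
    (by
      rintro _ _ ⟨i, s, rfl, rfl⟩
      exact ((W.inn i).shaded_region s).trans ((S i).out.shaded_region s).symm)
  out := ((Net.toQuot _ _ _ _).comp (Net.inl _ _)).comp W.out
  inn j := ((Net.toQuot _ _ _ _).comp (Net.inr W.net (fun i => (S i).net) (ofLex j).1)).comp
    ((S (ofLex j).1).inn (ofLex j).2)

/-! ### Drawing diagrams

In `draw`, the pair `(0, j)` stands for marked point (or segment) number `j` of the external
box, and `(i, j)` with `i > 0` for number `j` of the `i`-th internal box. -/

/-- `t` strands joining points `i, i + 1, …` of box `a` to points `j, j + 1, …` of box `b`. -/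
def para (a i b j t : ℕ) : Set ((ℕ × ℕ) × (ℕ × ℕ)) :=
  {e | ∃ s < t, e = ((a, i + s), (b, j + s))}

/-- `t` strands joining points `i, …, i + t - 1` of box `a` to points `j + t - 1, …, j` of
box `b`. -/
def anti (a i b j t : ℕ) : Set ((ℕ × ℕ) × (ℕ × ℕ)) :=
  {e | ∃ s < t, e = ((a, i + s), (b, j + (t - 1 - s)))}

/-- The number of a marked point or boundary segment. -/
def number {b m : ℕ} {n : Fin b → ℕ} : (Fin m ⊕ (Σ i, Fin (n i))) → ℕ × ℕ
  | Sum.inl p => (0, p.val)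
  | Sum.inr p => (p.1.val + 1, p.2.val)

/-- The diagram with external box of colour `c` and internal boxes of colours `col 0, col 1, …`
whose strands are the pairs in `J`. The regions are those cut out by the connected pieces of
the picture, where pieces are placed relative to each other by declaring that the segments paired
by `A` lie in the same region. -/
def draw (c : Col) {b : ℕ} (col : Fin b → Col) (J A : Set ((ℕ × ℕ) × (ℕ × ℕ))) : Diagram c where
  Box := Fin b
  boxOrder := inferInstance
  boxFinite := inferInstance
  boxCol := col
  net := ((Net.boundary c).union fun i => Net.boundary (col i)).quot
    (fun x y => (number (b := b) (m := 2 * c.size) (n := fun i => 2 * (col i).size) x,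
      number (b := b) (m := 2 * c.size) (n := fun i => 2 * (col i).size) y) ∈ J)
    (fun r r' => (number (b := b) (m := c.segs) (n := fun i => (col i).segs) r,
      number (b := b) (m := c.segs) (n := fun i => (col i).segs) r') ∈ A ∧
      ((Net.boundary c).union fun i => Net.boundary (col i)).shaded r =
        ((Net.boundary c).union fun i => Net.boundary (col i)).shaded r')
    (fun _ _ h => h.2)
  out := (Net.toQuot _ _ _ _).comp (Net.inl _ _)
  inn i := (Net.toQuot _ _ _ _).comp (Net.inr _ (fun i => Net.boundary (col i)) i)

/-! ### The basic tangles -/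

/-- The multiplicative identity `1^c`: `c` vertical strands. -/
def one (c : Col) : Diagram c :=
  draw c (b := 0) Fin.elim0 (anti 0 0 0 c.size c.size) ∅

/-- `C^{0₊}` and `C^{0₋}` (for `c = 0₊, 0₋`): a single closed loop in a `0±`-box. -/
def loop (c : Col) (hc : c.size = 0) : Diagram c where
  Box := Fin 0
  boxOrder := inferInstance
  boxFinite := inferInstance
  boxCol := Fin.elim0
  net :=
    { Strand := Unit
      Region := Bool
      finStrand := inferInstance
      finRegion := inferInstance
      shaded := id
      white := fun _ => false
      black := fun _ => true
      shaded_white := fun _ => rfl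
      shaded_black := fun _ => rfl }
  out :=
    { strand := fun _ => ()
      region := fun s => c.segShaded s
      shaded_region := fun _ => rfl
      white_strand := fun x => absurd (show x.val < 2 * c.size from x.isLt) (by omega)
      black_strand := fun x => absurd (show x.val < 2 * c.size from x.isLt) (by omega) }
  inn i := i.elim0

/-- The inclusion `I_c^d` (`c ≤ d`), which adds vertical strands on the right of the box;
`I_c^c` is the identity tangle. In `I_{0₋}^d` with `d ≥ 1` the box lies between the first strand
and the second (if any). -/
def incl (c d : Col) : Diagram d :=
  draw d (fun _ : Fin 1 => c)
    (para 0 0 1 0 c.size ∪ para 0 (2 * d.size - c.size) 1 c.size c.size ∪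
      anti 0 c.size 0 d.size (d.size - c.size))
    {((0, if c = Col.zeroMinus ∧ d ≠ Col.zeroMinus then 1 else 0), (1, 0))}

/-- The right expectation `ER_d^c` (`c ≤ d`), which closes the last strands of the box on
the right. In `ER_d^{0₋}` with `d ≥ 1` the first strand is closed on the left and the
others on the right. -/
def er (d c : Col) : Diagram c :=
  draw c (fun _ : Fin 1 => d)
    (para 0 0 1 0 c.size ∪ para 0 c.size 1 (2 * d.size - c.size) c.size ∪
      anti 1 c.size 1 d.size (d.size - c.size))
    {((0, 0), (1, if c = Col.zeroMinus ∧ d ≠ Col.zeroMinus then 1 else 0))}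

/-- The multiplication `M_{c,d}^e` (`|c - d| ≤ e ≤ c + d`): the first box is above the second,
they are joined by `c + d - e` strands, and the other points are joined to the external box. -/
def mul (c d e : Col) : Diagram e :=
  draw e ![c, d]
    (para 0 0 1 0 (c.size + e.size - d.size) ∪
      anti 1 (c.size + e.size - d.size) 2 0 (c.size + d.size - e.size) ∪
      para 0 (c.size + e.size - d.size) 2 (c.size + d.size - e.size) (d.size + e.size - c.size))
    {((0, 0), (1, 0)), ((0, 0), (2, 0))}

/-- The Jones projection tangle `E^n`, `n ≥ 2`: `n - 2` vertical strands, followed by a cap and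
a cup. -/
def jones (n : ℕ) : Diagram (Col.box n) :=
  draw (Col.box n) (b := 0) Fin.elim0
    (anti 0 0 0 (n + 2) (n - 2) ∪ anti 0 (n - 2) 0 (n - 1) 1 ∪ anti 0 n 0 (n + 1) 1) ∅

/-- The left expectation `EL_n^n`, `n ≥ 1`: the first strand of the box is closed on the left, and
a vertical strand is put on the left of everything. -/
def el (n : ℕ) : Diagram (Col.box n) :=
  draw (Col.box n) (fun _ : Fin 1 => Col.box n)
    (anti 0 0 0 (2 * n - 1) 1 ∪ anti 1 0 1 (2 * n - 1) 1 ∪ para 0 1 1 1 (2 * n - 2))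
    {((0, 1), (1, 1))}

/-- The shift `SH_n^{n+2}`: two vertical strands are added on the left of the box. -/
def shift (n : ℕ) : Diagram (Col.box (n + 2)) :=
  draw (Col.box (n + 2)) (fun _ : Fin 1 => Col.box n)
    (anti 0 0 0 (2 * n + 2) 2 ∪ para 0 2 1 0 (2 * n))
    {((0, 2), (1, 0))}

/-- `M_{c,d}^e ∘ (S, T)`. -/
def mulComp {c d : Col} (e : Col) (S : Diagram c) (T : Diagram d) : Diagram e :=
  (mul c d e).comp fun i : Fin 2 => match i with
    | 0 => S
    | 1 => T

/-- The tangles `T^n` for `n = 0₊, 1, 2, …`. For `n ≤ k` this is `ER_k^n`, which for `n = k` is the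
identity tangle. For `n ≥ k` the tangle `T^{n+1}` is a new `k`-box on top of `T^n`, the two
being joined by the leftmost `k - 1` strands; so `T^n` has `n - k + 1` boxes of colour `k`
stacked above each other, numbered from the top. -/
def stack (k : ℕ) : (n : ℕ) → Diagram (Col.box n)
  | 0 => er (Col.box k) (Col.box 0)
  | n + 1 =>
    if n + 1 ≤ k then er (Col.box k) (Col.box (n + 1))
    else mulComp (Col.box (n + 1)) (incl (Col.box k) (Col.box k)) (stack k n)

/-- The tangles `T^c` for all colours `c` (with respect to `k`). -/
def tangleT (k : ℕ) : (c : Col) → Diagram c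
  | Col.box n => stack k n
  | Col.zeroMinus => er (Col.box k) Col.zeroMinus

end Diagram

/-! ### Templates and consequences -/

open Diagram

/-- A set of templates `S ⇒ T`. -/
abbrev Templates : Type 1 := ∀ c : Col, Diagram c → Diagram c → Prop

/-- The consequences of a set of templates: the smallest set of templates that contains it, contains
`T ⇒ T` for every tangle `T` (isotopic tangles being equal), and is closed under
transitivity and composition on the outside. -/
inductive Consequence (B : Templates) : ∀ c : Col, Diagram c → Diagram c → Prop
  | of {c : Col} {S T : Diagram c} (h : B c S T) : Consequence B c S T
  | refl {c : Col} {S T : Diagram c} (hS : S.IsTangle) (h : Nonempty (Isotopy S T)) :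
      Consequence B c S T
  | trans {c : Col} {S T V : Diagram c} (h₁ : Consequence B c S T) (h₂ : Consequence B c T V) :
      Consequence B c S V
  | comp {c : Col} (W : Diagram c) (hW : W.IsTangle) (S T : ∀ i : W.Box, Diagram (W.boxCol i))
      (h : ∀ i, Consequence B (W.boxCol i) (S i) (T i)) :
      Consequence B c (W.comp S) (W.comp T)

/-- The basic templates. -/
inductive Basic (k : ℕ) : ∀ c : Col, Diagram c → Diagram c → Prop
  | modulus (c : Col) (hc : c.size = 0) : Basic k c (loop c hc) (one c)
  | modulus' (c : Col) (hc : c.size = 0) : Basic k c (one c) (loop c hc)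
  | jones (n : ℕ) (h₂ : 2 ≤ n) (hn : n ≤ k) :
      Basic k (Col.box k) ((incl (Col.box n) (Col.box k)).comp fun _ => jones n)
        (incl (Col.box k) (Col.box k))
  | mult : Basic k (Col.box k) (mul (Col.box k) (Col.box k) (Col.box k))
      (incl (Col.box k) (Col.box k))
  | condExp : Basic k (Col.box k)
      ((incl (Col.box (k - 1)) (Col.box k)).comp fun _ => er (Col.box k) (Col.box (k - 1)))
      (incl (Col.box k) (Col.box k))
  | depth : Basic k (Col.box (k + 1)) (one (Col.box (k + 1))) (tangleT k (Col.box (k + 1)))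
  | shift : Basic k (Col.box (k + 2)) (shift k) (tangleT k (Col.box (k + 2)))

/-- `S ⇒ T` is a consequence of the basic templates for `k`. -/
def Implies (k : ℕ) {c : Col} (S T : Diagram c) : Prop := Consequence (Basic k) c S T

end Skein

/-!
Every template is derived by the same two moves: isotopies, and substitution of templates already
derived. The geometric content therefore lies in a supply of isotopies between composites of the
basic tangles, and in a reduction of all Temperley–Lieb tangles to generators.

**Isotopies.** A map out of a composite is the same as compatible maps out of its parts
(`exists_comp_hom`, `exists_draw_hom`), so that a map out of a composite of basic tangles is a
solution of a few equations between strands at marked points (`MulEqs`, `ErEqs`, …). A map between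
tangles that matches the boxes and the external boundaries is an isotopy as soon as there are no
closed loops (`BoxHom.isotopy_of_loopFree₂`): on the strands because a strand of a tangle is
determined by one of its ends, and on the regions because both pictures are connected and lie on a
sphere (`BoxHom.region_bijective`). For this criterion the diagrams involved have to be tangles.
Composites of tangles are tangles (`comp_isTangle`), and for the basic tangles the sphere condition
is checked with partial sums along the boundaries of the boxes (`draw_isTangle`).

**Stacks.** Associativity of the product (`mul_assoc_isotopy`), the multiplication template and the
conditional expectation template imply that a product of two stacks that are joined by at least
`k - 1` strands implies a stack (`mul_stacks_implies`). Together with the depth template this treats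
vertical strands, inclusions, expectations and products of the colours `n ≥ k`. For the colours
below `k` one argues by downward induction: `T^n` is the expectation of `T^{n+1}`; an inclusion of an
expectation is an expectation of a product with Temperley–Lieb generators (`incl_er_isotopy`); and an
expectation slides through a product (`mul_er_isotopy`).

**Temperley–Lieb tangles.** The modulus templates remove and insert closed loops, starting with an
innermost one (`IsTangle.exists_leaf`). So a tangle without boxes matters only through the matching
of its marked points (`implies_of_matching`). It consists of vertical strands or has a cap at the
top, since a matching in the plane is noncrossing (`IsTangle.noncrossing`), and caps are moved to the
right and split off by generators (`cap_implies_stack`). The generators come from the Jones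
projections and from products of vertical strands.

**Left side.** The shift is multiplicative (`shift_mul_isotopy`), and the left expectation is the shift
multiplied with two Temperley–Lieb tangles (`el_isotopy`). The colour `0₋` is reduced to the colour `1`
with the left expectation.
-/

namespace Skein

/-! ### Maps out of boundaries, drawings and composites -/

namespace Net

theorem Hom.ext {A B : Net} {f g : Hom A B} (h₁ : ∀ x, f.strand x = g.strand x)
    (h₂ : ∀ r, f.region r = g.region r) : f = g := by
  obtain ⟨f₁, f₂, _, _, _⟩ := f
  obtain ⟨g₁, g₂, _, _, _⟩ := g
  obtain rfl : f₁ = g₁ := funext h₁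
  obtain rfl : f₂ = g₂ := funext h₂
  rfl

/-- The identity map of a net. -/
def Hom.id (A : Net) : Hom A A where
  strand x := x
  region r := r
  shaded_region _ := rfl
  white_strand _ := rfl
  black_strand _ := rfl

theorem white_ne_black (A : Net) (x : A.Strand) : A.white x ≠ A.black x := by
  intro h
  have h₁ := A.shaded_white x
  rw [h, A.shaded_black] at h₁
  cases h₁

/-- The strand at marked point number `i` of a boundary, `none` if there is no such point. -/
def Hom.st {c : Col} {N : Net} (o : Hom (boundary c) N) (i : ℕ) : Option N.Strand :=
  if h : i < 2 * c.size then some (o.strand ⟨i, h⟩) else none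

/-- The region at boundary segment number `j`, read cyclically. -/
def Hom.rg {c : Col} {N : Net} (o : Hom (boundary c) N) (j : ℕ) : N.Region :=
  o.region (c.seg j)

theorem Hom.st_of_lt {c : Col} {N : Net} (o : Hom (boundary c) N) {i : ℕ} (h : i < 2 * c.size) :
    o.st i = some (o.strand ⟨i, h⟩) := dif_pos h

theorem Hom.st_comp {c : Col} {N N' : Net} (f : Hom N N') (o : Hom (boundary c) N) (i : ℕ) :
    (f.comp o).st i = (o.st i).map f.strand := by
  unfold Hom.st
  split_ifs <;> rfl

theorem Hom.lt_of_st {c : Col} {N : Net} {o : Hom (boundary c) N} {i : ℕ} {x : N.Strand}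
    (h : o.st i = some x) : i < 2 * c.size := by
  by_contra hc
  rw [Hom.st, dif_neg hc] at h
  cases h

theorem Hom.white_of_st {c : Col} {N : Net} {o : Hom (boundary c) N} {i : ℕ} {x : N.Strand}
    (h : o.st i = some x) : N.white x = o.rg (if i % 2 = 0 then i else i + 1) := by
  have hi := lt_of_st h
  rw [o.st_of_lt hi] at h
  cases h
  exact o.white_strand _

theorem Hom.black_of_st {c : Col} {N : Net} {o : Hom (boundary c) N} {i : ℕ} {x : N.Strand}
    (h : o.st i = some x) : N.black x = o.rg (if i % 2 = 0 then i + 1 else i) := by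
  have hi := lt_of_st h
  rw [o.st_of_lt hi] at h
  cases h
  exact o.black_strand _

theorem _root_.Skein.Col.seg_val (c : Col) (s : Fin c.segs) : c.seg s.val = s :=
  Fin.ext (Nat.mod_eq_of_lt s.isLt)

theorem _root_.Skein.Col.seg_two_mul_size (c : Col) : c.seg (2 * c.size) = c.seg 0 := by
  apply Fin.ext
  change 2 * c.size % max 1 (2 * c.size) = 0 % max 1 (2 * c.size)
  rcases Nat.eq_zero_or_pos c.size with h | h
  · simp [h]
  · rw [max_eq_right (by omega)]; simp

theorem Hom.rg_two_mul_size {c : Col} {N : Net} (o : Hom (boundary c) N) :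
    o.rg (2 * c.size) = o.rg 0 := by
  unfold Hom.rg
  rw [Col.seg_two_mul_size]

theorem Hom.rg_box {n : ℕ} {N : Net} (o : Hom (boundary (Col.box n)) N) :
    o.rg (2 * n) = o.rg 0 := o.rg_two_mul_size

/-- If a strand meets two boundaries at points of the same parity, then the segments before and
after these points lie in the same regions. -/
theorem Hom.rg_of_st_eq {c c' : Col} {N : Net} {o : Hom (boundary c) N} {o' : Hom (boundary c') N}
    {i j : ℕ} (h : o.st i = o'.st j) (hi : i < 2 * c.size) (hp : i % 2 = j % 2) :
    o.rg i = o'.rg j ∧ o.rg (i + 1) = o'.rg (j + 1) := by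
  have h₁ := o.st_of_lt hi
  have h₂ := h ▸ h₁
  have w := (white_of_st h₁).symm.trans (white_of_st h₂)
  have b := (black_of_st h₁).symm.trans (black_of_st h₂)
  rw [← hp] at w b
  split_ifs at w b
  · exact ⟨w, b⟩
  · exact ⟨b, w⟩

/-- If a strand meets two boundaries at points of opposite parity, then the segment before one
point and the segment after the other lie in the same region. -/
theorem Hom.rg_of_st_eq' {c c' : Col} {N : Net} {o : Hom (boundary c) N}
    {o' : Hom (boundary c') N} {i j : ℕ} (h : o.st i = o'.st j) (hi : i < 2 * c.size)
    (hp : i % 2 ≠ j % 2) : o.rg i = o'.rg (j + 1) ∧ o.rg (i + 1) = o'.rg j := by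
  have h₁ := o.st_of_lt hi
  have h₂ := h ▸ h₁
  have w := (white_of_st h₁).symm.trans (white_of_st h₂)
  have b := (black_of_st h₁).symm.trans (black_of_st h₂)
  split_ifs at w b
  · omega
  · exact ⟨w, b⟩
  · exact ⟨b, w⟩
  · omega

/-- A boundary is given by a sequence of strands and regions such that consecutive regions are the
two sides of the strand between them. -/
theorem exists_boundary {N : Net} (n : ℕ) (s : ℕ → Option N.Strand) (r : ℕ → N.Region)
    (hs : ∀ i < 2 * n, ∃ x, s i = some x ∧ N.white x = r (if i % 2 = 0 then i else i + 1) ∧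
      N.black x = r (if i % 2 = 0 then i + 1 else i))
    (hr : r (2 * n) = r 0) (h₀ : N.shaded (r 0) = false) :
    ∃ o : Hom (boundary (Col.box n)) N, (∀ i < 2 * n, o.st i = s i) ∧
      ∀ j ≤ 2 * n, o.rg j = r j := by
  choose f hf hw hb using hs
  have hr' : ∀ j ≤ 2 * n, r (((Col.box n).seg j).val) = r j := by
    intro j hj
    rcases hj.eq_or_lt with rfl | hj
    · have := Col.seg_two_mul_size (Col.box n)
      simp only [Col.size] at this
      rw [this, hr]
      rfl
    · congr 1
      exact Nat.mod_eq_of_lt (lt_of_lt_of_le hj (le_max_right _ _))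
  refine ⟨⟨fun (p : Fin (2 * n)) => f p.val p.isLt, fun (q : Fin (Col.box n).segs) => r q.val, ?_, ?_, ?_⟩,
    ?_, ?_⟩
  · intro (q : Fin (Col.box n).segs)
    have h₁ : q.val < max 1 (2 * n) := q.isLt
    change N.shaded (r q.val) = decide (q.val % 2 = 1)
    rcases hq : q.val with _ | j
    · simpa using h₀
    · have hj : j < 2 * n := by omega
      have w := hw j hj
      have b := hb j hj
      split_ifs at w b with hp
      · rw [← b, N.shaded_black, eq_comm, decide_eq_true_iff]; omega
      · rw [← w, N.shaded_white, eq_comm, decide_eq_false_iff_not]; omega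
  · intro (p : Fin (2 * n))
    have hp := p.isLt
    change N.white (f p.val hp) = r (((Col.box n).seg _).val)
    rw [hw p.val hp, hr' _ (by split_ifs <;> omega)]
  · intro (p : Fin (2 * n))
    have hp := p.isLt
    change N.black (f p.val hp) = r (((Col.box n).seg _).val)
    rw [hb p.val hp, hr' _ (by split_ifs <;> omega)]
  · intro i hi
    rw [Hom.st_of_lt _ (show i < 2 * (Col.box n).size from hi), hf i hi]
  · intro j hj
    exact hr' j hj

/-- The sum over a closed curve of the jumps of a function on the regions vanishes. -/
theorem Hom.sum_jump {c : Col} {N : Net} (o : Hom (boundary c) N) (g : N.Region → ZMod 2) :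
    ∑ p : Fin (2 * c.size), (g (N.white (o.strand p)) + g (N.black (o.strand p))) = 0 := by
  have h : ∀ p : Fin (2 * c.size), g (N.white (o.strand p)) + g (N.black (o.strand p)) =
      g (o.rg p.val) + g (o.rg (p.val + 1)) := by
    intro p
    have h₁ := o.st_of_lt p.isLt
    rw [white_of_st h₁, black_of_st h₁]
    split_ifs
    · rfl
    · rw [add_comm]
  rw [Finset.sum_congr rfl (fun p _ => h p),
    Fin.sum_univ_eq_sum_range (fun i => g (o.rg i) + g (o.rg (i + 1)))]
  have : ∀ n, ∑ i ∈ Finset.range n, (g (o.rg i) + g (o.rg (i + 1))) = g (o.rg 0) + g (o.rg n) := by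
    intro n
    induction n with
    | zero => simp [CharTwo.add_self_eq_zero]
    | succ n ih =>
      rw [Finset.sum_range_succ, ih]
      linear_combination CharTwo.add_self_eq_zero (g (o.rg n))
  rw [this, o.rg_two_mul_size, CharTwo.add_self_eq_zero]

/-- A function without jumps along a closed curve is constant on it. -/
theorem Hom.const_of_no_jump {c : Col} {N : Net} (o : Hom (boundary c) N) {α : Type*}
    (g : N.Region → α) (hg : ∀ p, g (N.white (o.strand p)) = g (N.black (o.strand p)))
    (j : ℕ) (hj : j ≤ 2 * c.size) : g (o.rg j) = g (o.rg 0) := by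
  induction j with
  | zero => rfl
  | succ j ih =>
    have h₁ := o.st_of_lt (show j < 2 * c.size by omega)
    have := hg ⟨j, by omega⟩
    rw [white_of_st h₁, black_of_st h₁] at this
    rw [← ih (by omega)]
    split_ifs at this
    · exact this.symm
    · exact this

theorem Hom.exists_rg {c : Col} {N : Net} (o : Hom (boundary c) N) (s : (boundary c).Region) :
    ∃ j ≤ 2 * c.size, j < c.segs ∧ o.region s = o.rg j := by
  have h : (s : Fin c.segs).val < max 1 (2 * c.size) := (s : Fin c.segs).isLt
  exact ⟨(s : Fin c.segs).val, by omega, h, congrArg o.region (c.seg_val s).symm⟩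

end Net

open Net

namespace Diagram

/-! ### Maps out of drawings -/

theorem mem_para {a i b j t x p y q : ℕ} :
    ((x, p), (y, q)) ∈ para a i b j t ↔ x = a ∧ y = b ∧ i ≤ p ∧ p < i + t ∧ q + i = p + j := by
  constructor
  · rintro ⟨s, hs, h⟩
    simp only [Prod.mk.injEq] at h
    omega
  · rintro ⟨rfl, rfl, h₁, h₂, h₃⟩
    refine ⟨p - i, by omega, ?_⟩
    simp only [Prod.mk.injEq, true_and]
    omega

theorem mem_anti {a i b j t x p y q : ℕ} :
    ((x, p), (y, q)) ∈ anti a i b j t ↔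
      x = a ∧ y = b ∧ i ≤ p ∧ p < i + t ∧ q + p + 1 = i + j + t := by
  constructor
  · rintro ⟨s, hs, h⟩
    simp only [Prod.mk.injEq] at h
    omega
  · rintro ⟨rfl, rfl, h₁, h₂, h₃⟩
    refine ⟨p - i, by omega, ?_⟩
    simp only [Prod.mk.injEq, true_and]
    omega

/-- The strand at a numbered marked point of a drawing, for given maps of the boundaries. -/
def pt {c : Col} {b : ℕ} {col : Fin b → Col} {N : Net} (o : Hom (boundary c) N)
    (l : ∀ i, Hom (boundary (col i)) N) : ℕ × ℕ → Option N.Strand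
  | (0, i) => o.st i
  | (a + 1, i) => if h : a < b then (l ⟨a, h⟩).st i else none

/-- The region at a numbered boundary segment of a drawing, for given maps of the boundaries. -/
def pr {c : Col} {b : ℕ} {col : Fin b → Col} {N : Net} (o : Hom (boundary c) N)
    (l : ∀ i, Hom (boundary (col i)) N) : ℕ × ℕ → Option N.Region
  | (0, j) => some (o.rg j)
  | (a + 1, j) => if h : a < b then some ((l ⟨a, h⟩).rg j) else none

/-- A map out of a drawing amounts to maps of the boundaries that respect the strands and the
placement of the pieces. -/
theorem exists_draw_hom {c : Col} {b : ℕ} {col : Fin b → Col} {J A : Set ((ℕ × ℕ) × (ℕ × ℕ))}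
    {N : Net} (o : Hom (boundary c) N) (l : ∀ i, Hom (boundary (col i)) N)
    (hJ : ∀ e ∈ J, pt o l e.1 = pt o l e.2) (hA : ∀ e ∈ A, pr o l e.1 = pr o l e.2) :
    ∃ h : Hom (draw c col J A).net N, h.comp (draw c col J A).out = o ∧
      ∀ i : Fin b, h.comp ((draw c col J A).inn i) = l i := by
  let fs : ((boundary c).union fun i => boundary (col i)).Strand → N.Strand :=
    Sum.elim o.strand (fun x => (l x.1).strand x.2)
  let fr : ((boundary c).union fun i => boundary (col i)).Region → N.Region :=
    Sum.elim o.region (fun x => (l x.1).region x.2)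
  have hs : ∀ x, pt o l (number (b := b) (m := 2 * c.size) (n := fun i => 2 * (col i).size) x) =
      some (fs x) := by
    rintro (p | ⟨i, p⟩)
    · exact o.st_of_lt p.isLt
    · exact (dif_pos i.isLt).trans ((l i).st_of_lt p.isLt)
  have hr : ∀ x, pr o l (number (b := b) (m := c.segs) (n := fun i => (col i).segs) x) =
      some (fr x) := by
    rintro (p | ⟨i, p⟩)
    · change some (o.region (c.seg p.val)) = some (o.region p)
      rw [Col.seg_val]
    · refine (dif_pos i.isLt).trans ?_
      change some ((l i).region ((col i).seg p.val)) = some ((l i).region p)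
      rw [Col.seg_val]
  have hw : ∀ x, N.white (fs x) = fr (((boundary c).union fun i => boundary (col i)).white x) := by
    rintro (p | ⟨i, p⟩)
    · exact o.white_strand p
    · exact (l i).white_strand p
  have hb : ∀ x, N.black (fs x) = fr (((boundary c).union fun i => boundary (col i)).black x) := by
    rintro (p | ⟨i, p⟩)
    · exact o.black_strand p
    · exact (l i).black_strand p
  have hJ' : ∀ x y, (number (b := b) (m := 2 * c.size) (n := fun i => 2 * (col i).size) x,
      number (b := b) (m := 2 * c.size) (n := fun i => 2 * (col i).size) y) ∈ J → fs x = fs y := by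
    intro x y h
    have := hJ _ h
    dsimp only at this
    rw [hs, hs] at this
    exact Option.some.inj this
  refine ⟨⟨Quot.lift fs hJ', Quot.lift fr ?_, ?_, ?_, ?_⟩, ?_, ?_⟩
  · rintro r r' (⟨h, -⟩ | ⟨x, y, h, ⟨rfl, rfl⟩ | ⟨rfl, rfl⟩⟩)
    · exact Option.some.inj ((hr r).symm.trans ((hA _ h).trans (hr r')))
    · rw [← hw, ← hw, hJ' x y h]
    · rw [← hb, ← hb, hJ' x y h]
  · rintro ⟨p | ⟨i, p⟩⟩
    · exact o.shaded_region p
    · exact (l i).shaded_region p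
  · rintro ⟨x⟩
    exact hw x
  · rintro ⟨x⟩
    exact hb x
  · exact Hom.ext (fun _ => rfl) (fun _ => rfl)
  · exact fun i => Hom.ext (fun _ => rfl) (fun _ => rfl)

/-- Marked points that are joined in the description of a drawing lie on the same strand. -/
theorem draw_strand_eq {c : Col} {b : ℕ} {col : Fin b → Col} {J A : Set ((ℕ × ℕ) × (ℕ × ℕ))}
    (x y : (draw c col J A).Mark)
    (h : (number (b := b) (m := 2 * c.size) (n := fun i => 2 * (col i).size) x,
      number (b := b) (m := 2 * c.size) (n := fun i => 2 * (col i).size) y) ∈ J) :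
    (draw c col J A).strandAt x = (draw c col J A).strandAt y := by
  rcases x with x | ⟨i, x⟩ <;> rcases y with y | ⟨j, y⟩ <;> exact Quot.sound h

theorem draw_out_out {c : Col} {b : ℕ} {col : Fin b → Col} {J A : Set ((ℕ × ℕ) × (ℕ × ℕ))}
    {i j : ℕ} (h : ((0, i), (0, j)) ∈ J) (hi : i < 2 * c.size) (hj : j < 2 * c.size) :
    (draw c col J A).out.st i = (draw c col J A).out.st j := by
  refine (Hom.st_of_lt _ hi).trans (Eq.trans ?_ (Hom.st_of_lt _ hj).symm)
  exact congrArg some (draw_strand_eq (c := c) (Sum.inl ⟨i, hi⟩) (Sum.inl ⟨j, hj⟩) h)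

theorem draw_out_inn {c : Col} {b : ℕ} {col : Fin b → Col} {J A : Set ((ℕ × ℕ) × (ℕ × ℕ))}
    {i j : ℕ} (a : Fin b) (h : ((0, i), (a.val + 1, j)) ∈ J) (hi : i < 2 * c.size)
    (hj : j < 2 * (col a).size) :
    (draw c col J A).out.st i = ((draw c col J A).inn a).st j := by
  refine (Hom.st_of_lt _ hi).trans (Eq.trans ?_ (Hom.st_of_lt _ hj).symm)
  exact congrArg some (draw_strand_eq (c := c) (Sum.inl ⟨i, hi⟩) (Sum.inr ⟨a, ⟨j, hj⟩⟩) h)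

theorem draw_inn_inn {c : Col} {b : ℕ} {col : Fin b → Col} {J A : Set ((ℕ × ℕ) × (ℕ × ℕ))}
    {i j : ℕ} (a a' : Fin b) (h : ((a.val + 1, i), (a'.val + 1, j)) ∈ J)
    (hi : i < 2 * (col a).size) (hj : j < 2 * (col a').size) :
    ((draw c col J A).inn a).st i = ((draw c col J A).inn a').st j := by
  refine (Hom.st_of_lt _ hi).trans (Eq.trans ?_ (Hom.st_of_lt _ hj).symm)
  exact congrArg some
    (draw_strand_eq (c := c) (Sum.inr ⟨a, ⟨i, hi⟩⟩) (Sum.inr ⟨a', ⟨j, hj⟩⟩) h)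

/-- Segments that are identified in the description of a drawing lie in the same region,
provided that they have the same shading. -/
theorem draw_region {c : Col} {b : ℕ} {col : Fin b → Col} {J A : Set ((ℕ × ℕ) × (ℕ × ℕ))}
    {i j : ℕ} (a : Fin b) (h : ((0, i), (a.val + 1, j)) ∈ A) (hi : i < c.segs)
    (hj : j < (col a).segs) (hs : c.segShaded ⟨i, hi⟩ = (col a).segShaded ⟨j, hj⟩) :
    (draw c col J A).out.rg i = ((draw c col J A).inn a).rg j := by
  have e₁ : c.seg i = ⟨i, hi⟩ := c.seg_val ⟨i, hi⟩
  have e₂ : (col a).seg j = ⟨j, hj⟩ := (col a).seg_val ⟨j, hj⟩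
  change (draw c col J A).out.region (c.seg i) =
    ((draw c col J A).inn a).region ((col a).seg j)
  rw [e₁, e₂]
  exact Quot.sound (Or.inl ⟨h, hs⟩)

/-! ### Maps out of composites -/

/-- The outer diagram of a composite. -/
def compL {c : Col} (W : Diagram c) (S : ∀ i : W.Box, Diagram (W.boxCol i)) :
    Hom W.net (W.comp S).net where
  strand x := Quot.mk _ (Sum.inl x)
  region r := Quot.mk _ (Sum.inl r)
  shaded_region _ := rfl
  white_strand _ := rfl
  black_strand _ := rfl

/-- The inner diagrams of a composite. -/
def compR {c : Col} (W : Diagram c) (S : ∀ i : W.Box, Diagram (W.boxCol i)) (i : W.Box) :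
    Hom (S i).net (W.comp S).net where
  strand x := Quot.mk _ (Sum.inr ⟨i, x⟩)
  region r := Quot.mk _ (Sum.inr ⟨i, r⟩)
  shaded_region _ := rfl
  white_strand _ := rfl
  black_strand _ := rfl

/-- In a composite, the boundary of a box of the outer diagram is the external boundary of the
diagram substituted into it. -/
theorem compL_inn {c : Col} (W : Diagram c) (S : ∀ i : W.Box, Diagram (W.boxCol i)) (i : W.Box) :
    (compL W S).comp (W.inn i) = (compR W S i).comp (S i).out :=
  Hom.ext (fun p => Quot.sound ⟨i, p, rfl, rfl⟩)
    (fun s => Quot.sound (Or.inl ⟨i, s, rfl, rfl⟩))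

/-- A map out of a composite amounts to compatible maps out of its parts. -/
theorem exists_comp_hom {c : Col} (W : Diagram c) (S : ∀ i : W.Box, Diagram (W.boxCol i)) {N : Net}
    (hW : Hom W.net N) (hS : ∀ i, Hom (S i).net N)
    (h : ∀ i, hW.comp (W.inn i) = (hS i).comp (S i).out) :
    ∃ f : Hom (W.comp S).net N, f.comp (compL W S) = hW ∧ ∀ i, f.comp (compR W S i) = hS i := by
  let fs : (W.net.union fun i => (S i).net).Strand → N.Strand :=
    Sum.elim hW.strand (fun x => (hS x.1).strand x.2)
  let fr : (W.net.union fun i => (S i).net).Region → N.Region :=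
    Sum.elim hW.region (fun x => (hS x.1).region x.2)
  have hw : ∀ x, N.white (fs x) = fr ((W.net.union fun i => (S i).net).white x) := by
    rintro (p | ⟨i, p⟩)
    · exact hW.white_strand p
    · exact (hS i).white_strand p
  have hb : ∀ x, N.black (fs x) = fr ((W.net.union fun i => (S i).net).black x) := by
    rintro (p | ⟨i, p⟩)
    · exact hW.black_strand p
    · exact (hS i).black_strand p
  have hs : ∀ x y, (∃ (i : W.Box) (p : Fin (2 * (W.boxCol i).size)),
      x = Sum.inl ((W.inn i).strand p) ∧ y = Sum.inr ⟨i, (S i).out.strand p⟩) → fs x = fs y := by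
    rintro _ _ ⟨i, p, rfl, rfl⟩
    exact congrArg (fun f : Hom (boundary (W.boxCol i)) N => f.strand p) (h i)
  refine ⟨⟨Quot.lift fs hs, Quot.lift fr ?_, ?_, ?_, ?_⟩, ?_, ?_⟩
  · rintro r r' (⟨i, s, rfl, rfl⟩ | ⟨x, y, h, ⟨rfl, rfl⟩ | ⟨rfl, rfl⟩⟩)
    · exact congrArg (fun f : Hom (boundary (W.boxCol i)) N => f.region s) (h i)
    · rw [← hw, ← hw, hs x y h]
    · rw [← hb, ← hb, hs x y h]
  · rintro ⟨p | ⟨i, p⟩⟩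
    · exact hW.shaded_region p
    · exact (hS i).shaded_region p
  · rintro ⟨x⟩
    exact hw x
  · rintro ⟨x⟩
    exact hb x
  · exact Hom.ext (fun _ => rfl) (fun _ => rfl)
  · exact fun i => Hom.ext (fun _ => rfl) (fun _ => rfl)

theorem comp_strand_cases {c : Col} (W : Diagram c) (S : ∀ i : W.Box, Diagram (W.boxCol i))
    (x : (W.comp S).net.Strand) :
    (∃ y, x = (compL W S).strand y) ∨ ∃ i y, x = (compR W S i).strand y := by
  rcases x with ⟨y | ⟨i, y⟩⟩
  · exact Or.inl ⟨y, rfl⟩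
  · exact Or.inr ⟨i, y, rfl⟩

theorem draw_strand_cases {c : Col} {b : ℕ} {col : Fin b → Col} {J A : Set ((ℕ × ℕ) × (ℕ × ℕ))}
    (x : (draw c col J A).net.Strand) : ∃ m, (draw c col J A).strandAt m = x := by
  rcases x with ⟨y | ⟨i, y⟩⟩
  · exact ⟨Sum.inl y, rfl⟩
  · exact ⟨Sum.inr ⟨i, y⟩, rfl⟩

end Diagram

end Skein

namespace Skein

open Net

namespace Diagram

/-! ### Planarity of drawings -/

/-- The number of marked points on the box number `a` of a drawing. -/
def sz (c : Col) {b : ℕ} (col : Fin b → Col) : ℕ → ℕ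
  | 0 => 2 * c.size
  | a + 1 => if h : a < b then 2 * (col ⟨a, h⟩).size else 0

theorem sz_succ (c : Col) {b : ℕ} (col : Fin b → Col) (i : Fin b) :
    sz c col (i.val + 1) = 2 * (col i).size := dif_pos i.isLt

/-- Whether the strand at a numbered marked point starts there; see `Diagram.starts`. -/
def StartsAt (x : ℕ × ℕ) : Prop := x.1 = 0 ↔ x.2 % 2 = 0

theorem number_valid {c : Col} {b : ℕ} {col : Fin b → Col}
    (x : Fin (2 * c.size) ⊕ (Σ i, Fin (2 * (col i).size))) :
    (number x).2 < sz c col (number x).1 := by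
  rcases x with p | ⟨i, p⟩
  · exact p.isLt
  · exact lt_of_lt_of_eq p.isLt (sz_succ c col i).symm

theorem exists_number {c : Col} {b : ℕ} {col : Fin b → Col} (y : ℕ × ℕ)
    (hy : y.2 < sz c col y.1) :
    ∃ x : Fin (2 * c.size) ⊕ (Σ i, Fin (2 * (col i).size)), number x = y := by
  rcases y with ⟨_ | a, i⟩
  · exact ⟨Sum.inl ⟨i, hy⟩, rfl⟩
  · by_cases h : a < b
    · exact ⟨Sum.inr ⟨⟨a, h⟩, ⟨i, lt_of_lt_of_eq hy (sz_succ c col ⟨a, h⟩)⟩⟩, rfl⟩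
    · simp only [sz, dif_neg h, not_lt_zero] at hy

theorem number_inj {c : Col} {b : ℕ} {col : Fin b → Col}
    (x y : Fin (2 * c.size) ⊕ (Σ i, Fin (2 * (col i).size))) (h : number x = number y) :
    x = y := by
  rcases x with p | ⟨⟨i, hi⟩, ⟨p, hp⟩⟩ <;> rcases y with q | ⟨⟨j, hj⟩, ⟨q, hq⟩⟩ <;>
    simp only [number, Prod.mk.injEq] at h
  · rw [Fin.ext h.2]
  · omega
  · omega
  · obtain ⟨h₁, rfl⟩ := h
    obtain rfl : i = j := by omega
    rfl

theorem starts_iff {c : Col} {b : ℕ} {col : Fin b → Col} {J A : Set ((ℕ × ℕ) × (ℕ × ℕ))}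
    (x : (draw c col J A).Mark) : (draw c col J A).starts x ↔
      StartsAt (number (b := b) (m := 2 * c.size) (n := fun i => 2 * (col i).size) x) := by
  rcases x with p | ⟨i, p⟩
  · change p.val % 2 = 0 ↔ (0 = 0 ↔ p.val % 2 = 0)
    simp
  · change p.val % 2 = 1 ↔ (i.val + 1 = 0 ↔ p.val % 2 = 0)
    omega

/-- A criterion for a drawing to be a tangle. The function `mate` gives the other end of a strand.
In `hF`, the values of a function `F` on the strands are summed along the boundary of each box; up
to constants `κ` these partial sums have to give a function on the regions. -/
theorem draw_isTangle {c : Col} {b : ℕ} {col : Fin b → Col} {J A : Set ((ℕ × ℕ) × (ℕ × ℕ))}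
    (mate : ℕ × ℕ → ℕ × ℕ)
    (hJ : ∀ x y, (x, y) ∈ J → x.2 < sz c col x.1 → y.2 < sz c col y.1 →
      mate x = y ∧ mate y = x ∧ (StartsAt x ↔ ¬ StartsAt y))
    (hM : ∀ x, x.2 < sz c col x.1 →
      (mate x).2 < sz c col (mate x).1 ∧ ((x, mate x) ∈ J ∨ (mate x, x) ∈ J))
    (hC : ∀ g : (draw c col J A).net.Region → ZMod 2,
      (∀ x, g ((draw c col J A).net.white x) = g ((draw c col J A).net.black x)) →
      ∀ i : Fin b, ∃ j ≤ 2 * c.size, ∃ j' ≤ 2 * (col i).size,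
        g ((draw c col J A).out.rg j) = g (((draw c col J A).inn i).rg j'))
    (hF : ∀ F : ℕ → ℕ → ZMod 2,
      (∀ x y, (x, y) ∈ J → x.2 < sz c col x.1 → y.2 < sz c col y.1 → F x.1 x.2 = F y.1 y.2) →
      (∀ a, ∑ i ∈ Finset.range (sz c col a), F a i = 0) →
      ∃ κ : ℕ → ZMod 2,
        (∀ x y, (x, y) ∈ J → x.2 < sz c col x.1 → y.2 < sz c col y.1 →
          κ x.1 + ∑ i ∈ Finset.range x.2, F x.1 i =
            κ y.1 + ∑ i ∈ Finset.range (if x.2 % 2 = y.2 % 2 then y.2 else y.2 + 1), F y.1 i) ∧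
        ∀ x y, (x, y) ∈ A → κ x.1 + ∑ i ∈ Finset.range x.2, F x.1 i =
          κ y.1 + ∑ i ∈ Finset.range y.2, F y.1 i) :
    (draw c col J A).IsTangle := by
  let num : (draw c col J A).Mark → ℕ × ℕ :=
    number (b := b) (m := 2 * c.size) (n := fun i => 2 * (col i).size)
  have hJ' : ∀ x y, (num x, num y) ∈ J → mate (num x) = num y ∧ mate (num y) = num x ∧
      (StartsAt (num x) ↔ ¬ StartsAt (num y)) :=
    fun x y h => hJ _ _ h (number_valid x) (number_valid y)
  have hM' : ∀ x : (draw c col J A).Mark, ∃ y, num y = mate (num x) ∧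
      (draw c col J A).strandAt x = (draw c col J A).strandAt y ∧
      ((draw c col J A).starts x ↔ ¬ (draw c col J A).starts y) := by
    intro x
    obtain ⟨h₁, h₂⟩ := hM _ (number_valid x)
    obtain ⟨y, hy⟩ := exists_number _ h₁
    refine ⟨y, hy, ?_, ?_⟩
    · rcases h₂ with h₂ | h₂ <;> rw [← hy] at h₂
      · exact draw_strand_eq x y h₂
      · exact (draw_strand_eq y x h₂).symm
    · have s₁ := starts_iff (J := J) (A := A) x
      have s₂ := starts_iff (J := J) (A := A) y
      rcases h₂ with h₂ | h₂ <;> rw [← hy] at h₂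
      · exact s₁.trans ((hJ' x y h₂).2.2.trans (not_congr s₂.symm))
      · have := (hJ' y x h₂).2.2
        exact s₁.trans ((by tauto : StartsAt (num x) ↔ ¬ StartsAt (num y)).trans
          (not_congr s₂.symm))
  -- The numbers of the starting point and of the end point of a strand.
  classical
  have key : ∀ P : ℕ × ℕ → Prop, (∀ x y, (num x, num y) ∈ J → (P (num x) ↔ ¬ P (num y))) →
      ∀ x y, P (num x) → P (num y) →
        (draw c col J A).strandAt x = (draw c col J A).strandAt y → x = y := by
    intro P hP x y hx hy hxy
    let L : (draw c col J A).net.Strand → ℕ × ℕ :=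
      Quot.lift (fun z => if P (num z) then num z else mate (num z)) (by
        intro z w hzw
        obtain ⟨h₁, h₂, -⟩ := hJ' z w hzw
        have h₃ := hP z w hzw
        by_cases h : P (num w)
        · rw [if_neg (by tauto), if_pos h, h₁]
        · rw [if_pos (by tauto), if_neg h, h₂])
    have hL : ∀ z, P (num z) → L ((draw c col J A).strandAt z) = num z := by
      rintro (z | ⟨i, z⟩) hz <;> exact if_pos hz
    have h := congrArg L hxy
    rw [hL x hx, hL y hy] at h
    exact number_inj x y h
  refine ⟨?_, ?_, ?_, ?_, ?_⟩
  · intro x y hx hy h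
    exact key StartsAt (fun x y h => (hJ' x y h).2.2) x y ((starts_iff x).1 hx)
      ((starts_iff y).1 hy) h
  · intro x y hx hy h
    refine key (fun z => ¬ StartsAt z) (fun x y h => ?_) x y (fun h => hx ((starts_iff x).2 h))
      (fun h => hy ((starts_iff y).2 h)) h
    have := (hJ' x y h).2.2
    tauto
  · intro x
    constructor
    · rintro ⟨p, hp, rfl⟩
      obtain ⟨q, -, h₁, h₂⟩ := hM' p
      exact ⟨q, by tauto, h₁.symm⟩
    · rintro ⟨p, hp, rfl⟩
      obtain ⟨q, -, h₁, h₂⟩ := hM' p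
      exact ⟨q, by tauto, h₁.symm⟩
  · intro g hg
    have h₀ : ∀ r, g r = g ((draw c col J A).out.rg 0) := by
      rintro ⟨s | ⟨i, s⟩⟩
      · obtain ⟨j, hj, -, h⟩ := (draw c col J A).out.exists_rg s
        change g ((draw c col J A).out.region s) = _
        rw [h]
        exact Hom.const_of_no_jump _ g (fun p => hg _) j hj
      · obtain ⟨j, hj, -, h⟩ := ((draw c col J A).inn i).exists_rg s
        obtain ⟨k, hk, k', hk', hg'⟩ := hC g hg i
        change g (((draw c col J A).inn i).region s) = _
        rw [h]
        exact (Hom.const_of_no_jump _ g (fun p => hg _) j hj).trans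
          ((Hom.const_of_no_jump ((draw c col J A).inn i) g (fun p => hg _) k' hk').symm.trans
            (hg'.symm.trans (Hom.const_of_no_jump _ g (fun p => hg _) k hk)))
    intro r s
    rw [h₀ r, h₀ s]
  · intro f hf₀ hf₁
    let F : ℕ → ℕ → ZMod 2 := fun a i =>
      (pt (draw c col J A).out (draw c col J A).inn (a, i)).elim 0 f
    have hFx : ∀ x : (draw c col J A).Mark,
        F (num x).1 (num x).2 = f ((draw c col J A).strandAt x) := by
      rintro (p | ⟨i, p⟩)
      · exact congrArg (fun o => Option.elim o 0 f) ((draw c col J A).out.st_of_lt p.isLt)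
      · have h₁ : pt (draw c col J A).out (draw c col J A).inn (i.val + 1, p.val) =
            ((draw c col J A).inn i).st p.val := dif_pos i.isLt
        exact congrArg (fun o => Option.elim o 0 f)
          (h₁.trans (((draw c col J A).inn i).st_of_lt p.isLt))
    obtain ⟨κ, hκ, hκA⟩ := hF F
      (by
        intro x y h hx hy
        obtain ⟨x', rfl⟩ := exists_number x hx
        obtain ⟨y', rfl⟩ := exists_number y hy
        exact (hFx x').trans ((congrArg f (draw_strand_eq x' y' h)).trans (hFx y').symm))
      (by
        rintro (_ | a)
        · refine Eq.trans ?_ hf₀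
          change ∑ i ∈ Finset.range (2 * c.size), F 0 i = _
          rw [← Fin.sum_univ_eq_sum_range]
          exact Finset.sum_congr rfl (fun p _ => hFx (Sum.inl p))
        · by_cases h : a < b
          · refine Eq.trans ?_ (hf₁ ⟨a, h⟩)
            have e : sz c col (a + 1) = 2 * (col ⟨a, h⟩).size := dif_pos h
            rw [e, ← Fin.sum_univ_eq_sum_range]
            exact Finset.sum_congr rfl (fun p _ => hFx (Sum.inr ⟨⟨a, h⟩, p⟩))
          · have e : sz c col (a + 1) = 0 := dif_neg h
            rw [e, Finset.sum_range_zero])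
    let H : ℕ → ℕ → ZMod 2 := fun a j => κ a + ∑ i ∈ Finset.range j, F a i
    have hsucc : ∀ a j, H a (j + 1) = H a j + F a j := by
      intro a j
      simp only [H, Finset.sum_range_succ, add_assoc]
    have hF₀ : ∀ a, H a (sz c col a) = H a 0 := by
      rintro (_ | a)
      · change κ 0 + ∑ i ∈ Finset.range (2 * c.size), F 0 i = _
        rw [← Fin.sum_univ_eq_sum_range]
        have : ∑ p : Fin (2 * c.size), F 0 p.val = 0 :=
          (Finset.sum_congr rfl (fun p _ => hFx (Sum.inl p))).trans hf₀
        rw [this]; simp [H]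
      · by_cases h : a < b
        · have e : sz c col (a + 1) = 2 * (col ⟨a, h⟩).size := dif_pos h
          rw [e]
          change κ (a + 1) + ∑ i ∈ Finset.range (2 * (col ⟨a, h⟩).size), F (a + 1) i = _
          rw [← Fin.sum_univ_eq_sum_range]
          have : ∑ p : Fin (2 * (col ⟨a, h⟩).size), F (a + 1) p.val = 0 :=
            (Finset.sum_congr rfl (fun p _ => hFx (Sum.inr ⟨⟨a, h⟩, p⟩))).trans (hf₁ ⟨a, h⟩)
          rw [this]; simp [H]
        · have e : sz c col (a + 1) = 0 := dif_neg h
          rw [e]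
    have hseg : ∀ (d : Col) (a : ℕ), sz c col a = 2 * d.size → ∀ j ≤ 2 * d.size,
        H a (d.seg j).val = H a j := by
      intro d a hd j hj
      rcases hj.eq_or_lt with rfl | hj
      · rw [Col.seg_two_mul_size, ← hd, hF₀]
        simp [Col.seg]
      · congr 1
        exact Nat.mod_eq_of_lt (lt_of_lt_of_le hj (le_max_right _ _))
    let G : ((boundary c).union fun i => boundary (col i)).Region → ZMod 2 := fun r =>
      H (number (b := b) (m := c.segs) (n := fun i => (col i).segs) r).1
        (number (b := b) (m := c.segs) (n := fun i => (col i).segs) r).2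
    have hle : ∀ (n p : ℕ), p < n → (if p % 2 = 0 then p else p + 1) ≤ n ∧
        (if p % 2 = 0 then p + 1 else p) ≤ n := by
      intro n p h
      split_ifs <;> omega
    have hw : ∀ x, G (((boundary c).union fun i => boundary (col i)).white x) =
        H (num x).1 (if (num x).2 % 2 = 0 then (num x).2 else (num x).2 + 1) := by
      rintro (p | ⟨i, p⟩)
      · exact hseg c 0 rfl _ (hle _ _ p.isLt).1
      · exact hseg (col i) (i.val + 1) (sz_succ c col i) _ (hle _ _ p.isLt).1
    have hb : ∀ x, G (((boundary c).union fun i => boundary (col i)).black x) =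
        H (num x).1 (if (num x).2 % 2 = 0 then (num x).2 + 1 else (num x).2) := by
      rintro (p | ⟨i, p⟩)
      · exact hseg c 0 rfl _ (hle _ _ p.isLt).2
      · exact hseg (col i) (i.val + 1) (sz_succ c col i) _ (hle _ _ p.isLt).2
    have hwb : ∀ x, f ((draw c col J A).strandAt x) =
        G (((boundary c).union fun i => boundary (col i)).white x) +
          G (((boundary c).union fun i => boundary (col i)).black x) := by
      intro x
      refine (hFx x).symm.trans (Eq.trans ?_ (congrArg₂ (· + ·) (hw x).symm (hb x).symm))
      have h := hsucc (num x).1 (num x).2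
      have h₂ := CharTwo.add_self_eq_zero (H (num x).1 (num x).2)
      split_ifs
      · rw [h, ← add_assoc, h₂, zero_add]
      · rw [h, add_comm (H _ _ + _), ← add_assoc, h₂, zero_add]
    -- A strand has the same white and the same black side at both of its ends.
    have hside : ∀ x y : (draw c col J A).Mark, (num x, num y) ∈ J →
        G (((boundary c).union fun i => boundary (col i)).white x) =
          G (((boundary c).union fun i => boundary (col i)).white y) ∧
        G (((boundary c).union fun i => boundary (col i)).black x) =
          G (((boundary c).union fun i => boundary (col i)).black y) := by
      intro x y h
      have h₁ : H (num x).1 (num x).2 = H (num y).1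
          (if (num x).2 % 2 = (num y).2 % 2 then (num y).2 else (num y).2 + 1) :=
        hκ _ _ h (number_valid x) (number_valid y)
      have h₂ : F (num x).1 (num x).2 = F (num y).1 (num y).2 :=
        (hFx x).trans ((congrArg f (draw_strand_eq x y h)).trans (hFx y).symm)
      have h₃ := hsucc (num x).1 (num x).2
      have h₄ := hsucc (num y).1 (num y).2
      have h₅ := CharTwo.add_self_eq_zero (F (num y).1 (num y).2)
      refine ⟨(hw x).trans (Eq.trans ?_ (hw y).symm), (hb x).trans (Eq.trans ?_ (hb y).symm)⟩
      · split_ifs at h₁ ⊢ with e₁ e₂ e₃ e₃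
        all_goals first
          | omega
          | exact h₁
          | (rw [h₃, h₄, h₁, h₂])
          | (rw [h₃, h₁, h₄, h₂, add_assoc, h₅, add_zero])
      · split_ifs at h₁ ⊢ with e₁ e₂ e₃ e₃
        all_goals first
          | omega
          | exact h₁
          | (rw [h₃, h₄, h₁, h₂])
          | (rw [h₃, h₁, h₄, h₂, add_assoc, h₅, add_zero])
    refine ⟨Quot.lift G ?_, ?_⟩
    · rintro r r' (⟨h, -⟩ | ⟨x, y, h, ⟨rfl, rfl⟩ | ⟨rfl, rfl⟩⟩)
      · exact hκA _ _ h
      · exact (hside x y h).1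
      · exact (hside x y h).2
    · rintro ⟨x⟩
      rcases x with x | ⟨i, x⟩
      · exact hwb (Sum.inl x)
      · exact hwb (Sum.inr ⟨i, x⟩)

end Diagram

end Skein

namespace Skein

open Net

namespace Diagram

/-! ### Composites of tangles are tangles -/

/-- In a finite set, a path along an injective partial function that starts at a point without
predecessor comes to an end. -/
theorem exists_last {V : Type*} [Finite V] {R : V → V → Prop}
    (hl : ∀ x y z, R x z → R y z → x = y) (v : V) (hv : ∀ x, ¬ R x v) :
    ∃ w, Relation.ReflTransGen R v w ∧ ∀ x, ¬ R w x := by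
  by_contra! hc
  have hc' : ∀ w : {w // Relation.ReflTransGen R v w},
      ∃ x : {w // Relation.ReflTransGen R v w}, R w.1 x.1 := by
    rintro ⟨w, hw⟩
    obtain ⟨x, hx⟩ := hc w hw
    exact ⟨⟨x, hw.tail hx⟩, hx⟩
  choose f hf using hc'
  let p : ℕ → {w // Relation.ReflTransGen R v w} := fun n => f^[n] ⟨v, .refl⟩
  have hp : ∀ n, R (p n).1 (p (n + 1)).1 := by
    intro n
    simp only [p, Function.iterate_succ_apply']
    exact hf _
  have hinj : ∀ m n, (p m).1 = (p (m + n)).1 → n = 0 := by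
    intro m
    induction m with
    | zero =>
      intro n h
      cases n with
      | zero => rfl
      | succ n =>
        have := hp (0 + n)
        rw [add_assoc, ← h] at this
        exact absurd this (hv _)
    | succ m ih =>
      intro n h
      refine ih n (hl _ _ (p (m + 1)).1 (hp m) ?_)
      rw [h, show m + 1 + n = m + n + 1 by ring]
      exact hp _
  have : Function.Injective (fun n => (p n).1) := by
    intro m n h
    dsimp only at h
    rcases le_total m n with h' | h'
    · obtain ⟨d, rfl⟩ := Nat.exists_eq_add_of_le h'
      rw [hinj _ _ h, add_zero]
    · obtain ⟨d, rfl⟩ := Nat.exists_eq_add_of_le h'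
      rw [hinj _ _ h.symm, add_zero]
  exact not_injective_infinite_finite _ this

/-- The classes of a relation that is functional in both directions are directed paths (or cycles). -/
theorem reflTransGen_of_eqvGen {V : Type*} {R : V → V → Prop}
    (hl : ∀ x y z, R x z → R y z → x = y) (hr : ∀ x y z, R x y → R x z → y = z) {v w : V}
    (h : Relation.EqvGen R v w) : Relation.ReflTransGen R v w ∨ Relation.ReflTransGen R w v := by
  induction h with
  | rel x y h => exact Or.inl (.single h)
  | refl x => exact Or.inl .refl
  | symm x y _ ih => exact ih.symm
  | trans x y z _ _ ih₁ ih₂ =>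
    rcases ih₁ with h₁ | h₁ <;> rcases ih₂ with h₂ | h₂
    · exact Or.inl (h₁.trans h₂)
    · have : Relator.RightUnique (Function.swap R) := fun a b c h h' => hl _ _ _ h h'
      have := Relation.ReflTransGen.total_of_right_unique this
        (Relation.reflTransGen_swap.2 h₁) (Relation.reflTransGen_swap.2 h₂)
      exact (this.imp Relation.reflTransGen_swap.1 Relation.reflTransGen_swap.1).symm
    · have : Relator.RightUnique R := fun a b c h h' => hr _ _ _ h h'
      exact Relation.ReflTransGen.total_of_right_unique this h₁ h₂
    · exact Or.inr (h₂.trans h₁)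

theorem eq_of_reflTransGen {V : Type*} {R : V → V → Prop} {v w : V}
    (h : Relation.ReflTransGen R v w) (hw : ∀ x, ¬ R x w) : v = w := by
  rcases h.cases_tail with h | ⟨x, _, hx⟩
  · exact h.symm
  · exact absurd hx (hw x)

/-- The strands that meet a marked point have two ends, so the sum over all marked points of a
function on the strands vanishes. -/
theorem IsTangle.sum_eq_zero {c : Col} {D : Diagram c} (hD : D.IsTangle)
    (f : D.net.Strand → ZMod 2)
    (h : ∀ i, ∑ p : Fin (2 * (D.boxCol i).size), f ((D.inn i).strand p) = 0) :
    ∑ p : Fin (2 * c.size), f (D.out.strand p) = 0 := by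
  classical
  have := Fintype.ofFinite D.Box
  have hex : ∀ m : D.Mark, ∃ m', D.strandAt m' = D.strandAt m ∧ (D.starts m ↔ ¬ D.starts m') := by
    intro m
    by_cases hm : D.starts m
    · obtain ⟨m', h₁, h₂⟩ := (hD.start_iff_end (D.strandAt m)).1 ⟨m, hm, rfl⟩
      exact ⟨m', h₂, by tauto⟩
    · obtain ⟨m', h₁, h₂⟩ := (hD.start_iff_end (D.strandAt m)).2 ⟨m, hm, rfl⟩
      exact ⟨m', h₂, by tauto⟩
  choose g hg hgs using hex
  have htot : ∑ m : D.Mark, f (D.strandAt m) = 0 := by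
    refine Finset.sum_involution (fun m _ => g m) (fun m _ => ?_) (fun m _ _ he => ?_)
      (fun m _ => Finset.mem_univ _) (fun m _ => ?_)
    · rw [hg, CharTwo.add_self_eq_zero]
    · have := hgs m
      rw [he] at this
      tauto
    · have h₁ := hgs m
      have h₂ := hgs (g m)
      have h₃ : D.strandAt (g (g m)) = D.strandAt m := (hg _).trans (hg _)
      by_cases hm : D.starts m
      · exact hD.start_inj _ _ (by tauto) hm h₃
      · exact hD.end_inj _ _ (by tauto) hm h₃
  rw [Fintype.sum_sum_type, Fintype.sum_sigma] at htot
  have h₂ : ∑ i, ∑ p : Fin (2 * (D.boxCol i).size), f (D.strandAt (Sum.inr ⟨i, p⟩)) = 0 :=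
    Finset.sum_eq_zero (fun i _ => h i)
  rw [h₂, add_zero] at htot
  exact htot

/-- The directed gluing relation on the strands of the parts of a composite: the first strand ends
where the second one starts, on the boundary of a box of `W`. -/
def Glue {c : Col} (W : Diagram c) (S : ∀ i : W.Box, Diagram (W.boxCol i)) :
    W.net.Strand ⊕ (Σ i, (S i).net.Strand) → W.net.Strand ⊕ (Σ i, (S i).net.Strand) → Prop :=
  fun x y => ∃ (i : W.Box) (p : Fin (2 * (W.boxCol i).size)),
    (p.val % 2 = 0 ∧ x = Sum.inl ((W.inn i).strand p) ∧ y = Sum.inr ⟨i, (S i).out.strand p⟩) ∨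
    (p.val % 2 = 1 ∧ x = Sum.inr ⟨i, (S i).out.strand p⟩ ∧ y = Sum.inl ((W.inn i).strand p))

/-- The strand of a part of a composite that ends at a given marked point. -/
def partAt {c : Col} (W : Diagram c) (S : ∀ i : W.Box, Diagram (W.boxCol i)) :
    (W.comp S).Mark → W.net.Strand ⊕ (Σ i, (S i).net.Strand)
  | Sum.inl p => Sum.inl (W.out.strand p)
  | Sum.inr ⟨i, p⟩ => Sum.inr ⟨(ofLex i).1, ((S (ofLex i).1).inn (ofLex i).2).strand p⟩

/-- The class in the composite of a strand of a part. -/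
def glued {c : Col} (W : Diagram c) (S : ∀ i : W.Box, Diagram (W.boxCol i))
    (x : W.net.Strand ⊕ (Σ i, (S i).net.Strand)) : (W.comp S).net.Strand := Quot.mk _ x

theorem glued_partAt {c : Col} (W : Diagram c) (S : ∀ i : W.Box, Diagram (W.boxCol i))
    (m : (W.comp S).Mark) : glued W S (partAt W S m) = (W.comp S).strandAt m := by
  rcases m with p | ⟨i, p⟩ <;> rfl

theorem glued_of_glue {c : Col} {W : Diagram c} {S : ∀ i : W.Box, Diagram (W.boxCol i)}
    {x y : W.net.Strand ⊕ (Σ i, (S i).net.Strand)} (h : Glue W S x y) :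
    glued W S x = glued W S y := by
  obtain ⟨i, p, ⟨-, rfl, rfl⟩ | ⟨-, rfl, rfl⟩⟩ := h
  · exact Quot.sound ⟨i, p, rfl, rfl⟩
  · exact (Quot.sound ⟨i, p, rfl, rfl⟩).symm

/-- Strands of the parts that become equal in the composite are connected by gluing points. -/
theorem eqvGen_of_glued_eq {c : Col} {W : Diagram c} {S : ∀ i : W.Box, Diagram (W.boxCol i)}
    {x y : W.net.Strand ⊕ (Σ i, (S i).net.Strand)} (h : glued W S x = glued W S y) :
    Relation.EqvGen (Glue W S) x y := by
  have h := Quot.eqvGen_exact h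
  clear * - h
  induction h with
  | rel x y h =>
    obtain ⟨i, p, rfl, rfl⟩ := h
    rcases Nat.mod_two_eq_zero_or_one p.val with hp | hp
    · exact .rel _ _ ⟨i, p, Or.inl ⟨hp, rfl, rfl⟩⟩
    · exact .symm _ _ (.rel _ _ ⟨i, p, Or.inr ⟨hp, rfl, rfl⟩⟩)
  | refl x => exact .refl _
  | symm x y _ ih => exact .symm _ _ ih
  | trans x y z _ _ ih₁ ih₂ => exact .trans _ _ _ ih₁ ih₂

section

variable {c : Col} {W : Diagram c} {S : ∀ i : W.Box, Diagram (W.boxCol i)}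

/-- The marked points of the parts of a composite. -/
inductive PartMark (W : Diagram c) (S : ∀ i : W.Box, Diagram (W.boxCol i)) where
  | outer (m : W.Mark)
  | inner (i : W.Box) (m : (S i).Mark)

/-- The strand of a part that ends at a given marked point of this part. -/
def PartMark.strand : PartMark W S → W.net.Strand ⊕ (Σ i, (S i).net.Strand)
  | outer m => Sum.inl (W.strandAt m)
  | inner i m => Sum.inr ⟨i, (S i).strandAt m⟩

/-- The direction of a strand of a part at a marked point; see `Diagram.starts`. -/
def PartMark.starts : PartMark W S → Prop
  | outer m => W.starts m
  | inner i m => (S i).starts m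

theorem partMark_start_inj (hW : W.IsTangle) (hS : ∀ i, (S i).IsTangle) (m n : PartMark W S)
    (hm : m.starts) (hn : n.starts) (h : m.strand = n.strand) : m = n := by
  cases m <;> cases n <;> simp only [PartMark.strand, Sum.inl.injEq, Sum.inr.injEq,
    reduceCtorEq, Sigma.mk.injEq] at h
  · rw [hW.start_inj _ _ hm hn h]
  · obtain ⟨rfl, h⟩ := h
    rw [(hS _).start_inj _ _ hm hn (eq_of_heq h)]

theorem partMark_end_inj (hW : W.IsTangle) (hS : ∀ i, (S i).IsTangle) (m n : PartMark W S)
    (hm : ¬ m.starts) (hn : ¬ n.starts) (h : m.strand = n.strand) : m = n := by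
  cases m <;> cases n <;> simp only [PartMark.strand, Sum.inl.injEq, Sum.inr.injEq,
    reduceCtorEq, Sigma.mk.injEq] at h
  · rw [hW.end_inj _ _ hm hn h]
  · obtain ⟨rfl, h⟩ := h
    rw [(hS _).end_inj _ _ hm hn (eq_of_heq h)]

theorem partMark_start_iff_end (hW : W.IsTangle) (hS : ∀ i, (S i).IsTangle)
    (x : W.net.Strand ⊕ (Σ i, (S i).net.Strand)) :
    (∃ m : PartMark W S, m.starts ∧ m.strand = x) ↔
      ∃ m : PartMark W S, ¬ m.starts ∧ m.strand = x := by
  rcases x with x | ⟨i, x⟩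
  · have h := hW.start_iff_end x
    constructor
    · rintro ⟨m | ⟨i, m⟩, hm, h'⟩
      · obtain ⟨n, hn, h''⟩ := h.1 ⟨m, hm, Sum.inl.inj h'⟩
        exact ⟨.outer n, hn, congrArg Sum.inl h''⟩
      · cases h'
    · rintro ⟨m | ⟨i, m⟩, hm, h'⟩
      · obtain ⟨n, hn, h''⟩ := h.2 ⟨m, hm, Sum.inl.inj h'⟩
        exact ⟨.outer n, hn, congrArg Sum.inl h''⟩
      · cases h'
  · have h := (hS i).start_iff_end x
    constructor
    · rintro ⟨m | ⟨j, m⟩, hm, h'⟩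
      · cases h'
      · simp only [PartMark.strand, Sum.inr.injEq, Sigma.mk.injEq] at h'
        obtain ⟨rfl, h'⟩ := h'
        obtain ⟨n, hn, rfl⟩ := h.1 ⟨m, hm, eq_of_heq h'⟩
        exact ⟨.inner j n, hn, rfl⟩
    · rintro ⟨m | ⟨j, m⟩, hm, h'⟩
      · cases h'
      · simp only [PartMark.strand, Sum.inr.injEq, Sigma.mk.injEq] at h'
        obtain ⟨rfl, h'⟩ := h'
        obtain ⟨n, hn, rfl⟩ := h.2 ⟨m, hm, eq_of_heq h'⟩
        exact ⟨.inner j n, hn, rfl⟩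

/-- A gluing point is the end of a strand of one part and the start of a strand of another part. -/
theorem glue_iff {x y : W.net.Strand ⊕ (Σ i, (S i).net.Strand)} :
    Glue W S x y ↔ ∃ (i : W.Box) (p : Fin (2 * (W.boxCol i).size)) (m n : PartMark W S),
      ¬ m.starts ∧ n.starts ∧ m.strand = x ∧ n.strand = y ∧
      ((m = .outer (Sum.inr ⟨i, p⟩) ∧ n = .inner i (Sum.inl p)) ∨
        (n = .outer (Sum.inr ⟨i, p⟩) ∧ m = .inner i (Sum.inl p))) := by
  constructor
  · rintro ⟨i, p, ⟨hp, rfl, rfl⟩ | ⟨hp, rfl, rfl⟩⟩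
    · refine ⟨i, p, .outer (Sum.inr ⟨i, p⟩), .inner i (Sum.inl p), ?_, hp, rfl, rfl,
        Or.inl ⟨rfl, rfl⟩⟩
      change ¬ p.val % 2 = 1
      omega
    · refine ⟨i, p, .inner i (Sum.inl p), .outer (Sum.inr ⟨i, p⟩), ?_, hp, rfl, rfl,
        Or.inr ⟨rfl, rfl⟩⟩
      change ¬ p.val % 2 = 0
      omega
  · rintro ⟨i, p, m, n, hm, hn, rfl, rfl, ⟨rfl, rfl⟩ | ⟨rfl, rfl⟩⟩
    · exact ⟨i, p, Or.inl ⟨hn, rfl, rfl⟩⟩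
    · exact ⟨i, p, Or.inr ⟨hn, rfl, rfl⟩⟩

theorem glue_left_unique (hW : W.IsTangle) (hS : ∀ i, (S i).IsTangle)
    (x y z : W.net.Strand ⊕ (Σ i, (S i).net.Strand)) (h₁ : Glue W S x z) (h₂ : Glue W S y z) :
    x = y := by
  obtain ⟨i, p, m, n, hm, hn, rfl, rfl, k₁⟩ := glue_iff.1 h₁
  obtain ⟨i', p', m', n', hm', hn', rfl, hz, k₂⟩ := glue_iff.1 h₂
  have h := partMark_start_inj hW hS n' n hn' hn hz
  rcases k₁ with ⟨e₁, e₂⟩ | ⟨e₁, e₂⟩ <;> rcases k₂ with ⟨e₃, e₄⟩ | ⟨e₃, e₄⟩ <;>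
    subst e₁ e₂ e₃ e₄ <;> cases h <;> rfl

theorem glue_right_unique (hW : W.IsTangle) (hS : ∀ i, (S i).IsTangle)
    (x y z : W.net.Strand ⊕ (Σ i, (S i).net.Strand)) (h₁ : Glue W S x y) (h₂ : Glue W S x z) :
    y = z := by
  obtain ⟨i, p, m, n, hm, hn, rfl, rfl, k₁⟩ := glue_iff.1 h₁
  obtain ⟨i', p', m', n', hm', hn', hz, rfl, k₂⟩ := glue_iff.1 h₂
  have h := partMark_end_inj hW hS m' m hm' hm hz
  rcases k₁ with ⟨e₁, e₂⟩ | ⟨e₁, e₂⟩ <;> rcases k₂ with ⟨e₃, e₄⟩ | ⟨e₃, e₄⟩ <;>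
    subst e₁ e₂ e₃ e₄ <;> cases h <;> rfl

/-- A marked point of the composite, as a marked point of a part. -/
def toPart : (W.comp S).Mark → PartMark W S
  | Sum.inl p => .outer (Sum.inl p)
  | Sum.inr ⟨i, p⟩ => .inner (ofLex i).1 (Sum.inr ⟨(ofLex i).2, p⟩)

theorem toPart_strand (m : (W.comp S).Mark) : (toPart m).strand = partAt W S m := by
  rcases m with p | ⟨i, p⟩ <;> rfl

theorem toPart_starts (m : (W.comp S).Mark) : (toPart m).starts ↔ (W.comp S).starts m := by
  rcases m with p | ⟨i, p⟩ <;> exact Iff.rfl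

theorem toPart_inj (m n : (W.comp S).Mark) (h : toPart m = toPart n) : m = n := by
  rcases m with p | ⟨⟨i, j⟩, p⟩ <;> rcases n with q | ⟨⟨i', j'⟩, q⟩
  · cases h; rfl
  · cases h
  · cases h
  · cases h; rfl

/-- A marked point of a part is a marked point of the composite or lies on the boundary of a box
of `W`, where parts are glued. -/
theorem toPart_or_glue (m : PartMark W S) : (∃ n, toPart n = m) ∨
    ∃ (i : W.Box) (p : Fin (2 * (W.boxCol i).size)),
      m = .outer (Sum.inr ⟨i, p⟩) ∨ m = .inner i (Sum.inl p) := by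
  rcases m with (p | ⟨i, p⟩) | ⟨i, p | ⟨j, p⟩⟩
  · exact Or.inl ⟨Sum.inl p, rfl⟩
  · exact Or.inr ⟨i, p, Or.inl rfl⟩
  · exact Or.inr ⟨i, p, Or.inr rfl⟩
  · exact Or.inl ⟨Sum.inr ⟨toLex ⟨i, j⟩, p⟩, rfl⟩

theorem toPart_not_glue (n : (W.comp S).Mark) (i : W.Box) (p : Fin (2 * (W.boxCol i).size)) :
    toPart n ≠ .outer (Sum.inr ⟨i, p⟩) ∧ toPart n ≠ .inner i (Sum.inl p) := by
  rcases n with q | ⟨⟨i', j'⟩, q⟩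
  · exact ⟨fun h => (by cases h), fun h => (by cases h)⟩
  · exact ⟨fun h => (by cases h), fun h => (by cases h)⟩

theorem glue_from_end {m : PartMark W S} (hm : ¬ m.starts) (h : ∀ n, toPart n ≠ m) :
    ∃ y, Glue W S m.strand y := by
  rcases toPart_or_glue m with ⟨n, hn⟩ | ⟨i, p, rfl | rfl⟩
  · exact absurd hn (h n)
  · have hm' : ¬ p.val % 2 = 1 := hm
    exact ⟨_, i, p, Or.inl ⟨by omega, rfl, rfl⟩⟩
  · have hm' : ¬ p.val % 2 = 0 := hm
    exact ⟨_, i, p, Or.inr ⟨by omega, rfl, rfl⟩⟩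

theorem glue_to_start {m : PartMark W S} (hm : m.starts) (h : ∀ n, toPart n ≠ m) :
    ∃ y, Glue W S y m.strand := by
  rcases toPart_or_glue m with ⟨n, hn⟩ | ⟨i, p, rfl | rfl⟩
  · exact absurd hn (h n)
  · exact ⟨_, i, p, Or.inr ⟨hm, rfl, rfl⟩⟩
  · exact ⟨_, i, p, Or.inl ⟨hm, rfl, rfl⟩⟩

theorem no_glue_to_start (hW : W.IsTangle) (hS : ∀ i, (S i).IsTangle) {m : (W.comp S).Mark}
    (hm : (W.comp S).starts m) (x : W.net.Strand ⊕ (Σ i, (S i).net.Strand)) :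
    ¬ Glue W S x (partAt W S m) := by
  intro h
  obtain ⟨i, p, m', n, hm', hn, -, h₁, h₂⟩ := glue_iff.1 h
  rw [← toPart_strand] at h₁
  obtain rfl := partMark_start_inj hW hS _ _ hn ((toPart_starts m).2 hm) h₁
  have := toPart_not_glue m i p
  tauto

theorem no_glue_from_end (hW : W.IsTangle) (hS : ∀ i, (S i).IsTangle) {m : (W.comp S).Mark}
    (hm : ¬ (W.comp S).starts m) (x : W.net.Strand ⊕ (Σ i, (S i).net.Strand)) :
    ¬ Glue W S (partAt W S m) x := by
  intro h
  obtain ⟨i, p, m', n, hm', hn, h₁, -, h₂⟩ := glue_iff.1 h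
  rw [← toPart_strand] at h₁
  obtain rfl := partMark_end_inj hW hS _ _ hm' (fun h => hm ((toPart_starts m).1 h)) h₁
  have := toPart_not_glue m i p
  tauto

theorem glued_of_reflTransGen {x y : W.net.Strand ⊕ (Σ i, (S i).net.Strand)}
    (h : Relation.ReflTransGen (Glue W S) x y) : glued W S x = glued W S y := by
  induction h with
  | refl => rfl
  | tail _ h ih => exact ih.trans (glued_of_glue h)

/-- Substituting tangles into a tangle yields a tangle. The strands of the composite are the
maximal paths of strands of the parts, so a path that has a start has an end. For the Jordan
property, functions on the regions are found for each part and adjusted by constants so as to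
agree along the glued boundaries. -/
theorem comp_isTangle (hW : W.IsTangle) (hS : ∀ i, (S i).IsTangle) : (W.comp S).IsTangle := by
  have hl := glue_left_unique hW hS
  have hr := glue_right_unique hW hS
  refine ⟨?_, ?_, ?_, ?_, ?_⟩
  · intro m n hm hn h
    rw [← glued_partAt, ← glued_partAt] at h
    have : partAt W S m = partAt W S n := by
      rcases reflTransGen_of_eqvGen hl hr (eqvGen_of_glued_eq h) with h | h
      · exact eq_of_reflTransGen h (no_glue_to_start hW hS hn)
      · exact (eq_of_reflTransGen h (no_glue_to_start hW hS hm)).symm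
    rw [← toPart_strand, ← toPart_strand] at this
    exact toPart_inj _ _ (partMark_start_inj hW hS _ _ ((toPart_starts m).2 hm)
      ((toPart_starts n).2 hn) this)
  · intro m n hm hn h
    rw [← glued_partAt, ← glued_partAt] at h
    have hsw : ∀ {x y}, Relation.ReflTransGen (Glue W S) x y → (∀ z, ¬ Glue W S x z) → x = y :=
      fun h h' => (eq_of_reflTransGen (Relation.reflTransGen_swap.2 h) h').symm
    have : partAt W S m = partAt W S n := by
      rcases reflTransGen_of_eqvGen hl hr (eqvGen_of_glued_eq h) with h | h
      · exact hsw h (no_glue_from_end hW hS hm)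
      · exact (hsw h (no_glue_from_end hW hS hn)).symm
    rw [← toPart_strand, ← toPart_strand] at this
    exact toPart_inj _ _ (partMark_end_inj hW hS _ _ (fun h => hm ((toPart_starts m).1 h))
      (fun h => hn ((toPart_starts n).1 h)) this)
  · intro x
    constructor
    · rintro ⟨m, hm, rfl⟩
      -- Follow the path of glued strands from its start to its last strand.
      obtain ⟨w, hw, hlast⟩ := exists_last hl _ (no_glue_to_start hW hS hm)
      have hstart : ∃ n : PartMark W S, n.starts ∧ n.strand = w := by
        rcases hw.cases_tail with h | ⟨v, -, h⟩
        · exact ⟨toPart m, (toPart_starts m).2 hm, by rw [toPart_strand, h]⟩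
        · obtain ⟨_, _, _, n, _, hn, _, h, _⟩ := glue_iff.1 h
          exact ⟨n, hn, h⟩
      obtain ⟨n, hn, rfl⟩ := (partMark_start_iff_end hW hS w).1 hstart
      obtain ⟨n', rfl⟩ : ∃ n', toPart n' = n := by
        by_contra! h
        obtain ⟨y, hy⟩ := glue_from_end hn h
        exact hlast y hy
      refine ⟨n', fun h => hn ((toPart_starts n').2 h), ?_⟩
      rw [← glued_partAt, ← glued_partAt, ← toPart_strand n']
      exact (glued_of_reflTransGen hw).symm
    · rintro ⟨m, hm, rfl⟩
      obtain ⟨w, hw, hlast⟩ := exists_last (R := Function.swap (Glue W S))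
        (fun x y z h h' => hr z x y h h') _ (no_glue_from_end hW hS hm)
      have hstart : ∃ n : PartMark W S, ¬ n.starts ∧ n.strand = w := by
        rcases hw.cases_tail with h | ⟨v, -, h⟩
        · exact ⟨toPart m, fun h => hm ((toPart_starts m).1 h), by rw [toPart_strand, h]⟩
        · obtain ⟨_, _, n, _, hn, _, h, _, _⟩ := glue_iff.1 h
          exact ⟨n, hn, h⟩
      obtain ⟨n, hn, rfl⟩ := (partMark_start_iff_end hW hS w).2 hstart
      obtain ⟨n', rfl⟩ : ∃ n', toPart n' = n := by
        by_contra! h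
        obtain ⟨y, hy⟩ := glue_to_start hn h
        exact hlast y hy
      refine ⟨n', (toPart_starts n').1 hn, ?_⟩
      rw [← glued_partAt, ← glued_partAt, ← toPart_strand n']
      exact glued_of_reflTransGen (Relation.reflTransGen_swap.1 hw)
  · intro g hg
    have h₁ : ∀ r s, g ((compL W S).region r) = g ((compL W S).region s) :=
      hW.connected (fun r => g ((compL W S).region r)) (fun x => hg ((compL W S).strand x))
    have h₂ : ∀ i r s, g ((compR W S i).region r) = g ((compR W S i).region s) := fun i =>
      (hS i).connected (fun r => g ((compR W S i).region r)) (fun x => hg ((compR W S i).strand x))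
    have h₃ : ∀ i, g ((compL W S).region ((W.inn i).rg 0)) =
        g ((compR W S i).region ((S i).out.rg 0)) := by
      intro i
      exact congrArg (fun o : Hom (boundary (W.boxCol i)) (W.comp S).net => g (o.rg 0))
        (compL_inn W S i)
    have h₀ : ∀ r, g r = g ((W.comp S).out.rg 0) := by
      rintro ⟨r | ⟨i, r⟩⟩
      · exact h₁ r _
      · exact (h₂ i r _).trans ((h₃ i).symm.trans (h₁ _ _))
    intro r s
    rw [h₀ r, h₀ s]
  · intro f hf₀ hf₁
    have hloc : ∀ i, ∃ g : (S i).net.Region → ZMod 2, ∀ x,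
        f ((compR W S i).strand x) = g ((S i).net.white x) + g ((S i).net.black x) := by
      intro i
      refine (hS i).jordan (fun x => f ((compR W S i).strand x)) ?_ ?_
      · exact (hS i).sum_eq_zero (fun x => f ((compR W S i).strand x))
          (fun j => hf₁ (toLex ⟨i, j⟩))
      · exact fun j => hf₁ (toLex ⟨i, j⟩)
    choose g hg using hloc
    have hinn : ∀ i p, (compL W S).strand ((W.inn i).strand p) =
        (compR W S i).strand ((S i).out.strand p) := fun i p =>
      congrArg (fun o : Hom (boundary (W.boxCol i)) (W.comp S).net => o.strand p) (compL_inn W S i)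
    obtain ⟨g₀, hg₀⟩ := hW.jordan (fun x => f ((compL W S).strand x)) hf₀ (by
      intro i
      refine Eq.trans ?_ ((S i).out.sum_jump (g i))
      refine Finset.sum_congr rfl (fun p _ => ?_)
      exact (congrArg f (hinn i p)).trans (hg i _))
    -- The functions found on `W` and on `S i` differ by a constant along the box `i`.
    let κ : W.Box → ZMod 2 := fun i => g₀ ((W.inn i).rg 0) + g i ((S i).out.rg 0)
    have hκ : ∀ i (s : (boundary (W.boxCol i)).Region),
        g₀ ((W.inn i).region s) = g i ((S i).out.region s) + κ i := by
      intro i s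
      let o : Hom (boundary (W.boxCol i)) (boundary (W.boxCol i)) := Hom.id _
      let d : (boundary (W.boxCol i)).Region → ZMod 2 := fun s =>
        g₀ ((W.inn i).region s) + g i ((S i).out.region s)
      have hd : ∀ p, d ((boundary (W.boxCol i)).white (o.strand p)) =
          d ((boundary (W.boxCol i)).black (o.strand p)) := by
        intro p
        have e₁ := hg₀ ((W.inn i).strand p)
        have e₂ := hg i ((S i).out.strand p)
        have e₃ := e₁.symm.trans ((congrArg f (hinn i p)).trans e₂)
        rw [(W.inn i).white_strand, (W.inn i).black_strand, (S i).out.white_strand,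
          (S i).out.black_strand] at e₃
        have e₄ : ∀ a b a' b' : ZMod 2, a + b = a' + b' → a + a' = b + b' := by decide
        exact e₄ _ _ _ _ e₃
      obtain ⟨j, hj, -, hs⟩ := o.exists_rg s
      have h := o.const_of_no_jump d hd j hj
      rw [← hs] at h
      have e₄ : ∀ a b c : ZMod 2, a + b = c → a = b + c := by decide
      exact e₄ _ _ _ h
    refine ⟨Quot.lift (Sum.elim g₀ (fun r => g r.1 r.2 + κ r.1)) ?_, ?_⟩
    · rintro r r' (⟨i, s, rfl, rfl⟩ | ⟨x, y, ⟨i, p, rfl, rfl⟩, ⟨rfl, rfl⟩ | ⟨rfl, rfl⟩⟩)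
      · exact hκ i s
      · refine Eq.trans ?_ ((hκ i ((boundary (W.boxCol i)).white p)).trans ?_)
        · exact congrArg g₀ ((W.inn i).white_strand p)
        · exact congrArg (fun r => g i r + κ i) ((S i).out.white_strand p).symm
      · refine Eq.trans ?_ ((hκ i ((boundary (W.boxCol i)).black p)).trans ?_)
        · exact congrArg g₀ ((W.inn i).black_strand p)
        · exact congrArg (fun r => g i r + κ i) ((S i).out.black_strand p).symm
    · rintro ⟨x | ⟨i, x⟩⟩
      · exact hg₀ x
      · refine (hg i x).trans ?_
        change _ = (g i ((S i).net.white x) + κ i) + (g i ((S i).net.black x) + κ i)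
        have e : ∀ a b c : ZMod 2, a + b = (a + c) + (b + c) := by decide
        exact e _ _ _

end

end Diagram

end Skein

namespace Skein

open Net

namespace Net

/-- Read a boundary of colour `d'` as one of the equal colour `d`. -/
def Hom.castCol {d d' : Col} {N : Net} (h : d = d') (o : Hom (boundary d') N) :
    Hom (boundary d) N := h ▸ o

theorem Hom.castCol_strand {d d' : Col} {N : Net} (h : d = d') (o : Hom (boundary d') N)
    (p : Fin (2 * d.size)) :
    (o.castCol h).strand p = o.strand (Fin.cast (congrArg (fun d : Col => 2 * d.size) h) p) := by
  subst h; rfl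

theorem Hom.castCol_region {d d' : Col} {N : Net} (h : d = d') (o : Hom (boundary d') N)
    (s : Fin d.segs) :
    (o.castCol h).region s = o.region (Fin.cast (congrArg Col.segs h) s) := by
  subst h; rfl

end Net

namespace Diagram

/-! ### A criterion for isotopy -/

/-- Isotopy is a symmetric relation. -/
theorem Isotopy.symm {c : Col} {X Y : Diagram c} (e : Isotopy X Y) : Nonempty (Isotopy Y X) := by
  have hcol : ∀ j, Y.boxCol j = X.boxCol (e.box.symm j) := by
    intro j
    rw [e.boxCol, OrderIso.apply_symm_apply]
  refine ⟨⟨e.box.symm, hcol, e.strand.symm, e.region.symm, ?_, ?_, ?_, ?_, ?_, ?_, ?_⟩⟩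
  · intro r
    rw [← e.shaded, Equiv.apply_symm_apply]
  · intro x
    rw [Equiv.eq_symm_apply, ← e.white, Equiv.apply_symm_apply]
  · intro x
    rw [Equiv.eq_symm_apply, ← e.black, Equiv.apply_symm_apply]
  · intro p
    rw [Equiv.symm_apply_eq, e.out_strand]
  · intro p
    rw [Equiv.symm_apply_eq, e.out_region]
  · intro j p
    rw [Equiv.symm_apply_eq]
    obtain ⟨i, rfl⟩ := e.box.surjective j
    have key : ∀ i' (hi : i' = i) (h : Y.boxCol (e.box i) = X.boxCol i'),
        (Y.inn (e.box i)).strand p = e.strand ((X.inn i').strand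
          (Fin.cast (congrArg (fun d : Col => 2 * d.size) h) p)) := by
      rintro _ rfl h
      exact (e.inn_strand _ (Fin.cast (congrArg (fun d : Col => 2 * d.size) h) p)).symm
    exact key _ (e.box.symm_apply_apply i) (hcol _)
  · intro j s
    rw [Equiv.symm_apply_eq]
    obtain ⟨i, rfl⟩ := e.box.surjective j
    have key : ∀ i' (hi : i' = i) (h : Y.boxCol (e.box i) = X.boxCol i'),
        (Y.inn (e.box i)).region s = e.region ((X.inn i').region
          (Fin.cast (congrArg Col.segs h) s)) := by
      rintro _ rfl h
      exact (e.inn_region _ (Fin.cast (congrArg Col.segs h) s)).symm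
    exact key _ (e.box.symm_apply_apply i) (hcol _)

/-- A map between the nets of two diagrams that respects the external and the internal boxes, the
latter being numbered by an ordered set `B` in both diagrams. -/
structure BoxHom {c : Col} (X Y : Diagram c) (B : Type) [LinearOrder B] where
  hom : Hom X.net Y.net
  out : hom.comp X.out = Y.out
  left : B ≃o X.Box
  right : B ≃o Y.Box
  inn : ∀ b, ∃ h : X.boxCol (left b) = Y.boxCol (right b),
    hom.comp (X.inn (left b)) = (Y.inn (right b)).castCol h

namespace BoxHom

variable {c : Col} {X Y : Diagram c} {B : Type} [LinearOrder B]

/-- The bijection between the internal boxes. -/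
def box (f : BoxHom X Y B) : X.Box ≃o Y.Box := f.left.symm.trans f.right

theorem inn_box (f : BoxHom X Y B) (i : X.Box) : ∃ h : X.boxCol i = Y.boxCol (f.box i),
    f.hom.comp (X.inn i) = (Y.inn (f.box i)).castCol h := by
  obtain ⟨b, rfl⟩ := f.left.surjective i
  have e : f.box (f.left b) = f.right b := by
    simp [box]
  rw [e]
  exact f.inn b

theorem boxCol (f : BoxHom X Y B) (i : X.Box) : X.boxCol i = Y.boxCol (f.box i) :=
  (f.inn_box i).1

theorem inn_strand (f : BoxHom X Y B) (i : X.Box) (p : Fin (2 * (X.boxCol i).size)) :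
    f.hom.strand ((X.inn i).strand p) = (Y.inn (f.box i)).strand
      (Fin.cast (congrArg (fun d : Col => 2 * d.size) (f.boxCol i)) p) := by
  obtain ⟨h, e⟩ := f.inn_box i
  exact (congrArg (fun o : Hom (boundary (X.boxCol i)) Y.net => o.strand p) e).trans
    (Hom.castCol_strand h _ p)

theorem inn_region (f : BoxHom X Y B) (i : X.Box) (s : Fin (X.boxCol i).segs) :
    f.hom.region ((X.inn i).region s) = (Y.inn (f.box i)).region
      (Fin.cast (congrArg Col.segs (f.boxCol i)) s) := by
  obtain ⟨h, e⟩ := f.inn_box i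
  exact (congrArg (fun o : Hom (boundary (X.boxCol i)) Y.net => o.region s) e).trans
    (Hom.castCol_region h _ s)

theorem out_strand (f : BoxHom X Y B) (p : Fin (2 * c.size)) :
    f.hom.strand (X.out.strand p) = Y.out.strand p :=
  congrArg (fun o : Hom (boundary c) Y.net => o.strand p) f.out

theorem out_region (f : BoxHom X Y B) (s : Fin c.segs) :
    f.hom.region (X.out.region s) = Y.out.region s :=
  congrArg (fun o : Hom (boundary c) Y.net => o.region s) f.out

/-- The marked point of `Y` that corresponds to a marked point of `X`. -/
def mark (f : BoxHom X Y B) : X.Mark → Y.Mark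
  | Sum.inl p => Sum.inl p
  | Sum.inr p =>
    Sum.inr ⟨f.box p.1, Fin.cast (congrArg (fun d : Col => 2 * d.size) (f.boxCol p.1)) p.2⟩

theorem strandAt_mark (f : BoxHom X Y B) (m : X.Mark) :
    Y.strandAt (f.mark m) = f.hom.strand (X.strandAt m) := by
  rcases m with p | ⟨i, p⟩
  · exact (f.out_strand p).symm
  · exact (f.inn_strand i p).symm

theorem starts_mark (f : BoxHom X Y B) (m : X.Mark) : Y.starts (f.mark m) ↔ X.starts m := by
  rcases m with p | ⟨i, p⟩ <;> exact Iff.rfl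

theorem mark_injective (f : BoxHom X Y B) : Function.Injective f.mark := by
  rintro (p | ⟨i, p⟩) (q | ⟨j, q⟩) h <;>
    simp only [mark, Sum.inl.injEq, Sum.inr.injEq, reduceCtorEq, Sigma.mk.injEq] at h
  · rw [h]
  · obtain ⟨h₁, h₂⟩ := h
    obtain rfl : i = j := f.box.injective h₁
    have := eq_of_heq h₂
    rw [Fin.cast_inj] at this
    rw [this]

/-- On the strands that meet marked points, the map is automatically injective, since a strand of
a tangle starts at one marked point only. -/
theorem injective (f : BoxHom X Y B) (hX : X.IsTangle) (hY : Y.IsTangle)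
    (hl : ∀ x y, (∀ m, X.strandAt m ≠ x) → f.hom.strand x = f.hom.strand y → x = y) :
    Function.Injective f.hom.strand := by
  have hstart : ∀ x, (∃ m, X.strandAt m = x) → ∃ m, X.starts m ∧ X.strandAt m = x := by
    rintro x ⟨m, hm⟩
    by_cases h : X.starts m
    · exact ⟨m, h, hm⟩
    · exact (X.strandAt m |> hX.start_iff_end |>.2 ⟨m, h, rfl⟩).imp
        fun n hn => ⟨hn.1, hn.2.trans hm⟩
  intro x y hxy
  by_cases hx : ∃ m, X.strandAt m = x
  · by_cases hy : ∃ m, X.strandAt m = y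
    · obtain ⟨m, hm, rfl⟩ := hstart x hx
      obtain ⟨n, hn, rfl⟩ := hstart y hy
      rw [← strandAt_mark, ← strandAt_mark] at hxy
      rw [f.mark_injective (hY.start_inj _ _ ((f.starts_mark m).2 hm) ((f.starts_mark n).2 hn) hxy)]
    · exact (hl y x (fun m h => hy ⟨m, h⟩) hxy.symm).symm
  · exact hl x y (fun m h => hx ⟨m, h⟩) hxy

/-- If the strands correspond to each other, then so do the regions. Injectivity: since `Y` lies on
a sphere, any function on the regions of `X` differs by a constant from one that comes from `Y`. -/
theorem region_bijective (f : BoxHom X Y B) (hX : X.IsTangle) (hY : Y.IsTangle)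
    (hf : Function.Bijective f.hom.strand) : Function.Bijective f.hom.region := by
  classical
  constructor
  · intro r s hrs
    -- The indicator function of `r` has jumps that come from `Y`, so it is a function on the
    -- regions of `Y`, up to a constant.
    let g : X.net.Region → ZMod 2 := fun t => if t = r then 1 else 0
    let e := Equiv.ofBijective _ hf
    let φ : Y.net.Strand → ZMod 2 := fun y =>
      g (X.net.white (e.symm y)) + g (X.net.black (e.symm y))
    have hφ : ∀ x, φ (f.hom.strand x) = g (X.net.white x) + g (X.net.black x) := by
      intro x
      have : e.symm (f.hom.strand x) = x := e.symm_apply_apply x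
      simp only [φ, this]
    obtain ⟨γ, hγ⟩ := hY.jordan φ
      (by
        refine Eq.trans (Finset.sum_congr rfl (fun p _ => ?_)) (X.out.sum_jump g)
        exact (congrArg φ (f.out_strand p).symm).trans (hφ _))
      (by
        intro j
        obtain ⟨i, rfl⟩ := f.box.surjective j
        refine Eq.trans ?_ ((X.inn i).sum_jump g)
        refine (Fintype.sum_equiv (finCongr (congrArg (fun d : Col => 2 * d.size) (f.boxCol i)))
          _ _ (fun p => ?_)).symm
        exact ((congrArg φ (f.inn_strand i p).symm).trans (hφ _)).symm)
    have hc := hX.connected (fun t => γ (f.hom.region t) + g t) (by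
      intro x
      have h := hγ (f.hom.strand x)
      rw [hφ, f.hom.white_strand, f.hom.black_strand] at h
      have e₃ : ∀ a b a' b' : ZMod 2, a + b = a' + b' → a' + a = b' + b := by decide
      exact e₃ _ _ _ _ h) r s
    simp only [hrs, add_right_inj] at hc
    by_contra hne
    simp only [g, if_neg (Ne.symm hne), if_true] at hc
    exact absurd hc (by decide)
  · intro r
    by_cases h : ∃ y, Y.net.white y = r ∨ Y.net.black y = r
    · obtain ⟨y, rfl | rfl⟩ := h <;> obtain ⟨x, rfl⟩ := hf.2 y
      · exact ⟨_, (f.hom.white_strand x).symm⟩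
      · exact ⟨_, (f.hom.black_strand x).symm⟩
    -- A region without strands on its boundary is the only one.
    · push Not at h
      have hc := hY.connected (fun t => if t = r then 1 else 0)
        (fun x => by rw [if_neg (h x).1, if_neg (h x).2]) r (Y.out.rg 0)
      refine ⟨X.out.rg 0, ?_⟩
      by_contra hne
      have e : f.hom.region (X.out.rg 0) = Y.out.rg 0 := f.out_region _
      rw [e] at hne
      rw [if_pos rfl, if_neg hne] at hc
      exact absurd hc (by decide)

/-- A map of tangles that respects the boxes and is bijective on the strands is an isotopy. -/
theorem isotopy (f : BoxHom X Y B) (hX : X.IsTangle) (hY : Y.IsTangle)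
    (hf : Function.Bijective f.hom.strand) : Nonempty (Isotopy X Y) :=
  ⟨⟨f.box, f.boxCol, Equiv.ofBijective _ hf,
    Equiv.ofBijective _ (f.region_bijective hX hY hf), f.hom.shaded_region, f.hom.white_strand,
    f.hom.black_strand, f.out_strand, f.out_region, f.inn_strand, f.inn_region⟩⟩

end BoxHom

/-! ### Boxes of composites -/

/-- The boxes of a composite whose outer diagram is drawn with one box. -/
def boxes₁ {c : Col} {col : Fin 1 → Col} {J A : Set ((ℕ × ℕ) × (ℕ × ℕ))}
    (S : ∀ i, Diagram (col i)) : (S 0).Box ≃o ((draw c col J A).comp S).Box where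
  toFun b := toLex ⟨(0 : Fin 1), b⟩
  invFun x := match x with
    | ⟨(0 : Fin 1), b⟩ => b
  left_inv _ := rfl
  right_inv := by
    rintro ⟨i, b⟩
    have h : ∀ i : Fin 1, i = 0 := fun i => Subsingleton.elim _ _
    obtain rfl : i = (0 : Fin 1) := h i
    rfl
  map_rel_iff' := by
    intro a b
    constructor
    · intro h
      rcases Sigma.lex_iff.1 h with h | ⟨_, h⟩
      · exact absurd h (lt_irrefl _)
      · exact h
    · intro h
      exact Sigma.Lex.right _ _ h

/-- The boxes of a composite whose outer diagram is drawn with two boxes. -/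
def boxes₂ {c : Col} {col : Fin 2 → Col} {J A : Set ((ℕ × ℕ) × (ℕ × ℕ))}
    (S : ∀ i, Diagram (col i)) :
    (S 0).Box ⊕ₗ (S 1).Box ≃o ((draw c col J A).comp S).Box where
  toFun x := match ofLex x with
    | Sum.inl b => toLex ⟨(0 : Fin 2), b⟩
    | Sum.inr b => toLex ⟨(1 : Fin 2), b⟩
  invFun x := match x with
    | ⟨(0 : Fin 2), b⟩ => toLex (Sum.inl b)
    | ⟨(1 : Fin 2), b⟩ => toLex (Sum.inr b)
  left_inv := by
    rintro (b | b) <;> rfl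
  right_inv := by
    rintro ⟨i, b⟩
    have hi : i = (0 : Fin 2) ∨ i = (1 : Fin 2) := by
      have : ∀ i : Fin 2, i = 0 ∨ i = 1 := by decide
      exact this i
    rcases hi with rfl | rfl <;> rfl
  map_rel_iff' := by
    have h01 : (0 : Fin 2) < 1 := by decide
    rintro (a | a) (b | b)
    · constructor
      · intro h
        rcases Sigma.lex_iff.1 h with h | ⟨_, h⟩
        · exact absurd h (lt_irrefl _)
        · exact Sum.Lex.inl h
      · intro h
        exact Sigma.Lex.right _ _ (Sum.Lex.inl_le_inl_iff.1 h)
    · constructor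
      · intro _
        exact Sum.Lex.inl_le_inr _ _
      · intro _
        exact Sigma.Lex.left _ _ h01
    · constructor
      · intro h
        rcases Sigma.lex_iff.1 h with h | ⟨h, _⟩
        · exact absurd (lt_trans h h01) (lt_irrefl _)
        · exact absurd h (ne_of_gt h01)
      · intro h
        exact absurd h Sum.Lex.not_inr_le_inl
    · constructor
      · intro h
        rcases Sigma.lex_iff.1 h with h | ⟨_, h⟩
        · exact absurd h (lt_irrefl _)
        · exact Sum.Lex.inr h
      · intro h
        exact Sigma.Lex.right _ _ (Sum.Lex.inr_le_inr_iff.1 h)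

/-! ### Loops -/

/-- There are no closed loops. -/
def LoopFree {c : Col} (D : Diagram c) : Prop := ∀ x, ∃ m, D.strandAt m = x

/-- Every strand meets an internal box. -/
def Full {c : Col} (D : Diagram c) : Prop :=
  ∀ x, ∃ (i : D.Box) (p : Fin (2 * (D.boxCol i).size)), (D.inn i).strand p = x

theorem Full.loopFree {c : Col} {D : Diagram c} (h : D.Full) : D.LoopFree := by
  intro x
  obtain ⟨i, p, rfl⟩ := h x
  exact ⟨Sum.inr ⟨i, p⟩, rfl⟩

theorem draw_loopFree {c : Col} {b : ℕ} {col : Fin b → Col} {J A : Set ((ℕ × ℕ) × (ℕ × ℕ))} :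
    (draw c col J A).LoopFree := draw_strand_cases

theorem compL_inn_strand {c : Col} (W : Diagram c) (S : ∀ i : W.Box, Diagram (W.boxCol i))
    (i : W.Box) (p : Fin (2 * (W.boxCol i).size)) :
    (compL W S).strand ((W.inn i).strand p) = (compR W S i).strand ((S i).out.strand p) :=
  congrArg (fun o : Hom (boundary (W.boxCol i)) (W.comp S).net => o.strand p) (compL_inn W S i)

/-- If every strand of the substituted diagrams meets an internal box, then no closed loop arises. -/
theorem LoopFree.comp {c : Col} {W : Diagram c} {S : ∀ i : W.Box, Diagram (W.boxCol i)}
    (hW : W.LoopFree) (hS : ∀ i, (S i).Full) : (W.comp S).LoopFree := by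
  have hin : ∀ i y, ∃ m, (W.comp S).strandAt m = (compR W S i).strand y := by
    intro i y
    obtain ⟨j, p, rfl⟩ := hS i y
    exact ⟨Sum.inr ⟨toLex ⟨i, j⟩, p⟩, rfl⟩
  intro x
  rcases comp_strand_cases W S x with ⟨y, rfl⟩ | ⟨i, y, rfl⟩
  · obtain ⟨p | ⟨i, p⟩, rfl⟩ := hW y
    · exact ⟨Sum.inl p, rfl⟩
    · obtain ⟨m, hm⟩ := hin i ((S i).out.strand p)
      exact ⟨m, hm.trans (compL_inn_strand W S i p).symm⟩
  · exact hin i y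

theorem Full.comp {c : Col} {W : Diagram c} {S : ∀ i : W.Box, Diagram (W.boxCol i)}
    (hW : W.Full) (hS : ∀ i, (S i).Full) : (W.comp S).Full := by
  have hin : ∀ i y, ∃ (j : (W.comp S).Box) (p : Fin (2 * ((W.comp S).boxCol j).size)),
      ((W.comp S).inn j).strand p = (compR W S i).strand y := by
    intro i y
    obtain ⟨j, p, rfl⟩ := hS i y
    exact ⟨toLex ⟨i, j⟩, p, rfl⟩
  intro x
  rcases comp_strand_cases W S x with ⟨y, rfl⟩ | ⟨i, y, rfl⟩
  · obtain ⟨i, p, rfl⟩ := hW y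
    obtain ⟨j, q, hq⟩ := hin i ((S i).out.strand p)
    exact ⟨j, q, hq.trans (compL_inn_strand W S i p).symm⟩
  · exact hin i y

/-- In the absence of loops, injectivity on the strands is automatic. -/
theorem BoxHom.isotopy_of_loopFree {c : Col} {X Y : Diagram c} {B : Type} [LinearOrder B]
    (f : BoxHom X Y B) (hX : X.IsTangle) (hY : Y.IsTangle) (hl : X.LoopFree)
    (hs : Function.Surjective f.hom.strand) : Nonempty (Isotopy X Y) := by
  refine f.isotopy hX hY ⟨f.injective hX hY (fun x y h => ?_), hs⟩
  obtain ⟨m, hm⟩ := hl x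
  exact absurd hm (h m)

end Diagram

end Skein

namespace Skein

open Net

namespace Diagram

/-! ### The strands of the basic tangles -/

section

variable {N N' : Net}

/-- The strands of `1^n`. -/
def OneEqs (n : ℕ) (o : Hom (boundary (Col.box n)) N) : Prop :=
  ∀ i < n, o.st i = o.st (2 * n - 1 - i)

/-- The strands and the placement of the box of `I_a^b`. -/
structure InclEqs (a b : ℕ) (o : Hom (boundary (Col.box b)) N)
    (h : Hom (boundary (Col.box a)) N) : Prop where
  left : ∀ i < a, o.st i = h.st i
  right : ∀ i < a, o.st (2 * b - a + i) = h.st (a + i)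
  join : ∀ i < b - a, o.st (a + i) = o.st (2 * b - 1 - a - i)
  rg : o.rg 0 = h.rg 0

/-- The strands and the placement of the box of `ER_d^c`. -/
structure ErEqs (d c : ℕ) (o : Hom (boundary (Col.box c)) N)
    (h : Hom (boundary (Col.box d)) N) : Prop where
  left : ∀ i < c, o.st i = h.st i
  right : ∀ i < c, o.st (c + i) = h.st (2 * d - c + i)
  join : ∀ i < d - c, h.st (c + i) = h.st (2 * d - 1 - c - i)
  rg : o.rg 0 = h.rg 0

/-- The strands and the placement of the boxes of `M_{a,b}^e`. -/
structure MulEqs (a b e : ℕ) (o : Hom (boundary (Col.box e)) N)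
    (h₁ : Hom (boundary (Col.box a)) N) (h₂ : Hom (boundary (Col.box b)) N) : Prop where
  left : ∀ i < a + e - b, o.st i = h₁.st i
  join : ∀ i < a + b - e, h₁.st (a + e - b + i) = h₂.st (a + b - e - 1 - i)
  right : ∀ i < b + e - a, o.st (a + e - b + i) = h₂.st (a + b - e + i)
  rg₁ : o.rg 0 = h₁.rg 0
  rg₂ : o.rg 0 = h₂.rg 0

/-- The strands and the placement of the box of `SH_n^{n+2}`. -/
structure ShiftEqs (n : ℕ) (o : Hom (boundary (Col.box (n + 2))) N)
    (h : Hom (boundary (Col.box n)) N) : Prop where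
  fst : o.st 0 = o.st (2 * n + 3)
  snd : o.st 1 = o.st (2 * n + 2)
  box : ∀ i < 2 * n, o.st (2 + i) = h.st i
  rg : o.rg 2 = h.rg 0

/-- The strands and the placement of the box of `EL_n^n`. -/
structure ElEqs (n : ℕ) (o : Hom (boundary (Col.box n)) N)
    (h : Hom (boundary (Col.box n)) N) : Prop where
  outer : o.st 0 = o.st (2 * n - 1)
  inner : h.st 0 = h.st (2 * n - 1)
  box : ∀ i < 2 * n - 2, o.st (1 + i) = h.st (1 + i)
  rg : o.rg 1 = h.rg 1

/-- The Temperley–Lieb generator with `n` strands that has a cap at the top points `i`, `i + 1`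
and a cup at the bottom points below them. -/
def gen (n i : ℕ) : Diagram (Col.box n) :=
  draw (Col.box n) (b := 0) Fin.elim0
    (anti 0 0 0 (2 * n - i) i ∪ anti 0 i 0 (i + 1) 1 ∪ anti 0 (2 * n - 2 - i) 0 (2 * n - 1 - i) 1 ∪
      anti 0 (i + 2) 0 n (n - i - 2)) ∅

/-- The strands of `gen n i`. -/
structure GenEqs (n i : ℕ) (o : Hom (boundary (Col.box n)) N) : Prop where
  cap : o.st i = o.st (i + 1)
  cup : o.st (2 * n - 2 - i) = o.st (2 * n - 1 - i)
  thru : ∀ j < n, j ≠ i → j ≠ i + 1 → o.st j = o.st (2 * n - 1 - j)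

/-- `n` strands without boxes: an arc joins the points `1`, `2`, and the other points are joined in
a nested way with the first point joined to the last one. -/
def arcLeft (n : ℕ) : Diagram (Col.box n) :=
  draw (Col.box n) (b := 0) Fin.elim0
    (anti 0 0 0 (2 * n - 1) 1 ∪ anti 0 1 0 2 1 ∪ anti 0 3 0 (n + 1) (n - 2)) ∅

/-- The strands of `arcLeft n`. -/
structure ArcLeftEqs (n : ℕ) (o : Hom (boundary (Col.box n)) N) : Prop where
  outer : o.st 0 = o.st (2 * n - 1)
  arc : o.st 1 = o.st 2
  thru : ∀ i < n - 2, o.st (3 + i) = o.st (2 * n - 2 - i)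

/-- The mirror image of `arcLeft n`: the arc joins the points `2 * n - 3`, `2 * n - 2`. -/
def arcRight (n : ℕ) : Diagram (Col.box n) :=
  draw (Col.box n) (b := 0) Fin.elim0
    (anti 0 0 0 (2 * n - 1) 1 ∪ anti 0 (2 * n - 3) 0 (2 * n - 2) 1 ∪
      anti 0 1 0 (n - 1) (n - 2)) ∅

/-- The strands of `arcRight n`. -/
structure ArcRightEqs (n : ℕ) (o : Hom (boundary (Col.box n)) N) : Prop where
  outer : o.st 0 = o.st (2 * n - 1)
  arc : o.st (2 * n - 3) = o.st (2 * n - 2)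
  thru : ∀ i < n - 2, o.st (1 + i) = o.st (2 * n - 4 - i)

theorem st_comp_eq {c c' : Col} {o : Hom (boundary c) N} {o' : Hom (boundary c') N}
    (f : Hom N N') {i j : ℕ} (h : o.st i = o'.st j) : (f.comp o).st i = (f.comp o').st j := by
  rw [Hom.st_comp, Hom.st_comp, h]

theorem rg_comp_eq {c c' : Col} {o : Hom (boundary c) N} {o' : Hom (boundary c') N}
    (f : Hom N N') {i j : ℕ} (h : o.rg i = o'.rg j) : (f.comp o).rg i = (f.comp o').rg j :=
  congrArg f.region h

theorem OneEqs.comp {n : ℕ} {o : Hom (boundary (Col.box n)) N} (h : OneEqs n o) (f : Hom N N') :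
    OneEqs n (f.comp o) := fun i hi => st_comp_eq f (h i hi)

theorem InclEqs.comp {a b : ℕ} {o : Hom (boundary (Col.box b)) N}
    {h : Hom (boundary (Col.box a)) N} (E : InclEqs a b o h) (f : Hom N N') :
    InclEqs a b (f.comp o) (f.comp h) :=
  ⟨fun i hi => st_comp_eq f (E.left i hi), fun i hi => st_comp_eq f (E.right i hi),
    fun i hi => st_comp_eq f (E.join i hi), rg_comp_eq f E.rg⟩

theorem ErEqs.comp {d c : ℕ} {o : Hom (boundary (Col.box c)) N}
    {h : Hom (boundary (Col.box d)) N} (E : ErEqs d c o h) (f : Hom N N') :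
    ErEqs d c (f.comp o) (f.comp h) :=
  ⟨fun i hi => st_comp_eq f (E.left i hi), fun i hi => st_comp_eq f (E.right i hi),
    fun i hi => st_comp_eq f (E.join i hi), rg_comp_eq f E.rg⟩

theorem MulEqs.comp {a b e : ℕ} {o : Hom (boundary (Col.box e)) N}
    {h₁ : Hom (boundary (Col.box a)) N} {h₂ : Hom (boundary (Col.box b)) N}
    (E : MulEqs a b e o h₁ h₂) (f : Hom N N') :
    MulEqs a b e (f.comp o) (f.comp h₁) (f.comp h₂) :=
  ⟨fun i hi => st_comp_eq f (E.left i hi), fun i hi => st_comp_eq f (E.join i hi),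
    fun i hi => st_comp_eq f (E.right i hi), rg_comp_eq f E.rg₁, rg_comp_eq f E.rg₂⟩

theorem ShiftEqs.comp {n : ℕ} {o : Hom (boundary (Col.box (n + 2))) N}
    {h : Hom (boundary (Col.box n)) N} (E : ShiftEqs n o h) (f : Hom N N') :
    ShiftEqs n (f.comp o) (f.comp h) :=
  ⟨st_comp_eq f E.fst, st_comp_eq f E.snd, fun i hi => st_comp_eq f (E.box i hi),
    rg_comp_eq f E.rg⟩

theorem ElEqs.comp {n : ℕ} {o : Hom (boundary (Col.box n)) N}
    {h : Hom (boundary (Col.box n)) N} (E : ElEqs n o h) (f : Hom N N') :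
    ElEqs n (f.comp o) (f.comp h) :=
  ⟨st_comp_eq f E.outer, st_comp_eq f E.inner, fun i hi => st_comp_eq f (E.box i hi),
    rg_comp_eq f E.rg⟩

theorem GenEqs.comp {n i : ℕ} {o : Hom (boundary (Col.box n)) N} (E : GenEqs n i o)
    (f : Hom N N') : GenEqs n i (f.comp o) :=
  ⟨st_comp_eq f E.cap, st_comp_eq f E.cup, fun j h₁ h₂ h₃ => st_comp_eq f (E.thru j h₁ h₂ h₃)⟩

theorem ArcLeftEqs.comp {n : ℕ} {o : Hom (boundary (Col.box n)) N} (E : ArcLeftEqs n o)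
    (f : Hom N N') : ArcLeftEqs n (f.comp o) :=
  ⟨st_comp_eq f E.outer, st_comp_eq f E.arc, fun i hi => st_comp_eq f (E.thru i hi)⟩

theorem ArcRightEqs.comp {n : ℕ} {o : Hom (boundary (Col.box n)) N} (E : ArcRightEqs n o)
    (f : Hom N N') : ArcRightEqs n (f.comp o) :=
  ⟨st_comp_eq f E.outer, st_comp_eq f E.arc, fun i hi => st_comp_eq f (E.thru i hi)⟩

/-! #### Maps out of drawings with at most two boxes -/

theorem exists_draw₀_hom {c : Col} {J : Set ((ℕ × ℕ) × (ℕ × ℕ))} (o : Hom (boundary c) N)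
    (hJ : ∀ x p y q, ((x, p), (y, q)) ∈ J → x = 0 ∧ y = 0 ∧ o.st p = o.st q) :
    ∃ h : Hom (draw c (b := 0) Fin.elim0 J ∅).net N,
      h.comp (draw c (b := 0) Fin.elim0 J ∅).out = o := by
  obtain ⟨h, h₁, -⟩ := exists_draw_hom (c := c) (b := 0) (col := Fin.elim0) (J := J) (A := ∅) o
    (fun i => i.elim0)
    (by
      rintro ⟨⟨x, p⟩, ⟨y, q⟩⟩ h
      obtain ⟨rfl, rfl, e⟩ := hJ _ _ _ _ h
      exact e)
    (by rintro e ⟨⟩)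
  exact ⟨h, h₁⟩

/-- A map out of a composite whose outer diagram is drawn with one box `d`, in terms of a map `f`
of the substituted diagram. -/
theorem exists_draw₁_hom {c d : Col} {J A : Set ((ℕ × ℕ) × (ℕ × ℕ))} (o : Hom (boundary c) N)
    (S : Diagram d) (f : Hom S.net N)
    (hJ : ∀ x p y q, ((x, p), (y, q)) ∈ J →
      (x = 0 ∧ y = 0 ∧ o.st p = o.st q) ∨ (x = 0 ∧ y = 1 ∧ o.st p = (f.comp S.out).st q) ∨
      (x = 1 ∧ y = 1 ∧ (f.comp S.out).st p = (f.comp S.out).st q))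
    (hA : ∀ x p y q, ((x, p), (y, q)) ∈ A → x = 0 ∧ y = 1 ∧ o.rg p = (f.comp S.out).rg q) :
    ∃ h : Hom ((draw c (fun _ : Fin 1 => d) J A).comp fun _ => S).net N,
      h.comp ((draw c (fun _ : Fin 1 => d) J A).comp fun _ => S).out = o ∧
      h.comp (compR (draw c (fun _ : Fin 1 => d) J A) (fun _ => S) (0 : Fin 1)) = f := by
  obtain ⟨h, h₁, h₂⟩ := exists_draw_hom (c := c) (b := 1) (col := fun _ => d) (J := J) (A := A) o
    (fun _ => f.comp S.out)
    (by
      rintro ⟨⟨x, p⟩, ⟨y, q⟩⟩ h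
      rcases hJ _ _ _ _ h with ⟨rfl, rfl, e⟩ | ⟨rfl, rfl, e⟩ | ⟨rfl, rfl, e⟩ <;> exact e)
    (by
      rintro ⟨⟨x, p⟩, ⟨y, q⟩⟩ h
      obtain ⟨rfl, rfl, e⟩ := hA _ _ _ _ h
      exact congrArg some e)
  obtain ⟨g, hg, hg'⟩ := exists_comp_hom (draw c (fun _ : Fin 1 => d) J A) (fun _ => S) h
    (fun _ => f) h₂
  refine ⟨g, ?_, hg' (0 : Fin 1)⟩
  rw [← h₁, ← hg]
  rfl

/-- A map out of a composite whose outer diagram is drawn with two boxes, in terms of maps of the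
substituted diagrams. -/
theorem exists_draw₂_hom {c : Col} {col : Fin 2 → Col} {J A : Set ((ℕ × ℕ) × (ℕ × ℕ))}
    (o : Hom (boundary c) N) (S : ∀ i, Diagram (col i)) (f : ∀ i, Hom (S i).net N)
    (hJ : ∀ x p y q, ((x, p), (y, q)) ∈ J →
      (x = 0 ∧ y = 1 ∧ o.st p = ((f 0).comp (S 0).out).st q) ∨
      (x = 0 ∧ y = 2 ∧ o.st p = ((f 1).comp (S 1).out).st q) ∨
      (x = 1 ∧ y = 2 ∧ ((f 0).comp (S 0).out).st p = ((f 1).comp (S 1).out).st q))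
    (hA : ∀ x p y q, ((x, p), (y, q)) ∈ A →
      (x = 0 ∧ y = 1 ∧ o.rg p = ((f 0).comp (S 0).out).rg q) ∨
      (x = 0 ∧ y = 2 ∧ o.rg p = ((f 1).comp (S 1).out).rg q)) :
    ∃ h : Hom ((draw c col J A).comp S).net N,
      h.comp ((draw c col J A).comp S).out = o ∧
      h.comp (compR (draw c col J A) S (0 : Fin 2)) = f 0 ∧
      h.comp (compR (draw c col J A) S (1 : Fin 2)) = f 1 := by
  obtain ⟨h, h₁, h₂⟩ := exists_draw_hom (c := c) (b := 2) (col := col) (J := J) (A := A) o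
    (fun i => (f i).comp (S i).out)
    (by
      rintro ⟨⟨x, p⟩, ⟨y, q⟩⟩ h
      rcases hJ _ _ _ _ h with ⟨rfl, rfl, e⟩ | ⟨rfl, rfl, e⟩ | ⟨rfl, rfl, e⟩ <;> exact e)
    (by
      rintro ⟨⟨x, p⟩, ⟨y, q⟩⟩ h
      rcases hA _ _ _ _ h with ⟨rfl, rfl, e⟩ | ⟨rfl, rfl, e⟩ <;> exact congrArg some e)
  obtain ⟨g, hg, hg'⟩ := exists_comp_hom (draw c col J A) S h f h₂
  refine ⟨g, ?_, hg' (0 : Fin 2), hg' (1 : Fin 2)⟩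
  rw [← h₁, ← hg]
  rfl

/-! #### The individual tangles

The boundaries of each tangle satisfy its equations, and these equations are all that is needed for
a map out of the tangle, or out of a composite formed with it. -/

theorem one_eqs (n : ℕ) : OneEqs n (one (Col.box n)).out := by
  intro i hi
  refine draw_out_out (c := Col.box n) ?_ ?_ ?_
  · exact mem_anti.2 ⟨rfl, rfl, by simp only [Col.size]; omega⟩
  all_goals simp only [Col.size]; omega

theorem exists_one_hom {n : ℕ} {o : Hom (boundary (Col.box n)) N} (E : OneEqs n o) :
    ∃ h : Hom (one (Col.box n)).net N, h.comp (one (Col.box n)).out = o := by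
  refine exists_draw₀_hom o ?_
  intro x p y q h
  obtain ⟨rfl, rfl, h₁, h₂, h₃⟩ := mem_anti.1 h
  simp only [Col.size] at h₂ h₃
  refine ⟨rfl, rfl, ?_⟩
  rw [E p (by omega)]
  congr 1; omega

theorem gen_eqs {n i : ℕ} (h : i + 2 ≤ n) : GenEqs n i (gen n i).out := by
  refine ⟨?_, ?_, ?_⟩
  · refine draw_out_out (c := Col.box n) (Or.inl (Or.inl (Or.inr (mem_anti.2 ⟨rfl, rfl, ?_⟩)))) ?_ ?_ <;>
      (try simp only [Col.size]) <;> omega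
  · refine draw_out_out (c := Col.box n) (Or.inl (Or.inr (mem_anti.2 ⟨rfl, rfl, ?_⟩))) ?_ ?_ <;>
      (try simp only [Col.size]) <;> omega
  · intro j h₁ h₂ h₃
    refine draw_out_out (c := Col.box n) ?_ ?_ ?_
    · rcases lt_or_gt_of_ne h₂ with h₂ | h₂
      · exact Or.inl (Or.inl (Or.inl (mem_anti.2 ⟨rfl, rfl, by omega⟩)))
      · exact Or.inr (mem_anti.2 ⟨rfl, rfl, by omega⟩)
    all_goals simp only [Col.size]; omega

theorem exists_gen_hom {n i : ℕ} (hi : i + 2 ≤ n) {o : Hom (boundary (Col.box n)) N}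
    (E : GenEqs n i o) : ∃ h : Hom (gen n i).net N, h.comp (gen n i).out = o := by
  refine exists_draw₀_hom o ?_
  rintro x p y q (((h | h) | h) | h) <;> obtain ⟨rfl, rfl, h₁, h₂, h₃⟩ := mem_anti.1 h <;>
    refine ⟨rfl, rfl, ?_⟩
  · rw [E.thru p (by omega) (by omega) (by omega)]; congr 1; omega
  · obtain rfl : p = i := by omega
    rw [E.cap]; congr 1; omega
  · obtain rfl : p = 2 * n - 2 - i := by omega
    rw [E.cup]; congr 1; omega
  · rw [E.thru p (by omega) (by omega) (by omega)]; congr 1; omega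

theorem arcLeft_eqs {n : ℕ} (h : 2 ≤ n) : ArcLeftEqs n (arcLeft n).out := by
  refine ⟨?_, ?_, ?_⟩
  · refine draw_out_out (c := Col.box n) (Or.inl (Or.inl (mem_anti.2 ⟨rfl, rfl, ?_⟩))) ?_ ?_ <;>
      (try simp only [Col.size]) <;> omega
  · refine draw_out_out (c := Col.box n) (Or.inl (Or.inr (mem_anti.2 ⟨rfl, rfl, ?_⟩))) ?_ ?_ <;>
      (try simp only [Col.size, and_true]) <;> omega
  · intro i hi
    refine draw_out_out (c := Col.box n) (Or.inr (mem_anti.2 ⟨rfl, rfl, ?_⟩)) ?_ ?_ <;>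
      (try simp only [Col.size]) <;> omega

theorem arcRight_eqs {n : ℕ} (h : 2 ≤ n) : ArcRightEqs n (arcRight n).out := by
  refine ⟨?_, ?_, ?_⟩
  · refine draw_out_out (c := Col.box n) (Or.inl (Or.inl (mem_anti.2 ⟨rfl, rfl, ?_⟩))) ?_ ?_ <;>
      (try simp only [Col.size]) <;> omega
  · refine draw_out_out (c := Col.box n) (Or.inl (Or.inr (mem_anti.2 ⟨rfl, rfl, ?_⟩))) ?_ ?_ <;>
      (try simp only [Col.size]) <;> omega
  · intro i hi
    refine draw_out_out (c := Col.box n) (Or.inr (mem_anti.2 ⟨rfl, rfl, ?_⟩)) ?_ ?_ <;>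
      (try simp only [Col.size]) <;> omega

theorem incl_eqs {a b : ℕ} (h : a ≤ b) : InclEqs a b (incl (Col.box a) (Col.box b)).out
    ((incl (Col.box a) (Col.box b)).inn (0 : Fin 1)) := by
  refine ⟨?_, ?_, ?_, ?_⟩
  · intro i hi
    refine draw_out_inn (c := Col.box b) (0 : Fin 1) (Or.inl (Or.inl (mem_para.2 ⟨rfl, rfl, ?_⟩))) ?_ ?_ <;>
      (try simp only [Col.size, and_true]) <;> omega
  · intro i hi
    refine draw_out_inn (c := Col.box b) (0 : Fin 1) (Or.inl (Or.inr (mem_para.2 ⟨rfl, rfl, ?_⟩))) ?_ ?_ <;>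
      (try simp only [Col.size]) <;> omega
  · intro i hi
    refine draw_out_out (c := Col.box b) (Or.inr (mem_anti.2 ⟨rfl, rfl, ?_⟩)) ?_ ?_ <;>
      (try simp only [Col.size]) <;> omega
  · refine draw_region (c := Col.box b) (0 : Fin 1) ?_ (Col.segs_pos _) (Col.segs_pos _) rfl
    simp

theorem exists_incl_hom {a b : ℕ} (hab : a ≤ b) {o : Hom (boundary (Col.box b)) N}
    (S : Diagram (Col.box a)) (f : Hom S.net N) (E : InclEqs a b o (f.comp S.out)) :
    ∃ h : Hom ((incl (Col.box a) (Col.box b)).comp fun _ => S).net N,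
      h.comp ((incl (Col.box a) (Col.box b)).comp fun _ => S).out = o ∧
      h.comp (compR (incl (Col.box a) (Col.box b)) (fun _ => S) (0 : Fin 1)) = f := by
  refine exists_draw₁_hom o S f ?_ ?_
  · rintro x p y q ((h | h) | h)
    · obtain ⟨rfl, rfl, h₁, h₂, h₃⟩ := mem_para.1 h
      simp only [Col.size] at h₂
      refine Or.inr (Or.inl ⟨rfl, rfl, ?_⟩)
      rw [E.left p (by omega)]; congr 1; omega
    · obtain ⟨rfl, rfl, h₁, h₂, h₃⟩ := mem_para.1 h
      obtain ⟨s, rfl⟩ := Nat.exists_eq_add_of_le h₁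
      simp only [Col.size] at h₂ h₃
      refine Or.inr (Or.inl ⟨rfl, rfl, ?_⟩)
      refine (E.right s (by omega)).trans ?_; congr 1; omega
    · obtain ⟨rfl, rfl, h₁, h₂, h₃⟩ := mem_anti.1 h
      obtain ⟨s, rfl⟩ := Nat.exists_eq_add_of_le h₁
      simp only [Col.size] at h₂ h₃
      refine Or.inl ⟨rfl, rfl, ?_⟩
      refine (E.join s (by omega)).trans ?_; congr 1; omega
  · intro x p y q h
    simp only [reduceCtorEq, false_and, if_false, Set.mem_singleton_iff, Prod.mk.injEq] at h
    obtain ⟨⟨rfl, rfl⟩, rfl, rfl⟩ := h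
    exact ⟨rfl, rfl, E.rg⟩

theorem er_eqs {d c : ℕ} (h : c ≤ d) : ErEqs d c (er (Col.box d) (Col.box c)).out
    ((er (Col.box d) (Col.box c)).inn (0 : Fin 1)) := by
  refine ⟨?_, ?_, ?_, ?_⟩
  · intro i hi
    refine draw_out_inn (c := Col.box c) (0 : Fin 1) (Or.inl (Or.inl (mem_para.2 ⟨rfl, rfl, ?_⟩))) ?_ ?_ <;>
      (try simp only [Col.size, and_true]) <;> omega
  · intro i hi
    refine draw_out_inn (c := Col.box c) (0 : Fin 1) (Or.inl (Or.inr (mem_para.2 ⟨rfl, rfl, ?_⟩))) ?_ ?_ <;>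
      (try simp only [Col.size]) <;> omega
  · intro i hi
    refine draw_inn_inn (c := Col.box c) (0 : Fin 1) (0 : Fin 1) (Or.inr (mem_anti.2 ⟨rfl, rfl, ?_⟩)) ?_ ?_ <;>
      (try simp only [Col.size]) <;> omega
  · refine draw_region (c := Col.box c) (0 : Fin 1) ?_ (Col.segs_pos _) (Col.segs_pos _) rfl
    simp

theorem exists_er_hom {d c : ℕ} (hcd : c ≤ d) {o : Hom (boundary (Col.box c)) N}
    (S : Diagram (Col.box d)) (f : Hom S.net N) (E : ErEqs d c o (f.comp S.out)) :
    ∃ h : Hom ((er (Col.box d) (Col.box c)).comp fun _ => S).net N,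
      h.comp ((er (Col.box d) (Col.box c)).comp fun _ => S).out = o ∧
      h.comp (compR (er (Col.box d) (Col.box c)) (fun _ => S) (0 : Fin 1)) = f := by
  refine exists_draw₁_hom o S f ?_ ?_
  · rintro x p y q ((h | h) | h)
    · obtain ⟨rfl, rfl, h₁, h₂, h₃⟩ := mem_para.1 h
      simp only [Col.size] at h₂
      refine Or.inr (Or.inl ⟨rfl, rfl, ?_⟩)
      rw [E.left p (by omega)]; congr 1; omega
    · obtain ⟨rfl, rfl, h₁, h₂, h₃⟩ := mem_para.1 h
      obtain ⟨s, rfl⟩ := Nat.exists_eq_add_of_le h₁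
      simp only [Col.size] at h₂ h₃
      refine Or.inr (Or.inl ⟨rfl, rfl, ?_⟩)
      refine (E.right s (by omega)).trans ?_; congr 1; omega
    · obtain ⟨rfl, rfl, h₁, h₂, h₃⟩ := mem_anti.1 h
      obtain ⟨s, rfl⟩ := Nat.exists_eq_add_of_le h₁
      simp only [Col.size] at h₂ h₃
      refine Or.inr (Or.inr ⟨rfl, rfl, ?_⟩)
      refine (E.join s (by omega)).trans ?_; congr 1; omega
  · intro x p y q h
    simp only [reduceCtorEq, false_and, if_false, Set.mem_singleton_iff, Prod.mk.injEq] at h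
    obtain ⟨⟨rfl, rfl⟩, rfl, rfl⟩ := h
    exact ⟨rfl, rfl, E.rg⟩

theorem mul_eqs {a b e : ℕ} (h₁ : a ≤ b + e) (h₂ : b ≤ a + e) (h₃ : e ≤ a + b) :
    MulEqs a b e (mul (Col.box a) (Col.box b) (Col.box e)).out
      ((mul (Col.box a) (Col.box b) (Col.box e)).inn (0 : Fin 2))
      ((mul (Col.box a) (Col.box b) (Col.box e)).inn (1 : Fin 2)) := by
  have hc₀ : ∀ x, x < 2 * a → x < 2 * ((![Col.box a, Col.box b] : Fin 2 → Col) 0).size :=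
    fun _ h => h
  have hc₁ : ∀ x, x < 2 * b → x < 2 * ((![Col.box a, Col.box b] : Fin 2 → Col) 1).size :=
    fun _ h => h
  refine ⟨?_, ?_, ?_, ?_, ?_⟩
  · intro i hi
    refine draw_out_inn (c := Col.box e) (0 : Fin 2)
      (Or.inl (Or.inl (mem_para.2 ⟨rfl, rfl, ?_⟩))) ?_ (hc₀ _ ?_) <;>
      (try simp only [Col.size, and_true]) <;> omega
  · intro i hi
    refine draw_inn_inn (c := Col.box e) (0 : Fin 2) (1 : Fin 2)
      (Or.inl (Or.inr (mem_anti.2 ⟨rfl, rfl, ?_⟩))) (hc₀ _ ?_) (hc₁ _ ?_) <;>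
      (try simp only [Col.size]) <;> omega
  · intro i hi
    refine draw_out_inn (c := Col.box e) (1 : Fin 2)
      (Or.inr (mem_para.2 ⟨rfl, rfl, ?_⟩)) ?_ (hc₁ _ ?_) <;>
      (try simp only [Col.size]) <;> omega
  · exact draw_region (c := Col.box e) (0 : Fin 2) (by simp) (Col.segs_pos _) (Col.segs_pos _) rfl
  · exact draw_region (c := Col.box e) (1 : Fin 2) (by simp) (Col.segs_pos _) (Col.segs_pos _) rfl

/-- The two factors of a product. -/
def factors {c d : Col} (S : Diagram c) (T : Diagram d) : ∀ i : Fin 2, Diagram (![c, d] i) :=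
  fun i => match i with
    | 0 => S
    | 1 => T

theorem mulComp_eq {c d : Col} (e : Col) (S : Diagram c) (T : Diagram d) :
    mulComp e S T = (mul c d e).comp (factors S T) := rfl

/-- The upper factor of a product. -/
def mulL {c d : Col} (e : Col) (S : Diagram c) (T : Diagram d) :
    Hom S.net (mulComp e S T).net := compR (mul c d e) (factors S T) (0 : Fin 2)

/-- The lower factor of a product. -/
def mulR {c d : Col} (e : Col) (S : Diagram c) (T : Diagram d) :
    Hom T.net (mulComp e S T).net := compR (mul c d e) (factors S T) (1 : Fin 2)

theorem exists_mul_hom {a b e : ℕ} {o : Hom (boundary (Col.box e)) N}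
    (S : Diagram (Col.box a)) (T : Diagram (Col.box b)) (f : Hom S.net N) (g : Hom T.net N)
    (E : MulEqs a b e o (f.comp S.out) (g.comp T.out)) :
    ∃ h : Hom (mulComp (Col.box e) S T).net N, h.comp (mulComp (Col.box e) S T).out = o ∧
      h.comp (mulL (Col.box e) S T) = f ∧ h.comp (mulR (Col.box e) S T) = g := by
  let fg : ∀ i : Fin 2, Hom (factors S T i).net N := fun i => match i with
    | 0 => f
    | 1 => g
  refine exists_draw₂_hom o (factors S T) fg ?_ ?_
  · rintro x p y q ((h | h) | h)
    · obtain ⟨rfl, rfl, h₁, h₂, h₃⟩ := mem_para.1 h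
      simp only [Col.size] at h₂
      refine Or.inl ⟨rfl, rfl, ?_⟩
      refine (E.left p (by omega)).trans ?_
      congr 1; omega
    · obtain ⟨rfl, rfl, h₁, h₂, h₃⟩ := mem_anti.1 h
      obtain ⟨s, rfl⟩ := Nat.exists_eq_add_of_le h₁
      simp only [Col.size] at h₂ h₃
      refine Or.inr (Or.inr ⟨rfl, rfl, (E.join s (by omega)).trans ?_⟩)
      congr 1; omega
    · obtain ⟨rfl, rfl, h₁, h₂, h₃⟩ := mem_para.1 h
      obtain ⟨s, rfl⟩ := Nat.exists_eq_add_of_le h₁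
      simp only [Col.size] at h₂ h₃
      refine Or.inr (Or.inl ⟨rfl, rfl, (E.right s (by omega)).trans ?_⟩)
      congr 1; omega
  · intro x p y q h
    simp only [Set.mem_insert_iff, Set.mem_singleton_iff, Prod.mk.injEq] at h
    rcases h with ⟨⟨rfl, rfl⟩, rfl, rfl⟩ | ⟨⟨rfl, rfl⟩, rfl, rfl⟩
    · exact Or.inl ⟨rfl, rfl, E.rg₁⟩
    · exact Or.inr ⟨rfl, rfl, E.rg₂⟩

theorem shift_eqs (n : ℕ) : ShiftEqs n (shift n).out ((shift n).inn (0 : Fin 1)) := by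
  refine ⟨?_, ?_, ?_, ?_⟩
  · refine draw_out_out (c := Col.box (n + 2)) (Or.inl (mem_anti.2 ⟨rfl, rfl, ?_⟩)) ?_ ?_ <;>
      (try simp only [Col.size]) <;> omega
  · refine draw_out_out (c := Col.box (n + 2)) (Or.inl (mem_anti.2 ⟨rfl, rfl, ?_⟩)) ?_ ?_ <;>
      (try simp only [Col.size]) <;> omega
  · intro i hi
    refine draw_out_inn (c := Col.box (n + 2)) (0 : Fin 1) (Or.inr (mem_para.2 ⟨rfl, rfl, ?_⟩)) ?_ ?_ <;>
      (try simp only [Col.size]) <;> omega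
  · refine draw_region (c := Col.box (n + 2)) (0 : Fin 1) rfl ?_ (Col.segs_pos _) ?_
    · simp only [Col.segs, Col.size]; omega
    · simp [Col.segShaded]

theorem exists_shift_hom {n : ℕ} {o : Hom (boundary (Col.box (n + 2))) N}
    (S : Diagram (Col.box n)) (f : Hom S.net N) (E : ShiftEqs n o (f.comp S.out)) :
    ∃ h : Hom ((shift n).comp fun _ => S).net N, h.comp ((shift n).comp fun _ => S).out = o ∧
      h.comp (compR (shift n) (fun _ => S) (0 : Fin 1)) = f := by
  refine exists_draw₁_hom o S f ?_ ?_
  · rintro x p y q (h | h)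
    · obtain ⟨rfl, rfl, h₁, h₂, h₃⟩ := mem_anti.1 h
      refine Or.inl ⟨rfl, rfl, ?_⟩
      obtain rfl | rfl : p = 0 ∨ p = 1 := by omega
      · rw [E.fst]; congr 1; omega
      · rw [E.snd]; congr 1; omega
    · obtain ⟨rfl, rfl, h₁, h₂, h₃⟩ := mem_para.1 h
      obtain ⟨s, rfl⟩ := Nat.exists_eq_add_of_le h₁
      refine Or.inr (Or.inl ⟨rfl, rfl, ?_⟩)
      refine (E.box s (by omega)).trans ?_; congr 1; omega
  · intro x p y q h
    simp only [Set.mem_singleton_iff, Prod.mk.injEq] at h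
    obtain ⟨⟨rfl, rfl⟩, rfl, rfl⟩ := h
    exact ⟨rfl, rfl, E.rg⟩

theorem el_eqs {n : ℕ} (hn : 1 ≤ n) : ElEqs n (el n).out ((el n).inn (0 : Fin 1)) := by
  refine ⟨?_, ?_, ?_, ?_⟩
  · refine draw_out_out (c := Col.box n) (Or.inl (Or.inl (mem_anti.2 ⟨rfl, rfl, ?_⟩))) ?_ ?_ <;>
      (try simp only [Col.size]) <;> omega
  · refine draw_inn_inn (c := Col.box n) (0 : Fin 1) (0 : Fin 1)
      (Or.inl (Or.inr (mem_anti.2 ⟨rfl, rfl, ?_⟩))) ?_ ?_ <;>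
      (try simp only [Col.size]) <;> omega
  · intro i hi
    refine draw_out_inn (c := Col.box n) (0 : Fin 1) (Or.inr (mem_para.2 ⟨rfl, rfl, ?_⟩)) ?_ ?_ <;>
      (try simp only [Col.size, and_true]) <;> omega
  · have h : 1 < (Col.box n).segs := by simp only [Col.segs, Col.size]; omega
    exact draw_region (c := Col.box n) (0 : Fin 1) rfl h h rfl

theorem exists_el_hom {n : ℕ} {o : Hom (boundary (Col.box n)) N}
    (S : Diagram (Col.box n)) (f : Hom S.net N) (E : ElEqs n o (f.comp S.out)) :
    ∃ h : Hom ((el n).comp fun _ => S).net N, h.comp ((el n).comp fun _ => S).out = o ∧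
      h.comp (compR (el n) (fun _ => S) (0 : Fin 1)) = f := by
  refine exists_draw₁_hom o S f ?_ ?_
  · rintro x p y q ((h | h) | h)
    · obtain ⟨rfl, rfl, h₁, h₂, h₃⟩ := mem_anti.1 h
      refine Or.inl ⟨rfl, rfl, ?_⟩
      obtain rfl : p = 0 := by omega
      rw [E.outer]; congr 1; omega
    · obtain ⟨rfl, rfl, h₁, h₂, h₃⟩ := mem_anti.1 h
      refine Or.inr (Or.inr ⟨rfl, rfl, ?_⟩)
      obtain rfl : p = 0 := by omega
      rw [E.inner]; congr 1; omega
    · obtain ⟨rfl, rfl, h₁, h₂, h₃⟩ := mem_para.1 h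
      obtain ⟨s, rfl⟩ := Nat.exists_eq_add_of_le h₁
      refine Or.inr (Or.inl ⟨rfl, rfl, ?_⟩)
      refine (E.box s (by omega)).trans ?_; congr 1; omega
  · intro x p y q h
    simp only [Set.mem_singleton_iff, Prod.mk.injEq] at h
    obtain ⟨⟨rfl, rfl⟩, rfl, rfl⟩ := h
    exact ⟨rfl, rfl, E.rg⟩

end

end Diagram

end Skein

namespace Skein

open Net

namespace Diagram

/-! ### The basic diagrams are tangles -/

section Sums

variable {F : ℕ → ℕ → ZMod 2} {κ : ℕ → ZMod 2} {a b i j t : ℕ}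

/-- The partial sums of a function on the strands along the boundary of the box number `a`. -/
def partialSum (F : ℕ → ℕ → ZMod 2) (κ : ℕ → ZMod 2) (a j : ℕ) : ZMod 2 :=
  κ a + ∑ i ∈ Finset.range j, F a i

theorem partialSum_succ (a j : ℕ) : partialSum F κ a (j + 1) = partialSum F κ a j + F a j := by
  simp only [partialSum, Finset.sum_range_succ, add_assoc]

theorem partialSum_zero (a : ℕ) : partialSum F κ a 0 = κ a := by
  simp [partialSum]

/-- The sums along the two ends of a parallel band of strands agree if they agree at its beginning. -/
theorem partialSum_para (h : partialSum F κ a i = partialSum F κ b j)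
    (hF : ∀ s < t, F a (i + s) = F b (j + s)) :
    ∀ s ≤ t, partialSum F κ a (i + s) = partialSum F κ b (j + s) := by
  intro s hs
  induction s with
  | zero => exact h
  | succ s ih =>
    rw [← add_assoc, ← add_assoc, partialSum_succ, partialSum_succ, ih (by omega), hF s (by omega)]

/-- The sums along the two ends of a reversed band of strands agree if they agree on the outermost
side of the band. -/
theorem partialSum_anti_outer (h : partialSum F κ a i = partialSum F κ b (j + t))
    (hF : ∀ s < t, F a (i + s) = F b (j + (t - 1 - s))) :
    ∀ s ≤ t, partialSum F κ a (i + s) = partialSum F κ b (j + (t - s)) := by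
  intro s hs
  induction s with
  | zero => exact h
  | succ s ih =>
    have e := ih (by omega)
    have e₁ : j + (t - s) = j + (t - 1 - s) + 1 := by omega
    have e₂ : t - (s + 1) = t - 1 - s := by omega
    rw [e₁, partialSum_succ] at e
    rw [← add_assoc, partialSum_succ, hF s (by omega), e, add_assoc, CharTwo.add_self_eq_zero,
      add_zero, e₂]

/-- The sums along the two ends of a reversed band of strands agree if they agree on the innermost
side of the band. -/
theorem partialSum_anti_inner (h : partialSum F κ a (i + t) = partialSum F κ b j)
    (hF : ∀ s < t, F a (i + s) = F b (j + (t - 1 - s))) :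
    ∀ s ≤ t, partialSum F κ a (i + s) = partialSum F κ b (j + (t - s)) := by
  intro s hs
  obtain ⟨r, rfl⟩ := Nat.exists_eq_add_of_le hs
  have hr : s + r - s = r := by omega
  rw [hr]
  have key : ∀ r' ≤ r, partialSum F κ a (i + (s + r - r')) = partialSum F κ b (j + r') := by
    intro r' hr'
    induction r' with
    | zero => exact h
    | succ r' ih =>
      have e := ih (by omega)
      have e₁ : i + (s + r - r') = i + (s + r - (r' + 1)) + 1 := by omega
      have e₂ := hF (s + r - (r' + 1)) (by omega)
      have e₃ : s + r - 1 - (s + r - (r' + 1)) = r' := by omega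
      rw [e₃] at e₂
      rw [e₁, partialSum_succ, e₂] at e
      rw [← add_assoc, partialSum_succ, ← e, add_assoc, CharTwo.add_self_eq_zero, add_zero]
  have := key r le_rfl
  rwa [Nat.add_sub_cancel] at this

/-- The partial sums agree on the two sides of every strand of `J`; see `draw_isTangle`. -/
def Flat (F : ℕ → ℕ → ZMod 2) (κ : ℕ → ZMod 2) (J : Set ((ℕ × ℕ) × (ℕ × ℕ))) : Prop :=
  ∀ x y, (x, y) ∈ J → partialSum F κ x.1 x.2 =
    partialSum F κ y.1 (if x.2 % 2 = y.2 % 2 then y.2 else y.2 + 1)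

theorem Flat.union {J J' : Set ((ℕ × ℕ) × (ℕ × ℕ))} (h : Flat F κ J) (h' : Flat F κ J') :
    Flat F κ (J ∪ J') := by
  rintro x y (hxy | hxy)
  · exact h x y hxy
  · exact h' x y hxy

theorem flat_para (hp : t = 0 ∨ i % 2 = j % 2)
    (h : ∀ s ≤ t, partialSum F κ a (i + s) = partialSum F κ b (j + s)) :
    Flat F κ (para a i b j t) := by
  rintro _ _ ⟨s, hs, h'⟩
  obtain ⟨rfl, rfl⟩ := Prod.mk.inj h'
  refine (h s hs.le).trans ?_
  rw [if_pos (by dsimp only; omega)]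

theorem flat_para_zero (F : ℕ → ℕ → ZMod 2) (κ : ℕ → ZMod 2) (a i b j : ℕ) :
    Flat F κ (para a i b j 0) := by
  rintro _ _ ⟨s, hs, h'⟩
  exact absurd hs (Nat.not_lt_zero _)

theorem flat_anti (hp : t = 0 ∨ (i + j + t) % 2 = 0)
    (h : ∀ s ≤ t, partialSum F κ a (i + s) = partialSum F κ b (j + (t - s))) :
    Flat F κ (anti a i b j t) := by
  rintro _ _ ⟨s, hs, h'⟩
  obtain ⟨rfl, rfl⟩ := Prod.mk.inj h'
  refine (h s hs.le).trans ?_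
  rw [if_neg (by dsimp only; omega)]
  congr 1
  dsimp only
  omega

end Sums

theorem sz_eq_zero {c : Col} {b : ℕ} {col : Fin b → Col} {a : ℕ} (h : b < a) :
    sz c col a = 0 := by
  obtain ⟨a, rfl⟩ := Nat.exists_eq_succ_of_ne_zero (by omega : a ≠ 0)
  simp only [sz]
  rw [dif_neg (by omega)]

/-- A criterion for a drawing without boxes to be a tangle. -/
theorem draw₀_isTangle {n : ℕ} {J : Set ((ℕ × ℕ) × (ℕ × ℕ))} (mate : ℕ → ℕ)
    (hJ : ∀ x p y q, ((x, p), (y, q)) ∈ J → x = 0 ∧ y = 0 ∧ p < 2 * n ∧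
      mate p = q ∧ mate q = p ∧ p % 2 ≠ q % 2)
    (hM : ∀ p < 2 * n, mate p < 2 * n ∧ (((0, p), (0, mate p)) ∈ J ∨ ((0, mate p), (0, p)) ∈ J))
    (hF : ∀ (F : ℕ → ℕ → ZMod 2), (∀ p q, ((0, p), (0, q)) ∈ J → F 0 p = F 0 q) →
      partialSum F 0 0 (2 * n) = partialSum F 0 0 0 → Flat F 0 J) :
    (draw (Col.box n) (b := 0) Fin.elim0 J ∅).IsTangle := by
  refine draw_isTangle (fun x => (x.1, mate x.2)) ?_ ?_ ?_ ?_
  · rintro ⟨x, p⟩ ⟨y, q⟩ h hx hy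
    obtain ⟨rfl, rfl, -, h₁, h₂, h₃⟩ := hJ _ _ _ _ h
    refine ⟨congrArg _ h₁, congrArg _ h₂, ?_⟩
    simp only [StartsAt, true_iff]
    omega
  · rintro ⟨_ | x, p⟩ h
    · exact hM p h
    · simp only [sz, not_lt_zero, dite_false] at h
  · exact fun g hg i => i.elim0
  · intro F hF₁ hF₂
    refine ⟨0, fun x y h _ _ => hF F (fun p q h => ?_) ?_ x y h, fun x y h => h.elim⟩
    · obtain ⟨-, -, h₁, h₂, h₃, -⟩ := hJ _ _ _ _ h
      refine hF₁ (0, p) (0, q) h h₁ ?_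
      exact h₂ ▸ (hM p h₁).1
    · have := hF₂ 0
      change ∑ i ∈ Finset.range (2 * n), F 0 i = 0 at this
      simp only [partialSum, this, Finset.range_zero, Finset.sum_empty]

theorem one_isTangle (n : ℕ) : (one (Col.box n)).IsTangle := by
  refine draw₀_isTangle (fun p => 2 * n - 1 - p) ?_ ?_ ?_
  · intro x p y q h
    have := mem_anti.1 h
    simp only [Col.size] at this
    omega
  · intro p hp
    refine ⟨by omega, ?_⟩
    rcases lt_or_ge p n with h | h
    · exact Or.inl (mem_anti.2 ⟨rfl, rfl, by simp only [Col.size]; omega⟩)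
    · exact Or.inr (mem_anti.2 ⟨rfl, rfl, by simp only [Col.size]; omega⟩)
  · intro F h h₀
    refine flat_anti (Or.inr (by simp only [Col.size]; omega)) (partialSum_anti_inner ?_ ?_)
    · rw [zero_add]
    · exact fun s hs => h _ _ ⟨s, hs, rfl⟩

theorem gen_isTangle {n i : ℕ} (hi : i + 2 ≤ n) : (gen n i).IsTangle := by
  refine draw₀_isTangle (fun p => if p = i then i + 1 else if p = i + 1 then i else
    if p = 2 * n - 2 - i then 2 * n - 1 - i else if p = 2 * n - 1 - i then 2 * n - 2 - i else
    2 * n - 1 - p) ?_ ?_ ?_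
  · rintro x p y q (((h | h) | h) | h) <;> have := mem_anti.1 h <;>
      refine ⟨by omega, by omega, by omega, ?_, ?_, by omega⟩ <;> split_ifs <;> omega
  · intro p hp
    refine ⟨by split_ifs <;> omega, ?_⟩
    have key : ∀ q, q + p + 1 = 2 * n → (p < i ∨ (i + 2 ≤ p ∧ p < n) ∨ (n ≤ p ∧ i + 2 ≤ q) ∨ q < i) →
        ((0, p), (0, q)) ∈ anti 0 0 0 (2 * n - i) i ∨
        ((0, p), (0, q)) ∈ anti 0 (i + 2) 0 n (n - i - 2) ∨
        ((0, q), (0, p)) ∈ anti 0 0 0 (2 * n - i) i ∨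
        ((0, q), (0, p)) ∈ anti 0 (i + 2) 0 n (n - i - 2) := by
      intro q hq h
      simp only [mem_anti, true_and]
      omega
    split_ifs with h₁ h₂ h₃ h₄
    · exact Or.inl (Or.inl (Or.inl (Or.inr (mem_anti.2 ⟨rfl, rfl, by omega⟩))))
    · exact Or.inr (Or.inl (Or.inl (Or.inr (mem_anti.2 ⟨rfl, rfl, by omega⟩))))
    · exact Or.inl (Or.inl (Or.inr (mem_anti.2 ⟨rfl, rfl, by omega⟩)))
    · exact Or.inr (Or.inl (Or.inr (mem_anti.2 ⟨rfl, rfl, by omega⟩)))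
    · rcases key (2 * n - 1 - p) (by omega) (by omega) with h | h | h | h
      · exact Or.inl (Or.inl (Or.inl (Or.inl h)))
      · exact Or.inl (Or.inr h)
      · exact Or.inr (Or.inl (Or.inl (Or.inl h)))
      · exact Or.inr (Or.inr h)
  · intro F h h₀
    refine (((flat_anti (by omega) (partialSum_anti_outer ?_ ?_)).union
      (flat_anti (by omega) (partialSum_anti_inner ?_ ?_))).union
      (flat_anti (by omega) (partialSum_anti_inner ?_ ?_))).union
      (flat_anti (by omega) (partialSum_anti_inner ?_ ?_))
    · rw [← h₀]; congr 1; omega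
    · exact fun s hs => h _ _ (Or.inl (Or.inl (Or.inl ⟨s, hs, rfl⟩)))
    · rfl
    · exact fun s hs => h _ _ (Or.inl (Or.inl (Or.inr ⟨s, hs, rfl⟩)))
    · congr 1; omega
    · exact fun s hs => h _ _ (Or.inl (Or.inr ⟨s, hs, rfl⟩))
    · congr 1; omega
    · exact fun s hs => h _ _ (Or.inr ⟨s, hs, rfl⟩)

theorem arcLeft_isTangle {n : ℕ} (hn : 2 ≤ n) : (arcLeft n).IsTangle := by
  refine draw₀_isTangle (fun p => if p = 0 then 2 * n - 1 else if p = 2 * n - 1 then 0 else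
    if p = 1 then 2 else if p = 2 then 1 else 2 * n + 1 - p) ?_ ?_ ?_
  · rintro x p y q ((h | h) | h) <;> have := mem_anti.1 h <;>
      refine ⟨by omega, by omega, by omega, ?_, ?_, by omega⟩ <;> split_ifs <;> omega
  · intro p hp
    refine ⟨by split_ifs <;> omega, ?_⟩
    split_ifs with h₁ h₂ h₃ h₄
    · exact Or.inl (Or.inl (Or.inl (mem_anti.2 ⟨rfl, rfl, by omega⟩)))
    · exact Or.inr (Or.inl (Or.inl (mem_anti.2 ⟨rfl, rfl, by omega⟩)))
    · exact Or.inl (Or.inl (Or.inr (mem_anti.2 ⟨rfl, rfl, by omega⟩)))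
    · exact Or.inr (Or.inl (Or.inr (mem_anti.2 ⟨rfl, rfl, by omega⟩)))
    · rcases lt_or_ge p (n + 1) with h | h
      · exact Or.inl (Or.inr (mem_anti.2 ⟨rfl, rfl, by omega⟩))
      · exact Or.inr (Or.inr (mem_anti.2 ⟨rfl, rfl, by omega⟩))
  · intro F h h₀
    refine ((flat_anti (by omega) (partialSum_anti_outer ?_ ?_)).union
      (flat_anti (by omega) (partialSum_anti_inner ?_ ?_))).union
      (flat_anti (by omega) (partialSum_anti_inner ?_ ?_))
    · rw [← h₀]; congr 1; omega
    · exact fun s hs => h _ _ (Or.inl (Or.inl ⟨s, hs, rfl⟩))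
    · rfl
    · exact fun s hs => h _ _ (Or.inl (Or.inr ⟨s, hs, rfl⟩))
    · congr 1; omega
    · exact fun s hs => h _ _ (Or.inr ⟨s, hs, rfl⟩)

theorem arcRight_isTangle {n : ℕ} (hn : 2 ≤ n) : (arcRight n).IsTangle := by
  refine draw₀_isTangle (fun p => if p = 0 then 2 * n - 1 else if p = 2 * n - 1 then 0 else
    if p = 2 * n - 3 then 2 * n - 2 else if p = 2 * n - 2 then 2 * n - 3 else 2 * n - 3 - p) ?_ ?_ ?_
  · rintro x p y q ((h | h) | h) <;> have := mem_anti.1 h <;>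
      refine ⟨by omega, by omega, by omega, ?_, ?_, by omega⟩ <;> split_ifs <;> omega
  · intro p hp
    refine ⟨by split_ifs <;> omega, ?_⟩
    split_ifs with h₁ h₂ h₃ h₄
    · exact Or.inl (Or.inl (Or.inl (mem_anti.2 ⟨rfl, rfl, by omega⟩)))
    · exact Or.inr (Or.inl (Or.inl (mem_anti.2 ⟨rfl, rfl, by omega⟩)))
    · exact Or.inl (Or.inl (Or.inr (mem_anti.2 ⟨rfl, rfl, by omega⟩)))
    · exact Or.inr (Or.inl (Or.inr (mem_anti.2 ⟨rfl, rfl, by omega⟩)))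
    · rcases lt_or_ge p (n - 1) with h | h
      · exact Or.inl (Or.inr (mem_anti.2 ⟨rfl, rfl, by omega⟩))
      · exact Or.inr (Or.inr (mem_anti.2 ⟨rfl, rfl, by omega⟩))
  · intro F h h₀
    refine ((flat_anti (by omega) (partialSum_anti_outer ?_ ?_)).union
      (flat_anti (by omega) (partialSum_anti_inner ?_ ?_))).union
      (flat_anti (by omega) (partialSum_anti_inner ?_ ?_))
    · rw [← h₀]; congr 1; omega
    · exact fun s hs => h _ _ (Or.inl (Or.inl ⟨s, hs, rfl⟩))
    · congr 1; omega
    · exact fun s hs => h _ _ (Or.inl (Or.inr ⟨s, hs, rfl⟩))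
    · congr 1; omega
    · exact fun s hs => h _ _ (Or.inr ⟨s, hs, rfl⟩)

/-- A criterion for a drawing with one box to be a tangle. The functions `m₀`, `m₁` give the other
end of a strand that starts at the external or internal box. -/
theorem draw₁_isTangle {c d : Col} {J : Set ((ℕ × ℕ) × (ℕ × ℕ))} {i₀ j₀ : ℕ} (m₀ m₁ : ℕ → ℕ × ℕ)
    (hJ : ∀ x p y q, ((x, p), (y, q)) ∈ J →
      (x = 0 ∧ y = 0 ∧ p < 2 * c.size ∧ q < 2 * c.size ∧ p % 2 ≠ q % 2 ∧
        m₀ p = (0, q) ∧ m₀ q = (0, p)) ∨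
      (x = 0 ∧ y = 1 ∧ p < 2 * c.size ∧ q < 2 * d.size ∧ p % 2 = q % 2 ∧
        m₀ p = (1, q) ∧ m₁ q = (0, p)) ∨
      (x = 1 ∧ y = 1 ∧ p < 2 * d.size ∧ q < 2 * d.size ∧ p % 2 ≠ q % 2 ∧
        m₁ p = (1, q) ∧ m₁ q = (1, p)))
    (hM₀ : ∀ p < 2 * c.size, ((0, p), m₀ p) ∈ J ∨ (m₀ p, (0, p)) ∈ J)
    (hM₁ : ∀ p < 2 * d.size, ((1, p), m₁ p) ∈ J ∨ (m₁ p, (1, p)) ∈ J)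
    (hi : i₀ ≤ 2 * c.size) (hj : j₀ ≤ 2 * d.size)
    (hA : (draw c (fun _ : Fin 1 => d) J {((0, i₀), (1, j₀))}).out.rg i₀ =
      ((draw c (fun _ : Fin 1 => d) J {((0, i₀), (1, j₀))}).inn (0 : Fin 1)).rg j₀)
    (hF : ∀ F κ, (∀ x y, (x, y) ∈ J → F x.1 x.2 = F y.1 y.2) →
      partialSum F κ 0 (2 * c.size) = partialSum F κ 0 0 →
      partialSum F κ 1 (2 * d.size) = partialSum F κ 1 0 →
      partialSum F κ 0 i₀ = partialSum F κ 1 j₀ → Flat F κ J) :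
    (draw c (fun _ : Fin 1 => d) J {((0, i₀), (1, j₀))}).IsTangle := by
  have hs : ∀ x, sz c (fun _ : Fin 1 => d) (x + 2) = 0 :=
    fun x => sz_eq_zero (by omega)
  have hv : ∀ x y, (x, y) ∈ J → x.2 < sz c (fun _ : Fin 1 => d) x.1 ∧
      y.2 < sz c (fun _ : Fin 1 => d) y.1 := by
    rintro ⟨x, p⟩ ⟨y, q⟩ h
    rcases hJ _ _ _ _ h with h' | h' | h' <;> obtain ⟨rfl, rfl, h₁, h₂, -⟩ := h' <;>
      exact ⟨h₁, h₂⟩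
  have hM : ∀ x, x.2 < sz c (fun _ : Fin 1 => d) x.1 →
      (x, if x.1 = 0 then m₀ x.2 else m₁ x.2) ∈ J ∨ (if x.1 = 0 then m₀ x.2 else m₁ x.2, x) ∈ J := by
    rintro ⟨_ | _ | x, p⟩ h
    · exact hM₀ p h
    · exact hM₁ p h
    · rw [hs] at h
      exact absurd h (Nat.not_lt_zero _)
  refine draw_isTangle (fun x => if x.1 = 0 then m₀ x.2 else m₁ x.2) ?_ ?_ ?_ ?_
  · rintro ⟨x, p⟩ ⟨y, q⟩ h - -
    rcases hJ _ _ _ _ h with h' | h' | h' <;> obtain ⟨rfl, rfl, -, -, h₁, h₂, h₃⟩ := h' <;>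
      refine ⟨h₂, h₃, ?_⟩ <;> simp only [StartsAt, true_iff, one_ne_zero, false_iff] <;> omega
  · intro x hx
    refine ⟨?_, hM x hx⟩
    rcases hM x hx with h | h
    · exact (hv _ _ h).2
    · exact (hv _ _ h).1
  · intro g hg i
    obtain rfl : i = 0 := Subsingleton.elim _ _
    exact ⟨i₀, hi, j₀, hj, congrArg g hA⟩
  · intro F hF₁ hF₂
    have hF₃ : ∀ κ a, partialSum F κ a (sz c (fun _ : Fin 1 => d) a) = partialSum F κ a 0 := by
      intro κ a
      simp only [partialSum, hF₂, Finset.range_zero, Finset.sum_empty]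
    refine ⟨fun a => if a = 0 then 0 else
      ∑ i ∈ Finset.range i₀, F 0 i + ∑ i ∈ Finset.range j₀, F 1 i, ?_⟩
    generalize hκ : (fun a => if a = 0 then 0 else
      ∑ i ∈ Finset.range i₀, F 0 i + ∑ i ∈ Finset.range j₀, F 1 i) = κ
    have h₀ : partialSum F κ 0 i₀ = partialSum F κ 1 j₀ := by
      rw [← hκ]
      simp only [partialSum, if_true, one_ne_zero, if_false, zero_add]
      rw [add_assoc, CharTwo.add_self_eq_zero, add_zero]
    refine ⟨fun x y h _ _ => hF F κ (fun x y h => hF₁ x y h (hv x y h).1 (hv x y h).2)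
      (hF₃ κ 0) (hF₃ κ 1) h₀ x y h, ?_⟩
    rintro x y h
    obtain ⟨rfl, rfl⟩ := Prod.mk.inj h
    exact h₀

theorem incl_isTangle {a b : ℕ} (h : a ≤ b) : (incl (Col.box a) (Col.box b)).IsTangle := by
  refine draw₁_isTangle (c := Col.box b) (d := Col.box a) (i₀ := 0) (j₀ := 0)
    (fun p => if p < a then (1, p) else if p < 2 * b - a then (0, 2 * b - 1 - p) else
      (1, p + 2 * a - 2 * b))
    (fun p => if p < a then (0, p) else (0, p + 2 * b - 2 * a)) ?_ ?_ ?_ ?_ ?_ ?_ ?_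
  · simp only [Col.size]
    rintro x p y q ((h' | h') | h')
    · have := mem_para.1 h'
      refine Or.inr (Or.inl ⟨by omega, by omega, by omega, by omega, by omega, ?_, ?_⟩) <;>
        split_ifs <;> exact congrArg₂ Prod.mk (by omega) (by omega)
    · have := mem_para.1 h'
      refine Or.inr (Or.inl ⟨by omega, by omega, by omega, by omega, by omega, ?_, ?_⟩) <;>
        split_ifs <;> exact congrArg₂ Prod.mk (by omega) (by omega)
    · have := mem_anti.1 h'
      refine Or.inl ⟨by omega, by omega, by omega, by omega, by omega, ?_, ?_⟩ <;>
        split_ifs <;> exact congrArg₂ Prod.mk (by omega) (by omega)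
  · simp only [Col.size]
    intro p hp
    split_ifs with h₁ h₂
    · exact Or.inl (Or.inl (Or.inl (mem_para.2 ⟨rfl, rfl, by omega⟩)))
    · rcases lt_or_ge p b with h₃ | h₃
      · exact Or.inl (Or.inr (mem_anti.2 ⟨rfl, rfl, by omega⟩))
      · exact Or.inr (Or.inr (mem_anti.2 ⟨rfl, rfl, by omega⟩))
    · exact Or.inl (Or.inl (Or.inr (mem_para.2 ⟨rfl, rfl, by omega⟩)))
  · simp only [Col.size]
    intro p hp
    split_ifs with h₁
    · exact Or.inr (Or.inl (Or.inl (mem_para.2 ⟨rfl, rfl, by omega⟩)))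
    · exact Or.inr (Or.inl (Or.inr (mem_para.2 ⟨rfl, rfl, by omega⟩)))
  · omega
  · omega
  · exact (incl_eqs h).rg
  · simp only [Col.size]
    intro F κ hJ h₀ h₁ h₂
    have e₁ := partialSum_para (t := a) h₂ (fun s hs => hJ _ _ (Or.inl (Or.inl ⟨s, hs, rfl⟩)))
    have e₂ := partialSum_anti_inner (F := F) (κ := κ) (a := 0) (b := 0) (i := a) (j := b)
      (t := b - a) (by congr 1; omega) (fun s hs => hJ _ _ (Or.inr ⟨s, hs, rfl⟩))
    refine ((flat_para (by omega) e₁).union (flat_para (by omega) (partialSum_para ?_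
      (fun s hs => hJ _ _ (Or.inl (Or.inr ⟨s, hs, rfl⟩)))))).union (flat_anti (by omega) e₂)
    have e₃ := e₁ a le_rfl
    rw [zero_add] at e₃
    rw [← e₃]
    refine Eq.trans ?_ (e₂ 0 (Nat.zero_le _)).symm
    congr 1; omega

theorem incl_zeroMinus_isTangle : (incl Col.zeroMinus (Col.box 1)).IsTangle := by
  refine draw₁_isTangle (c := Col.box 1) (d := Col.zeroMinus) (i₀ := 1) (j₀ := 0)
    (fun p => (0, 1 - p)) (fun p => (0, 0)) ?_ ?_ ?_ ?_ ?_ ?_ ?_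
  · simp only [Col.size]
    rintro x p y q ((h' | h') | h')
    · have := mem_para.1 h'; omega
    · have := mem_para.1 h'; omega
    · have := mem_anti.1 h'
      refine Or.inl ⟨by omega, by omega, by omega, by omega, by omega, ?_, ?_⟩ <;>
        exact congrArg₂ Prod.mk (by omega) (by omega)
  · simp only [Col.size]
    intro p hp
    obtain rfl | rfl : p = 0 ∨ p = 1 := by omega
    · exact Or.inl (Or.inr (mem_anti.2 ⟨rfl, rfl, by omega⟩))
    · exact Or.inr (Or.inr (mem_anti.2 ⟨rfl, rfl, by omega⟩))
  · simp only [Col.size]; omega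
  · simp only [Col.size]; omega
  · omega
  · exact draw_region (c := Col.box 1) (0 : Fin 1) rfl (by decide) (by decide) rfl
  · simp only [Col.size]
    intro F κ hJ h₀ h₁ h₂
    exact ((flat_para_zero _ _ _ _ _ _).union (flat_para_zero _ _ _ _ _ _)).union
      (flat_anti (by omega) (partialSum_anti_inner rfl
        (fun s hs => hJ _ _ (Or.inr ⟨s, hs, rfl⟩))))

theorem er_isTangle {d c : ℕ} (h : c ≤ d) : (er (Col.box d) (Col.box c)).IsTangle := by
  refine draw₁_isTangle (c := Col.box c) (d := Col.box d) (i₀ := 0) (j₀ := 0)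
    (fun p => if p < c then (1, p) else (1, p + 2 * d - 2 * c))
    (fun p => if p < c then (0, p) else if p < 2 * d - c then (1, 2 * d - 1 - p) else
      (0, p + 2 * c - 2 * d)) ?_ ?_ ?_ ?_ ?_ ?_ ?_
  · simp only [Col.size]
    rintro x p y q ((h' | h') | h')
    · have := mem_para.1 h'
      refine Or.inr (Or.inl ⟨by omega, by omega, by omega, by omega, by omega, ?_, ?_⟩) <;>
        split_ifs <;> exact congrArg₂ Prod.mk (by omega) (by omega)
    · have := mem_para.1 h'
      refine Or.inr (Or.inl ⟨by omega, by omega, by omega, by omega, by omega, ?_, ?_⟩) <;>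
        split_ifs <;> exact congrArg₂ Prod.mk (by omega) (by omega)
    · have := mem_anti.1 h'
      refine Or.inr (Or.inr ⟨by omega, by omega, by omega, by omega, by omega, ?_, ?_⟩) <;>
        split_ifs <;> exact congrArg₂ Prod.mk (by omega) (by omega)
  · simp only [Col.size]
    intro p hp
    split_ifs with h₁
    · exact Or.inl (Or.inl (Or.inl (mem_para.2 ⟨rfl, rfl, by omega⟩)))
    · exact Or.inl (Or.inl (Or.inr (mem_para.2 ⟨rfl, rfl, by omega⟩)))
  · simp only [Col.size]
    intro p hp
    split_ifs with h₁ h₂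
    · exact Or.inr (Or.inl (Or.inl (mem_para.2 ⟨rfl, rfl, by omega⟩)))
    · rcases lt_or_ge p d with h₃ | h₃
      · exact Or.inl (Or.inr (mem_anti.2 ⟨rfl, rfl, by omega⟩))
      · exact Or.inr (Or.inr (mem_anti.2 ⟨rfl, rfl, by omega⟩))
    · exact Or.inr (Or.inl (Or.inr (mem_para.2 ⟨rfl, rfl, by omega⟩)))
  · omega
  · omega
  · exact (er_eqs h).rg
  · simp only [Col.size]
    intro F κ hJ h₀ h₁ h₂
    have e₁ := partialSum_para (t := c) h₂ (fun s hs => hJ _ _ (Or.inl (Or.inl ⟨s, hs, rfl⟩)))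
    have e₂ := partialSum_anti_inner (F := F) (κ := κ) (a := 1) (b := 1) (i := c) (j := d)
      (t := d - c) (by congr 1; omega) (fun s hs => hJ _ _ (Or.inr ⟨s, hs, rfl⟩))
    refine ((flat_para (by omega) e₁).union (flat_para (by omega) (partialSum_para ?_
      (fun s hs => hJ _ _ (Or.inl (Or.inr ⟨s, hs, rfl⟩)))))).union (flat_anti (by omega) e₂)
    have e₃ := e₁ c le_rfl
    rw [zero_add] at e₃
    rw [e₃]
    refine (e₂ 0 (Nat.zero_le _)).trans ?_
    congr 1; omega

theorem er_zeroMinus_isTangle {d : ℕ} (hd : 1 ≤ d) :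
    (er (Col.box d) Col.zeroMinus).IsTangle := by
  refine draw₁_isTangle (c := Col.zeroMinus) (d := Col.box d) (i₀ := 0) (j₀ := 1)
    (fun p => (0, 0)) (fun p => (1, 2 * d - 1 - p)) ?_ ?_ ?_ ?_ ?_ ?_ ?_
  · simp only [Col.size]
    rintro x p y q ((h' | h') | h')
    · have := mem_para.1 h'; omega
    · have := mem_para.1 h'; omega
    · have := mem_anti.1 h'
      refine Or.inr (Or.inr ⟨by omega, by omega, by omega, by omega, by omega, ?_, ?_⟩) <;>
        exact congrArg₂ Prod.mk (by omega) (by omega)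
  · simp only [Col.size]; omega
  · simp only [Col.size]
    intro p hp
    rcases lt_or_ge p d with h₃ | h₃
    · exact Or.inl (Or.inr (mem_anti.2 ⟨rfl, rfl, by omega⟩))
    · exact Or.inr (Or.inr (mem_anti.2 ⟨rfl, rfl, by omega⟩))
  · omega
  · simp only [Col.size]; omega
  · refine draw_region (c := Col.zeroMinus) (0 : Fin 1) rfl (by decide) ?_ rfl
    simp only [Col.segs, Col.size]; omega
  · simp only [Col.size]
    intro F κ hJ h₀ h₁ h₂
    exact ((flat_para_zero _ _ _ _ _ _).union (flat_para_zero _ _ _ _ _ _)).union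
      (flat_anti (by omega) (partialSum_anti_inner (by congr 1; omega)
        (fun s hs => hJ _ _ (Or.inr ⟨s, hs, rfl⟩))))

theorem el_isTangle {n : ℕ} (hn : 1 ≤ n) : (el n).IsTangle := by
  refine draw₁_isTangle (c := Col.box n) (d := Col.box n) (i₀ := 1) (j₀ := 1)
    (fun p => if p = 0 then (0, 2 * n - 1) else if p = 2 * n - 1 then (0, 0) else (1, p))
    (fun p => if p = 0 then (1, 2 * n - 1) else if p = 2 * n - 1 then (1, 0) else (0, p))
    ?_ ?_ ?_ ?_ ?_ ?_ ?_
  · simp only [Col.size]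
    rintro x p y q ((h' | h') | h')
    · have := mem_anti.1 h'
      refine Or.inl ⟨by omega, by omega, by omega, by omega, by omega, ?_, ?_⟩ <;>
        split_ifs <;> exact congrArg₂ Prod.mk (by omega) (by omega)
    · have := mem_anti.1 h'
      refine Or.inr (Or.inr ⟨by omega, by omega, by omega, by omega, by omega, ?_, ?_⟩) <;>
        split_ifs <;> exact congrArg₂ Prod.mk (by omega) (by omega)
    · have := mem_para.1 h'
      refine Or.inr (Or.inl ⟨by omega, by omega, by omega, by omega, by omega, ?_, ?_⟩) <;>
        split_ifs <;> exact congrArg₂ Prod.mk (by omega) (by omega)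
  · simp only [Col.size]
    intro p hp
    split_ifs with h₁ h₂
    · exact Or.inl (Or.inl (Or.inl (mem_anti.2 ⟨rfl, rfl, by omega⟩)))
    · exact Or.inr (Or.inl (Or.inl (mem_anti.2 ⟨rfl, rfl, by omega⟩)))
    · exact Or.inl (Or.inr (mem_para.2 ⟨rfl, rfl, by omega⟩))
  · simp only [Col.size]
    intro p hp
    split_ifs with h₁ h₂
    · exact Or.inl (Or.inl (Or.inr (mem_anti.2 ⟨rfl, rfl, by omega⟩)))
    · exact Or.inr (Or.inl (Or.inr (mem_anti.2 ⟨rfl, rfl, by omega⟩)))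
    · exact Or.inr (Or.inr (mem_para.2 ⟨rfl, rfl, by omega⟩))
  · simp only [Col.size]; omega
  · simp only [Col.size]; omega
  · exact (el_eqs hn).rg
  · simp only [Col.size]
    intro F κ hJ h₀ h₁ h₂
    refine ((flat_anti (by omega) (partialSum_anti_outer ?_
        (fun s hs => hJ _ _ (Or.inl (Or.inl ⟨s, hs, rfl⟩))))).union
      (flat_anti (by omega) (partialSum_anti_outer ?_
        (fun s hs => hJ _ _ (Or.inl (Or.inr ⟨s, hs, rfl⟩)))))).union
      (flat_para (by omega) (partialSum_para h₂ (fun s hs => hJ _ _ (Or.inr ⟨s, hs, rfl⟩))))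
    · rw [← h₀]; congr 1; omega
    · rw [← h₁]; congr 1; omega

theorem shift_isTangle (n : ℕ) : (shift n).IsTangle := by
  refine draw₁_isTangle (c := Col.box (n + 2)) (d := Col.box n) (i₀ := 2) (j₀ := 0)
    (fun p => if p < 2 then (0, 2 * n + 3 - p) else if 2 * n + 2 ≤ p then (0, 2 * n + 3 - p) else
      (1, p - 2))
    (fun p => (0, p + 2)) ?_ ?_ ?_ ?_ ?_ ?_ ?_
  · simp only [Col.size]
    rintro x p y q (h' | h')
    · have := mem_anti.1 h'
      refine Or.inl ⟨by omega, by omega, by omega, by omega, by omega, ?_, ?_⟩ <;>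
        split_ifs <;> exact congrArg₂ Prod.mk (by omega) (by omega)
    · have := mem_para.1 h'
      refine Or.inr (Or.inl ⟨by omega, by omega, by omega, by omega, by omega, ?_, ?_⟩)
      · split_ifs <;> exact congrArg₂ Prod.mk (by omega) (by omega)
      · exact congrArg₂ Prod.mk (by omega) (by omega)
  · simp only [Col.size]
    intro p hp
    split_ifs with h₁ h₂
    · exact Or.inl (Or.inl (mem_anti.2 ⟨rfl, rfl, by omega⟩))
    · exact Or.inr (Or.inl (mem_anti.2 ⟨rfl, rfl, by omega⟩))
    · exact Or.inl (Or.inr (mem_para.2 ⟨rfl, rfl, by omega⟩))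
  · simp only [Col.size]
    intro p hp
    exact Or.inr (Or.inr (mem_para.2 ⟨rfl, rfl, by omega⟩))
  · simp only [Col.size]; omega
  · simp only [Col.size]; omega
  · exact (shift_eqs n).rg
  · simp only [Col.size]
    intro F κ hJ h₀ h₁ h₂
    refine (flat_anti (by omega) (partialSum_anti_outer ?_
        (fun s hs => hJ _ _ (Or.inl ⟨s, hs, rfl⟩)))).union
      (flat_para (by omega) (partialSum_para h₂ (fun s hs => hJ _ _ (Or.inr ⟨s, hs, rfl⟩))))
    rw [← h₀]; congr 1

/-- Two boxes without marked points in a region of the colour of the picture. -/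
theorem mul_isTangle_of_size_eq_zero {c : Col} (hc : c.size = 0) : (mul c c c).IsTangle := by
  have hsz : ∀ a, sz c (![c, c] : Fin 2 → Col) a = 0 := by
    rintro (_ | _ | _ | a)
    · change 2 * c.size = 0; omega
    · change 2 * c.size = 0; omega
    · change 2 * c.size = 0; omega
    · exact sz_eq_zero (by omega)
  have hv : ∀ x : ℕ × ℕ, ¬ x.2 < sz c (![c, c] : Fin 2 → Col) x.1 := by
    intro x
    rw [hsz]
    exact Nat.not_lt_zero _
  refine draw_isTangle (fun x => x) (fun x y _ h => absurd h (hv x)) (fun x h => absurd h (hv x))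
    ?_ ?_
  · intro g hg i
    refine ⟨0, Nat.zero_le _, 0, Nat.zero_le _, congrArg g ?_⟩
    have hi : ∀ i : Fin 2, i = 0 ∨ i = 1 := by decide
    rcases hi i with rfl | rfl
    · exact draw_region (c := c) (0 : Fin 2) (by simp) (Col.segs_pos _) (Col.segs_pos _) rfl
    · exact draw_region (c := c) (1 : Fin 2) (by simp) (Col.segs_pos _) (Col.segs_pos _) rfl
  · intro F _ _
    refine ⟨0, fun x y _ h => absurd h (hv x), ?_⟩
    intro x y h
    simp only [Set.mem_insert_iff, Set.mem_singleton_iff, Prod.mk.injEq] at h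
    rcases h with ⟨rfl, rfl⟩ | ⟨rfl, rfl⟩ <;> simp

theorem mul_isTangle {a b e : ℕ} (h₁ : a ≤ b + e) (h₂ : b ≤ a + e) (h₃ : e ≤ a + b) :
    (mul (Col.box a) (Col.box b) (Col.box e)).IsTangle := by
  have hs : ∀ x, sz (Col.box e) (![Col.box a, Col.box b] : Fin 2 → Col) (x + 3) = 0 :=
    fun x => sz_eq_zero (by omega)
  let m : ℕ × ℕ → ℕ × ℕ := fun x =>
    if x.1 = 0 then if x.2 < a + e - b then (1, x.2) else (2, x.2 + 2 * b - 2 * e)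
    else if x.1 = 1 then if x.2 < a + e - b then (0, x.2) else (2, 2 * a - 1 - x.2)
    else if x.2 < a + b - e then (1, 2 * a - 1 - x.2) else (0, x.2 + 2 * e - 2 * b)
  have hm0 : ∀ p, m (0, p) = if p < a + e - b then (1, p) else (2, p + 2 * b - 2 * e) :=
    fun p => rfl
  have hm1 : ∀ p, m (1, p) = if p < a + e - b then (0, p) else (2, 2 * a - 1 - p) := fun p => rfl
  have hm2 : ∀ p, m (2, p) = if p < a + b - e then (1, 2 * a - 1 - p) else
      (0, p + 2 * e - 2 * b) := fun p => rfl
  refine draw_isTangle m ?_ ?_ ?_ ?_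
  · simp only [Col.size]
    rintro ⟨x, p⟩ ⟨y, q⟩ ((h | h) | h) - -
    · obtain ⟨rfl, rfl, h⟩ := mem_para.1 h
      rw [hm0, hm1]
      refine ⟨?_, ?_, ?_⟩
      · split_ifs <;> exact congrArg₂ Prod.mk (by omega) (by omega)
      · split_ifs <;> exact congrArg₂ Prod.mk (by omega) (by omega)
      · simp only [StartsAt, true_iff, one_ne_zero, false_iff]; omega
    · obtain ⟨rfl, rfl, h⟩ := mem_anti.1 h
      rw [hm1, hm2]
      refine ⟨?_, ?_, ?_⟩
      · split_ifs <;> exact congrArg₂ Prod.mk (by omega) (by omega)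
      · split_ifs <;> exact congrArg₂ Prod.mk (by omega) (by omega)
      · simp only [StartsAt, OfNat.ofNat_ne_zero, one_ne_zero, false_iff]; omega
    · obtain ⟨rfl, rfl, h⟩ := mem_para.1 h
      rw [hm0, hm2]
      refine ⟨?_, ?_, ?_⟩
      · split_ifs <;> exact congrArg₂ Prod.mk (by omega) (by omega)
      · split_ifs <;> exact congrArg₂ Prod.mk (by omega) (by omega)
      · simp only [StartsAt, true_iff, OfNat.ofNat_ne_zero, false_iff]; omega
  · simp only [Col.size]
    rintro ⟨_ | _ | _ | x, p⟩ h
    · change p < 2 * e at h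
      rw [hm0]
      split_ifs with h'
      · exact ⟨(by omega : p < 2 * a), Or.inl (Or.inl (Or.inl (mem_para.2 ⟨rfl, rfl, by omega⟩)))⟩
      · exact ⟨(by omega : p + 2 * b - 2 * e < 2 * b),
          Or.inl (Or.inr (mem_para.2 ⟨rfl, rfl, by omega⟩))⟩
    · change p < 2 * a at h
      rw [zero_add, hm1]
      split_ifs with h'
      · exact ⟨(by omega : p < 2 * e), Or.inr (Or.inl (Or.inl (mem_para.2 ⟨rfl, rfl, by omega⟩)))⟩
      · exact ⟨(by omega : 2 * a - 1 - p < 2 * b),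
          Or.inl (Or.inl (Or.inr (mem_anti.2 ⟨rfl, rfl, by omega⟩)))⟩
    · change p < 2 * b at h
      rw [zero_add, one_add_one_eq_two, hm2]
      split_ifs with h'
      · exact ⟨(by omega : 2 * a - 1 - p < 2 * a),
          Or.inr (Or.inl (Or.inr (mem_anti.2 ⟨rfl, rfl, by omega⟩)))⟩
      · exact ⟨(by omega : p + 2 * e - 2 * b < 2 * e),
          Or.inr (Or.inr (mem_para.2 ⟨rfl, rfl, by omega⟩))⟩
    · exact absurd h (by rw [hs]; exact Nat.not_lt_zero _)
  · intro g hg i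
    refine ⟨0, Nat.zero_le _, 0, Nat.zero_le _, congrArg g ?_⟩
    have hi : ∀ i : Fin 2, i = 0 ∨ i = 1 := by decide
    rcases hi i with rfl | rfl
    · exact (mul_eqs h₁ h₂ h₃).rg₁
    · exact (mul_eqs h₁ h₂ h₃).rg₂
  · simp only [Col.size]
    intro F hF₁ hF₂
    have hS1 : ∑ i ∈ Finset.range (2 * a), F 1 i = 0 := hF₂ 1
    have hP : ∀ s < a + e - b, F 0 (0 + s) = F 1 (0 + s) := fun s hs =>
      hF₁ (0, 0 + s) (1, 0 + s) (Or.inl (Or.inl ⟨s, hs, rfl⟩)) (by omega : 0 + s < 2 * e)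
        (by omega : 0 + s < 2 * a)
    have hQ : ∀ s < a + b - e, F 1 (a + e - b + s) = F 2 (0 + (a + b - e - 1 - s)) := fun s hs =>
      hF₁ (1, _) (2, _) (Or.inl (Or.inr ⟨s, hs, rfl⟩)) (by omega : a + e - b + s < 2 * a)
        (by omega : 0 + (a + b - e - 1 - s) < 2 * b)
    have hR : ∀ s < b + e - a, F 0 (a + e - b + s) = F 2 (a + b - e + s) := fun s hs =>
      hF₁ (0, _) (2, _) (Or.inr ⟨s, hs, rfl⟩) (by omega : a + e - b + s < 2 * e)
        (by omega : a + b - e + s < 2 * b)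
    have e₁ := partialSum_para (F := F) (κ := 0) (a := 0) (b := 1) (i := 0) (j := 0) rfl hP
    have e₂ := partialSum_anti_inner (κ := 0) (i := a + e - b) (j := 0) (t := a + b - e) (by
      have : a + e - b + (a + b - e) = 2 * a := by omega
      rw [this, partialSum, hS1, partialSum_zero]; rfl) hQ
    have e₃ := e₁ _ le_rfl
    have e₄ := e₂ 0 (Nat.zero_le _)
    rw [zero_add] at e₃ e₄
    have e₅ := partialSum_para (κ := 0) (e₃.trans e₄) hR
    have key : Flat F 0 _ := ((flat_para (by omega) e₁).union (flat_anti (by omega) e₂)).union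
      (flat_para (by omega) e₅)
    refine ⟨0, fun x y h _ _ => key x y h, ?_⟩
    intro x y h
    simp only [Set.mem_insert_iff, Set.mem_singleton_iff, Prod.mk.injEq] at h
    rcases h with ⟨rfl, rfl⟩ | ⟨rfl, rfl⟩ <;> simp

end Diagram

end Skein

namespace Skein

open Net

namespace Diagram

/-! ### Relations between the boundaries of composites -/

section

variable {N N' : Net}

theorem MulEqs.st_left {a b e : ℕ} {o : Hom (boundary (Col.box e)) N}
    {h₁ : Hom (boundary (Col.box a)) N} {h₂ : Hom (boundary (Col.box b)) N}
    (E : MulEqs a b e o h₁ h₂) (i : ℕ) (h : i + b < a + e) : o.st i = h₁.st i :=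
  E.left i (by omega)

theorem MulEqs.st_right {a b e : ℕ} {o : Hom (boundary (Col.box e)) N}
    {h₁ : Hom (boundary (Col.box a)) N} {h₂ : Hom (boundary (Col.box b)) N}
    (E : MulEqs a b e o h₁ h₂) (hb : b ≤ a + e) (he : e ≤ a + b) (i : ℕ) (h : a + e ≤ i + b)
    (hi : i < 2 * e) : o.st i = h₂.st (i + 2 * b - 2 * e) := by
  have := E.right (i + b - (a + e)) (by omega)
  rwa [show a + e - b + (i + b - (a + e)) = i by omega,
    show a + b - e + (i + b - (a + e)) = i + 2 * b - 2 * e by omega] at this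

/-- The strands between the two factors, numbered from the upper factor. -/
theorem MulEqs.st_join {a b e : ℕ} {o : Hom (boundary (Col.box e)) N}
    {h₁ : Hom (boundary (Col.box a)) N} {h₂ : Hom (boundary (Col.box b)) N}
    (E : MulEqs a b e o h₁ h₂) (hb : b ≤ a + e) (i : ℕ) (h : a + e ≤ i + b) (hi : i < 2 * a) :
    h₁.st i = h₂.st (2 * a - 1 - i) := by
  have := E.join (i + b - (a + e)) (by omega)
  rwa [show a + e - b + (i + b - (a + e)) = i by omega,
    show a + b - e - 1 - (i + b - (a + e)) = 2 * a - 1 - i by omega] at this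

theorem MulEqs.st {a b e : ℕ} {o : Hom (boundary (Col.box e)) N}
    {h₁ : Hom (boundary (Col.box a)) N} {h₂ : Hom (boundary (Col.box b)) N}
    (E : MulEqs a b e o h₁ h₂) (hb : b ≤ a + e) (he : e ≤ a + b) (i : ℕ) (hi : i < 2 * e) :
    o.st i = if i + b < a + e then h₁.st i else h₂.st (i + 2 * b - 2 * e) := by
  split_ifs with h
  · exact E.st_left i h
  · exact E.st_right hb he i (by omega) hi

theorem MulEqs.joined {a b e : ℕ} {o : Hom (boundary (Col.box e)) N}
    {h₁ : Hom (boundary (Col.box a)) N} {h₂ : Hom (boundary (Col.box b)) N}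
    (E : MulEqs a b e o h₁ h₂) (hb : b ≤ a + e) {i j : ℕ}
    (h : i + j + 1 = 2 * a ∧ a + e ≤ i + b) : h₁.st i = h₂.st j :=
  (E.st_join hb i h.2 (by omega)).trans (congrArg h₂.st (by omega))

theorem ErEqs.st {d c : ℕ} {o : Hom (boundary (Col.box c)) N}
    {h : Hom (boundary (Col.box d)) N} (E : ErEqs d c o h) (hc : c ≤ d) (i : ℕ) (hi : i < 2 * c) :
    o.st i = h.st (if i < c then i else i + 2 * d - 2 * c) := by
  split_ifs with h'
  · exact E.left i h'
  · have := E.right (i - c) (by omega)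
    rwa [show c + (i - c) = i by omega, show 2 * d - c + (i - c) = i + 2 * d - 2 * c by omega] at this

theorem ErEqs.st_join {d c : ℕ} {o : Hom (boundary (Col.box c)) N}
    {h : Hom (boundary (Col.box d)) N} (E : ErEqs d c o h) (i : ℕ) (hc : c ≤ i)
    (hi : i + c < 2 * d) : h.st i = h.st (2 * d - 1 - i) := by
  rcases lt_or_ge i d with h' | h'
  · have := E.join (i - c) (by omega)
    rwa [show c + (i - c) = i by omega, show 2 * d - 1 - c - (i - c) = 2 * d - 1 - i by omega] at this
  · have := E.join (2 * d - 1 - c - i) (by omega)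
    rw [show c + (2 * d - 1 - c - i) = 2 * d - 1 - i by omega,
      show 2 * d - 1 - c - (2 * d - 1 - c - i) = i by omega] at this
    exact this.symm

theorem ErEqs.joined {d c : ℕ} {o : Hom (boundary (Col.box c)) N}
    {h : Hom (boundary (Col.box d)) N} (E : ErEqs d c o h) {i j : ℕ}
    (hij : i + j + 1 = 2 * d ∧ c ≤ i ∧ c ≤ j) : h.st i = h.st j :=
  (E.st_join i hij.2.1 (by omega)).trans (congrArg h.st (by omega))

theorem InclEqs.st {a b : ℕ} {o : Hom (boundary (Col.box b)) N}
    {h : Hom (boundary (Col.box a)) N} (E : InclEqs a b o h) (hab : a ≤ b) (i : ℕ)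
    (hi : i < 2 * a) : h.st i = o.st (if i < a then i else i + 2 * b - 2 * a) := by
  split_ifs with h'
  · exact (E.left i h').symm
  · have := E.right (i - a) (by omega)
    rw [show a + (i - a) = i by omega,
      show 2 * b - a + (i - a) = i + 2 * b - 2 * a by omega] at this
    exact this.symm

theorem InclEqs.st_join {a b : ℕ} {o : Hom (boundary (Col.box b)) N}
    {h : Hom (boundary (Col.box a)) N} (E : InclEqs a b o h) (i : ℕ)
    (ha : a ≤ i) (hi : i + a < 2 * b) : o.st i = o.st (2 * b - 1 - i) := by
  rcases lt_or_ge i b with h' | h'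
  · have := E.join (i - a) (by omega)
    rwa [show a + (i - a) = i by omega, show 2 * b - 1 - a - (i - a) = 2 * b - 1 - i by omega] at this
  · have := E.join (2 * b - 1 - a - i) (by omega)
    rw [show a + (2 * b - 1 - a - i) = 2 * b - 1 - i by omega,
      show 2 * b - 1 - a - (2 * b - 1 - a - i) = i by omega] at this
    exact this.symm

theorem InclEqs.joined {a b : ℕ} {o : Hom (boundary (Col.box b)) N}
    {h : Hom (boundary (Col.box a)) N} (E : InclEqs a b o h) {i j : ℕ}
    (hij : i + j + 1 = 2 * b ∧ a ≤ i ∧ a ≤ j) : o.st i = o.st j :=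
  (E.st_join i hij.2.1 (by omega)).trans (congrArg o.st (by omega))

theorem OneEqs.st {n : ℕ} {o : Hom (boundary (Col.box n)) N} (E : OneEqs n o) (i : ℕ)
    (hi : i < 2 * n) : o.st i = o.st (2 * n - 1 - i) := by
  rcases lt_or_ge i n with h' | h'
  · exact E i h'
  · have := E (2 * n - 1 - i) (by omega)
    rw [show 2 * n - 1 - (2 * n - 1 - i) = i by omega] at this
    exact this.symm

theorem OneEqs.joined {n : ℕ} {o : Hom (boundary (Col.box n)) N} (E : OneEqs n o) {i j : ℕ}
    (hij : i + j + 1 = 2 * n) : o.st i = o.st j :=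
  (E.st i (by omega)).trans (congrArg o.st (by omega))

/-- The external boundary of a product is determined by the boundaries of the factors. -/
theorem exists_mulEqs {a b e : ℕ} (ha : a ≤ b + e) (hb : b ≤ a + e) (he : e ≤ a + b)
    (h₁ : Hom (boundary (Col.box a)) N) (h₂ : Hom (boundary (Col.box b)) N)
    (hj : ∀ i, a + e ≤ i + b → i < 2 * a → h₁.st i = h₂.st (2 * a - 1 - i))
    (hr : h₁.rg 0 = h₂.rg 0) : ∃ o, MulEqs a b e o h₁ h₂ := by
  have hp : h₁.rg (a + e - b) = h₂.rg (a + b - e) := by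
    by_cases h : a + b = e
    · rw [show a + e - b = 2 * a by omega, show a + b - e = 0 by omega, h₁.rg_box, hr]
    · have := (Hom.rg_of_st_eq' (hj (a + e - b) (by omega) (by omega))
        (show a + e - b < 2 * a by omega) (by omega)).1
      rwa [show 2 * a - 1 - (a + e - b) + 1 = a + b - e by omega] at this
  let s : ℕ → Option N.Strand := fun i =>
    if i < a + e - b then h₁.st i else h₂.st (i + 2 * b - 2 * e)
  let r : ℕ → N.Region := fun j => if j ≤ a + e - b then h₁.rg j else h₂.rg (j + 2 * b - 2 * e)
  have hr₁ : ∀ j ≤ a + e - b, r j = h₁.rg j := fun j hj => if_pos hj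
  have hr₂ : ∀ j, a + e - b ≤ j → r j = h₂.rg (j + 2 * b - 2 * e) := by
    intro j hj
    rcases hj.eq_or_lt with rfl | hj
    · rw [hr₁ _ le_rfl, hp]; congr 1; omega
    · exact if_neg (by omega)
  obtain ⟨o, ho, hor⟩ := exists_boundary e s r
    (by
      intro i hi
      by_cases h : i < a + e - b
      · have hx := h₁.st_of_lt (show i < 2 * a by omega)
        refine ⟨_, (if_pos h).trans hx, ?_, ?_⟩
        · rw [Hom.white_of_st hx, hr₁ _ (by split_ifs <;> omega)]
        · rw [Hom.black_of_st hx, hr₁ _ (by split_ifs <;> omega)]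
      · have hx := h₂.st_of_lt (show i + 2 * b - 2 * e < 2 * b by omega)
        refine ⟨_, (if_neg h).trans hx, ?_, ?_⟩
        · rw [Hom.white_of_st hx, hr₂ _ (by split_ifs <;> omega)]
          congr 1; split_ifs <;> omega
        · rw [Hom.black_of_st hx, hr₂ _ (by split_ifs <;> omega)]
          congr 1; split_ifs <;> omega)
    (by
      rw [hr₂ _ (by omega), show 2 * e + 2 * b - 2 * e = 2 * b by omega, h₂.rg_box, ← hr,
        hr₁ _ (Nat.zero_le _)])
    (by
      rw [hr₁ _ (Nat.zero_le _)]
      exact h₁.shaded_region _)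
  have h0 : o.rg 0 = h₁.rg 0 := (hor 0 (Nat.zero_le _)).trans (hr₁ _ (Nat.zero_le _))
  refine ⟨o, ?_, ?_, ?_, h0, h0.trans hr⟩
  · intro i hi
    exact (ho i (by omega)).trans (if_pos hi)
  · intro i hi
    rw [hj _ (by omega) (by omega)]; congr 1; omega
  · intro i hi
    refine (ho _ (by omega)).trans ((if_neg (by omega)).trans ?_)
    congr 1; omega

/-- The external boundary of an expectation is determined by the boundary of the box. -/
theorem exists_erEqs {d c : ℕ} (hc : c ≤ d) (h : Hom (boundary (Col.box d)) N)
    (hj : ∀ i, c ≤ i → i < d → h.st i = h.st (2 * d - 1 - i)) : ∃ o, ErEqs d c o h := by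
  have hp : h.rg c = h.rg (2 * d - c) := by
    by_cases hcd : c = d
    · congr 1; omega
    · have := (Hom.rg_of_st_eq' (hj c le_rfl (by omega)) (show c < 2 * d by omega) (by omega)).1
      rwa [show 2 * d - 1 - c + 1 = 2 * d - c by omega] at this
  let s : ℕ → Option N.Strand := fun i => if i < c then h.st i else h.st (i + 2 * d - 2 * c)
  let r : ℕ → N.Region := fun j => if j ≤ c then h.rg j else h.rg (j + 2 * d - 2 * c)
  have hr₁ : ∀ j ≤ c, r j = h.rg j := fun j hj => if_pos hj
  have hr₂ : ∀ j, c ≤ j → r j = h.rg (j + 2 * d - 2 * c) := by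
    intro j hj
    rcases hj.eq_or_lt with rfl | hj
    · rw [hr₁ _ le_rfl, hp]; congr 1; omega
    · exact if_neg (by omega)
  obtain ⟨o, ho, hor⟩ := exists_boundary c s r
    (by
      intro i hi
      by_cases h' : i < c
      · have hx := h.st_of_lt (show i < 2 * d by omega)
        refine ⟨_, (if_pos h').trans hx, ?_, ?_⟩
        · rw [Hom.white_of_st hx, hr₁ _ (by split_ifs <;> omega)]
        · rw [Hom.black_of_st hx, hr₁ _ (by split_ifs <;> omega)]
      · have hx := h.st_of_lt (show i + 2 * d - 2 * c < 2 * d by omega)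
        refine ⟨_, (if_neg h').trans hx, ?_, ?_⟩
        · rw [Hom.white_of_st hx, hr₂ _ (by split_ifs <;> omega)]
          congr 1; split_ifs <;> omega
        · rw [Hom.black_of_st hx, hr₂ _ (by split_ifs <;> omega)]
          congr 1; split_ifs <;> omega)
    (by
      rw [hr₂ _ (by omega), show 2 * c + 2 * d - 2 * c = 2 * d by omega, h.rg_box,
        hr₁ _ (Nat.zero_le _)])
    (by
      rw [hr₁ _ (Nat.zero_le _)]
      exact h.shaded_region _)
  refine ⟨o, ?_, ?_, ?_, (hor 0 (Nat.zero_le _)).trans (hr₁ _ (Nat.zero_le _))⟩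
  · intro i hi
    exact (ho i (by omega)).trans (if_pos hi)
  · intro i hi
    refine (ho _ (by omega)).trans ((if_neg (by omega)).trans ?_)
    congr 1; omega
  · intro i hi
    rw [hj _ (by omega) (by omega)]; congr 1; omega

/-! #### The strands of composites -/

theorem mulComp_eqs {a b e : ℕ} (ha : a ≤ b + e) (hb : b ≤ a + e) (he : e ≤ a + b)
    (S : Diagram (Col.box a)) (T : Diagram (Col.box b)) :
    MulEqs a b e (mulComp (Col.box e) S T).out ((mulL (Col.box e) S T).comp S.out)
      ((mulR (Col.box e) S T).comp T.out) := by
  have E := (mul_eqs ha hb he).comp (compL (mul (Col.box a) (Col.box b) (Col.box e)) (factors S T))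
  have e₁ := compL_inn (mul (Col.box a) (Col.box b) (Col.box e)) (factors S T) (0 : Fin 2)
  have e₂ := compL_inn (mul (Col.box a) (Col.box b) (Col.box e)) (factors S T) (1 : Fin 2)
  exact e₁ ▸ e₂ ▸ E

theorem inclComp_eqs {a b : ℕ} (h : a ≤ b) (S : Diagram (Col.box a)) :
    InclEqs a b ((incl (Col.box a) (Col.box b)).comp fun _ => S).out
      ((compR (incl (Col.box a) (Col.box b)) (fun _ => S) (0 : Fin 1)).comp S.out) := by
  have E := (incl_eqs h).comp (compL (incl (Col.box a) (Col.box b)) (fun _ => S))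
  have e₁ := compL_inn (incl (Col.box a) (Col.box b)) (fun _ => S) (0 : Fin 1)
  exact e₁ ▸ E

theorem erComp_eqs {d c : ℕ} (h : c ≤ d) (S : Diagram (Col.box d)) :
    ErEqs d c ((er (Col.box d) (Col.box c)).comp fun _ => S).out
      ((compR (er (Col.box d) (Col.box c)) (fun _ => S) (0 : Fin 1)).comp S.out) := by
  have E := (er_eqs h).comp (compL (er (Col.box d) (Col.box c)) (fun _ => S))
  have e₁ := compL_inn (er (Col.box d) (Col.box c)) (fun _ => S) (0 : Fin 1)
  exact e₁ ▸ E

theorem shiftComp_eqs (n : ℕ) (S : Diagram (Col.box n)) :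
    ShiftEqs n ((shift n).comp fun _ => S).out
      ((compR (shift n) (fun _ => S) (0 : Fin 1)).comp S.out) := by
  have E := (shift_eqs n).comp (compL (shift n) (fun _ => S))
  have e₁ := compL_inn (shift n) (fun _ => S) (0 : Fin 1)
  exact e₁ ▸ E

theorem elComp_eqs {n : ℕ} (hn : 1 ≤ n) (S : Diagram (Col.box n)) :
    ElEqs n ((el n).comp fun _ => S).out
      ((compR (el n) (fun _ => S) (0 : Fin 1)).comp S.out) := by
  have E := (el_eqs hn).comp (compL (el n) (fun _ => S))
  have e₁ := compL_inn (el n) (fun _ => S) (0 : Fin 1)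
  exact e₁ ▸ E

/-- A map out of a product; its external boundary is the one forced by the factors. -/
theorem exists_mulComp_hom {a b : ℕ} (e : ℕ) (ha : a ≤ b + e) (hb : b ≤ a + e) (he : e ≤ a + b)
    (S : Diagram (Col.box a)) (T : Diagram (Col.box b)) (f : Hom S.net N) (g : Hom T.net N)
    (hj : ∀ i, a + e ≤ i + b → i < 2 * a → (f.comp S.out).st i = (g.comp T.out).st (2 * a - 1 - i))
    (hr : (f.comp S.out).rg 0 = (g.comp T.out).rg 0) :
    ∃ h : Hom (mulComp (Col.box e) S T).net N,
      MulEqs a b e (h.comp (mulComp (Col.box e) S T).out) (f.comp S.out) (g.comp T.out) ∧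
      h.comp (mulL (Col.box e) S T) = f ∧ h.comp (mulR (Col.box e) S T) = g := by
  obtain ⟨o, E⟩ := exists_mulEqs ha hb he _ _ hj hr
  obtain ⟨h, h₀, h₁, h₂⟩ := exists_mul_hom S T f g E
  exact ⟨h, h₀ ▸ E, h₁, h₂⟩

/-- A map out of an expectation; its external boundary is the one forced by the box. -/
theorem exists_erComp_hom {d : ℕ} (c : ℕ) (hc : c ≤ d) (S : Diagram (Col.box d)) (f : Hom S.net N)
    (hj : ∀ i, c ≤ i → i < d → (f.comp S.out).st i = (f.comp S.out).st (2 * d - 1 - i)) :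
    ∃ h : Hom ((er (Col.box d) (Col.box c)).comp fun _ => S).net N,
      ErEqs d c (h.comp ((er (Col.box d) (Col.box c)).comp fun _ => S).out) (f.comp S.out) ∧
      h.comp (compR (er (Col.box d) (Col.box c)) (fun _ => S) (0 : Fin 1)) = f := by
  obtain ⟨o, E⟩ := exists_erEqs hc _ hj
  obtain ⟨h, h₀, h₁⟩ := exists_er_hom hc S f E
  exact ⟨h, h₀ ▸ E, h₁⟩

end

/-! ### Strands of composites that end somewhere -/

/-- The strand ends at a marked point. -/
def IsArc {c : Col} (D : Diagram c) (x : D.net.Strand) : Prop := ∃ m, D.strandAt m = x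

theorem isArc_out_st {c : Col} {D : Diagram c} {i : ℕ} {x : D.net.Strand}
    (h : D.out.st i = some x) : D.IsArc x := by
  have hi := Hom.lt_of_st h
  rw [D.out.st_of_lt hi] at h
  exact ⟨Sum.inl ⟨i, hi⟩, Option.some.inj h⟩

theorem isArc_compR_inn {c : Col} (W : Diagram c) (S : ∀ i : W.Box, Diagram (W.boxCol i))
    (i : W.Box) (j : (S i).Box) (p : Fin (2 * ((S i).boxCol j).size)) :
    (W.comp S).IsArc ((compR W S i).strand (((S i).inn j).strand p)) :=
  ⟨Sum.inr ⟨toLex ⟨i, j⟩, p⟩, rfl⟩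

/-- A composite with a drawn outer diagram is free of loops if the boxes produce none. -/
theorem loopFree_draw_comp {c : Col} {b : ℕ} {col : Fin b → Col} {J A : Set ((ℕ × ℕ) × (ℕ × ℕ))}
    {S : ∀ i, Diagram (col i)}
    (h : ∀ i y, ((draw c col J A).comp S).IsArc ((compR (draw c col J A) S i).strand y)) :
    ((draw c col J A).comp S).LoopFree := by
  intro (x : ((draw c col J A).comp S).net.Strand)
  rcases comp_strand_cases (draw c col J A) S x with ⟨y, rfl⟩ | ⟨i, y, rfl⟩
  · obtain ⟨p | ⟨i, p⟩, rfl⟩ := draw_strand_cases y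
    · exact ⟨Sum.inl p, rfl⟩
    · obtain ⟨m, hm⟩ := h i ((S i).out.strand p)
      exact ⟨m, hm.trans (compL_inn_strand (draw c col J A) S i p).symm⟩
  · exact h i y

/-- Outside of the loop free diagram `S`, only the boundary strands of `S` need to be examined. -/
theorem isArc_compR_of_loopFree {c : Col} {W : Diagram c} {S : ∀ i : W.Box, Diagram (W.boxCol i)}
    (i : W.Box) (hS : (S i).LoopFree)
    (h : ∀ p x, ((compR W S i).comp (S i).out).st p = some x → (W.comp S).IsArc x)
    (y : (S i).net.Strand) : (W.comp S).IsArc ((compR W S i).strand y) := by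
  obtain ⟨p | ⟨j, p⟩, rfl⟩ := hS y
  · exact h p.val _ (Hom.st_of_lt _ p.isLt)
  · exact isArc_compR_inn W S i j p

theorem isArc_compR_of_full {c : Col} {W : Diagram c} {S : ∀ i : W.Box, Diagram (W.boxCol i)}
    (i : W.Box) (hS : (S i).Full) (y : (S i).net.Strand) :
    (W.comp S).IsArc ((compR W S i).strand y) := by
  obtain ⟨j, p, rfl⟩ := hS y
  exact isArc_compR_inn W S i j p

theorem mulComp_loopFree {c d : Col} (e : Col) (S : Diagram c) (T : Diagram d)
    (hS : ∀ y, (mulComp e S T).IsArc ((mulL e S T).strand y))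
    (hT : ∀ y, (mulComp e S T).IsArc ((mulR e S T).strand y)) : (mulComp e S T).LoopFree := by
  refine loopFree_draw_comp ?_
  intro i
  have hi : ∀ i : Fin 2, i = 0 ∨ i = 1 := by decide
  rcases hi i with rfl | rfl
  · exact hS
  · exact hT

theorem mulComp_loopFree_left {a b e : ℕ} (ha : a ≤ b + e) (hb : b ≤ a + e) (he : e ≤ a + b)
    {S : Diagram (Col.box a)} {T : Diagram (Col.box b)} (hS : S.Full) (hT : T.LoopFree) :
    (mulComp (Col.box e) S T).LoopFree := by
  have h₁ : ∀ y, (mulComp (Col.box e) S T).IsArc ((mulL (Col.box e) S T).strand y) :=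
    fun y => isArc_compR_of_full (W := mul (Col.box a) (Col.box b) (Col.box e))
      (S := factors S T) (0 : Fin 2) hS y
  refine mulComp_loopFree _ S T h₁ (fun y => isArc_compR_of_loopFree
    (W := mul (Col.box a) (Col.box b) (Col.box e)) (S := factors S T) (1 : Fin 2) hT ?_ y)
  intro p x hx
  have hx : ((mulR (Col.box e) S T).comp T.out).st p = some x := hx
  have hp : p < 2 * b := Hom.lt_of_st hx
  have E := mulComp_eqs ha hb he S T
  rcases lt_or_ge (p + e) (a + b) with h | h
  · have := E.st_join hb (2 * a - 1 - p) (by omega) (by omega)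
    rw [show 2 * a - 1 - (2 * a - 1 - p) = p by omega, hx, Hom.st_comp] at this
    obtain ⟨y, -, hy⟩ := Option.map_eq_some_iff.1 this
    exact hy ▸ h₁ y
  · have := E.st_right hb he (p + 2 * e - 2 * b) (by omega) (by omega)
    rw [show p + 2 * e - 2 * b + 2 * b - 2 * e = p by omega, hx] at this
    exact isArc_out_st this

theorem mulComp_loopFree_right {a b e : ℕ} (ha : a ≤ b + e) (hb : b ≤ a + e) (he : e ≤ a + b)
    {S : Diagram (Col.box a)} {T : Diagram (Col.box b)} (hS : S.LoopFree) (hT : T.Full) :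
    (mulComp (Col.box e) S T).LoopFree := by
  have h₁ : ∀ y, (mulComp (Col.box e) S T).IsArc ((mulR (Col.box e) S T).strand y) :=
    fun y => isArc_compR_of_full (W := mul (Col.box a) (Col.box b) (Col.box e))
      (S := factors S T) (1 : Fin 2) hT y
  refine mulComp_loopFree _ S T (fun y => isArc_compR_of_loopFree
    (W := mul (Col.box a) (Col.box b) (Col.box e)) (S := factors S T) (0 : Fin 2) hS ?_ y) h₁
  intro p x hx
  have hx : ((mulL (Col.box e) S T).comp S.out).st p = some x := hx
  have hp : p < 2 * a := Hom.lt_of_st hx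
  have E := mulComp_eqs ha hb he S T
  rcases lt_or_ge (p + b) (a + e) with h | h
  · exact isArc_out_st ((E.st_left p h).trans hx)
  · have := (E.st_join hb p (by omega) (by omega)).symm.trans hx
    rw [Hom.st_comp] at this
    obtain ⟨y, -, hy⟩ := Option.map_eq_some_iff.1 this
    exact hy ▸ h₁ y

theorem inclComp_loopFree {a b : ℕ} (hab : a ≤ b) {S : Diagram (Col.box a)} (hS : S.LoopFree) :
    ((incl (Col.box a) (Col.box b)).comp fun _ => S).LoopFree := by
  refine loopFree_draw_comp (fun i => isArc_compR_of_loopFree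
    (W := incl (Col.box a) (Col.box b)) (S := fun _ => S) i hS ?_)
  intro p x hx
  have hi : ∀ i : Fin 1, i = 0 := fun i => Subsingleton.elim _ _
  obtain rfl := hi i
  exact isArc_out_st (((inclComp_eqs hab S).st hab p (Hom.lt_of_st hx)).symm.trans hx)

theorem draw_full {c : Col} {b : ℕ} {col : Fin b → Col} {J A : Set ((ℕ × ℕ) × (ℕ × ℕ))}
    (h : ∀ p < 2 * c.size, ∃ (i : Fin b) (j : ℕ), j < 2 * (col i).size ∧
      ((0, p), (i.val + 1, j)) ∈ J) : (draw c col J A).Full := by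
  intro x
  obtain ⟨p | ⟨i, p⟩, rfl⟩ := draw_strand_cases x
  · obtain ⟨i, j, hj, hJ⟩ := h p.val p.isLt
    exact ⟨i, ⟨j, hj⟩, (draw_strand_eq (c := c) (Sum.inl p) (Sum.inr ⟨i, ⟨j, hj⟩⟩) hJ).symm⟩
  · exact ⟨i, p, rfl⟩

theorem er_full {d c : ℕ} (h : c ≤ d) : (er (Col.box d) (Col.box c)).Full := by
  refine draw_full (fun p hp => ⟨(0 : Fin 1), ?_⟩)
  change p < 2 * c at hp
  change ∃ j, j < 2 * d ∧ _
  rcases lt_or_ge p c with h' | h'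
  · exact ⟨p, by omega, Or.inl (Or.inl (mem_para.2 ⟨rfl, rfl, by simp only [Col.size, and_true]; omega⟩))⟩
  · exact ⟨p + 2 * d - 2 * c, by omega,
      Or.inl (Or.inr (mem_para.2 ⟨rfl, rfl, by simp only [Col.size]; omega⟩))⟩

theorem mul_full {a b e : ℕ} (ha : a ≤ b + e) (hb : b ≤ a + e) (he : e ≤ a + b) :
    (mul (Col.box a) (Col.box b) (Col.box e)).Full := by
  refine draw_full (fun p hp => ?_)
  change p < 2 * e at hp
  rcases lt_or_ge p (a + e - b) with h' | h'
  · exact ⟨(0 : Fin 2), p, (by omega : p < 2 * a),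
      Or.inl (Or.inl (mem_para.2 ⟨rfl, rfl, by simp only [Col.size, and_true]; omega⟩))⟩
  · exact ⟨(1 : Fin 2), p + 2 * b - 2 * e, (by omega : _ < 2 * b),
      Or.inr (mem_para.2 ⟨rfl, rfl, by simp only [Col.size]; omega⟩)⟩

theorem mulComp_full {a b e : ℕ} (ha : a ≤ b + e) (hb : b ≤ a + e) (he : e ≤ a + b)
    {S : Diagram (Col.box a)} {T : Diagram (Col.box b)} (hS : S.Full) (hT : T.Full) :
    (mulComp (Col.box e) S T).Full := by
  refine (mul_full ha hb he).comp (S := factors S T) ?_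
  intro i
  have hi : ∀ i : Fin 2, i = 0 ∨ i = 1 := by decide
  rcases hi i with rfl | rfl
  · exact hS
  · exact hT

theorem mulComp_isTangle {c d e : Col} (h : (mul c d e).IsTangle) {S : Diagram c} {T : Diagram d}
    (hS : S.IsTangle) (hT : T.IsTangle) : (mulComp e S T).IsTangle := by
  refine comp_isTangle (S := factors S T) h ?_
  intro i
  have hi : ∀ i : Fin 2, i = 0 ∨ i = 1 := by decide
  rcases hi i with rfl | rfl
  · exact hS
  · exact hT

/-- A map between loop free tangles that respects all boxes is an isotopy. -/
theorem BoxHom.isotopy_of_loopFree₂ {c : Col} {X Y : Diagram c} {B : Type} [LinearOrder B]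
    (f : BoxHom X Y B) (hX : X.IsTangle) (hY : Y.IsTangle) (hl : X.LoopFree) (hl' : Y.LoopFree) :
    Nonempty (Isotopy X Y) := by
  refine f.isotopy_of_loopFree hX hY hl ?_
  intro y
  obtain ⟨p | ⟨j, p⟩, rfl⟩ := hl' y
  · exact ⟨_, f.out_strand p⟩
  · obtain ⟨i, rfl⟩ := f.box.surjective j
    refine ⟨(X.inn i).strand
      (Fin.cast (congrArg (fun d : Col => 2 * d.size) (f.boxCol i)).symm p), ?_⟩
    exact (f.inn_strand i _).trans rfl

/-! ### Boxes of products -/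

/-- The boxes of a product. -/
def mulBoxes {c d : Col} (e : Col) (S : Diagram c) (T : Diagram d) :
    S.Box ⊕ₗ T.Box ≃o (mulComp e S T).Box := boxes₂ (factors S T)

/-- The boxes of a product whose lower factor has none. -/
def mulBoxesL {c d : Col} (e : Col) (S : Diagram c) (T : Diagram d) [IsEmpty T.Box] :
    S.Box ≃o (mulComp e S T).Box :=
  OrderIso.sumLexEmpty.symm.trans (mulBoxes e S T)

/-- The boxes of a product whose upper factor has none. -/
def mulBoxesR {c d : Col} (e : Col) (S : Diagram c) (T : Diagram d) [IsEmpty S.Box] :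
    T.Box ≃o (mulComp e S T).Box :=
  OrderIso.emptySumLex.symm.trans (mulBoxes e S T)

/-- The box of an expectation. -/
def erBoxes {d : Col} (c : Col) (S : Diagram d) : S.Box ≃o ((er d c).comp fun _ => S).Box :=
  boxes₁ (fun _ : Fin 1 => S)

/-- The box of an inclusion. -/
def inclBoxes {c : Col} (d : Col) (S : Diagram c) : S.Box ≃o ((incl c d).comp fun _ => S).Box :=
  boxes₁ (fun _ : Fin 1 => S)

/-- The box of a shift. -/
def shiftBoxes {n : ℕ} (S : Diagram (Col.box n)) : S.Box ≃o ((shift n).comp fun _ => S).Box :=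
  boxes₁ (fun _ : Fin 1 => S)

/-- The box of a left expectation. -/
def elBoxes {n : ℕ} (S : Diagram (Col.box n)) : S.Box ≃o ((el n).comp fun _ => S).Box :=
  boxes₁ (fun _ : Fin 1 => S)

end Diagram

end Skein

namespace Skein

open Net

namespace Diagram

/-! ### Isotopies between products -/

section

variable {N : Net}

/-- The expectation of a product is the product with one more strand between the factors. -/
theorem MulEqs.er {a p : ℕ} (hp : p + 1 ≤ 2 * a)
    {o : Hom (boundary (Col.box p)) N} {o' : Hom (boundary (Col.box (p + 1))) N}
    {s t : Hom (boundary (Col.box a)) N} (E : MulEqs a a p o s t)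
    (E' : MulEqs a a (p + 1) o' s t) : ErEqs (p + 1) p o o' := by
  have e := E.st (by omega) (by omega)
  have e' := E'.st (by omega) (by omega)
  refine ⟨?_, ?_, ?_, E.rg₁.trans E'.rg₁.symm⟩
  · intro i hi
    rw [e _ (by omega), e' _ (by omega), if_pos (by omega), if_pos (by omega)]
  · intro i hi
    rw [e _ (by omega), e' _ (by omega), if_neg (by omega), if_neg (by omega)]
    exact congrArg _ (by omega)
  · intro i hi
    rw [e' _ (by omega), e' _ (by omega), if_pos (by omega), if_neg (by omega)]
    exact E.joined (by omega) (by omega)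

/-- The equations of `s (t u)` with outer boundary `o` imply those of `(s t) u`; the numbers are as in
`mul_assoc_isotopy`. -/
theorem MulEqs.assoc {a b c p q p' v : ℕ} (ha : a ≤ b + p) (hb : b ≤ a + p) (hp : p ≤ a + b)
    (hp' : p ≤ c + q) (hc : c ≤ p + q) (hq : q ≤ p + c) (hv : p' + v = b + c)
    (h : (v + q = p + c ∧ p + c + a ≤ q + p + b) ∨ (v + a = p + b ∧ p + b + q ≤ p + c + a))
    {o : Hom (boundary (Col.box q)) N} {o' : Hom (boundary (Col.box p')) N}
    {o'' : Hom (boundary (Col.box p)) N} {s : Hom (boundary (Col.box a)) N}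
    {t : Hom (boundary (Col.box b)) N} {u : Hom (boundary (Col.box c)) N}
    (E : MulEqs b c p' o' t u) (E' : MulEqs a p' q o s o') (E'' : MulEqs a b p o'' s t) :
    MulEqs p c q o o'' u := by
  have e := E.st (by omega) (by omega)
  have e' := E'.st (by omega) (by omega)
  have e'' := E''.st hb hp
  refine ⟨?_, ?_, ?_, E'.rg₁.trans E''.rg₁.symm, E'.rg₂.trans E.rg₂⟩
  · intro i hi
    rw [e' _ (by omega), e'' _ (by omega)]
    split_ifs <;> (try rw [e _ (by omega)]) <;> (try split_ifs) <;>
      first | omega | exact congrArg _ (by omega)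
  · intro i hi
    rw [e'' _ (by omega)]
    split_ifs with h₁
    · refine (E'.joined (j := 2 * a - 1 - (p + q - c + i)) (by omega) (by omega)).trans ?_
      rw [e _ (by omega)]
      split_ifs <;> first | omega | exact congrArg _ (by omega)
    · exact E.joined (by omega) (by omega)
  · intro i hi
    rw [e' _ (by omega), e _ (by omega)]
    split_ifs <;> first | omega | exact congrArg _ (by omega)

theorem MulEqs.assoc_joined {a b c p q p' v : ℕ} (hb : b ≤ a + p) (hp : p ≤ a + b)
    (hp' : p ≤ c + q) (hc : c ≤ p + q) (hv : p' + v = b + c)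
    (h : (v + q = p + c ∧ p + c + a ≤ q + p + b) ∨ (v + a = p + b ∧ p + b + q ≤ p + c + a))
    {o : Hom (boundary (Col.box q)) N} {o' : Hom (boundary (Col.box p')) N}
    {s : Hom (boundary (Col.box a)) N}
    {t : Hom (boundary (Col.box b)) N} {u : Hom (boundary (Col.box c)) N}
    (E : MulEqs b c p' o' t u) (E' : MulEqs a p' q o s o') (i : ℕ) (hi : a + p ≤ i + b)
    (hi' : i < 2 * a) : s.st i = t.st (2 * a - 1 - i) := by
  refine (E'.joined (j := 2 * a - 1 - i) (by omega) (by omega)).trans ?_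
  rw [E.st (by omega) (by omega) _ (by omega), if_pos (by omega)]

theorem MulEqs.incl_of_one {n m : ℕ} (h : n ≤ m) {o u : Hom (boundary (Col.box m)) N}
    {s : Hom (boundary (Col.box n)) N} (E : MulEqs n m m o s u) (E' : OneEqs m u) :
    InclEqs n m o s := by
  have e := E.st (by omega) (by omega)
  refine ⟨?_, ?_, ?_, E.rg₁⟩
  · intro i hi
    rw [e _ (by omega), if_pos (by omega)]
  · intro i hi
    rw [e _ (by omega), if_neg (by omega)]
    exact (E'.joined (j := n - 1 - i) (by omega)).trans (E.joined (by omega) (by omega)).symm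
  · intro i hi
    rw [e _ (by omega), e _ (by omega), if_neg (by omega), if_neg (by omega)]
    exact E'.joined (by omega)

theorem MulEqs.er_of_one {n : ℕ} {o : Hom (boundary (Col.box n)) N}
    {x u : Hom (boundary (Col.box (n + 1))) N} (E : MulEqs (n + 1) (n + 1) n o x u)
    (E' : OneEqs (n + 1) u) : ErEqs (n + 1) n o x := by
  have e := E.st (by omega) (by omega)
  refine ⟨?_, ?_, ?_, E.rg₁⟩
  · intro i hi
    rw [e _ (by omega), if_pos (by omega)]
  · intro i hi
    rw [e _ (by omega), if_neg (by omega)]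
    exact (E'.joined (j := n - 1 - i) (by omega)).trans (E.joined (by omega) (by omega)).symm
  · intro i hi
    exact (E.joined (j := n + 1 - i) (by omega) (by omega)).trans ((E'.joined (j := n + i)
      (by omega)).trans (E.joined (by omega) (by omega)).symm)

theorem ErEqs.trans {d c b : ℕ} (hb : b ≤ c) (hc : c ≤ d) {o : Hom (boundary (Col.box b)) N}
    {o' : Hom (boundary (Col.box c)) N} {y : Hom (boundary (Col.box d)) N} (E : ErEqs c b o o')
    (E' : ErEqs d c o' y) : ErEqs d b o y := by
  have e := E.st (by omega)
  have e' := E'.st (by omega)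
  refine ⟨?_, ?_, ?_, E.rg.trans E'.rg⟩
  · intro i hi
    rw [e _ (by omega), if_pos (by omega), e' _ (by omega), if_pos (by omega)]
  · intro i hi
    rw [e _ (by omega), if_neg (by omega), e' _ (by omega), if_neg (by omega)]
    exact congrArg _ (by omega)
  · intro i hi
    rcases lt_or_ge (b + i) c with h | h
    · have := (e' (b + i) (by omega)).symm.trans ((E.joined (j := 2 * c - 1 - b - i)
        (by omega)).trans (e' _ (by omega)))
      rw [if_pos (by omega), if_neg (by omega)] at this
      exact this.trans (congrArg _ (by omega))
    · exact E'.joined (by omega)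

theorem MulEqs.of_incl {k n : ℕ} (hk : 1 ≤ k) (hn : k ≤ n) {o s : Hom (boundary (Col.box n)) N}
    {j : Hom (boundary (Col.box k)) N} {z : Hom (boundary (Col.box (k - 1))) N}
    (E : MulEqs k n n o j s) (E' : InclEqs (k - 1) k j z) : MulEqs (k - 1) n n o z s := by
  have e := E.st (by omega) (by omega)
  have e' := E'.st (by omega)
  refine ⟨?_, ?_, ?_, E.rg₁.trans E'.rg, E.rg₂⟩
  · intro i hi
    rw [e _ (by omega), if_pos (by omega), e' _ (by omega), if_pos (by omega)]
  · intro i hi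
    rw [e' _ (by omega), if_neg (by omega)]
    exact E.joined (by omega) (by omega)
  · intro i hi
    rw [e _ (by omega)]
    split_ifs with h
    · exact (E'.joined (j := k) (by omega)).trans (E.joined (by omega) (by omega))
    · exact congrArg _ (by omega)

theorem MulEqs.stretch_joined {k n : ℕ} (hk : 1 ≤ k) (hn : k + 1 ≤ n) {o : Hom (boundary (Col.box (n + 1))) N}
    {o' : Hom (boundary (Col.box n)) N} {v : Hom (boundary (Col.box (n - 1))) N}
    {s t : Hom (boundary (Col.box k)) N} (E : MulEqs k n (n + 1) o s o')
    (E' : MulEqs (n - 1) k n o' v t) (E'' : OneEqs (n - 1) v) (i : ℕ) (hi : k + 1 ≤ i)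
    (hi' : i < 2 * k) : s.st i = t.st (2 * k - 1 - i) := by
  refine (E.joined (j := 2 * k - 1 - i) (by omega) (by omega)).trans ?_
  rw [E'.st (by omega) (by omega) _ (by omega), if_pos (by omega)]
  exact (E''.joined (j := 2 * n - 2 - 2 * k + i) (by omega)).trans (E'.joined (by omega) (by omega))

/-- The equations behind `incl_mul_isotopy`. -/
theorem MulEqs.stretch {k n : ℕ} (hk : 1 ≤ k) (hn : k + 1 ≤ n) {o : Hom (boundary (Col.box (n + 1))) N}
    {o' : Hom (boundary (Col.box n)) N} {v : Hom (boundary (Col.box (n - 1))) N}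
    {s t : Hom (boundary (Col.box k)) N} {w : Hom (boundary (Col.box (k + 1))) N}
    (E : MulEqs k n (n + 1) o s o')
    (E' : MulEqs (n - 1) k n o' v t) (E'' : OneEqs (n - 1) v) (F : MulEqs k k (k + 1) w s t) :
    InclEqs (k + 1) (n + 1) o w := by
  have e := E.st (by omega) (by omega)
  have e' := E'.st (by omega) (by omega)
  have f := F.st (by omega)
  refine ⟨?_, ?_, ?_, E.rg₁.trans F.rg₁.symm⟩
  · intro i hi
    rw [e _ (by omega), if_pos (by omega), F.st_left _ (by omega)]
  · intro i hi
    rw [e _ (by omega), if_neg (by omega), e' _ (by omega), if_neg (by omega),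
      F.st_right (by omega) (by omega) _ (by omega) (by omega)]
    exact congrArg _ (by omega)
  · intro i hi
    rw [e _ (by omega), if_neg (by omega), e _ (by omega), if_neg (by omega), e' _ (by omega),
      if_pos (by omega), e' _ (by omega), if_pos (by omega)]
    exact E''.joined (by omega)

end

/-- If every strand of `S` meets a box, and the boxes of `S` are boxes of `Y`, then the strands of `S`
end at marked points of `Y`. -/
theorem full_inn {c d : Col} {Y : Diagram c} {S : Diagram d} (hS : S.Full) (f : Hom S.net Y.net)
    (h : ∀ b, ∃ (j : Y.Box) (e : S.boxCol b = Y.boxCol j),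
      f.comp (S.inn b) = (Y.inn j).castCol e) (x : S.net.Strand) : Y.IsArc (f.strand x) := by
  obtain ⟨b, p, rfl⟩ := hS x
  obtain ⟨j, e, he⟩ := h b
  have := congrArg (fun o : Hom (boundary (S.boxCol b)) Y.net => o.strand p) he
  rw [Hom.castCol_strand] at this
  exact ⟨Sum.inr ⟨j, _⟩, this.symm⟩

/-- The expectation of a product of diagrams of equal colour is the product with one more
strand in between. -/
theorem er_mul_isotopy {a p : ℕ} (hp : p + 1 ≤ 2 * a)
    {S T : Diagram (Col.box a)} (hS : S.IsTangle) (hT : T.IsTangle) (fS : S.Full) (fT : T.Full) :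
    Nonempty (Isotopy ((er (Col.box (p + 1)) (Col.box p)).comp fun _ =>
      mulComp (Col.box (p + 1)) S T) (mulComp (Col.box p) S T)) := by
  have E := mulComp_eqs (e := p) (by omega) (by omega) (by omega) S T
  obtain ⟨f, E₁, f₁, f₂⟩ := exists_mulComp_hom (p + 1) (by omega) (by omega) (by omega) S T
    (mulL (Col.box p) S T) (mulR (Col.box p) S T)
    (fun i hi hi' => E.st_join (by omega) i (by omega) hi') (E.rg₁.symm.trans E.rg₂)
  obtain ⟨g, g₀, g₁⟩ := exists_er_hom (by omega) _ f (E.er hp E₁)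
  refine BoxHom.isotopy_of_loopFree₂ (B := S.Box ⊕ₗ T.Box)
    ⟨g, g₀, (mulBoxes _ S T).trans (erBoxes _ _), mulBoxes _ S T, ?_⟩
    (comp_isTangle (er_isTangle (by omega)) fun _ =>
      mulComp_isTangle (mul_isTangle (by omega) (by omega) (by omega)) hS hT)
    (mulComp_isTangle (mul_isTangle (by omega) (by omega) (by omega)) hS hT)
    ((er_full (by omega)).comp fun _ =>
      mulComp_full (by omega) (by omega) (by omega) fS fT).loopFree
    (mulComp_full (by omega) (by omega) (by omega) fS fT).loopFree
  rintro (b | b)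
  · exact ⟨rfl, congrArg (fun h => Hom.comp h (S.inn b)) (g₁ ▸ f₁)⟩
  · exact ⟨rfl, congrArg (fun h => Hom.comp h (T.inn b)) (g₁ ▸ f₂)⟩

/-- Associativity of the product. In the product on the left, `a + b - p` strands join the first
two factors; of the `p + c - q` strands that end at the third factor, `v` come from the second. -/
theorem mul_assoc_isotopy {a b c p q p' v : ℕ} (ha : a ≤ b + p) (hb : b ≤ a + p) (hp : p ≤ a + b)
    (hp' : p ≤ c + q) (hc : c ≤ p + q) (hq : q ≤ p + c) (hv : p' + v = b + c)
    (h : (v + q = p + c ∧ p + c + a ≤ q + p + b) ∨ (v + a = p + b ∧ p + b + q ≤ p + c + a))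
    {S : Diagram (Col.box a)} {T : Diagram (Col.box b)} {U : Diagram (Col.box c)}
    (hS : S.IsTangle) (hT : T.IsTangle) (hU : U.IsTangle) (fS : S.Full) (fT : T.Full)
    (fU : U.Full) :
    Nonempty (Isotopy (mulComp (Col.box q) (mulComp (Col.box p) S T) U)
      (mulComp (Col.box q) S (mulComp (Col.box p') T U))) := by
  have E := mulComp_eqs (e := q) (a := a) (b := p') (by omega) (by omega) (by omega) S
    (mulComp (Col.box p') T U)
  have E' := (mulComp_eqs (e := p') (a := b) (b := c) (by omega) (by omega) (by omega) T U).comp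
    (mulR (Col.box q) S (mulComp (Col.box p') T U))
  obtain ⟨f, E₁, f₁, f₂⟩ := exists_mulComp_hom p ha hb hp S T
    (mulL (Col.box q) S (mulComp (Col.box p') T U))
    ((mulR (Col.box q) S (mulComp (Col.box p') T U)).comp (mulL _ T U))
    (E'.assoc_joined hb hp hp' hc hv h E) (E.rg₁.symm.trans (E.rg₂.trans E'.rg₁))
  obtain ⟨g, g₀, g₁, g₂⟩ := exists_mul_hom _ U f
    ((mulR (Col.box q) S (mulComp (Col.box p') T U)).comp (mulR _ T U))
    (E'.assoc ha hb hp hp' hc hq hv h E E₁)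
  refine BoxHom.isotopy_of_loopFree₂ (B := (S.Box ⊕ₗ T.Box) ⊕ₗ U.Box)
    ⟨g, g₀, (OrderIso.sumLexCongr (mulBoxes _ S T) (OrderIso.refl _)).trans (mulBoxes _ _ U),
      (OrderIso.sumLexAssoc _ _ _).trans
        ((OrderIso.sumLexCongr (OrderIso.refl _) (mulBoxes _ T U)).trans (mulBoxes _ S _)), ?_⟩
    (mulComp_isTangle (mul_isTangle (by omega) (by omega) (by omega))
      (mulComp_isTangle (mul_isTangle ha hb hp) hS hT) hU)
    (mulComp_isTangle (mul_isTangle (by omega) (by omega) (by omega)) hS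
      (mulComp_isTangle (mul_isTangle (by omega) (by omega) (by omega)) hT hU))
    (mulComp_full (by omega) (by omega) (by omega) (mulComp_full ha hb hp fS fT) fU).loopFree
    (mulComp_full (by omega) (by omega) (by omega) fS
      (mulComp_full (by omega) (by omega) (by omega) fT fU)).loopFree
  rintro ((b | b) | b)
  · exact ⟨rfl, congrArg (fun h => Hom.comp h (S.inn b)) (g₁ ▸ f₁)⟩
  · exact ⟨rfl, congrArg (fun h => Hom.comp h (T.inn b)) (g₁ ▸ f₂)⟩
  · exact ⟨rfl, congrArg (fun h => Hom.comp h (U.inn b)) g₂⟩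

instance (c : Col) : IsEmpty (one c).Box := inferInstanceAs (IsEmpty (Fin 0))

theorem one_loopFree (c : Col) : (one c).LoopFree := draw_loopFree

/-- An inclusion is the product with vertical strands. -/
theorem incl_isotopy_mul_one {n m : ℕ} (h : n ≤ m) {S : Diagram (Col.box n)} (hS : S.IsTangle)
    (fS : S.Full) : Nonempty (Isotopy ((incl (Col.box n) (Col.box m)).comp fun _ => S)
      (mulComp (Col.box m) S (one (Col.box m)))) := by
  have E := mulComp_eqs (e := m) (by omega) (by omega) (by omega) S (one (Col.box m))
  have E' := (one_eqs m).comp (mulR (Col.box m) S (one (Col.box m)))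
  obtain ⟨g, g₀, g₁⟩ := exists_incl_hom h S _ (E.incl_of_one h E')
  exact BoxHom.isotopy_of_loopFree₂ (B := S.Box)
    ⟨g, g₀, inclBoxes _ S, mulBoxesL _ S _,
      fun b => ⟨rfl, congrArg (fun h => Hom.comp h (S.inn b)) g₁⟩⟩
    (comp_isTangle (incl_isTangle h) fun _ => hS)
    (mulComp_isTangle (mul_isTangle (by omega) (by omega) (by omega)) hS (one_isTangle m))
    (inclComp_loopFree h fS.loopFree)
    (mulComp_loopFree_left (by omega) (by omega) (by omega) fS (one_loopFree _))

/-- An expectation is a product with vertical strands. -/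
theorem er_isotopy_mul_one {n : ℕ} {S : Diagram (Col.box (n + 1))} (hS : S.IsTangle)
    (fS : S.Full) : Nonempty (Isotopy ((er (Col.box (n + 1)) (Col.box n)).comp fun _ => S)
      (mulComp (Col.box n) S (one (Col.box (n + 1))))) := by
  have E := mulComp_eqs (e := n) (by omega) (by omega) (by omega) S (one (Col.box (n + 1)))
  have E' := (one_eqs (n + 1)).comp (mulR (Col.box n) S (one (Col.box (n + 1))))
  obtain ⟨g, g₀, g₁⟩ := exists_er_hom (by omega) S _ (E.er_of_one E')
  exact BoxHom.isotopy_of_loopFree₂ (B := S.Box)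
    ⟨g, g₀, erBoxes _ S, mulBoxesL _ S _,
      fun b => ⟨rfl, congrArg (fun h => Hom.comp h (S.inn b)) g₁⟩⟩
    (comp_isTangle (er_isTangle (by omega)) fun _ => hS)
    (mulComp_isTangle (mul_isTangle (by omega) (by omega) (by omega)) hS (one_isTangle _))
    ((er_full (by omega)).comp fun _ => fS).loopFree
    (mulComp_loopFree_left (by omega) (by omega) (by omega) fS (one_loopFree _))

/-- Expectations compose. -/
theorem er_er_isotopy {d c b : ℕ} (hb : b ≤ c) (hc : c ≤ d) {S : Diagram (Col.box d)}
    (hS : S.IsTangle) (fS : S.Full) :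
    Nonempty (Isotopy ((er (Col.box d) (Col.box b)).comp fun _ => S)
      ((er (Col.box c) (Col.box b)).comp fun _ => (er (Col.box d) (Col.box c)).comp fun _ => S)) := by
  have E := erComp_eqs hb ((er (Col.box d) (Col.box c)).comp fun _ => S)
  have E' := (erComp_eqs hc S).comp (compR (er (Col.box c) (Col.box b))
    (fun _ => (er (Col.box d) (Col.box c)).comp fun _ => S) (0 : Fin 1))
  obtain ⟨g, g₀, g₁⟩ := exists_er_hom (by omega) S
    ((compR (er (Col.box c) (Col.box b)) (fun _ => (er (Col.box d) (Col.box c)).comp fun _ => S)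
      (0 : Fin 1)).comp (compR (er (Col.box d) (Col.box c)) (fun _ => S) (0 : Fin 1)))
    (E.trans hb hc E')
  exact BoxHom.isotopy_of_loopFree₂ (B := S.Box)
    ⟨g, g₀, erBoxes _ S, (erBoxes _ S).trans (erBoxes _ _),
      fun b => ⟨rfl, congrArg (fun h => Hom.comp h (S.inn b)) g₁⟩⟩
    (comp_isTangle (er_isTangle (by omega)) fun _ => hS)
    (comp_isTangle (er_isTangle hb) fun _ => comp_isTangle (er_isTangle hc) fun _ => hS)
    ((er_full (by omega)).comp fun _ => fS).loopFree
    ((er_full hb).comp fun _ => (er_full hc).comp fun _ => fS).loopFree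

/-- Vertical strands added to a factor on its right can be absorbed by the product. -/
theorem mul_incl_isotopy {k n : ℕ} (hk : 1 ≤ k) (hn : k ≤ n) {Z : Diagram (Col.box (k - 1))}
    {S : Diagram (Col.box n)} (hZ : Z.IsTangle) (hS : S.IsTangle) (fZ : Z.Full) (fS : S.Full) :
    Nonempty (Isotopy (mulComp (Col.box n) Z S)
      (mulComp (Col.box n) ((incl (Col.box (k - 1)) (Col.box k)).comp fun _ => Z) S)) := by
  have E := mulComp_eqs (e := n) (by omega) (by omega) (by omega)
    ((incl (Col.box (k - 1)) (Col.box k)).comp fun _ => Z) S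
  have E' := (inclComp_eqs (by omega : k - 1 ≤ k) Z).comp
    (mulL (Col.box n) ((incl (Col.box (k - 1)) (Col.box k)).comp fun _ => Z) S)
  obtain ⟨g, g₀, g₁, g₂⟩ := exists_mul_hom Z S
    ((mulL (Col.box n) ((incl (Col.box (k - 1)) (Col.box k)).comp fun _ => Z) S).comp
      (compR (incl (Col.box (k - 1)) (Col.box k)) (fun _ => Z) (0 : Fin 1))) _
    (E.of_incl hk hn E')
  refine BoxHom.isotopy_of_loopFree₂ (B := Z.Box ⊕ₗ S.Box)
    ⟨g, g₀, mulBoxes _ Z S,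
      (OrderIso.sumLexCongr (inclBoxes _ Z) (OrderIso.refl _)).trans (mulBoxes _ _ S), ?_⟩
    (mulComp_isTangle (mul_isTangle (by omega) (by omega) (by omega)) hZ hS)
    (mulComp_isTangle (mul_isTangle (by omega) (by omega) (by omega))
      (comp_isTangle (incl_isTangle (by omega)) fun _ => hZ) hS)
    (mulComp_full (by omega) (by omega) (by omega) fZ fS).loopFree
    (mulComp_loopFree_right (by omega) (by omega) (by omega)
      (inclComp_loopFree (by omega) fZ.loopFree) fS)
  rintro (b | b)
  · exact ⟨rfl, congrArg (fun h => Hom.comp h (Z.inn b)) g₁⟩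
  · exact ⟨rfl, congrArg (fun h => Hom.comp h (S.inn b)) g₂⟩

/-- Vertical strands at the right of a product of `k`-boxes that are joined by `k - 1` strands can
be moved between the factors. -/
theorem incl_mul_isotopy {k n : ℕ} (hk : 1 ≤ k) (hn : k + 1 ≤ n) {S T : Diagram (Col.box k)}
    (hS : S.IsTangle) (hT : T.IsTangle) (fS : S.Full) (fT : T.Full) :
    Nonempty (Isotopy
      ((incl (Col.box (k + 1)) (Col.box (n + 1))).comp fun _ => mulComp (Col.box (k + 1)) S T)
      (mulComp (Col.box (n + 1)) S (mulComp (Col.box n) (one (Col.box (n - 1))) T))) := by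
  have E := mulComp_eqs (e := n + 1) (by omega) (by omega) (by omega) S
    (mulComp (Col.box n) (one (Col.box (n - 1))) T)
  have E' := (mulComp_eqs (e := n) (by omega) (by omega) (by omega) (one (Col.box (n - 1))) T).comp
    (mulR (Col.box (n + 1)) S (mulComp (Col.box n) (one (Col.box (n - 1))) T))
  have E'' := ((one_eqs (n - 1)).comp (mulL (Col.box n) (one (Col.box (n - 1))) T)).comp
    (mulR (Col.box (n + 1)) S (mulComp (Col.box n) (one (Col.box (n - 1))) T))
  obtain ⟨f, E₁, f₁, f₂⟩ := exists_mulComp_hom (k + 1) (by omega) (by omega) (by omega) S T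
    (mulL (Col.box (n + 1)) S (mulComp (Col.box n) (one (Col.box (n - 1))) T))
    ((mulR (Col.box (n + 1)) S (mulComp (Col.box n) (one (Col.box (n - 1))) T)).comp
      (mulR (Col.box n) (one (Col.box (n - 1))) T))
    (fun i hi hi' => E.stretch_joined hk hn E' E'' i (by omega) hi')
    (E.rg₁.symm.trans (E.rg₂.trans E'.rg₂))
  obtain ⟨g, g₀, g₁⟩ := exists_incl_hom (by omega) _ f (E.stretch hk hn E' E'' E₁)
  refine BoxHom.isotopy_of_loopFree₂ (B := S.Box ⊕ₗ T.Box)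
    ⟨g, g₀, (mulBoxes _ S T).trans (inclBoxes _ _),
      (OrderIso.sumLexCongr (OrderIso.refl _) (mulBoxesR _ _ T)).trans (mulBoxes _ S _), ?_⟩
    (comp_isTangle (incl_isTangle (by omega)) fun _ =>
      mulComp_isTangle (mul_isTangle (by omega) (by omega) (by omega)) hS hT)
    (mulComp_isTangle (mul_isTangle (by omega) (by omega) (by omega)) hS
      (mulComp_isTangle (mul_isTangle (by omega) (by omega) (by omega)) (one_isTangle _) hT))
    (inclComp_loopFree (by omega)
      (mulComp_full (by omega) (by omega) (by omega) fS fT).loopFree)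
    (mulComp_loopFree_left (by omega) (by omega) (by omega) fS
      (mulComp_loopFree_right (by omega) (by omega) (by omega) (one_loopFree _) fT))
  rintro (b | b)
  · exact ⟨rfl, congrArg (fun h => Hom.comp h (S.inn b)) (g₁ ▸ f₁)⟩
  · exact ⟨rfl, congrArg (fun h => Hom.comp h (T.inn b)) (g₁ ▸ f₂)⟩

end Diagram

end Skein

namespace Skein

open Net

namespace Diagram

section

variable {N : Net}

/-! ### Further isotopies -/

theorem GenEqs.through {n i : ℕ} {o : Hom (boundary (Col.box n)) N} (E : GenEqs n i o)
    {j j' : ℕ} (hj : j + j' + 1 = 2 * n)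
    (h : (j < i ∨ i + 2 ≤ j) ∧ (j' < i ∨ i + 2 ≤ j')) : o.st j = o.st j' := by
  rcases lt_or_ge j n with h' | h'
  · exact (E.thru j h' (by omega) (by omega)).trans (congrArg _ (by omega))
  · exact ((E.thru j' (by omega) (by omega) (by omega)).trans (congrArg _ (by omega))).symm

theorem ShiftEqs.st {n : ℕ} {o : Hom (boundary (Col.box (n + 2))) N}
    {h : Hom (boundary (Col.box n)) N} (E : ShiftEqs n o h) {i j : ℕ}
    (hi : j = i + 2 ∧ i < 2 * n) : o.st j = h.st i := by
  have := E.box i hi.2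
  rwa [show 2 + i = j by omega] at this

theorem ElEqs.st {n : ℕ} {o : Hom (boundary (Col.box n)) N}
    {h : Hom (boundary (Col.box n)) N} (E : ElEqs n o h) {i : ℕ} (hi : 1 ≤ i)
    (hi' : i + 1 < 2 * n) : o.st i = h.st i := by
  have := E.box (i - 1) (by omega)
  rwa [show 1 + (i - 1) = i by omega] at this

/-! #### Sliding an expectation through a product -/

theorem MulEqs.slide_joined {n : ℕ} {o : Hom (boundary (Col.box n)) N}
    {w x j : Hom (boundary (Col.box (n + 1))) N} {z : Hom (boundary (Col.box n)) N}
    (E : ErEqs (n + 1) n o w) (E' : MulEqs (n + 1) (n + 1) (n + 1) w x j)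
    (E'' : InclEqs n (n + 1) j z) : x.st n = x.st (n + 1) := by
  have e' := E'.st (by omega) (by omega)
  have h := E.joined (i := n) (j := n + 1) (by omega)
  rw [e' _ (by omega), e' _ (by omega), if_pos (by omega), if_neg (by omega)] at h
  refine h.trans ((E''.joined (j := n) (by omega)).trans ?_)
  exact (E'.joined (by omega) (by omega)).symm

/-- The equations behind `mul_er_isotopy`. -/
theorem MulEqs.slide {n : ℕ} {o e : Hom (boundary (Col.box n)) N}
    {w x j : Hom (boundary (Col.box (n + 1))) N} {z : Hom (boundary (Col.box n)) N}
    (E : ErEqs (n + 1) n o w) (E' : MulEqs (n + 1) (n + 1) (n + 1) w x j)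
    (E'' : InclEqs n (n + 1) j z) (F : ErEqs (n + 1) n e x) : MulEqs n n n o e z := by
  have h := E.st (by omega)
  have h' := E'.st (by omega) (by omega)
  have h'' := E''.st (by omega)
  have f := F.st (by omega)
  refine ⟨?_, ?_, ?_, (E.rg.trans E'.rg₁).trans F.rg.symm, (E.rg.trans E'.rg₂).trans E''.rg⟩
  · intro i hi
    rw [h _ (by omega), if_pos (by omega), h' _ (by omega), if_pos (by omega), f _ (by omega),
      if_pos (by omega)]
  · intro i hi
    rw [f _ (by omega), if_neg (by omega), h'' _ (by omega), if_pos (by omega)]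
    exact E'.joined (by omega) (by omega)
  · intro i hi
    rw [h _ (by omega), if_neg (by omega), h' _ (by omega), if_neg (by omega), h'' _ (by omega),
      if_neg (by omega)]
    exact congrArg _ (by omega)

end

section Covered

variable {c : Col} {Y : Diagram c}

/-- All strands of a part of a diagram end at a marked point of the diagram. -/
def Covered {d : Col} {D : Diagram d} (f : Hom D.net Y.net) : Prop := ∀ x, Y.IsArc (f.strand x)

/-- All strands along a boundary end at a marked point of the diagram. -/
def CoveredAt {d : Col} (o : Hom (boundary d) Y.net) : Prop := ∀ p x, o.st p = some x → Y.IsArc x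

theorem coveredAt_out : CoveredAt Y.out := fun _ _ h => isArc_out_st h

theorem CoveredAt.of_eq {d d' : Col} {o : Hom (boundary d) Y.net} {o' : Hom (boundary d') Y.net}
    (h : CoveredAt o') {p q : ℕ} (e : o.st p = o'.st q) {x : Y.net.Strand} (hx : o.st p = some x) :
    Y.IsArc x := h q x (e.symm.trans hx)

theorem Covered.out {d : Col} {D : Diagram d} {f : Hom D.net Y.net} (h : Covered f) :
    CoveredAt (f.comp D.out) := by
  intro p x hx
  rw [Hom.st_comp] at hx
  obtain ⟨y, -, rfl⟩ := Option.map_eq_some_iff.1 hx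
  exact h y

theorem LoopFree.covered {d : Col} {D : Diagram d} (hD : D.LoopFree) (f : Hom D.net Y.net)
    (h : CoveredAt (f.comp D.out)) (h' : ∀ i p, Y.IsArc (f.strand ((D.inn i).strand p))) :
    Covered f := by
  intro y
  obtain ⟨p | ⟨j, p⟩, rfl⟩ := hD y
  · exact h p.val _ (Hom.st_of_lt _ p.isLt)
  · exact h' j p

theorem LoopFree.covered_of_isEmpty {d : Col} {D : Diagram d} [IsEmpty D.Box] (hD : D.LoopFree)
    (f : Hom D.net Y.net) (h : CoveredAt (f.comp D.out)) : Covered f :=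
  hD.covered f h (fun i => isEmptyElim i)

/-- The strands of a composite are covered if those of the parts and of the external boundary are. -/
theorem Covered.comp {d : Col} {W : Diagram d} {S : ∀ i : W.Box, Diagram (W.boxCol i)}
    (hW : W.LoopFree) (f : Hom (W.comp S).net Y.net) (h : CoveredAt (f.comp (W.comp S).out))
    (hS : ∀ i, Covered (f.comp (compR W S i))) : Covered f := by
  intro x
  rcases comp_strand_cases W S x with ⟨y, rfl⟩ | ⟨i, y, rfl⟩
  · obtain ⟨p | ⟨i, p⟩, rfl⟩ := hW y
    · exact h p.val _ (Hom.st_of_lt _ p.isLt)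
    · have := hS i ((S i).out.strand p)
      exact (compL_inn_strand W S i p).symm ▸ this
  · exact hS i y

theorem Covered.comp_of_full {d : Col} {W : Diagram d} {S : ∀ i : W.Box, Diagram (W.boxCol i)}
    (hW : W.Full) (f : Hom (W.comp S).net Y.net)
    (hS : ∀ i, Covered (f.comp (compR W S i))) : Covered f := by
  intro x
  rcases comp_strand_cases W S x with ⟨y, rfl⟩ | ⟨i, y, rfl⟩
  · obtain ⟨i, p, rfl⟩ := hW y
    have := hS i ((S i).out.strand p)
    exact (compL_inn_strand W S i p).symm ▸ this
  · exact hS i y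

theorem Covered.mulComp {a b e : ℕ} (ha : a ≤ b + e) (hb : b ≤ a + e) (he : e ≤ a + b)
    {S : Diagram (Col.box a)} {T : Diagram (Col.box b)}
    {f : Hom (mulComp (Col.box e) S T).net Y.net} (hS : Covered (f.comp (mulL (Col.box e) S T)))
    (hT : Covered (f.comp (mulR (Col.box e) S T))) : Covered f := by
  refine Covered.comp_of_full (W := mul (Col.box a) (Col.box b) (Col.box e)) (S := factors S T)
    (mul_full ha hb he) (show Hom ((mul (Col.box a) (Col.box b) (Col.box e)).comp
      (factors S T)).net Y.net from f) ?_
  intro i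
  have hi : ∀ i : Fin 2, i = 0 ∨ i = 1 := by decide
  rcases hi i with rfl | rfl
  · exact hS
  · exact hT

theorem Covered.er {d e : ℕ} (h : e ≤ d) {S : Diagram (Col.box d)}
    {f : Hom ((Diagram.er (Col.box d) (Col.box e)).comp fun _ => S).net Y.net}
    (hS : Covered (f.comp (compR (Diagram.er (Col.box d) (Col.box e)) (fun _ => S) (0 : Fin 1)))) :
    Covered f := by
  refine Covered.comp_of_full (S := fun _ => S) (er_full h) f ?_
  intro i
  have hi : ∀ i : Fin 1, i = 0 := fun i => Subsingleton.elim _ _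
  obtain rfl := hi i
  exact hS

theorem Covered.draw₁ {c d : Col} {J A : Set ((ℕ × ℕ) × (ℕ × ℕ))} {S : Diagram d}
    {f : Hom ((draw c (fun _ : Fin 1 => d) J A).comp fun _ => S).net Y.net}
    (hf : CoveredAt (f.comp ((draw c (fun _ : Fin 1 => d) J A).comp fun _ => S).out))
    (hS : Covered (f.comp (compR (draw c (fun _ : Fin 1 => d) J A) (fun _ => S) (0 : Fin 1)))) :
    Covered f := by
  refine Covered.comp draw_loopFree f hf ?_
  intro i
  have hi : ∀ i : Fin 1, i = 0 := fun i => Subsingleton.elim _ _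
  obtain rfl := hi i
  exact hS

theorem Covered.loopFree (h : Covered (Y := Y) (Hom.id Y.net)) : Y.LoopFree := h

end Covered

/-- An expectation slides through a product: `E(S) T = E(S I(T))`, where `I(T)` is `T` with one more
vertical strand. -/
theorem mul_er_isotopy {n : ℕ} {S : Diagram (Col.box (n + 1))} {T : Diagram (Col.box n)}
    (hS : S.IsTangle) (hT : T.IsTangle) (fS : S.Full) (fT : T.Full) :
    Nonempty (Isotopy
      (mulComp (Col.box n) ((er (Col.box (n + 1)) (Col.box n)).comp fun _ => S) T)
      ((er (Col.box (n + 1)) (Col.box n)).comp fun _ => mulComp (Col.box (n + 1)) S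
        ((incl (Col.box n) (Col.box (n + 1))).comp fun _ => T))) := by
  set IT := (incl (Col.box n) (Col.box (n + 1))).comp fun _ => T with hIT
  set P := mulComp (Col.box (n + 1)) S IT with hP
  set Y := (er (Col.box (n + 1)) (Col.box n)).comp fun _ => P with hY
  let p : Hom P.net Y.net := compR (er (Col.box (n + 1)) (Col.box n)) (fun _ => P) (0 : Fin 1)
  let s : Hom S.net Y.net := p.comp (mulL _ S IT)
  let j : Hom IT.net Y.net := p.comp (mulR _ S IT)
  let t : Hom T.net Y.net := j.comp (compR (incl (Col.box n) (Col.box (n + 1))) (fun _ => T) (0 : Fin 1))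
  have E : ErEqs (n + 1) n Y.out (p.comp P.out) := erComp_eqs (by omega) P
  have E' : MulEqs (n + 1) (n + 1) (n + 1) (p.comp P.out) (s.comp S.out) (j.comp IT.out) :=
    (mulComp_eqs (by omega) (by omega) (by omega) S IT).comp p
  have E'' : InclEqs n (n + 1) (j.comp IT.out) (t.comp T.out) := (inclComp_eqs (by omega) T).comp j
  obtain ⟨f, E₁, f₁⟩ := exists_erComp_hom n (by omega) S s (by
    intro i hi hi'
    obtain rfl : i = n := by omega
    exact (E'.slide_joined E E'').trans (congrArg _ (by omega)))
  obtain ⟨g, g₀, g₁, g₂⟩ := exists_mul_hom _ T f t (E'.slide E E'' E₁)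
  refine BoxHom.isotopy_of_loopFree₂ (B := S.Box ⊕ₗ T.Box)
    ⟨g, g₀, (OrderIso.sumLexCongr (erBoxes _ S) (OrderIso.refl _)).trans (mulBoxes _ _ T),
      ((OrderIso.sumLexCongr (OrderIso.refl _) (inclBoxes _ T)).trans (mulBoxes _ S _)).trans
        (erBoxes _ _), ?_⟩
    (mulComp_isTangle (mul_isTangle (by omega) (by omega) (by omega))
      (comp_isTangle (er_isTangle (by omega)) fun _ => hS) hT)
    (comp_isTangle (er_isTangle (by omega)) fun _ =>
      mulComp_isTangle (mul_isTangle (by omega) (by omega) (by omega)) hS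
        (comp_isTangle (incl_isTangle (by omega)) fun _ => hT))
    (mulComp_full (by omega) (by omega) (by omega) ((er_full (by omega)).comp fun _ => fS)
      fT).loopFree ?_
  · rintro (b | b)
    · exact ⟨rfl, congrArg (fun h => Hom.comp h (S.inn b)) (g₁ ▸ f₁)⟩
    · exact ⟨rfl, congrArg (fun h => Hom.comp h (T.inn b)) g₂⟩
  · have cs : Covered s := full_inn fS s fun b =>
      ⟨erBoxes _ _ (mulBoxes _ S _ (toLex (Sum.inl b))), rfl, rfl⟩
    have ct : Covered t := full_inn fT t fun b =>
      ⟨erBoxes _ _ (mulBoxes _ S _ (toLex (Sum.inr (inclBoxes _ T b)))), rfl, rfl⟩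
    refine Covered.loopFree (Covered.er (by omega) (Covered.mulComp (by omega) (by omega) (by omega) cs
      (Covered.draw₁ (f := j) ?_ ct)))
    intro i x hx
    have hi : i < 2 * (n + 1) := Hom.lt_of_st hx
    rcases lt_or_ge i n with h | h
    · exact ct.out.of_eq (E''.left i h) hx
    rcases lt_or_ge (n + 1) i with h' | h'
    · exact ct.out.of_eq ((congrArg _ (by omega)).trans (E''.right (i - n - 2) (by omega))) hx
    have hj := (E'.joined (i := n + 1) (j := n) (by omega) (by omega)).symm
    rcases (show i = n ∨ i = n + 1 by omega) with rfl | rfl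
    · exact cs.out.of_eq hj hx
    · exact cs.out.of_eq ((E''.joined (by omega)).trans hj) hx

end Diagram

end Skein

namespace Skein

open Net

namespace Diagram

/-! ### Diagrams without internal boxes -/

section

variable {c : Col}

/-- The jump of a function on the regions at a marked point, read along the boundary. -/
theorem jump {N : Net} (o : Hom (boundary c) N) {f : N.Strand → ZMod 2} {g : N.Region → ZMod 2}
    (hg : ∀ x, f x = g (N.white x) + g (N.black x)) {i : ℕ} (hi : i < 2 * c.size) :
    f (o.strand ⟨i, hi⟩) = g (o.rg i) + g (o.rg (i + 1)) := by
  have hs := Hom.st_of_lt o hi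
  rw [hg, Hom.white_of_st hs, Hom.black_of_st hs]
  split_ifs
  · rfl
  · exact add_comm _ _

/-- In the absence of boxes, every marked point is joined to another one, of opposite parity. -/
theorem IsTangle.exists_mate {Q : Diagram c} [IsEmpty Q.Box] (hQ : Q.IsTangle) {i : ℕ}
    (hi : i < 2 * c.size) :
    ∃ j < 2 * c.size, Q.out.st i = Q.out.st j ∧ i % 2 ≠ j % 2 := by
  have key := hQ.start_iff_end (Q.out.strand ⟨i, hi⟩)
  rcases Nat.mod_two_eq_zero_or_one i with h | h
  · obtain ⟨p | ⟨a, -⟩, hp, hp'⟩ := key.1 ⟨Sum.inl ⟨i, hi⟩, h, rfl⟩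
    · refine ⟨p.val, p.isLt, ?_, fun e => hp (e.symm.trans h)⟩
      rw [Hom.st_of_lt _ hi, Hom.st_of_lt _ p.isLt]
      exact congrArg some hp'.symm
    · exact isEmptyElim a
  · obtain ⟨p | ⟨a, -⟩, hp, hp'⟩ := key.2 ⟨Sum.inl ⟨i, hi⟩,
      fun e : i % 2 = 0 => by omega, rfl⟩
    · refine ⟨p.val, p.isLt, ?_, fun e => ?_⟩
      · rw [Hom.st_of_lt _ hi, Hom.st_of_lt _ p.isLt]
        exact congrArg some hp'.symm
      · have : p.val % 2 = 0 := hp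
        omega
    · exact isEmptyElim a

theorem IsTangle.eq_of_st_eq {Q : Diagram c} (hQ : Q.IsTangle) {i j : ℕ} (hi : i < 2 * c.size)
    (h : Q.out.st i = Q.out.st j) (hp : i % 2 = j % 2) : i = j := by
  have hj : j < 2 * c.size := Hom.lt_of_st (h.symm.trans (Hom.st_of_lt _ hi))
  rw [Hom.st_of_lt _ hi, Hom.st_of_lt _ hj] at h
  have h' := Option.some.inj h
  rcases Nat.mod_two_eq_zero_or_one i with e | e
  · have := hQ.start_inj (Sum.inl ⟨i, hi⟩) (Sum.inl ⟨j, hj⟩) e (hp.symm.trans e) h'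
    exact congrArg Fin.val (Sum.inl.inj this)
  · have := hQ.end_inj (Sum.inl ⟨i, hi⟩) (Sum.inl ⟨j, hj⟩) (fun e' : i % 2 = 0 => by omega)
      (fun e' : j % 2 = 0 => by omega) h'
    exact congrArg Fin.val (Sum.inl.inj this)

/-- If marked points that are joined in `Q` are joined in `Y`, then the converse holds. -/
theorem IsTangle.matching_symm {Q Y : Diagram c} [IsEmpty Q.Box] (hQ : Q.IsTangle)
    (hY : Y.IsTangle)
    (h : ∀ i j, Q.out.st i = Q.out.st j → Y.out.st i = Y.out.st j) {i j : ℕ}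
    (hi : i < 2 * c.size) (hj : j < 2 * c.size)
    (e : Y.out.st i = Y.out.st j) : Q.out.st i = Q.out.st j := by
  by_cases hij : i % 2 = j % 2
  · rw [hY.eq_of_st_eq hi e hij]
  obtain ⟨m, hm, e', hp⟩ := hQ.exists_mate hi
  have := hY.eq_of_st_eq hj (e.symm.trans (h _ _ e')) (by omega)
  rw [this, e']

/-- The diagram without closed loops in which the same points are joined as in `Q`. -/
def matchingDraw (Q : Diagram c) : Diagram c :=
  draw c (b := 0) Fin.elim0 {e | ∃ p q, e = ((0, p), (0, q)) ∧ p % 2 = 0 ∧ q % 2 = 1 ∧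
    p < 2 * c.size ∧ q < 2 * c.size ∧ Q.out.st p = Q.out.st q} ∅

/-- Planarity is inherited from `Q`: the partial sums required by `draw_isTangle` are the values on the
boundary of a function on the regions of `Q`. -/
theorem matchingDraw_isTangle {Q : Diagram c} [IsEmpty Q.Box] (hQ : Q.IsTangle) :
    (matchingDraw Q).IsTangle := by
  classical
  have hm : ∀ i, ∃ j, i < 2 * c.size →
      j < 2 * c.size ∧ Q.out.st i = Q.out.st j ∧ i % 2 ≠ j % 2 := by
    intro i
    by_cases hi : i < 2 * c.size
    · obtain ⟨j, h⟩ := hQ.exists_mate hi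
      exact ⟨j, fun _ => h⟩
    · exact ⟨0, fun h => absurd h hi⟩
  choose m hm using hm
  refine draw_isTangle (fun x => (0, m x.2)) ?_ ?_ (fun g hg i => i.elim0) ?_
  · rintro _ _ ⟨p, q, h, hp, hq, hp', hq', e⟩ - -
    obtain ⟨rfl, rfl⟩ := Prod.mk.inj h
    obtain ⟨h₁, h₂, h₃⟩ := hm p hp'
    obtain ⟨h₄, h₅, h₆⟩ := hm q hq'
    have h₇ : m p = q := hQ.eq_of_st_eq h₁ (h₂.symm.trans e) (by omega)
    have h₈ : m q = p := hQ.eq_of_st_eq h₄ (h₅.symm.trans e.symm) (by omega)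
    refine ⟨congrArg (Prod.mk 0) h₇, congrArg (Prod.mk 0) h₈, ?_⟩
    simp only [StartsAt, true_iff]
    omega
  · rintro ⟨_ | x, p⟩ h
    · obtain ⟨h₁, h₂, h₃⟩ := hm p h
      refine ⟨h₁, ?_⟩
      rcases Nat.mod_two_eq_zero_or_one p with e | e
      · exact Or.inl ⟨p, m p, rfl, e, by omega, h, h₁, h₂⟩
      · exact Or.inr ⟨m p, p, rfl, by omega, e, h₁, h, h₂.symm⟩
    · simp only [sz, not_lt_zero, dite_false] at h
  · intro F hF₁ hF₂
    have hF : ∀ p q, p < 2 * c.size → q < 2 * c.size → Q.out.st p = Q.out.st q → F 0 p = F 0 q := by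
      intro p q hp hq e
      by_cases hpq : p % 2 = q % 2
      · rw [hQ.eq_of_st_eq hp e hpq]
      rcases Nat.mod_two_eq_zero_or_one p with h | h
      · exact hF₁ (0, p) (0, q) ⟨p, q, rfl, h, by omega, hp, hq, e⟩ hp hq
      · exact (hF₁ (0, q) (0, p) ⟨q, p, rfl, by omega, h, hq, hp, e.symm⟩ hq hp).symm
    have hf : ∀ x : Q.net.Strand, ∃ a : ZMod 2, ∀ p, Q.out.st p = some x → a = F 0 p := by
      intro x
      by_cases hx : ∃ p, Q.out.st p = some x
      · obtain ⟨p, hp⟩ := hx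
        exact ⟨F 0 p, fun q hq => hF p q (Hom.lt_of_st hp) (Hom.lt_of_st hq) (hp.trans hq.symm)⟩
      · exact ⟨0, fun p hp => absurd ⟨p, hp⟩ hx⟩
    choose f hf using hf
    have hf' : ∀ p : Fin (2 * c.size), f (Q.out.strand p) = F 0 p.val :=
      fun p => hf _ _ (Hom.st_of_lt _ p.isLt)
    obtain ⟨g, hg⟩ := hQ.jordan f (by
      simp only [hf']
      rw [Fin.sum_univ_eq_sum_range (F 0)]
      exact hF₂ 0) (fun i => isEmptyElim i)
    have hs : ∀ j ≤ 2 * c.size, ∑ i ∈ Finset.range j, F 0 i = g (Q.out.rg 0) + g (Q.out.rg j) := by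
      intro j
      induction j with
      | zero => exact fun _ => (CharTwo.add_self_eq_zero _).symm
      | succ j ih =>
        intro hj
        rw [Finset.sum_range_succ, ih (by omega), ← hf' ⟨j, hj⟩, jump Q.out hg]
        have : ∀ a b d : ZMod 2, a + b + (b + d) = a + d := by decide
        exact this _ _ _
    refine ⟨0, ?_, fun x y h => h.elim⟩
    rintro _ _ ⟨p, q, h, hp, hq, hp', hq', e⟩ - -
    obtain ⟨rfl, rfl⟩ := Prod.mk.inj h
    rw [if_neg (by show ¬ p % 2 = q % 2; omega)]
    show 0 + _ = 0 + _
    rw [zero_add, zero_add, hs _ hp'.le, hs _ hq']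
    rw [(Hom.rg_of_st_eq' e hp' (by omega)).1]

/-- A diagram without boxes and closed loops is determined by which marked points are joined. -/
theorem matchingDraw_isotopy {Q Y : Diagram c} [IsEmpty Q.Box] [IsEmpty Y.Box] (hQ : Q.IsTangle)
    (hY : Y.IsTangle) (lY : Y.LoopFree)
    (h : ∀ i j, Q.out.st i = Q.out.st j → Y.out.st i = Y.out.st j) :
    Nonempty (Isotopy (matchingDraw Q) Y) := by
  obtain ⟨f, f₀, -⟩ := exists_draw_hom (c := c) (b := 0) (col := Fin.elim0)
    (J := {e | ∃ p q, e = ((0, p), (0, q)) ∧ p % 2 = 0 ∧ q % 2 = 1 ∧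
    p < 2 * c.size ∧ q < 2 * c.size ∧ Q.out.st p = Q.out.st q}) (A := ∅) Y.out
    (fun i => i.elim0) (by
      rintro _ ⟨p, q, rfl, -, -, -, -, e⟩
      exact h p q e) (fun e he => he.elim)
  exact BoxHom.isotopy_of_loopFree₂ (B := Fin 0)
    ⟨f, f₀, OrderIso.refl _, ⟨Equiv.equivOfIsEmpty _ _, fun {a} => a.elim0⟩, fun b => b.elim0⟩
    (matchingDraw_isTangle hQ) hY draw_loopFree lY

end

/-! ### Closed loops -/

section

variable {c : Col} {Q : Diagram c}

/-- The strand `x` is a closed loop, and the region `r` on one of its sides meets no other strand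
and is not at the boundary. -/
structure IsLeaf (Q : Diagram c) (x : Q.net.Strand) (r : Q.net.Region) : Prop where
  not_arc : ¬ Q.IsArc x
  side : Q.net.white x = r ∨ Q.net.black x = r
  white : ∀ y, Q.net.white y = r → y = x
  black : ∀ y, Q.net.black y = r → y = x
  out : ∀ s, Q.out.region s ≠ r

/-- An innermost closed loop bounds a region that meets nothing else. -/
theorem IsTangle.exists_leaf [IsEmpty Q.Box] (hQ : Q.IsTangle) (h : ¬ Q.LoopFree) :
    ∃ x r, IsLeaf Q x r := by
  classical
  have hg : ∀ x : {x // ¬ Q.IsArc x}, ∃ g : Q.net.Region → ZMod 2,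
      ∀ y, (if y = x.val then (1 : ZMod 2) else 0) = g (Q.net.white y) + g (Q.net.black y) := by
    intro x
    refine hQ.jordan (fun y => if y = x.val then (1 : ZMod 2) else 0) ?_ (fun i => isEmptyElim i)
    refine Finset.sum_eq_zero fun p _ => if_neg fun e => x.2 ⟨Sum.inl p, e⟩
  choose g hg using hg
  have two : ∀ {a b : ZMod 2}, 0 = a + b → a = b := by decide
  have one_ne : ∀ {a b : ZMod 2}, 1 = a + b → a ≠ b := by decide
  have alt : ∀ {a b d : ZMod 2}, a ≠ b → a ≠ d → b = d := by decide
  have same : ∀ x : {x // ¬ Q.IsArc x}, ∀ y, y ≠ x.val →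
      g x (Q.net.white y) = g x (Q.net.black y) := fun x y hy =>
    two ((if_neg hy).symm.trans (hg x y))
  have diff : ∀ x : {x // ¬ Q.IsArc x}, g x (Q.net.white x.val) ≠ g x (Q.net.black x.val) :=
    fun x => one_ne ((if_pos rfl).symm.trans (hg x x.val))
  have outer : ∀ x : {x // ¬ Q.IsArc x}, ∀ s, g x (Q.out.region s) = g x (Q.out.rg 0) := by
    intro x s
    obtain ⟨j, hj, -, e⟩ := Q.out.exists_rg s
    rw [e]
    exact Q.out.const_of_no_jump (g x) (fun p => same x _ fun e => x.2 ⟨Sum.inl p, e⟩) j hj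
  let I : {x // ¬ Q.IsArc x} → Set Q.net.Region := fun x => {r | g x r ≠ g x (Q.out.rg 0)}
  obtain ⟨x₀, hx₀⟩ := not_forall.1 h
  have : Nonempty {x // ¬ Q.IsArc x} := ⟨⟨x₀, hx₀⟩⟩
  -- `I x` is the interior of the loop `x`; a loop with the smallest interior is innermost.
  obtain ⟨x, hx⟩ := Finite.exists_min fun x => (I x).ncard
  -- no strand lies inside the loop `x`
  have empty : ∀ y, y ≠ x.val → Q.net.white y ∉ I x := by
    intro y hy hw
    have hb : Q.net.black y ∈ I x := by
      show g x _ ≠ _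
      rw [← same x y hy]
      exact hw
    have hya : ¬ Q.IsArc y := by
      rintro ⟨p | ⟨i, -⟩, rfl⟩
      · refine hw ?_
        exact (congrArg (g x) (Q.out.white_strand p)).trans (outer x _)
      · exact isEmptyElim i
    let y' : {x // ¬ Q.IsArc x} := ⟨y, hya⟩
    -- The loop `y` does not separate regions outside `x`, so its interior would be smaller.
    have key := hQ.connected (fun r => if r ∈ I x then 0 else g y' r + g y' (Q.net.white x.val)) (by
      intro z
      by_cases hz : z = x.val
      · subst hz
        have e := same y' x.val (Ne.symm hy)
        have h0 := CharTwo.add_self_eq_zero (g y' (Q.net.white x.val))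
        simp only [← e, h0, ite_self]
      · have e : Q.net.white z ∈ I x ↔ Q.net.black z ∈ I x := by
          show g x _ ≠ _ ↔ g x _ ≠ _
          rw [same x z hz]
        by_cases hzI : Q.net.white z ∈ I x
        · simp only [if_pos hzI, if_pos (e.1 hzI)]
        · have hzy : z ≠ y := fun e' => hzI (e' ▸ hw)
          simp only [if_neg hzI, if_neg (fun h' => hzI (e.2 h')), same y' z hzy])
    have const : ∀ r, r ∉ I x → g y' r = g y' (Q.net.white x.val) := by
      intro r hr
      have := key (Q.net.white y) r
      simp only [if_pos hw, if_neg hr] at this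
      exact two this
    have h0 : Q.out.rg 0 ∉ I x := fun h => h rfl
    have sub : I y' ⊆ I x := by
      intro r hr
      by_contra hr'
      exact hr ((const r hr').trans (const _ h0).symm)
    have hlt : (I y').ncard < (I x).ncard := by
      refine Set.ncard_lt_ncard ⟨sub, fun hsup => ?_⟩ (Set.toFinite _)
      exact diff y' (alt (hsup hw).symm (hsup hb).symm)
    exact absurd (hx y') (not_le.2 hlt)
  have empty' : ∀ y, y ≠ x.val → Q.net.black y ∉ I x := by
    intro y hy hb
    refine empty y hy ?_
    show g x _ ≠ _
    rw [same x y hy]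
    exact hb
  have hr : ∃ r ∈ I x, Q.net.white x.val = r ∨ Q.net.black x.val = r := by
    by_cases hw : Q.net.white x.val ∈ I x
    · exact ⟨_, hw, Or.inl rfl⟩
    · refine ⟨_, ?_, Or.inr rfl⟩
      have hw' : g x (Q.net.white x.val) = g x (Q.out.rg 0) := not_not.1 hw
      exact fun hb => diff x (hw'.trans hb.symm)
  obtain ⟨r, hrI, hr⟩ := hr
  exact ⟨x.val, r, x.2, hr, fun y e => by_contra fun hy => empty y hy (e ▸ hrI),
    fun y e => by_contra fun hy => empty' y hy (e ▸ hrI), fun s e => hrI (e ▸ outer x s)⟩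

end

end Diagram

end Skein

namespace Skein

open Net

namespace Diagram

section

variable {c : Col} {Q : Diagram c} {x : Q.net.Strand} {r : Q.net.Region}

/-- The colour of a box without marked points in a white or in a black region. -/
def emptyCol : Bool → Col
  | false => Col.box 0
  | true => Col.zeroMinus

/-- The colour of a box in the region on the other side of a closed loop around `r`. -/
def leafCol (Q : Diagram c) (r : Q.net.Region) : Col := emptyCol (!Q.net.shaded r)

theorem leafCol_size (Q : Diagram c) (r : Q.net.Region) : (leafCol Q r).size = 0 := by
  unfold leafCol
  cases Q.net.shaded r <;> rfl

theorem emptyCol_segShaded : ∀ (b : Bool) (s : Fin (emptyCol b).segs),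
    (emptyCol b).segShaded s = b
  | false, s => by
    have : s.val = 0 := Nat.lt_one_iff.1 s.isLt
    show decide (s.val % 2 = 1) = false
    rw [this]
    rfl
  | true, _ => rfl

theorem leafCol_segShaded (Q : Diagram c) (r : Q.net.Region) (s : Fin (leafCol Q r).segs) :
    (leafCol Q r).segShaded s = !Q.net.shaded r := emptyCol_segShaded _ s

theorem not_lt_leafCol_size {p : ℕ} : ¬ p < 2 * (leafCol Q r).size := by
  rw [leafCol_size]
  omega

/-- The region on the other side of a closed loop around `r`. -/
def outside (Q : Diagram c) (x : Q.net.Strand) (r : Q.net.Region) : Q.net.Region :=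
  if Q.net.shaded r then Q.net.white x else Q.net.black x

theorem outside_shaded (Q : Diagram c) (x : Q.net.Strand) (r : Q.net.Region) :
    Q.net.shaded (outside Q x r) = !Q.net.shaded r := by
  unfold outside
  split_ifs with h
  · rw [Q.net.shaded_white, h]; rfl
  · rw [Q.net.shaded_black, Bool.eq_false_iff.2 h]; rfl

theorem outside_ne (Q : Diagram c) (x : Q.net.Strand) (r : Q.net.Region) : outside Q x r ≠ r := by
  intro e
  have := outside_shaded Q x r
  rw [e] at this
  simp at this

theorem outside_eq (Q : Diagram c) (x : Q.net.Strand) (r : Q.net.Region) :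
    outside Q x r = if (!Q.net.shaded r) then Q.net.black x else Q.net.white x := by
  unfold outside
  cases Q.net.shaded r <;> rfl

/-- The diagram in which the closed loop around the region `r` is replaced by a box without
marked points. -/
def openLeaf (h : IsLeaf Q x r) : Diagram c where
  Box := Unit
  boxOrder := inferInstance
  boxFinite := inferInstance
  boxCol _ := leafCol Q r
  net :=
    { Strand := {y // y ≠ x}
      Region := {s // s ≠ r}
      finStrand := inferInstance
      finRegion := inferInstance
      shaded := fun s => Q.net.shaded s.1
      white := fun y => ⟨Q.net.white y.1, fun e => y.2 (h.white _ e)⟩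
      black := fun y => ⟨Q.net.black y.1, fun e => y.2 (h.black _ e)⟩
      shaded_white := fun y => Q.net.shaded_white y.1
      shaded_black := fun y => Q.net.shaded_black y.1 }
  out :=
    { strand := fun p => ⟨Q.out.strand p, fun e => h.not_arc ⟨Sum.inl p, e⟩⟩
      region := fun s => ⟨Q.out.region s, h.out s⟩
      shaded_region := fun s => Q.out.shaded_region s
      white_strand := fun p => Subtype.ext (Q.out.white_strand p)
      black_strand := fun p => Subtype.ext (Q.out.black_strand p) }
  inn _ :=
    { strand := fun p => absurd p.isLt not_lt_leafCol_size
      region := fun _ => ⟨outside Q x r, outside_ne Q x r⟩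
      shaded_region := fun s => (outside_shaded Q x r).trans (leafCol_segShaded Q r s).symm
      white_strand := fun p => absurd p.isLt not_lt_leafCol_size
      black_strand := fun p => absurd p.isLt not_lt_leafCol_size }

/-- The embedding into the original diagram of the diagram without the loop. -/
def openLeafHom (h : IsLeaf Q x r) : Hom (openLeaf h).net Q.net where
  strand y := y.1
  region s := s.1
  shaded_region _ := rfl
  white_strand _ := rfl
  black_strand _ := rfl

theorem openLeaf_isTangle [IsEmpty Q.Box] (hQ : Q.IsTangle) (h : IsLeaf Q x r) :
    (openLeaf h).IsTangle := by
  classical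
  have inl : ∀ p : (openLeaf h).Mark, ∃ q, p = Sum.inl q := by
    rintro (p | ⟨i, p⟩)
    · exact ⟨p, rfl⟩
    · exact absurd p.isLt not_lt_leafCol_size
  constructor
  · intro p q hp hq e
    obtain ⟨p, rfl⟩ := inl p
    obtain ⟨q, rfl⟩ := inl q
    exact congrArg _ (Sum.inl.inj (hQ.start_inj (Sum.inl p) (Sum.inl q) hp hq
      (congrArg Subtype.val e)))
  · intro p q hp hq e
    obtain ⟨p, rfl⟩ := inl p
    obtain ⟨q, rfl⟩ := inl q
    exact congrArg _ (Sum.inl.inj (hQ.end_inj (Sum.inl p) (Sum.inl q) hp hq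
      (congrArg Subtype.val e)))
  · intro y
    have key := hQ.start_iff_end y.1
    constructor
    · rintro ⟨p, hp, e⟩
      obtain ⟨p, rfl⟩ := inl p
      obtain ⟨q | ⟨i, -⟩, hq, e'⟩ := key.1 ⟨Sum.inl p, hp, congrArg Subtype.val e⟩
      · exact ⟨Sum.inl q, hq, Subtype.ext e'⟩
      · exact isEmptyElim i
    · rintro ⟨p, hp, e⟩
      obtain ⟨p, rfl⟩ := inl p
      obtain ⟨q | ⟨i, -⟩, hq, e'⟩ := key.2 ⟨Sum.inl p, hp, congrArg Subtype.val e⟩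
      · exact ⟨Sum.inl q, hq, Subtype.ext e'⟩
      · exact isEmptyElim i
  · intro g hg s t
    let o : (openLeaf h).net.Region := ⟨outside Q x r, outside_ne Q x r⟩
    let g' : Q.net.Region → ZMod 2 := fun s => if hs : s = r then g o else g ⟨s, hs⟩
    have hg' : ∀ s : (openLeaf h).net.Region, g' s.1 = g s := fun s => dif_neg s.2
    have hr : g' r = g o := dif_pos rfl
    have := hQ.connected g' (by
      intro y
      by_cases hy : y = x
      · subst hy
        have ho := hg' o
        have hout : outside Q y r = Q.net.white y ∨ outside Q y r = Q.net.black y := by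
          unfold outside
          split_ifs
          · exact Or.inl rfl
          · exact Or.inr rfl
        have ne := outside_ne Q y r
        have e : ∀ s, s = r ∨ s = outside Q y r → g' s = g o := by
          rintro s (rfl | rfl)
          · exact hr
          · exact ho
        have wb := white_ne_black Q.net y
        rcases h.side with e₁ | e₁ <;> rcases hout with e₂ | e₂
        · exact absurd (e₂.trans e₁) ne
        · rw [e _ (Or.inl e₁), e _ (Or.inr e₂.symm)]
        · rw [e _ (Or.inl e₁), e _ (Or.inr e₂.symm)]
        · exact absurd (e₂.trans e₁) ne
      · have := hg ⟨y, hy⟩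
        rw [← hg', ← hg'] at this
        exact this) s.1 t.1
    rwa [hg', hg'] at this
  · intro f hf _
    obtain ⟨g, hg⟩ := hQ.jordan (fun y => if hy : y = x then 0 else f ⟨y, hy⟩) (by
      refine Eq.trans (Finset.sum_congr rfl fun p _ => ?_) hf
      exact dif_neg fun e => h.not_arc ⟨Sum.inl p, e⟩) (fun i => isEmptyElim i)
    refine ⟨fun s => g s.1, fun y => ?_⟩
    have := hg y.1
    rw [dif_neg y.2] at this
    exact this

/-- Substituting a closed loop into the new box gives the original diagram back. -/
theorem openLeaf_comp_loop_isotopy [IsEmpty Q.Box] (hQ : Q.IsTangle) (h : IsLeaf Q x r)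
    (hl : (loop (leafCol Q r) (leafCol_size Q r)).IsTangle) :
    Nonempty (Isotopy ((openLeaf h).comp fun _ => loop (leafCol Q r) (leafCol_size Q r)) Q) := by
  let L := loop (leafCol Q r) (leafCol_size Q r)
  let l : Hom L.net Q.net :=
    { strand := fun _ => x
      region := fun b : Bool => if b then Q.net.black x else Q.net.white x
      shaded_region := by
        rintro (_ | _)
        · exact Q.net.shaded_white x
        · exact Q.net.shaded_black x
      white_strand := fun _ => rfl
      black_strand := fun _ => rfl }
  obtain ⟨f, f₁, f₂⟩ := exists_comp_hom (openLeaf h) (fun _ => L) (openLeafHom h) (fun _ => l) (by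
    intro i
    refine Hom.ext (fun p => absurd p.isLt not_lt_leafCol_size) fun s => ?_
    show outside Q x r = if (leafCol Q r).segShaded s then Q.net.black x else Q.net.white x
    rw [outside_eq]
    exact congrArg (fun b : Bool => if b then Q.net.black x else Q.net.white x)
      (leafCol_segShaded Q r s).symm)
  have hL : ∀ y, f.strand ((compL (openLeaf h) fun _ => L).strand y) = y.1 := fun y =>
    congrArg (fun k : Hom (openLeaf h).net Q.net => k.strand y) f₁
  have hR : ∀ i y, f.strand ((compR (openLeaf h) (fun _ => L) i).strand y) = x := fun i y =>
    congrArg (fun k : Hom L.net Q.net => k.strand y) (f₂ i)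
  have : IsEmpty (Σₗ _ : Unit, Fin 0) := ⟨fun b => (ofLex b).2.elim0⟩
  refine BoxHom.isotopy (B := Fin 0) ⟨f, ?_, ⟨Equiv.equivOfIsEmpty (Fin 0) (Σₗ _ : Unit, Fin 0),
      fun {a} => a.elim0⟩, ⟨Equiv.equivOfIsEmpty _ _, fun {a} => a.elim0⟩, fun b => b.elim0⟩
    (comp_isTangle (openLeaf_isTangle hQ h) fun _ => hl) hQ ⟨?_, ?_⟩
  · exact (congrArg (fun k : Hom (openLeaf h).net Q.net => k.comp (openLeaf h).out) f₁)
  · intro a b e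
    rcases comp_strand_cases (openLeaf h) (fun _ => L) a with ⟨y, rfl⟩ | ⟨i, y, rfl⟩ <;>
      rcases comp_strand_cases (openLeaf h) (fun _ => L) b with ⟨z, rfl⟩ | ⟨j, z, rfl⟩
    · exact congrArg _ (Subtype.ext ((hL y).symm.trans (e.trans (hL z))))
    · exact absurd ((hL y).symm.trans (e.trans (hR j z))) y.2
    · exact absurd ((hL z).symm.trans (e.symm.trans (hR i y))) z.2
    · rfl
  · intro y
    by_cases hy : y = x
    · exact ⟨(compR (openLeaf h) (fun _ => L) ()).strand (), (hR () ()).trans hy.symm⟩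
    · exact ⟨(compL (openLeaf h) fun _ => L).strand ⟨y, hy⟩, hL _⟩

/-- Removing the closed loop reduces the number of strands. -/
theorem card_openLeaf_comp_one (h : IsLeaf Q x r) :
    Nat.card ((openLeaf h).comp fun _ => one (leafCol Q r)).net.Strand < Nat.card Q.net.Strand := by
  refine lt_of_le_of_lt (Nat.card_le_card_of_surjective
    (compL (openLeaf h) fun _ => one (leafCol Q r)).strand ?_)
    (Finite.card_subtype_lt (p := fun y => y ≠ x) (x := x) (not_not.2 rfl))
  intro a
  rcases comp_strand_cases (openLeaf h) (fun _ => one (leafCol Q r)) a with ⟨y, rfl⟩ | ⟨i, y, rfl⟩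
  · exact ⟨y, rfl⟩
  · obtain ⟨p | ⟨j, -⟩, -⟩ := draw_strand_cases y
    · exact absurd p.isLt not_lt_leafCol_size
    · exact j.elim0

theorem openLeaf_comp_matching (h : IsLeaf Q x r) {i j : ℕ} (e : Q.out.st i = Q.out.st j) :
    ((openLeaf h).comp fun _ => one (leafCol Q r)).out.st i =
      ((openLeaf h).comp fun _ => one (leafCol Q r)).out.st j := by
  have : (openLeaf h).out.st i = (openLeaf h).out.st j := by
    have e' : (((openLeafHom h).comp (openLeaf h).out).st i) =
      (((openLeafHom h).comp (openLeaf h).out).st j) := e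
    rw [Hom.st_comp, Hom.st_comp] at e'
    exact Option.map_injective (fun a b => Subtype.ext) e'
  exact st_comp_eq (compL (openLeaf h) fun _ => one (leafCol Q r)) this

end

theorem loop_isTangle (c : Col) (hc : c.size = 0) : (loop c hc).IsTangle := by
  have hm : ∀ p : (loop c hc).Mark, False := by
    rintro (p | ⟨i, -⟩)
    · have := p.isLt
      omega
    · exact i.elim0
  refine ⟨fun p => (hm p).elim, fun p => (hm p).elim,
    fun x => ⟨fun ⟨p, _⟩ => (hm p).elim, fun ⟨p, _⟩ => (hm p).elim⟩, ?_, ?_⟩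
  · intro g hg
    have := hg ()
    rintro (_ | _) (_ | _)
    · rfl
    · exact this
    · exact this.symm
    · rfl
  · intro f _ _
    refine ⟨fun b : Bool => if b then f () else 0, fun x => ?_⟩
    exact (zero_add _).symm

theorem one_isTangle_of_size_eq_zero (c : Col) (hc : c.size = 0) : (one c).IsTangle := by
  have h : ∀ x : ℕ × ℕ, ¬ x.2 < sz c (b := 0) Fin.elim0 x.1 := by
    rintro ⟨_ | a, p⟩
    · simp [sz, hc]
    · simp [sz]
  exact draw_isTangle id (fun x _ _ hx => absurd hx (h x)) (fun x hx => absurd hx (h x))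
    (fun _ _ i => i.elim0) (fun F _ _ => ⟨0, fun x _ _ hx => absurd hx (h x),
      fun _ _ h => h.elim⟩)

instance {c d : Col} (S : Diagram c) [h : IsEmpty S.Box] :
    IsEmpty ((incl c d).comp fun _ => S).Box :=
  ⟨fun b => h.elim (ofLex b).2⟩

instance {c d : Col} (S : Diagram d) [h : IsEmpty S.Box] :
    IsEmpty ((er d c).comp fun _ => S).Box :=
  ⟨fun b => h.elim (ofLex b).2⟩

instance {c d e : Col} (S : Diagram c) (T : Diagram d) [IsEmpty S.Box] [IsEmpty T.Box] :
    IsEmpty (mulComp e S T).Box := by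
  refine ⟨fun b => ?_⟩
  rcases (mulBoxes e S T).symm b with b | b
  · exact isEmptyElim b
  · exact isEmptyElim b

end Diagram

/-! ### Consequences -/

open Diagram

section

variable {k : ℕ}

theorem Implies.trans {c : Col} {S T V : Diagram c} (h : Implies k S T) (h' : Implies k T V) :
    Implies k S V := Consequence.trans h h'

theorem implies_of_isotopy {c : Col} {S T : Diagram c} (hS : S.IsTangle)
    (h : Nonempty (Isotopy S T)) : Implies k S T := Consequence.refl hS h

theorem implies_of_isotopy_symm {c : Col} {S T : Diagram c} (hT : T.IsTangle)
    (h : Nonempty (Isotopy S T)) : Implies k T S := Consequence.refl hT (h.elim fun e => e.symm)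

theorem Implies.rfl {c : Col} {S : Diagram c} (hS : S.IsTangle) : Implies k S S :=
  implies_of_isotopy hS ⟨⟨OrderIso.refl _, fun _ => Eq.refl _, Equiv.refl _, Equiv.refl _,
    fun _ => Eq.refl _, fun _ => Eq.refl _, fun _ => Eq.refl _, fun _ => Eq.refl _,
    fun _ => Eq.refl _, fun _ _ => Eq.refl _, fun _ _ => Eq.refl _⟩⟩

/-- Closed loops can be removed and inserted. -/
theorem exists_loopFree {c : Col} (Q : Diagram c) [hb : IsEmpty Q.Box] (hQ : Q.IsTangle) :
    ∃ Q' : Diagram c, IsEmpty Q'.Box ∧ Q'.IsTangle ∧ Q'.LoopFree ∧ Implies k Q Q' ∧ Implies k Q' Q ∧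
      ∀ i j, Q.out.st i = Q.out.st j → Q'.out.st i = Q'.out.st j := by
  by_cases hl : Q.LoopFree
  · exact ⟨Q, hb, hQ, hl, Implies.rfl hQ, Implies.rfl hQ, fun _ _ h => h⟩
  obtain ⟨x, r, h⟩ := hQ.exists_leaf hl
  have hc := leafCol_size Q r
  have tL := loop_isTangle _ hc
  have tO := one_isTangle_of_size_eq_zero _ hc
  have tW := openLeaf_isTangle hQ h
  have iso := openLeaf_comp_loop_isotopy hQ h tL
  have _hb : IsEmpty ((openLeaf h).comp fun _ => one (leafCol Q r)).Box :=
    ⟨fun b => (show Fin 0 from (ofLex b).2).elim0⟩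
  have _hlt := card_openLeaf_comp_one h
  obtain ⟨Q', h₁, h₂, h₃, h₄, h₅, h₆⟩ := exists_loopFree
    ((openLeaf h).comp fun _ => one (leafCol Q r)) (comp_isTangle tW fun _ => tO)
  refine ⟨Q', h₁, h₂, h₃, ?_, ?_, fun i j e => h₆ i j (openLeaf_comp_matching h e)⟩
  · refine ((implies_of_isotopy_symm hQ iso).trans ?_).trans h₄
    exact Consequence.comp _ tW _ _ fun i => Consequence.of (Basic.modulus _ hc)
  · refine h₅.trans (Implies.trans ?_ (implies_of_isotopy (comp_isTangle tW fun _ => tL) iso))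
    exact Consequence.comp _ tW _ _ fun i => Consequence.of (Basic.modulus' _ hc)
termination_by Nat.card Q.net.Strand

/-- Up to the modulus templates, a Temperley–Lieb tangle is determined by which points
it joins. -/
theorem implies_of_matching {c : Col} {Q Y : Diagram c} [IsEmpty Q.Box] [IsEmpty Y.Box]
    (hQ : Q.IsTangle) (hY : Y.IsTangle)
    (h : ∀ i j, Q.out.st i = Q.out.st j → Y.out.st i = Y.out.st j) : Implies k Q Y := by
  obtain ⟨Q', _, h₂, h₃, h₄, -, h₆⟩ := exists_loopFree (k := k) Q hQ
  obtain ⟨Y', _, h₂', h₃', -, h₅', h₆'⟩ := exists_loopFree (k := k) Y hY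
  have iso := matchingDraw_isotopy hQ h₂ h₃ h₆
  have iso' := matchingDraw_isotopy hQ h₂' h₃' fun i j e => h₆' i j (h i j e)
  exact ((h₄.trans (implies_of_isotopy_symm h₂ iso)).trans
    (implies_of_isotopy (matchingDraw_isTangle hQ) iso')).trans h₅'

end

end Skein

namespace Skein

open Net

namespace Diagram

section

variable {N : Net}

/-! ### Isotopies for shifts and left expectations -/

theorem MulEqs.shift_joined {a b e : ℕ} (ha : a ≤ b + e) (hb : b ≤ a + e)
    {o : Hom (boundary (Col.box (e + 2))) N} {u : Hom (boundary (Col.box (a + 2))) N}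
    {v : Hom (boundary (Col.box (b + 2))) N} {s : Hom (boundary (Col.box a)) N}
    {t : Hom (boundary (Col.box b)) N} (E : MulEqs (a + 2) (b + 2) (e + 2) o u v)
    (U : ShiftEqs a u s) (V : ShiftEqs b v t) (i : ℕ) (hi : a + e ≤ i + b) (hi' : i < 2 * a) :
    s.st i = t.st (2 * a - 1 - i) :=
  ((U.st (j := i + 2) (by omega)).symm.trans (E.joined (j := 2 * a + 1 - i) (by omega)
    (by omega))).trans (V.st (by omega))

theorem MulEqs.shift_fst {a b e : ℕ} (hb : b ≤ a + e) (he : e ≤ a + b)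
    {o : Hom (boundary (Col.box (e + 2))) N} {u : Hom (boundary (Col.box (a + 2))) N}
    {v : Hom (boundary (Col.box (b + 2))) N} {s : Hom (boundary (Col.box a)) N}
    (E : MulEqs (a + 2) (b + 2) (e + 2) o u v) (U : ShiftEqs a u s) :
    u.st 0 = v.st 0 ∧ u.st 1 = v.st 1 :=
  ⟨U.fst.trans (E.joined (by omega) (by omega)), U.snd.trans (E.joined (by omega) (by omega))⟩

theorem MulEqs.shift_rg {a b e : ℕ} (hb : b ≤ a + e) (he : e ≤ a + b)
    {o : Hom (boundary (Col.box (e + 2))) N} {u : Hom (boundary (Col.box (a + 2))) N}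
    {v : Hom (boundary (Col.box (b + 2))) N} {s : Hom (boundary (Col.box a)) N}
    {t : Hom (boundary (Col.box b)) N} (E : MulEqs (a + 2) (b + 2) (e + 2) o u v)
    (U : ShiftEqs a u s) (V : ShiftEqs b v t) : s.rg 0 = t.rg 0 :=
  U.rg.symm.trans ((Hom.rg_of_st_eq (E.shift_fst hb he U).2
    (show 1 < 2 * (a + 2) by omega) rfl).2.trans V.rg)

/-- The equations behind `shift_mul_isotopy`. -/
theorem MulEqs.shift {a b e : ℕ} (ha : a ≤ b + e) (hb : b ≤ a + e) (he : e ≤ a + b)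
    {o : Hom (boundary (Col.box (e + 2))) N} {u : Hom (boundary (Col.box (a + 2))) N}
    {v : Hom (boundary (Col.box (b + 2))) N} {s : Hom (boundary (Col.box a)) N}
    {t : Hom (boundary (Col.box b)) N} {m : Hom (boundary (Col.box e)) N}
    (E : MulEqs (a + 2) (b + 2) (e + 2) o u v)
    (U : ShiftEqs a u s) (V : ShiftEqs b v t) (F : MulEqs a b e m s t) : ShiftEqs e o m := by
  have h := E.st (by omega) (by omega)
  have f := F.st (by omega) (by omega)
  obtain ⟨e₀, e₁⟩ := E.shift_fst hb he U
  have h₀ := E.st_left 0 (by omega)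
  have h₁ := E.st_left 1 (by omega)
  refine ⟨?_, ?_, ?_, ?_⟩
  · rw [h₀, e₀, V.fst, h _ (by omega), if_neg (by omega)]
    exact congrArg _ (by omega)
  · rw [h₁, e₁, V.snd, h _ (by omega), if_neg (by omega)]
    exact congrArg _ (by omega)
  · intro i hi
    rw [h _ (by omega), f _ (by omega)]
    split_ifs
    · exact U.st (by omega)
    · omega
    · omega
    · exact V.st (by omega)
  · exact (Hom.rg_of_st_eq h₁ (show 1 < 2 * (e + 2) by omega) rfl).2.trans (U.rg.trans F.rg₁.symm)

/-- The equations behind `el_er_isotopy`. -/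
theorem ElEqs.slide {n : ℕ} (hn : 1 ≤ n) {o : Hom (boundary (Col.box n)) N}
    {g y : Hom (boundary (Col.box (n + 1))) N} {e : Hom (boundary (Col.box n)) N}
    (E : ErEqs (n + 1) n o g) (F : ElEqs (n + 1) g y) (E' : ErEqs (n + 1) n e y) :
    ElEqs n o e := by
  have h := E.st (by omega)
  have f := E'.st (by omega)
  have h₀ := F.outer
  have h₁ := F.inner
  refine ⟨?_, ?_, ?_, ?_⟩
  · rw [h 0 (by omega), h _ (by omega), if_pos (by omega), if_neg (by omega), h₀]
    exact congrArg _ (by omega)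
  · rw [f 0 (by omega), f _ (by omega), if_pos (by omega), if_neg (by omega), h₁]
    exact congrArg _ (by omega)
  · intro i hi
    rw [h _ (by omega), f _ (by omega)]
    split_ifs
    · exact F.st (by omega) (by omega)
    · exact F.st (by omega) (by omega)
  · exact (Hom.rg_of_st_eq (E.left 0 (by omega)) (show 0 < 2 * n by omega) rfl).2.trans
      (F.rg.trans (Hom.rg_of_st_eq (E'.left 0 (by omega)) (show 0 < 2 * n by omega) rfl).2.symm)

/-- The strands of the product of `SH_n^{n+2}` with two diagrams without boxes that yields
the left expectation. -/
theorem ElEqs.of_shift {n : ℕ} (hn : 1 ≤ n) {o x : Hom (boundary (Col.box n)) N}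
    {w p : Hom (boundary (Col.box (n + 1))) N} {q h : Hom (boundary (Col.box (n + 2))) N}
    (E : MulEqs (n + 1) (n + 1) n o w p) (E' : MulEqs (n + 2) (n + 2) (n + 1) w q h)
    (H : ShiftEqs n h x) (Q : ArcRightEqs (n + 2) q) (P : ArcLeftEqs (n + 1) p) :
    ElEqs n o x := by
  have q_thru : ∀ i j, i + j = 2 * n + 1 → 1 ≤ i → i ≤ n → q.st i = q.st j := fun i j hij hi hi' =>
    (congrArg _ (by omega)).trans ((Q.thru (i - 1) (by omega)).trans (congrArg _ (by omega)))
  have p_thru : ∀ i j, i + j = 2 * n + 3 → 3 ≤ j → j ≤ n + 1 → p.st i = p.st j :=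
    fun i j hij hi hi' =>
    ((congrArg _ (by omega)).trans ((P.thru (j - 3) (by omega)).trans (congrArg _ (by omega)))).symm
  have o_left : ∀ i < n, o.st i = w.st i := fun i hi => E.st_left i (by omega)
  have o_right : ∀ i < n, o.st (n + i) = p.st (n + 2 + i) := fun i hi =>
    (E.st_right (by omega) (by omega) _ (by omega) (by omega)).trans (congrArg _ (by omega))
  have w_p : ∀ i j, i + j = 2 * n + 1 → n ≤ i → w.st i = p.st j := fun i j hij hi =>
    E.joined (by omega) (by omega)
  have w_q : ∀ i < n + 1, w.st i = q.st i := fun i hi => E'.st_left i (by omega)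
  have q_h : ∀ i j, i + j = 2 * n + 3 → n + 1 ≤ i → q.st i = h.st j := fun i j hij hi =>
    E'.joined (by omega) (by omega)
  have w_h : ∀ i, n + 1 ≤ i → i < 2 * n + 2 → w.st i = h.st (i + 2) := fun i hi hi' =>
    (E'.st_right (by omega) (by omega) _ (by omega) (by omega)).trans (congrArg _ (by omega))
  have h_x : ∀ i < 2 * n, h.st (i + 2) = x.st i := fun i hi => H.st (by omega)
  have q_outer : q.st 0 = q.st (2 * n + 3) := Q.outer
  have q_arc : q.st (2 * n + 1) = q.st (2 * n + 2) := Q.arc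
  have p_outer : p.st 0 = p.st (2 * n + 1) := P.outer
  have h_fst : h.st 0 = h.st (2 * n + 3) := H.fst
  have h_snd : h.st 1 = h.st (2 * n + 2) := H.snd
  have oh : o.st 0 = h.st 0 := (o_left 0 (by omega)).trans ((w_q 0 (by omega)).trans
    (q_outer.trans (q_h _ 0 (by omega) (by omega))))
  have xh : x.st 0 = h.st 1 := (h_x 0 (by omega)).symm.trans ((q_h (2 * n + 1) 2 (by omega)
    (by omega)).symm.trans (q_arc.trans (q_h _ _ (by omega) (by omega))))
  refine ⟨?_, ?_, ?_, ?_⟩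
  · refine oh.trans (h_fst.trans ((w_h (2 * n + 1) (by omega) (by omega)).symm.trans
      ((w_p _ 0 (by omega) (by omega)).trans (p_outer.trans ?_))))
    exact ((congrArg _ (by omega)).trans ((o_right (n - 1) (by omega)).trans
      (congrArg _ (by omega)))).symm
  · refine xh.trans (h_snd.trans ((w_h (2 * n) (by omega) (by omega)).symm.trans
      ((w_p _ 1 (by omega) (by omega)).trans (P.arc.trans ((w_p (2 * n - 1) 2 (by omega)
      (by omega)).symm.trans ?_)))))
    rcases Nat.lt_or_ge 1 n with h1 | h1
    · exact (w_h _ (by omega) (by omega)).trans (h_x _ (by omega))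
    · refine (w_q _ (by omega)).trans ((q_thru _ 2 (by omega) (by omega) (by omega)).trans
        ((q_h _ 3 (by omega) (by omega)).trans ((h_x 1 (by omega)).trans (congrArg _ (by omega)))))
  · intro i hi
    have wx : ∀ j, 1 ≤ j → j + 1 < 2 * n → w.st j = x.st j := by
      intro j hj hj'
      rcases Nat.lt_or_ge n j with h1 | h1
      · exact (w_h j (by omega) (by omega)).trans (h_x j (by omega))
      · exact (w_q j (by omega)).trans ((q_thru j (2 * n + 1 - j) (by omega) hj h1).trans
          ((q_h _ (j + 2) (by omega) (by omega)).trans (h_x j (by omega))))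
    rcases Nat.lt_or_ge (1 + i) n with h1 | h1
    · exact (o_left _ h1).trans (wx _ (by omega) (by omega))
    · refine (congrArg _ (by omega)).trans ((o_right (1 + i - n) (by omega)).trans
        ((p_thru _ (2 * n - i) (by omega) (by omega) (by omega)).trans
        ((w_p (1 + i) _ (by omega) (by omega)).symm.trans (wx _ (by omega) (by omega)))))
  · exact (Hom.rg_of_st_eq oh (show 0 < 2 * n by omega) rfl).2.trans
      (Hom.rg_of_st_eq' xh (show 0 < 2 * n by omega) (by omega)).2.symm

/-- Pulling an expectation through the two generators of its basic construction. -/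
structure BasicConstruction (n : ℕ) (o : Hom (boundary (Col.box (n + 1))) N)
    (w a j b : Hom (boundary (Col.box (n + 2))) N) (z : Hom (boundary (Col.box (n + 2))) N)
    (y : Hom (boundary (Col.box (n + 1))) N) : Prop where
  er : ErEqs (n + 2) (n + 1) o w
  mul : MulEqs (n + 2) (n + 2) (n + 2) w a j
  mul' : MulEqs (n + 2) (n + 2) (n + 2) j z b
  incl : InclEqs (n + 1) (n + 2) z y
  gen : GenEqs (n + 2) n a
  gen' : GenEqs (n + 2) n b

theorem BasicConstruction.joined {n : ℕ} {o : Hom (boundary (Col.box (n + 1))) N}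
    {w a j b : Hom (boundary (Col.box (n + 2))) N} {z : Hom (boundary (Col.box (n + 2))) N}
    {y : Hom (boundary (Col.box (n + 1))) N} (E : BasicConstruction n o w a j b z y) :
    z.st (n + 1) = y.st n ∧ z.st (n + 1) = y.st (n + 1) := by
  have zy : z.st n = y.st n := E.incl.left n (by omega)
  have zy' : z.st (n + 3) = y.st (n + 1) := (congrArg _ (by omega)).trans (E.incl.right 0 (by omega))
  have jz : ∀ i < n + 2, j.st i = z.st i := fun i hi => E.mul'.st_left i (by omega)
  have zb : ∀ i i', i + i' = 2 * n + 3 → n + 2 ≤ i → z.st i = b.st i' := fun i i' h h' =>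
    E.mul'.joined (by omega) (by omega)
  have aj : ∀ i i', i + i' = 2 * n + 3 → n + 2 ≤ i → a.st i = j.st i' := fun i i' h h' =>
    E.mul.joined (by omega) (by omega)
  have cup : a.st (n + 2) = a.st (n + 3) :=
    (congrArg _ (by omega)).trans (E.gen.cup.trans (congrArg _ (by omega)))
  refine ⟨?_, ?_⟩
  · exact (jz _ (by omega)).symm.trans ((aj (n + 2) _ (by omega) (by omega)).symm.trans
      (cup.trans ((aj _ n (by omega) (by omega)).trans ((jz _ (by omega)).trans zy))))
  · exact (E.incl.joined (j := n + 2) (by omega)).trans ((zb _ (n + 1) (by omega) (by omega)).trans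
      (E.gen'.cap.symm.trans ((zb (n + 3) n (by omega) (by omega)).symm.trans zy')))

/-- The result is the inclusion of the expectation. -/
theorem BasicConstruction.inclEqs {n : ℕ} {o : Hom (boundary (Col.box (n + 1))) N}
    {w a j b : Hom (boundary (Col.box (n + 2))) N} {z : Hom (boundary (Col.box (n + 2))) N}
    {y : Hom (boundary (Col.box (n + 1))) N} (E : BasicConstruction n o w a j b z y)
    {e : Hom (boundary (Col.box n)) N} (F : ErEqs (n + 1) n e y) : InclEqs n (n + 1) o e := by
  have jz : ∀ i < n + 2, j.st i = z.st i := fun i hi => E.mul'.st_left i (by omega)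
  have jb : ∀ i, n + 2 ≤ i → i < 2 * n + 4 → j.st i = b.st i := fun i hi hi' =>
    (E.mul'.st_right (by omega) (by omega) i (by omega) (by omega)).trans (congrArg _ (by omega))
  have wj : ∀ i, n + 2 ≤ i → i < 2 * n + 4 → w.st i = j.st i := fun i hi hi' =>
    (E.mul.st_right (by omega) (by omega) i (by omega) (by omega)).trans (congrArg _ (by omega))
  have wa : ∀ i < n + 2, w.st i = a.st i := fun i hi => E.mul.st_left i (by omega)
  have aj : ∀ i i', i + i' = 2 * n + 3 → n + 2 ≤ i → a.st i = j.st i' := fun i i' h h' =>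
    E.mul.joined (by omega) (by omega)
  have zb : ∀ i i', i + i' = 2 * n + 3 → n + 2 ≤ i → z.st i = b.st i' := fun i i' h h' =>
    E.mul'.joined (by omega) (by omega)
  have ow : ∀ i, n + 1 ≤ i → i < 2 * n + 2 → o.st i = w.st (i + 2) := fun i hi hi' => by
    rw [E.er.st (by omega) _ (by omega), if_neg (by omega)]
    exact congrArg _ (by omega)
  have ey : ∀ i, n ≤ i → i < 2 * n → e.st i = y.st (i + 2) := fun i hi hi' => by
    rw [F.st (by omega) _ (by omega), if_neg (by omega)]
    exact congrArg _ (by omega)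
  refine ⟨?_, ?_, ?_, ?_⟩
  · intro i hi
    refine (E.er.left i (by omega)).trans ((wa i (by omega)).trans
      ((E.gen.through (j' := 2 * n + 3 - i) (by omega) (by omega)).trans
      ((aj _ i (by omega) (by omega)).trans ((jz i (by omega)).trans
      ((E.incl.left i (by omega)).trans (F.left i hi).symm)))))
  · intro i hi
    refine (ow _ (by omega) (by omega)).trans ((wj _ (by omega) (by omega)).trans
      ((jb _ (by omega) (by omega)).trans ((E.gen'.through (j' := n - 1 - i) (by omega)
      (by omega)).trans ((zb (n + 4 + i) _ (by omega) (by omega)).symm.trans ?_))))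
    refine Eq.trans ?_ (ey (n + i) (by omega) (by omega)).symm
    refine (congrArg _ (by omega)).trans ((E.incl.right (i + 1) (by omega)).trans
      (congrArg _ (by omega)))
  · intro i hi
    obtain rfl : i = 0 := by omega
    have cup : b.st (n + 2) = b.st (n + 3) :=
      (congrArg _ (by omega)).trans (E.gen'.cup.trans (congrArg _ (by omega)))
    refine (E.er.left n (by omega)).trans ((wa n (by omega)).trans (E.gen.cap.trans
      ((wa (n + 1) (by omega)).symm.trans ((E.er.joined (j := n + 2) (by omega)).trans
      ((wj _ (by omega) (by omega)).trans ((jb _ (by omega) (by omega)).trans (cup.trans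
      ((jb _ (by omega) (by omega)).symm.trans ((wj _ (by omega) (by omega)).symm.trans
      ?_)))))))))
    exact (ow (n + 1) (by omega) (by omega)).symm.trans (congrArg _ (by omega))
  · exact E.er.rg.trans (E.mul.rg₂.trans (E.mul'.rg₁.trans (E.incl.rg.trans F.rg.symm)))

end

/-- Substituting identity tangles changes nothing. -/
theorem comp_incl_isotopy {c : Col} {W : Diagram c} (hW : W.IsTangle) (lW : W.LoopFree)
    (h : ∀ i, (incl (W.boxCol i) (W.boxCol i)).IsTangle) :
    Nonempty (Isotopy (W.comp fun i => incl (W.boxCol i) (W.boxCol i)) W) := by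
  have hI : ∀ i, ∃ f : Hom (incl (W.boxCol i) (W.boxCol i)).net W.net,
      f.comp (incl (W.boxCol i) (W.boxCol i)).out = W.inn i ∧
      ∀ j : Fin 1, f.comp ((incl (W.boxCol i) (W.boxCol i)).inn j) = W.inn i := by
    intro i
    refine exists_draw_hom (col := fun _ : Fin 1 => W.boxCol i) (W.inn i) (fun _ => W.inn i) ?_ ?_
    · rintro ⟨⟨x, p⟩, ⟨y, q⟩⟩ (h | h)
      · rcases h with h | h <;> obtain ⟨rfl, rfl, h⟩ := mem_para.1 h
        · obtain rfl : p = q := by omega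
          rfl
        · obtain rfl : p = q := by omega
          rfl
      · have := (mem_anti.1 h).2.2
        omega
    · rintro _ rfl
      have : ¬ (W.boxCol i = Col.zeroMinus ∧ W.boxCol i ≠ Col.zeroMinus) := fun h => h.2 h.1
      rw [if_neg this]
      rfl
  choose f f₀ f₁ using hI
  obtain ⟨g, g₀, g₁⟩ := exists_comp_hom W (fun i => incl (W.boxCol i) (W.boxCol i)) (Hom.id _) f
    (fun i => (f₀ i).symm)
  refine BoxHom.isotopy_of_loopFree₂ (B := W.Box) ⟨g, congrArg (fun k => Hom.comp k W.out) g₀,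
      { toFun := fun i => toLex ⟨i, (0 : Fin 1)⟩
        invFun := fun b => (ofLex b).1
        left_inv := fun i => rfl
        right_inv := ?_
        map_rel_iff' := ?_ }, OrderIso.refl _, fun b => ⟨rfl, ?_⟩⟩
    (comp_isTangle hW h) hW (lW.comp fun i => ?_) lW
  · rintro ⟨i, j⟩
    have hj : ∀ j : Fin 1, j = 0 := fun j => Subsingleton.elim _ _
    obtain rfl := hj j
    rfl
  · intro a b
    show toLex (⟨a, (0 : Fin 1)⟩ : Σ _ : W.Box, Fin 1) ≤ toLex ⟨b, 0⟩ ↔ a ≤ b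
    rw [Sigma.Lex.le_def]
    constructor
    · rintro (h | ⟨h, -⟩)
      · exact le_of_lt h
      · exact le_of_eq h
    · intro h
      rcases lt_or_eq_of_le h with h | h
      · exact Or.inl h
      · exact Or.inr ⟨h, le_of_eq (Subsingleton.elim _ _)⟩
  · have : (g.comp (compR W (fun i => incl (W.boxCol i) (W.boxCol i)) b)).comp
        ((incl (W.boxCol b) (W.boxCol b)).inn (0 : Fin 1)) = W.inn b := by
      rw [g₁ b]
      exact f₁ b 0
    exact this
  · refine draw_full fun p hp => ⟨0, p, hp, ?_⟩
    rcases Nat.lt_or_ge p (W.boxCol i).size with h | h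
    · exact Or.inl (Or.inl (mem_para.2 ⟨rfl, rfl, by omega, by omega, by omega⟩))
    · exact Or.inl (Or.inr (mem_para.2 ⟨rfl, rfl, by omega, by omega, by omega⟩))

/-- The shift is multiplicative. -/
theorem shift_mul_isotopy {a b e : ℕ} (ha : a ≤ b + e) (hb : b ≤ a + e) (he : e ≤ a + b)
    {S : Diagram (Col.box a)} {T : Diagram (Col.box b)} (hS : S.IsTangle) (hT : T.IsTangle)
    (fS : S.Full) (fT : T.Full) :
    Nonempty (Isotopy ((shift e).comp fun _ => mulComp (Col.box e) S T)
      (mulComp (Col.box (e + 2)) ((shift a).comp fun _ => S) ((shift b).comp fun _ => T))) := by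
  set U := (shift a).comp fun _ => S with hU
  set V := (shift b).comp fun _ => T with hV
  set Y := mulComp (Col.box (e + 2)) U V with hY
  let u : Hom U.net Y.net := mulL _ U V
  let v : Hom V.net Y.net := mulR _ U V
  let s : Hom S.net Y.net := u.comp (compR (shift a) (fun _ => S) (0 : Fin 1))
  let t : Hom T.net Y.net := v.comp (compR (shift b) (fun _ => T) (0 : Fin 1))
  have E : MulEqs (a + 2) (b + 2) (e + 2) Y.out (u.comp U.out) (v.comp V.out) :=
    mulComp_eqs (by omega) (by omega) (by omega) U V
  have EU : ShiftEqs a (u.comp U.out) (s.comp S.out) := (shiftComp_eqs a S).comp u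
  have EV : ShiftEqs b (v.comp V.out) (t.comp T.out) := (shiftComp_eqs b T).comp v
  obtain ⟨f, F, f₁, f₂⟩ := exists_mulComp_hom e ha hb he S T s t (E.shift_joined ha hb EU EV)
    (E.shift_rg hb he EU EV)
  obtain ⟨g, g₀, g₁⟩ := exists_shift_hom _ f (E.shift ha hb he EU EV F)
  have cs : Covered s := full_inn fS s fun b =>
    ⟨mulBoxes _ U V (toLex (Sum.inl (shiftBoxes S b))), rfl, rfl⟩
  have ct : Covered t := full_inn fT t fun b =>
    ⟨mulBoxes _ U V (toLex (Sum.inr (shiftBoxes T b))), rfl, rfl⟩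
  obtain ⟨e₀, e₁⟩ := E.shift_fst hb he EU
  have cu : CoveredAt (u.comp U.out) := by
    intro i x hx
    have hi : i < 2 * (a + 2) := Hom.lt_of_st hx
    have c0 : ∀ y, (u.comp U.out).st 0 = some y → Y.IsArc y := fun y =>
      (coveredAt_out (Y := Y)).of_eq (E.st_left 0 (by omega)).symm
    have c1 : ∀ y, (u.comp U.out).st 1 = some y → Y.IsArc y := fun y =>
      (coveredAt_out (Y := Y)).of_eq (E.st_left 1 (by omega)).symm
    rcases (show i = 0 ∨ i = 1 ∨ i = 2 * a + 2 ∨ i = 2 * a + 3 ∨ (2 ≤ i ∧ i < 2 * a + 2) by omega)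
      with rfl | rfl | rfl | rfl | h
    · exact c0 x hx
    · exact c1 x hx
    · exact c1 x (EU.snd.trans hx)
    · exact c0 x (EU.fst.trans hx)
    · exact cs.out.of_eq (EU.st (i := i - 2) (by omega)) hx
  have cv : CoveredAt (v.comp V.out) := by
    intro i x hx
    have hi : i < 2 * (b + 2) := Hom.lt_of_st hx
    rcases (show i = 0 ∨ i = 1 ∨ i = 2 * b + 2 ∨ i = 2 * b + 3 ∨ (2 ≤ i ∧ i < 2 * b + 2) by omega)
      with rfl | rfl | rfl | rfl | h
    · exact cu 0 x (e₀.trans hx)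
    · exact cu 1 x (e₁.trans hx)
    · exact cu 1 x (e₁.trans (EV.snd.trans hx))
    · exact cu 0 x (e₀.trans (EV.fst.trans hx))
    · exact ct.out.of_eq (EV.st (i := i - 2) (by omega)) hx
  refine BoxHom.isotopy_of_loopFree₂ (B := S.Box ⊕ₗ T.Box)
    ⟨g, g₀, (mulBoxes _ S T).trans (shiftBoxes _),
      (OrderIso.sumLexCongr (shiftBoxes S) (shiftBoxes T)).trans (mulBoxes _ U V), ?_⟩
    (comp_isTangle (shift_isTangle e) fun _ => mulComp_isTangle (mul_isTangle ha hb he) hS hT)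
    (mulComp_isTangle (mul_isTangle (by omega) (by omega) (by omega))
      (comp_isTangle (shift_isTangle a) fun _ => hS)
      (comp_isTangle (shift_isTangle b) fun _ => hT))
    (draw_loopFree.comp fun _ => mulComp_full ha hb he fS fT)
    (Covered.loopFree (Covered.mulComp (by omega) (by omega) (by omega)
      (Covered.draw₁ (f := u) cu cs) (Covered.draw₁ (f := v) cv ct)))
  rintro (b | b)
  · exact ⟨rfl, congrArg (fun h => Hom.comp h (S.inn b)) (g₁ ▸ f₁)⟩
  · exact ⟨rfl, congrArg (fun h => Hom.comp h (T.inn b)) (g₁ ▸ f₂)⟩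

/-- The left expectation commutes with the expectation. -/
theorem el_er_isotopy {n : ℕ} (hn : 1 ≤ n) {S : Diagram (Col.box (n + 1))} (hS : S.IsTangle)
    (fS : S.Full) :
    Nonempty (Isotopy ((el n).comp fun _ => (er (Col.box (n + 1)) (Col.box n)).comp fun _ => S)
      ((er (Col.box (n + 1)) (Col.box n)).comp fun _ => (el (n + 1)).comp fun _ => S)) := by
  set G := (el (n + 1)).comp fun _ => S with hG
  set Y := (er (Col.box (n + 1)) (Col.box n)).comp fun _ => G with hY
  let g : Hom G.net Y.net := compR (er (Col.box (n + 1)) (Col.box n)) (fun _ => G) (0 : Fin 1)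
  let s : Hom S.net Y.net := g.comp (compR (el (n + 1)) (fun _ => S) (0 : Fin 1))
  have E : ErEqs (n + 1) n Y.out (g.comp G.out) := erComp_eqs (by omega) G
  have F : ElEqs (n + 1) (g.comp G.out) (s.comp S.out) := (elComp_eqs (by omega) S).comp g
  obtain ⟨f, E', f₁⟩ := exists_erComp_hom n (by omega) S s (by
    intro i hi hi'
    obtain rfl : i = n := by omega
    exact (F.st hn (by omega)).symm.trans ((E.joined (j := i + 1) (by omega)).trans
      ((F.st (by omega) (by omega)).trans (congrArg _ (by omega)))))
  obtain ⟨l, l₀, l₁⟩ := exists_el_hom _ f (F.slide hn E E')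
  have cs : Covered s := full_inn fS s fun b => ⟨erBoxes _ G (elBoxes S b), rfl, rfl⟩
  refine BoxHom.isotopy_of_loopFree₂ (B := S.Box)
    ⟨l, l₀, (erBoxes _ S).trans (elBoxes _), (elBoxes S).trans (erBoxes _ _),
      fun b => ⟨rfl, congrArg (fun h => Hom.comp h (S.inn b)) (l₁ ▸ f₁)⟩⟩
    (comp_isTangle (el_isTangle hn) fun _ => comp_isTangle (er_isTangle (by omega)) fun _ => hS)
    (comp_isTangle (er_isTangle (by omega)) fun _ => comp_isTangle (el_isTangle (by omega))
      fun _ => hS)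
    (draw_loopFree.comp fun _ => (er_full (by omega)).comp fun _ => fS)
    (Covered.loopFree (Covered.er (by omega) (Covered.draw₁ (f := g) ?_ cs)))
  intro i x hx
  have hi : i < 2 * (n + 1) := Hom.lt_of_st hx
  have c0 : ∀ y, (g.comp G.out).st 0 = some y → Y.IsArc y := fun y =>
    (coveredAt_out (Y := Y)).of_eq (E.left 0 (by omega)).symm
  rcases (show i = 0 ∨ i = 2 * n + 1 ∨ (1 ≤ i ∧ i < 2 * n + 1) by omega) with rfl | rfl | h
  · exact c0 x hx
  · exact c0 x (F.outer.trans hx)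
  · exact cs.out.of_eq (F.st h.1 (by omega)) hx

end Diagram

end Skein

namespace Skein

open Net

namespace Diagram

instance (n i : ℕ) : IsEmpty (gen n i).Box := inferInstanceAs (IsEmpty (Fin 0))
instance (n : ℕ) : IsEmpty (arcLeft n).Box := inferInstanceAs (IsEmpty (Fin 0))
instance (n : ℕ) : IsEmpty (arcRight n).Box := inferInstanceAs (IsEmpty (Fin 0))

theorem gen_loopFree (n i : ℕ) : (gen n i).LoopFree := draw_loopFree

theorem arcLeft_loopFree (n : ℕ) : (arcLeft n).LoopFree := draw_loopFree

theorem arcRight_loopFree (n : ℕ) : (arcRight n).LoopFree := draw_loopFree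

/-- An expectation followed by an inclusion is obtained from the generator of the basic
construction. -/
theorem incl_er_isotopy {n : ℕ} {S : Diagram (Col.box (n + 1))} (hS : S.IsTangle) (fS : S.Full) :
    Nonempty (Isotopy
      ((incl (Col.box n) (Col.box (n + 1))).comp fun _ =>
        (er (Col.box (n + 1)) (Col.box n)).comp fun _ => S)
      ((er (Col.box (n + 2)) (Col.box (n + 1))).comp fun _ =>
        mulComp (Col.box (n + 2)) (gen (n + 2) n) (mulComp (Col.box (n + 2))
          ((incl (Col.box (n + 1)) (Col.box (n + 2))).comp fun _ => S) (gen (n + 2) n)))) := by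
  set G := gen (n + 2) n with hG
  set Z := (incl (Col.box (n + 1)) (Col.box (n + 2))).comp fun _ => S with hZ
  set J := mulComp (Col.box (n + 2)) Z G with hJ
  set P := mulComp (Col.box (n + 2)) G J with hP
  set Y := (er (Col.box (n + 2)) (Col.box (n + 1))).comp fun _ => P with hY
  let p : Hom P.net Y.net := compR (er (Col.box (n + 2)) (Col.box (n + 1))) (fun _ => P) (0 : Fin 1)
  let a : Hom G.net Y.net := p.comp (mulL _ G J)
  let j : Hom J.net Y.net := p.comp (mulR _ G J)
  let z : Hom Z.net Y.net := j.comp (mulL _ Z G)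
  let b : Hom G.net Y.net := j.comp (mulR _ Z G)
  let s : Hom S.net Y.net :=
    z.comp (compR (incl (Col.box (n + 1)) (Col.box (n + 2))) (fun _ => S) (0 : Fin 1))
  have E : BasicConstruction n Y.out (p.comp P.out) (a.comp G.out) (j.comp J.out) (b.comp G.out)
      (z.comp Z.out) (s.comp S.out) :=
    ⟨erComp_eqs (by omega) P, (mulComp_eqs (by omega) (by omega) (by omega) G J).comp p,
      (mulComp_eqs (by omega) (by omega) (by omega) Z G).comp j,
      (inclComp_eqs (by omega) S).comp z, (gen_eqs (by omega)).comp a, (gen_eqs (by omega)).comp b⟩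
  obtain ⟨e₁, e₂⟩ := E.joined
  obtain ⟨f, F, f₁⟩ := exists_erComp_hom n (by omega) S s (by
    intro i hi hi'
    obtain rfl : i = n := by omega
    exact e₁.symm.trans (e₂.trans (congrArg _ (by omega))))
  obtain ⟨l, l₀, l₁⟩ := exists_incl_hom (by omega) _ f (E.inclEqs F)
  have cs : Covered s := full_inn fS s fun b =>
    ⟨erBoxes _ _ (mulBoxesR _ G J (mulBoxesL _ Z G (inclBoxes _ S b))), rfl, rfl⟩
  have cz : CoveredAt (z.comp Z.out) := by
    intro i x hx
    have hi : i < 2 * (n + 2) := Hom.lt_of_st hx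
    rcases Nat.lt_or_ge i (n + 1) with h | h
    · exact cs.out.of_eq (E.incl.left i h) hx
    rcases (show i = n + 1 ∨ i = n + 2 ∨ n + 3 ≤ i by omega) with rfl | rfl | h
    · exact cs.out.of_eq e₁ hx
    · exact cs.out.of_eq ((E.incl.joined (j := n + 1) (by omega)).trans e₁) hx
    · exact cs.out.of_eq ((congrArg _ (by omega)).trans (E.incl.right (i - n - 3) (by omega))) hx
  have ca : CoveredAt (a.comp G.out) := by
    have c0 : ∀ y, (a.comp G.out).st n = some y → Y.IsArc y := fun y =>
      (coveredAt_out (Y := Y)).of_eq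
        ((E.mul.st_left n (by omega)).symm.trans (E.er.left n (by omega)).symm)
    have c1 : ∀ i, n + 2 ≤ i → ∀ y, (a.comp G.out).st i = some y → Y.IsArc y := fun i hi y hy =>
      have hi' : i < 2 * (n + 2) := Hom.lt_of_st hy
      cz.of_eq ((E.mul.joined (j := 2 * n + 3 - i) (by omega) (by omega)).trans
        (E.mul'.st_left _ (by omega))) hy
    intro i x hx
    have hi : i < 2 * (n + 2) := Hom.lt_of_st hx
    rcases (show i < n ∨ i = n ∨ i = n + 1 ∨ n + 2 ≤ i by omega) with h | rfl | rfl | h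
    · exact c1 (2 * n + 3 - i) (by omega) x
        ((E.gen.through (j := 2 * n + 3 - i) (by omega) (by omega)).trans hx)
    · exact c0 x hx
    · exact c0 x (E.gen.cap.trans hx)
    · exact c1 i h x hx
  have cb : CoveredAt (b.comp G.out) := by
    have c0 : ∀ y, (b.comp G.out).st (n + 2) = some y → Y.IsArc y := fun y =>
      ca.of_eq (((congrArg _ (by omega)).trans ((E.mul'.st_right (by omega) (by omega) (n + 2)
        (by omega) (by omega)).symm.trans ((congrArg _ (by omega)).trans
        (E.mul.st_right (by omega) (by omega) (n + 2) (by omega) (by omega)).symm))).trans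
        ((E.er.joined (j := n + 1) (by omega)).trans (E.mul.st_left (n + 1) (by omega))))
    have c1 : ∀ i, i < n + 2 → ∀ y, (b.comp G.out).st i = some y → Y.IsArc y := fun i hi y hy =>
      cz.of_eq (E.mul'.joined (i := 2 * n + 3 - i) (by omega) (by omega)).symm hy
    have cup : (b.comp G.out).st (n + 2) = (b.comp G.out).st (n + 3) :=
      (congrArg _ (by omega)).trans (E.gen'.cup.trans (congrArg _ (by omega)))
    intro i x hx
    have hi : i < 2 * (n + 2) := Hom.lt_of_st hx
    rcases (show i < n + 2 ∨ i = n + 2 ∨ i = n + 3 ∨ n + 4 ≤ i by omega) with h | rfl | rfl | h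
    · exact c1 i h x hx
    · exact c0 x hx
    · exact c0 x (cup.trans hx)
    · exact c1 (2 * n + 3 - i) (by omega) x
        ((E.gen'.through (j := 2 * n + 3 - i) (by omega) (by omega)).trans hx)
  exact BoxHom.isotopy_of_loopFree₂ (B := S.Box)
    ⟨l, l₀, (erBoxes _ S).trans (inclBoxes _ _),
      (inclBoxes _ S).trans ((mulBoxesL _ Z G).trans ((mulBoxesR _ G J).trans (erBoxes _ P))),
      fun b => ⟨rfl, congrArg (fun h => Hom.comp h (S.inn b)) (l₁ ▸ f₁)⟩⟩
    (comp_isTangle (incl_isTangle (by omega)) fun _ => comp_isTangle (er_isTangle (by omega))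
      fun _ => hS)
    (comp_isTangle (er_isTangle (by omega)) fun _ =>
      mulComp_isTangle (mul_isTangle (by omega) (by omega) (by omega)) (gen_isTangle (by omega))
        (mulComp_isTangle (mul_isTangle (by omega) (by omega) (by omega))
          (comp_isTangle (incl_isTangle (by omega)) fun _ => hS) (gen_isTangle (by omega))))
    (draw_loopFree.comp fun _ => (er_full (by omega)).comp fun _ => fS)
    (Covered.loopFree (Covered.er (by omega) (Covered.mulComp (by omega) (by omega) (by omega)
      ((gen_loopFree _ _).covered_of_isEmpty a ca)
      (Covered.mulComp (f := j) (by omega) (by omega) (by omega)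
        (Covered.draw₁ (f := z) cz cs) ((gen_loopFree _ _).covered_of_isEmpty b cb)))))

/-- The left expectation in terms of the shift. -/
theorem el_isotopy {n : ℕ} (hn : 1 ≤ n) {S : Diagram (Col.box n)} (hS : S.IsTangle)
    (fS : S.Full) :
    Nonempty (Isotopy ((el n).comp fun _ => S)
      (mulComp (Col.box n) (mulComp (Col.box (n + 1)) (arcRight (n + 2))
        ((shift n).comp fun _ => S)) (arcLeft (n + 1)))) := by
  set Q := arcRight (n + 2) with hQ
  set P := arcLeft (n + 1) with hP
  set H := (shift n).comp fun _ => S with hH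
  set W := mulComp (Col.box (n + 1)) Q H with hW
  set Y := mulComp (Col.box n) W P with hY
  let w : Hom W.net Y.net := mulL _ W P
  let p : Hom P.net Y.net := mulR _ W P
  let q : Hom Q.net Y.net := w.comp (mulL _ Q H)
  let h : Hom H.net Y.net := w.comp (mulR _ Q H)
  let s : Hom S.net Y.net := h.comp (compR (shift n) (fun _ => S) (0 : Fin 1))
  have E : MulEqs (n + 1) (n + 1) n Y.out (w.comp W.out) (p.comp P.out) :=
    mulComp_eqs (by omega) (by omega) (by omega) W P
  have E' : MulEqs (n + 2) (n + 2) (n + 1) (w.comp W.out) (q.comp Q.out) (h.comp H.out) :=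
    (mulComp_eqs (by omega) (by omega) (by omega) Q H).comp w
  have EH : ShiftEqs n (h.comp H.out) (s.comp S.out) := (shiftComp_eqs n S).comp h
  have EQ : ArcRightEqs (n + 2) (q.comp Q.out) := (arcRight_eqs (by omega)).comp q
  have EP : ArcLeftEqs (n + 1) (p.comp P.out) := (arcLeft_eqs (by omega)).comp p
  have F := ElEqs.of_shift hn E E' EH EQ EP
  obtain ⟨l, l₀, l₁⟩ := exists_el_hom S s F
  have cs : Covered s := full_inn fS s fun b =>
    ⟨mulBoxesL _ W P (mulBoxesR _ Q H (shiftBoxes S b)), rfl, rfl⟩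
  have q_h : ∀ i j, i + j = 2 * n + 3 → n + 1 ≤ i → (q.comp Q.out).st i = (h.comp H.out).st j :=
    fun i j hij hi => E'.joined (by omega) (by omega)
  have q_outer : (q.comp Q.out).st 0 = (q.comp Q.out).st (2 * n + 3) := EQ.outer
  have q_arc : (q.comp Q.out).st (2 * n + 1) = (q.comp Q.out).st (2 * n + 2) := EQ.arc
  have ch : CoveredAt (h.comp H.out) := by
    have c0 : ∀ y, (h.comp H.out).st 0 = some y → Y.IsArc y := fun y =>
      (coveredAt_out (Y := Y)).of_eq ((q_h (2 * n + 3) 0 (by omega) (by omega)).symm.trans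
        (q_outer.symm.trans ((E'.st_left 0 (by omega)).symm.trans (E.st_left 0 (by omega)).symm)))
    have c1 : ∀ y, (h.comp H.out).st 1 = some y → Y.IsArc y := fun y =>
      cs.out.of_eq ((q_h (2 * n + 2) 1 (by omega) (by omega)).symm.trans
        (q_arc.symm.trans ((q_h _ 2 (by omega) (by omega)).trans (EH.st (i := 0) (by omega)))))
    intro i x hx
    have hi : i < 2 * (n + 2) := Hom.lt_of_st hx
    rcases (show i = 0 ∨ i = 1 ∨ i = 2 * n + 2 ∨ i = 2 * n + 3 ∨ (2 ≤ i ∧ i < 2 * n + 2) by omega)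
      with rfl | rfl | rfl | rfl | hi'
    · exact c0 x hx
    · exact c1 x hx
    · exact c1 x (EH.snd.trans hx)
    · exact c0 x (EH.fst.trans hx)
    · exact cs.out.of_eq (EH.st (i := i - 2) (by omega)) hx
  have cq : CoveredAt (q.comp Q.out) := by
    have c1 : ∀ i, n + 1 ≤ i → ∀ y, (q.comp Q.out).st i = some y → Y.IsArc y := fun i hi y hy =>
      have hi' : i < 2 * (n + 2) := Hom.lt_of_st hy
      ch.of_eq (q_h i (2 * n + 3 - i) (by omega) hi) hy
    intro i x hx
    rcases (show i = 0 ∨ (1 ≤ i ∧ i ≤ n) ∨ n + 1 ≤ i by omega) with rfl | hi | hi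
    · exact c1 _ (by omega) x (q_outer.symm.trans hx)
    · refine c1 (2 * n + 1 - i) (by omega) x (Eq.trans ?_ hx)
      exact ((congrArg _ (by omega)).trans ((EQ.thru (i - 1) (by omega)).trans
        (congrArg _ (by omega)))).symm
    · exact c1 i hi x hx
  have cw : CoveredAt (w.comp W.out) := by
    intro i x hx
    have hi : i < 2 * (n + 1) := Hom.lt_of_st hx
    rcases Nat.lt_or_ge i (n + 1) with hi' | hi'
    · exact cq.of_eq (E'.st_left i (by omega)) hx
    · exact ch.of_eq (E'.st_right (by omega) (by omega) i (by omega) (by omega)) hx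
  have cp : CoveredAt (p.comp P.out) := by
    intro i x hx
    have hi : i < 2 * (n + 1) := Hom.lt_of_st hx
    rcases Nat.lt_or_ge i (n + 2) with hi' | hi'
    · exact cw.of_eq (E.joined (i := 2 * n + 1 - i) (by omega) (by omega)).symm hx
    · exact (coveredAt_out (Y := Y)).of_eq ((congrArg _ (by omega)).trans (E.st_right (by omega)
        (by omega) (i - 2) (by omega) (by omega)).symm) hx
  exact BoxHom.isotopy_of_loopFree₂ (B := S.Box)
    ⟨l, l₀, elBoxes S, (shiftBoxes S).trans ((mulBoxesR _ Q H).trans (mulBoxesL _ W P)),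
      fun b => ⟨rfl, congrArg (fun h => Hom.comp h (S.inn b)) l₁⟩⟩
    (comp_isTangle (el_isTangle hn) fun _ => hS)
    (mulComp_isTangle (mul_isTangle (by omega) (by omega) (by omega))
      (mulComp_isTangle (mul_isTangle (by omega) (by omega) (by omega))
        (arcRight_isTangle (by omega)) (comp_isTangle (shift_isTangle n) fun _ => hS))
      (arcLeft_isTangle (by omega)))
    (draw_loopFree.comp fun _ => fS)
    (Covered.loopFree (Covered.mulComp (by omega) (by omega) (by omega)
      (Covered.mulComp (f := w) (by omega) (by omega) (by omega)
        ((arcRight_loopFree _).covered_of_isEmpty q cq) (Covered.draw₁ (f := h) ch cs))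
      ((arcLeft_loopFree _).covered_of_isEmpty p cp)))

end Diagram

end Skein

namespace Skein

open Net

namespace Diagram

section

variable {N N' : Net}

/-! ### Isotopies for the colour `0₋` -/

/-- A boundary of colour `0₋` is a black region. -/
theorem exists_zeroMinus_hom (r : N.Region) (h : N.shaded r = true) :
    ∃ m : Hom (boundary Col.zeroMinus) N, m.rg 0 = r :=
  ⟨{ strand := fun p => absurd p.isLt (Nat.not_lt_zero _)
     region := fun _ => r
     shaded_region := fun _ => h
     white_strand := fun p => absurd p.isLt (Nat.not_lt_zero _)
     black_strand := fun p => absurd p.isLt (Nat.not_lt_zero _) }, rfl⟩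

theorem shaded_rg_one {n : ℕ} (hn : 1 ≤ n) (o : Hom (boundary (Col.box n)) N) :
    N.shaded (o.rg 1) = true := by
  refine (o.shaded_region _).trans ?_
  have h1 : max 1 (2 * n) = 2 * n := by omega
  show decide (1 % (max 1 (2 * n)) % 2 = 1) = true
  rw [h1, Nat.mod_eq_of_lt (show 1 < 2 * n by omega)]
  rfl

/-- The strands and the placement of the box of `ER_d^{0₋}`. -/
structure ErMinusEqs (d : ℕ) (o : Hom (boundary Col.zeroMinus) N)
    (h : Hom (boundary (Col.box d)) N) : Prop where
  join : ∀ i < d, h.st i = h.st (2 * d - 1 - i)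
  rg : o.rg 0 = h.rg 1

/-- The strand and the placement of the box of `I_{0₋}^1`. -/
structure InclMinusEqs (o : Hom (boundary (Col.box 1)) N)
    (m : Hom (boundary Col.zeroMinus) N) : Prop where
  join : o.st 0 = o.st 1
  rg : o.rg 1 = m.rg 0

/-- The placement of the boxes of `M_{0₋,0₋}^{0₋}`. -/
structure MulMinusEqs (o m m' : Hom (boundary Col.zeroMinus) N) : Prop where
  rg₁ : o.rg 0 = m.rg 0
  rg₂ : o.rg 0 = m'.rg 0

theorem ErMinusEqs.comp {d : ℕ} {o : Hom (boundary Col.zeroMinus) N}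
    {h : Hom (boundary (Col.box d)) N} (E : ErMinusEqs d o h) (f : Hom N N') :
    ErMinusEqs d (f.comp o) (f.comp h) :=
  ⟨fun i hi => st_comp_eq f (E.join i hi), rg_comp_eq f E.rg⟩

theorem InclMinusEqs.comp {o : Hom (boundary (Col.box 1)) N}
    {m : Hom (boundary Col.zeroMinus) N} (E : InclMinusEqs o m) (f : Hom N N') :
    InclMinusEqs (f.comp o) (f.comp m) := ⟨st_comp_eq f E.join, rg_comp_eq f E.rg⟩

theorem erMinusComp_eqs {d : ℕ} (hd : 1 ≤ d) (S : Diagram (Col.box d)) :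
    ErMinusEqs d ((er (Col.box d) Col.zeroMinus).comp fun _ => S).out
      ((compR (er (Col.box d) Col.zeroMinus) (fun _ => S) (0 : Fin 1)).comp S.out) := by
  have E : ErMinusEqs d (er (Col.box d) Col.zeroMinus).out
      ((er (Col.box d) Col.zeroMinus).inn (0 : Fin 1)) := by
    refine ⟨fun i hi => ?_, ?_⟩
    · refine draw_inn_inn (c := Col.zeroMinus) (0 : Fin 1) (0 : Fin 1)
        (Or.inr (mem_anti.2 ⟨rfl, rfl, ?_⟩)) ?_ ?_ <;>
        (try simp only [Col.size]) <;> omega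
    · refine draw_region (c := Col.zeroMinus) (0 : Fin 1) rfl (by decide) ?_ rfl
      simp only [Col.segs, Col.size]; omega
  have := E.comp (compL (er (Col.box d) Col.zeroMinus) fun _ => S)
  exact (compL_inn (er (Col.box d) Col.zeroMinus) (fun _ => S) (0 : Fin 1)) ▸ this

theorem exists_erMinus_hom {d : ℕ} {o : Hom (boundary Col.zeroMinus) N}
    (S : Diagram (Col.box d)) (f : Hom S.net N) (E : ErMinusEqs d o (f.comp S.out)) :
    ∃ h : Hom ((er (Col.box d) Col.zeroMinus).comp fun _ => S).net N,
      h.comp ((er (Col.box d) Col.zeroMinus).comp fun _ => S).out = o ∧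
      h.comp (compR (er (Col.box d) Col.zeroMinus) (fun _ => S) (0 : Fin 1)) = f := by
  refine exists_draw₁_hom o S f ?_ ?_
  · rintro x p y q ((h | h) | h)
    · have := mem_para.1 h
      simp only [Col.size] at this
      omega
    · have := mem_para.1 h
      simp only [Col.size] at this
      omega
    · obtain ⟨rfl, rfl, h₁, h₂, h₃⟩ := mem_anti.1 h
      simp only [Col.size] at h₂ h₃
      refine Or.inr (Or.inr ⟨rfl, rfl, (E.join p (by omega)).trans (congrArg _ (by omega))⟩)
  · intro x p y q h
    have h' : ((x, p), (y, q)) = ((0, 0), (1, 1)) := h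
    simp only [Prod.mk.injEq] at h'
    obtain ⟨⟨rfl, rfl⟩, rfl, rfl⟩ := h'
    exact ⟨rfl, rfl, E.rg⟩

theorem inclMinusComp_eqs (S : Diagram Col.zeroMinus) :
    InclMinusEqs ((incl Col.zeroMinus (Col.box 1)).comp fun _ => S).out
      ((compR (incl Col.zeroMinus (Col.box 1)) (fun _ => S) (0 : Fin 1)).comp S.out) := by
  have E : InclMinusEqs (incl Col.zeroMinus (Col.box 1)).out
      ((incl Col.zeroMinus (Col.box 1)).inn (0 : Fin 1)) := by
    refine ⟨?_, ?_⟩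
    · exact draw_out_out (c := Col.box 1) (Or.inr (mem_anti.2 (by decide))) (by decide) (by decide)
    · exact draw_region (c := Col.box 1) (0 : Fin 1) rfl (by decide) (by decide) rfl
  have := E.comp (compL (incl Col.zeroMinus (Col.box 1)) fun _ => S)
  exact (compL_inn (incl Col.zeroMinus (Col.box 1)) (fun _ => S) (0 : Fin 1)) ▸ this

theorem exists_inclMinus_hom {o : Hom (boundary (Col.box 1)) N}
    (S : Diagram Col.zeroMinus) (f : Hom S.net N) (E : InclMinusEqs o (f.comp S.out)) :
    ∃ h : Hom ((incl Col.zeroMinus (Col.box 1)).comp fun _ => S).net N,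
      h.comp ((incl Col.zeroMinus (Col.box 1)).comp fun _ => S).out = o ∧
      h.comp (compR (incl Col.zeroMinus (Col.box 1)) (fun _ => S) (0 : Fin 1)) = f := by
  refine exists_draw₁_hom o S f ?_ ?_
  · rintro x p y q ((h | h) | h)
    · have := mem_para.1 h
      simp only [Col.size] at this
      omega
    · have := mem_para.1 h
      simp only [Col.size] at this
      omega
    · obtain ⟨rfl, rfl, h₁, h₂, h₃⟩ := mem_anti.1 h
      simp only [Col.size] at h₂ h₃
      refine Or.inl ⟨rfl, rfl, ?_⟩
      obtain ⟨rfl, rfl⟩ : p = 0 ∧ q = 1 := by omega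
      exact E.join
  · intro x p y q h
    have h' : ((x, p), (y, q)) = ((0, 1), (1, 0)) := h
    simp only [Prod.mk.injEq] at h'
    obtain ⟨⟨rfl, rfl⟩, rfl, rfl⟩ := h'
    exact ⟨rfl, rfl, E.rg⟩

theorem exists_mulMinus_hom {o : Hom (boundary Col.zeroMinus) N}
    (S T : Diagram Col.zeroMinus) (f : Hom S.net N) (g : Hom T.net N)
    (E : MulMinusEqs o (f.comp S.out) (g.comp T.out)) :
    ∃ h : Hom (mulComp Col.zeroMinus S T).net N, h.comp (mulComp Col.zeroMinus S T).out = o ∧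
      h.comp (mulL Col.zeroMinus S T) = f ∧ h.comp (mulR Col.zeroMinus S T) = g := by
  let fg : ∀ i : Fin 2, Hom (factors S T i).net N := fun i => match i with
    | 0 => f
    | 1 => g
  refine exists_draw₂_hom o (factors S T) fg ?_ ?_
  · rintro x p y q ((h | h) | h)
    · have := mem_para.1 h
      simp only [Col.size] at this
      omega
    · have := mem_anti.1 h
      simp only [Col.size] at this
      omega
    · have := mem_para.1 h
      simp only [Col.size] at this
      omega
  · intro x p y q h
    simp only [Set.mem_insert_iff, Set.mem_singleton_iff, Prod.mk.injEq] at h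
    rcases h with ⟨⟨rfl, rfl⟩, rfl, rfl⟩ | ⟨⟨rfl, rfl⟩, rfl, rfl⟩
    · exact Or.inl ⟨rfl, rfl, E.rg₁⟩
    · exact Or.inr ⟨rfl, rfl, E.rg₂⟩

theorem ErMinusEqs.trans {d : ℕ} (hd : 1 ≤ d) {o : Hom (boundary Col.zeroMinus) N}
    {g : Hom (boundary (Col.box 1)) N} {s : Hom (boundary (Col.box d)) N}
    (E : ErMinusEqs 1 o g) (F : ErEqs d 1 g s) : ErMinusEqs d o s := by
  refine ⟨fun i hi => ?_, E.rg.trans (Hom.rg_of_st_eq (F.left 0 (by omega)) (by decide) rfl).2⟩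
  rcases Nat.eq_zero_or_pos i with rfl | h
  · exact (F.left 0 (by omega)).symm.trans ((E.join 0 (by omega)).trans
      ((F.right 0 (by omega)).trans (congrArg _ (by omega))))
  · exact F.joined (by omega)

theorem MulEqs.er_zeroMinus {o m : Hom (boundary Col.zeroMinus) N}
    {w x j : Hom (boundary (Col.box 1)) N} {z : Hom (boundary Col.zeroMinus) N}
    (E : ErMinusEqs 1 o w) (F : MulEqs 1 1 1 w x j) (G : InclMinusEqs j z)
    (hm : m.rg 0 = x.rg 1) : ErMinusEqs 1 m x ∧ MulMinusEqs o m z := by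
  have wx : w.st 0 = x.st 0 := F.st_left 0 (by omega)
  have wj : w.st 1 = j.st 1 := F.st_right (by omega) (by omega) 1 (by omega) (by omega)
  have xj : x.st 1 = j.st 0 := F.joined (by omega) (by omega)
  have ww : w.st 0 = w.st 1 := E.join 0 (by omega)
  refine ⟨⟨fun i hi => ?_, hm⟩, ?_, ?_⟩
  · obtain rfl : i = 0 := by omega
    exact wx.symm.trans (ww.trans (wj.trans (G.join.symm.trans xj.symm)))
  · exact E.rg.trans ((Hom.rg_of_st_eq wx (by decide) rfl).2.trans hm.symm)
  · exact E.rg.trans ((Hom.rg_of_st_eq wj (by decide) rfl).1.trans G.rg)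

end

theorem er_zeroMinus_full (d : ℕ) : (er (Col.box d) Col.zeroMinus).Full :=
  draw_full fun _ hp => absurd hp (by simp [Col.size])

theorem mul_zeroMinus_full : (mul Col.zeroMinus Col.zeroMinus Col.zeroMinus).Full :=
  draw_full fun _ hp => absurd hp (by simp [Col.size])

theorem mulComp_zeroMinus_full {S T : Diagram Col.zeroMinus} (fS : S.Full) (fT : T.Full) :
    (mulComp Col.zeroMinus S T).Full := by
  refine Full.comp (W := mul Col.zeroMinus Col.zeroMinus Col.zeroMinus) (S := factors S T)
    mul_zeroMinus_full fun i => ?_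
  have hi : ∀ i : Fin 2, i = 0 ∨ i = 1 := by decide
  rcases hi i with rfl | rfl
  · exact fS
  · exact fT

theorem Covered.er_zeroMinus {c : Col} {Y : Diagram c} {d : ℕ} {S : Diagram (Col.box d)}
    {f : Hom ((Diagram.er (Col.box d) Col.zeroMinus).comp fun _ => S).net Y.net}
    (hS : Covered (f.comp (compR (Diagram.er (Col.box d) Col.zeroMinus) (fun _ => S) (0 : Fin 1)))) :
    Covered f := by
  refine Covered.comp_of_full (S := fun _ => S) (er_zeroMinus_full d) f ?_
  intro i
  have hi : ∀ i : Fin 1, i = 0 := fun i => Subsingleton.elim _ _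
  obtain rfl := hi i
  exact hS

/-- The expectation onto colour `0₋` factors through colour `1`. -/
theorem er_zeroMinus_isotopy {d : ℕ} (hd : 1 ≤ d) {S : Diagram (Col.box d)} (hS : S.IsTangle)
    (fS : S.Full) :
    Nonempty (Isotopy ((er (Col.box d) Col.zeroMinus).comp fun _ => S)
      ((er (Col.box 1) Col.zeroMinus).comp fun _ =>
        (er (Col.box d) (Col.box 1)).comp fun _ => S)) := by
  set G := (er (Col.box d) (Col.box 1)).comp fun _ => S with hG
  have E := erMinusComp_eqs le_rfl G
  have F := (erComp_eqs hd S).comp (compR (er (Col.box 1) Col.zeroMinus) (fun _ => G) (0 : Fin 1))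
  obtain ⟨l, l₀, l₁⟩ := exists_erMinus_hom S
    ((compR (er (Col.box 1) Col.zeroMinus) (fun _ => G) (0 : Fin 1)).comp
      (compR (er (Col.box d) (Col.box 1)) (fun _ => S) (0 : Fin 1))) (E.trans hd F)
  exact BoxHom.isotopy_of_loopFree₂ (B := S.Box)
    ⟨l, l₀, erBoxes _ S, (erBoxes _ S).trans (erBoxes _ _),
      fun b => ⟨rfl, congrArg (fun h => Hom.comp h (S.inn b)) l₁⟩⟩
    (comp_isTangle (er_zeroMinus_isTangle hd) fun _ => hS)
    (comp_isTangle (er_zeroMinus_isTangle le_rfl) fun _ => comp_isTangle (er_isTangle hd)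
      fun _ => hS)
    ((er_zeroMinus_full d).comp fun _ => fS).loopFree
    ((er_zeroMinus_full 1).comp fun _ => (er_full hd).comp fun _ => fS).loopFree

/-- Passing to colour `0₋` and back is the left expectation of colour `1`. -/
theorem incl_er_zeroMinus_isotopy {S : Diagram (Col.box 1)} (hS : S.IsTangle) (fS : S.Full) :
    Nonempty (Isotopy ((incl Col.zeroMinus (Col.box 1)).comp fun _ =>
        (er (Col.box 1) Col.zeroMinus).comp fun _ => S)
      ((el 1).comp fun _ => S)) := by
  have E := elComp_eqs le_rfl S
  obtain ⟨m, hm⟩ := exists_zeroMinus_hom _ (shaded_rg_one le_rfl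
    ((compR (el 1) (fun _ => S) (0 : Fin 1)).comp S.out))
  have F : ErMinusEqs 1 m ((compR (el 1) (fun _ => S) (0 : Fin 1)).comp S.out) := by
    refine ⟨fun i hi => ?_, hm⟩
    obtain rfl : i = 0 := by omega
    exact E.inner
  obtain ⟨f, f₀, f₁⟩ := exists_erMinus_hom S _ F
  obtain ⟨l, l₀, l₁⟩ := exists_inclMinus_hom _ f
    (⟨E.outer, E.rg.trans (hm.symm.trans (congrArg (fun k => Hom.rg k 0) f₀.symm))⟩ :
      InclMinusEqs ((el 1).comp fun _ => S).out
        (f.comp ((er (Col.box 1) Col.zeroMinus).comp fun _ => S).out))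
  exact BoxHom.isotopy_of_loopFree₂ (B := S.Box)
    ⟨l, l₀, (erBoxes _ S).trans (inclBoxes _ _), elBoxes S,
      fun b => ⟨rfl, congrArg (fun h => Hom.comp h (S.inn b)) (l₁ ▸ f₁)⟩⟩
    (comp_isTangle incl_zeroMinus_isTangle fun _ =>
      comp_isTangle (er_zeroMinus_isTangle le_rfl) fun _ => hS)
    (comp_isTangle (el_isTangle le_rfl) fun _ => hS)
    (draw_loopFree.comp fun _ => (er_zeroMinus_full 1).comp fun _ => fS)
    (draw_loopFree.comp fun _ => fS)

/-- The analogue of `mul_er_isotopy` for the expectation onto colour `0₋`. -/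
theorem mul_er_zeroMinus_isotopy {S : Diagram (Col.box 1)} {T : Diagram Col.zeroMinus}
    (hS : S.IsTangle) (hT : T.IsTangle) (fS : S.Full) (fT : T.Full) :
    Nonempty (Isotopy
      (mulComp Col.zeroMinus ((er (Col.box 1) Col.zeroMinus).comp fun _ => S) T)
      ((er (Col.box 1) Col.zeroMinus).comp fun _ => mulComp (Col.box 1) S
        ((incl Col.zeroMinus (Col.box 1)).comp fun _ => T))) := by
  set IT := (incl Col.zeroMinus (Col.box 1)).comp fun _ => T with hIT
  set P := mulComp (Col.box 1) S IT with hP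
  set Y := (er (Col.box 1) Col.zeroMinus).comp fun _ => P with hY
  let p : Hom P.net Y.net := compR (er (Col.box 1) Col.zeroMinus) (fun _ => P) (0 : Fin 1)
  let s : Hom S.net Y.net := p.comp (mulL _ S IT)
  let j : Hom IT.net Y.net := p.comp (mulR _ S IT)
  let t : Hom T.net Y.net := j.comp (compR (incl Col.zeroMinus (Col.box 1)) (fun _ => T) (0 : Fin 1))
  have E : ErMinusEqs 1 Y.out (p.comp P.out) := erMinusComp_eqs le_rfl P
  have F : MulEqs 1 1 1 (p.comp P.out) (s.comp S.out) (j.comp IT.out) :=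
    (mulComp_eqs (by omega) (by omega) (by omega) S IT).comp p
  have G : InclMinusEqs (j.comp IT.out) (t.comp T.out) := (inclMinusComp_eqs T).comp j
  obtain ⟨m, hm⟩ := exists_zeroMinus_hom _ (shaded_rg_one le_rfl (s.comp S.out))
  obtain ⟨H, K⟩ := MulEqs.er_zeroMinus E F G hm
  obtain ⟨f, f₀, f₁⟩ := exists_erMinus_hom S s H
  obtain ⟨g, g₀, g₁, g₂⟩ := exists_mulMinus_hom _ T f t (f₀ ▸ K)
  refine BoxHom.isotopy_of_loopFree₂ (B := S.Box ⊕ₗ T.Box)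
    ⟨g, g₀, (OrderIso.sumLexCongr (erBoxes _ S) (OrderIso.refl _)).trans (mulBoxes _ _ T),
      ((OrderIso.sumLexCongr (OrderIso.refl _) (inclBoxes _ T)).trans (mulBoxes _ S _)).trans
        (erBoxes _ _), ?_⟩
    (mulComp_isTangle (mul_isTangle_of_size_eq_zero rfl)
      (comp_isTangle (er_zeroMinus_isTangle le_rfl) fun _ => hS) hT)
    (comp_isTangle (er_zeroMinus_isTangle le_rfl) fun _ =>
      mulComp_isTangle (mul_isTangle (by omega) (by omega) (by omega)) hS
        (comp_isTangle incl_zeroMinus_isTangle fun _ => hT))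
    (mulComp_zeroMinus_full ((er_zeroMinus_full 1).comp fun _ => fS) fT).loopFree ?_
  · rintro (b | b)
    · exact ⟨rfl, congrArg (fun h => Hom.comp h (S.inn b)) (g₁ ▸ f₁)⟩
    · exact ⟨rfl, congrArg (fun h => Hom.comp h (T.inn b)) g₂⟩
  · have cs : Covered s := full_inn fS s fun b =>
      ⟨erBoxes _ _ (mulBoxes _ S _ (toLex (Sum.inl b))), rfl, rfl⟩
    have ct : Covered t := full_inn fT t fun b =>
      ⟨erBoxes _ _ (mulBoxes _ S _ (toLex (Sum.inr (inclBoxes _ T b)))), rfl, rfl⟩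
    refine Covered.loopFree (Covered.er_zeroMinus (Covered.mulComp (by omega) (by omega) (by omega)
      cs (Covered.draw₁ (f := j) ?_ ct)))
    intro i x hx
    have hi : i < 2 * 1 := Hom.lt_of_st hx
    have h0 : (s.comp S.out).st 1 = (j.comp IT.out).st 0 := F.joined (by omega) (by omega)
    rcases (show i = 0 ∨ i = 1 by omega) with rfl | rfl
    · exact cs.out.of_eq h0.symm hx
    · exact cs.out.of_eq (G.join.symm.trans h0.symm) hx

end Diagram

end Skein

namespace Skein

open Net Diagram

/-! ### The stacks -/

namespace Diagram

theorem er_self (n : ℕ) : er (Col.box n) (Col.box n) = incl (Col.box n) (Col.box n) := by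
  have hJ : para 0 0 1 0 n ∪ para 0 n 1 (2 * n - n) n ∪ anti 1 n 1 n (n - n) =
      para 0 0 1 0 n ∪ para 0 (2 * n - n) 1 n n ∪ anti 0 n 0 n (n - n) := by
    have h : 2 * n - n = n := by omega
    rw [h]
    congr 1
    ext ⟨⟨x, p⟩, y, q⟩
    rw [mem_anti, mem_anti]
    omega
  have hA : ({((0, 0), (1, if Col.box n = Col.zeroMinus ∧ Col.box n ≠ Col.zeroMinus then 1 else 0))} :
      Set ((ℕ × ℕ) × (ℕ × ℕ))) =
      {((0, if Col.box n = Col.zeroMinus ∧ Col.box n ≠ Col.zeroMinus then 1 else 0), (1, 0))} := by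
    simp
  show draw (Col.box n) (fun _ : Fin 1 => Col.box n) (para 0 0 1 0 n ∪ para 0 n 1 (2 * n - n) n ∪
    anti 1 n 1 n (n - n)) _ = draw _ _ (para 0 0 1 0 n ∪ para 0 (2 * n - n) 1 n n ∪
    anti 0 n 0 n (n - n)) _
  rw [hJ, hA]

theorem stack_of_le {k n : ℕ} (h : n ≤ k) : stack k n = er (Col.box k) (Col.box n) := by
  cases n with
  | zero => rfl
  | succ n => exact if_pos h

theorem stack_self (k : ℕ) : stack k k = incl (Col.box k) (Col.box k) :=
  (stack_of_le le_rfl).trans (er_self k)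

theorem stack_succ {k n : ℕ} (h : k ≤ n) : stack k (n + 1) =
    mulComp (Col.box (n + 1)) (stack k k) (stack k n) := by
  rw [stack_self]
  exact if_neg (by omega)

theorem stack_isTangle {k : ℕ} (hk : 1 ≤ k) (n : ℕ) : (stack k n).IsTangle := by
  induction n with
  | zero => exact er_isTangle (Nat.zero_le k)
  | succ n ih =>
    rcases Nat.lt_or_ge n k with h | h
    · rw [stack_of_le (by omega)]
      exact er_isTangle (by omega)
    · rw [stack_succ h, stack_self]
      exact mulComp_isTangle (mul_isTangle (by omega) (by omega) (by omega))
        (incl_isTangle le_rfl) ih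

/-- Every strand of a stack meets a box. -/
theorem stack_full {k : ℕ} (hk : 1 ≤ k) (n : ℕ) : (stack k n).Full := by
  induction n with
  | zero => exact er_full (Nat.zero_le k)
  | succ n ih =>
    rcases Nat.lt_or_ge n k with h | h
    · rw [stack_of_le (by omega)]
      exact er_full (by omega)
    · rw [stack_succ h, stack_of_le le_rfl]
      exact mulComp_full (by omega) (by omega) (by omega) (er_full le_rfl) ih

theorem factors_incl (c d : Col) :
    factors (incl c c) (incl d d) = fun i => incl (![c, d] i) (![c, d] i) := by
  funext i
  have hi : ∀ i : Fin 2, i = 0 ∨ i = 1 := by decide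
  rcases hi i with rfl | rfl <;> rfl

end Diagram

section

variable {k : ℕ}

theorem Implies.mul {a b e : ℕ} (ha : a ≤ b + e) (hb : b ≤ a + e) (he : e ≤ a + b)
    {S S' : Diagram (Col.box a)} {T T' : Diagram (Col.box b)} (h : Implies k S S')
    (h' : Implies k T T') : Implies k (mulComp (Col.box e) S T) (mulComp (Col.box e) S' T') := by
  refine Consequence.comp _ (mul_isTangle ha hb he) (factors S T) (factors S' T') fun i => ?_
  have hi : ∀ i : Fin 2, i = 0 ∨ i = 1 := by decide
  rcases hi i with rfl | rfl
  · exact h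
  · exact h'

theorem Implies.er {d c : ℕ} (hc : c ≤ d) {S T : Diagram (Col.box d)} (h : Implies k S T) :
    Implies k ((Diagram.er (Col.box d) (Col.box c)).comp fun _ => S)
      ((Diagram.er (Col.box d) (Col.box c)).comp fun _ => T) :=
  Consequence.comp _ (er_isTangle hc) (fun _ => S) (fun _ => T) fun _ => h

theorem Implies.incl {a b : ℕ} (hb : a ≤ b) {S T : Diagram (Col.box a)} (h : Implies k S T) :
    Implies k ((Diagram.incl (Col.box a) (Col.box b)).comp fun _ => S)
      ((Diagram.incl (Col.box a) (Col.box b)).comp fun _ => T) :=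
  Consequence.comp _ (incl_isTangle hb) (fun _ => S) (fun _ => T) fun _ => h

theorem Implies.el {n : ℕ} (hn : 1 ≤ n) {S T : Diagram (Col.box n)} (h : Implies k S T) :
    Implies k ((Diagram.el n).comp fun _ => S) ((Diagram.el n).comp fun _ => T) :=
  Consequence.comp _ (el_isTangle hn) (fun _ => S) (fun _ => T) fun _ => h

theorem Implies.er_zeroMinus {d : ℕ} (hd : 1 ≤ d) {S T : Diagram (Col.box d)}
    (h : Implies k S T) :
    Implies k ((Diagram.er (Col.box d) Col.zeroMinus).comp fun _ => S)
      ((Diagram.er (Col.box d) Col.zeroMinus).comp fun _ => T) :=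
  Consequence.comp _ (er_zeroMinus_isTangle hd) (fun _ => S) (fun _ => T) fun _ => h

theorem Implies.incl_zeroMinus {S T : Diagram Col.zeroMinus} (h : Implies k S T) :
    Implies k ((Diagram.incl Col.zeroMinus (Col.box 1)).comp fun _ => S)
      ((Diagram.incl Col.zeroMinus (Col.box 1)).comp fun _ => T) :=
  Consequence.comp _ incl_zeroMinus_isTangle (fun _ => S) (fun _ => T) fun _ => h

theorem Implies.mul_zeroMinus {S S' T T' : Diagram Col.zeroMinus} (h : Implies k S S')
    (h' : Implies k T T') :
    Implies k (mulComp Col.zeroMinus S T) (mulComp Col.zeroMinus S' T') := by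
  refine Consequence.comp _ (mul_isTangle_of_size_eq_zero (Eq.refl 0)) (factors S T) (factors S' T')
    fun i => ?_
  have hi : ∀ i : Fin 2, i = 0 ∨ i = 1 := by decide
  rcases hi i with rfl | rfl
  · exact h
  · exact h'

/-! ### Products of stacks -/

theorem mul_implies_stack (k : ℕ) :
    Implies k (mulComp (Col.box k) (stack k k) (stack k k)) (stack k k) := by
  have ht : (mul (Col.box k) (Col.box k) (Col.box k)).IsTangle :=
    mul_isTangle (by omega) (by omega) (by omega)
  have hI : ∀ i : Fin 2, (incl (![Col.box k, Col.box k] i) (![Col.box k, Col.box k] i)).IsTangle := by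
    intro i
    have hi : ∀ i : Fin 2, i = 0 ∨ i = 1 := by decide
    rcases hi i with rfl | rfl
    · exact incl_isTangle le_rfl
    · exact incl_isTangle le_rfl
  have iso := comp_incl_isotopy ht draw_loopFree hI
  have e : mulComp (Col.box k) (stack k k) (stack k k) =
      (mul (Col.box k) (Col.box k) (Col.box k)).comp
        fun i : Fin 2 => incl (![Col.box k, Col.box k] i) (![Col.box k, Col.box k] i) := by
    rw [stack_self, mulComp_eq, factors_incl]
  rw [e, stack_self]
  exact (implies_of_isotopy (comp_isTangle ht hI) iso).trans (Consequence.of Basic.mult)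

/-- The tangle `T^k` is an identity tangle, so substituting it changes nothing. -/
theorem er_stack_isotopy {n : ℕ} (hn : n ≤ k) :
    Nonempty (Isotopy ((er (Col.box k) (Col.box n)).comp fun _ => stack k k) (stack k n)) := by
  rw [stack_of_le hn, stack_self]
  exact comp_incl_isotopy (er_isTangle hn) draw_loopFree fun _ => incl_isTangle le_rfl

theorem incl_stack_isotopy {n : ℕ} (hn : k ≤ n) :
    Nonempty (Isotopy ((incl (Col.box k) (Col.box n)).comp fun _ => stack k k)
      (incl (Col.box k) (Col.box n))) := by
  rw [stack_self]
  exact comp_incl_isotopy (incl_isTangle hn) draw_loopFree fun _ => incl_isTangle le_rfl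

theorem shift_stack_isotopy (k : ℕ) :
    Nonempty (Isotopy ((shift k).comp fun _ => stack k k) (shift k)) := by
  rw [stack_self]
  exact comp_incl_isotopy (shift_isTangle k) draw_loopFree fun _ => incl_isTangle le_rfl

/-- Multiplication of a stack by one more box that is joined to it by `k` strands. -/
theorem mul_stack_implies (hk : 1 ≤ k) {n : ℕ} (hn : k ≤ n) :
    Implies k (mulComp (Col.box n) (stack k k) (stack k n)) (stack k n) := by
  rcases Nat.eq_or_lt_of_le hn with rfl | h
  · exact mul_implies_stack k
  obtain ⟨m, rfl⟩ : ∃ m, n = m + 1 := ⟨n - 1, by omega⟩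
  have t := stack_isTangle hk
  have f := stack_full hk
  rw [stack_succ (show k ≤ m by omega)]
  refine Implies.trans (implies_of_isotopy_symm ?_ (mul_assoc_isotopy (a := k) (b := k) (c := m)
    (p := k) (q := m + 1) (p' := m + 1) (v := k - 1) (by omega) (by omega) (by omega) (by omega)
    (by omega) (by omega) (by omega) (Or.inl (by omega)) (t k) (t k) (t m) (f k) (f k) (f m)))
    (Implies.mul (by omega) (by omega) (by omega) (mul_implies_stack k) (Implies.rfl (t m)))
  exact mulComp_isTangle (mul_isTangle (by omega) (by omega) (by omega)) (t k)
    (mulComp_isTangle (mul_isTangle (by omega) (by omega) (by omega)) (t k) (t m))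

/-- Stacks that are joined by `k - 1` strands form a stack. -/
theorem mul_stack_stack (hk : 1 ≤ k) {m n q : ℕ} (hm : k ≤ m) (hn : k ≤ n)
    (hq : q + k = m + n + 1) :
    Implies k (mulComp (Col.box q) (stack k m) (stack k n)) (stack k q) ∧
      Implies k (stack k q) (mulComp (Col.box q) (stack k m) (stack k n)) := by
  have t := stack_isTangle hk
  have f := stack_full hk
  induction m, hm using Nat.le_induction generalizing q with
  | base =>
    obtain rfl : q = n + 1 := by omega
    rw [← stack_succ hn]
    exact ⟨Implies.rfl (t _), Implies.rfl (t _)⟩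
  | succ m hm ih =>
    obtain ⟨q, rfl⟩ : ∃ q', q = q' + 1 := ⟨q - 1, by omega⟩
    have iso := mul_assoc_isotopy (a := k) (b := m) (c := n)
      (p := m + 1) (q := q + 1) (p' := q) (v := k - 1) (by omega) (by omega) (by omega) (by omega)
      (by omega) (by omega) (by omega) (Or.inl (by omega)) (t k) (t m) (t n) (f k) (f m) (f n)
    have t₁ := mulComp_isTangle (mul_isTangle (a := m) (b := n) (e := q) (by omega) (by omega)
      (by omega)) (t m) (t n)
    have t₂ := mulComp_isTangle (mul_isTangle (a := k) (b := q) (e := q + 1) (by omega) (by omega)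
      (by omega)) (t k) t₁
    have t₃ := mulComp_isTangle (mul_isTangle (a := m + 1) (b := n) (e := q + 1) (by omega)
      (by omega) (by omega)) (t (m + 1)) (t n)
    obtain ⟨h₁, h₂⟩ := ih (q := q) (by omega)
    rw [stack_succ (show k ≤ q by omega)]
    rw [stack_succ hm] at t₃ ⊢
    exact ⟨(implies_of_isotopy t₃ iso).trans
        (Implies.mul (by omega) (by omega) (by omega) (Implies.rfl (t k)) h₁),
      (Implies.mul (by omega) (by omega) (by omega) (Implies.rfl (t k)) h₂).trans
        (implies_of_isotopy_symm t₂ iso)⟩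

theorem condExp_implies (hk : 1 ≤ k) :
    Implies k ((incl (Col.box (k - 1)) (Col.box k)).comp fun _ =>
      (er (Col.box k) (Col.box (k - 1))).comp fun _ => stack k k) (stack k k) := by
  have iso := er_stack_isotopy (k := k) (n := k - 1) (by omega)
  have h := Implies.incl (k := k) (a := k - 1) (b := k) (by omega) (implies_of_isotopy (comp_isTangle
    (er_isTangle (show k - 1 ≤ k by omega)) fun _ => stack_isTangle hk k) iso)
  refine h.trans ?_
  rw [stack_of_le (show k - 1 ≤ k by omega), stack_self]
  exact Consequence.of Basic.condExp

/-- Multiplication of a stack by one more box that is joined to it by `k + 1` strands. -/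
theorem mul_stack_implies_pred (hk : 1 ≤ k) {m : ℕ} (hm : k ≤ m) :
    Implies k (mulComp (Col.box m) (stack k k) (stack k (m + 1))) (stack k m) := by
  have t := stack_isTangle hk
  have f := stack_full hk
  have t₀ := mulComp_isTangle (mul_isTangle (a := k) (b := k) (e := k - 1) (by omega) (by omega)
    (by omega)) (t k) (t k)
  have tE := comp_isTangle (er_isTangle (show k - 1 ≤ k by omega)) fun _ => t k
  have fE := (er_full (show k - 1 ≤ k by omega)).comp fun _ => f k
  rw [stack_succ hm]
  refine (implies_of_isotopy_symm ?_ (mul_assoc_isotopy (a := k) (b := k) (c := m)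
    (p := k - 1) (q := m) (p' := m + 1) (v := k - 1) (by omega) (by omega) (by omega) (by omega)
    (by omega) (by omega) (by omega) (Or.inl (by omega)) (t k) (t k) (t m) (f k) (f k)
      (f m))).trans ?_
  · exact mulComp_isTangle (mul_isTangle (by omega) (by omega) (by omega)) (t k)
      (mulComp_isTangle (mul_isTangle (by omega) (by omega) (by omega)) (t k) (t m))
  have h : Implies k (mulComp (Col.box (k - 1)) (stack k k) (stack k k))
      ((er (Col.box k) (Col.box (k - 1))).comp fun _ => stack k k) := by
    obtain ⟨l, rfl⟩ : ∃ l, k = l + 1 := ⟨k - 1, by omega⟩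
    exact (implies_of_isotopy_symm t₀ (er_mul_isotopy (a := l + 1) (p := l) (by omega) (t _) (t _)
      (f _) (f _))).trans (Implies.er (by omega) (mul_implies_stack _))
  refine (Implies.mul (by omega) (by omega) (by omega) h (Implies.rfl (t m))).trans ?_
  refine (implies_of_isotopy ?_ (mul_incl_isotopy hk hm tE (t m) fE (f m))).trans ?_
  · exact mulComp_isTangle (mul_isTangle (by omega) (by omega) (by omega)) tE (t m)
  exact (Implies.mul (by omega) (by omega) (by omega) (condExp_implies hk)
    (Implies.rfl (t m))).trans (mul_stack_implies hk hm)

/-- The product of two stacks that are joined by at least `k - 1` strands implies a stack. -/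
theorem mul_stacks_implies (hk : 1 ≤ k) {m n p : ℕ} (hm : k ≤ m) (hn : m ≤ n) (hp : k ≤ p)
    (h₁ : n ≤ p + 1) (h₂ : p + k ≤ m + n + 1) :
    Implies k (mulComp (Col.box p) (stack k m) (stack k n)) (stack k p) := by
  have t := stack_isTangle hk
  have f := stack_full hk
  have base : ∀ {n p : ℕ}, k ≤ n → k ≤ p → n ≤ p + 1 → p ≤ n + 1 →
      Implies k (mulComp (Col.box p) (stack k k) (stack k n)) (stack k p) := by
    intro n p hn hp h₁ h₂
    rcases (show n = p + 1 ∨ n = p ∨ p = n + 1 by omega) with rfl | rfl | rfl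
    · exact mul_stack_implies_pred hk hp
    · exact mul_stack_implies hk hn
    · rw [← stack_succ hn]
      exact Implies.rfl (t _)
  induction m, hm using Nat.le_induction generalizing n with
  | base => exact base hn hp h₁ (by omega)
  | succ m hm ih =>
    -- The last box of the first stack is joined to the second stack by `v` strands.
    obtain ⟨v, hv⟩ : ∃ v, v = min (m + 1 + n - p) (k + 1) := ⟨_, rfl⟩
    have hv' : (v = m + 1 + n - p ∧ m + 1 + n ≤ p + k + 1) ∨ (v = k + 1 ∧ p + k + 1 ≤ m + 1 + n) := by
      omega
    obtain ⟨p', hp'⟩ : ∃ p', p' + v = k + n := ⟨k + n - v, by omega⟩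
    have iso := mul_assoc_isotopy (a := m) (b := k) (c := n)
      (p := m + 1) (q := p) (p' := p') (v := v) (by omega) (by omega) (by omega) (by omega)
      (by omega) (by omega) hp' (by omega) (t m) (t k) (t n) (f m) (f k) (f n)
    have h := (mul_stack_stack hk (m := m) (n := k) (q := m + 1) hm le_rfl (by omega)).2
    refine (Implies.mul (by omega) (by omega) (by omega) h (Implies.rfl (t n))).trans
      ((implies_of_isotopy ?_ iso).trans ((Implies.mul (by omega) (by omega) (by omega)
        (Implies.rfl (t m)) (base (by omega) (by omega) (by omega) (by omega))).trans
          (ih (by omega) (by omega) (by omega))))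
    exact mulComp_isTangle (mul_isTangle (by omega) (by omega) (by omega))
      (mulComp_isTangle (mul_isTangle (by omega) (by omega) (by omega)) (t m) (t k)) (t n)

end

end Skein

namespace Skein

open Net Diagram

/-! ### Temperley–Lieb tangles that are equal up to closed loops -/

namespace Diagram

theorem jones_eq_gen {n : ℕ} (hn : 2 ≤ n) : jones n = gen n (n - 2) := by
  have h₁ : 2 * n - (n - 2) = n + 2 := by omega
  have h₂ : n - 2 + 1 = n - 1 := by omega
  have h₃ : 2 * n - 2 - (n - 2) = n := by omega
  have h₄ : 2 * n - 1 - (n - 2) = n + 1 := by omega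
  have h₅ : n - (n - 2) - 2 = 0 := by omega
  have h₆ : anti 0 (n - 2 + 2) 0 n 0 = ∅ := by
    ext ⟨⟨x, p⟩, y, q⟩
    simp only [mem_anti, Set.mem_empty_iff_false, iff_false]
    omega
  rw [gen, h₁, h₂, h₃, h₄, h₅, h₆, Set.union_empty]
  rfl

section

variable {N : Net}

theorem OneEqs.er {n : ℕ} {o : Hom (boundary (Col.box n)) N}
    {w : Hom (boundary (Col.box (n + 1))) N} (E : ErEqs (n + 1) n o w) (F : OneEqs (n + 1) w) :
    OneEqs n o := by
  intro i hi
  rw [E.st (by omega) _ (by omega), if_pos hi, E.st (by omega) _ (by omega), if_neg (by omega)]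
  exact F.joined (by omega)

theorem OneEqs.incl {a b : ℕ} (h : a ≤ b) {o : Hom (boundary (Col.box b)) N}
    {w : Hom (boundary (Col.box a)) N} (E : InclEqs a b o w) (F : OneEqs a w) : OneEqs b o := by
  intro i hi
  rcases Nat.lt_or_ge i a with h' | h'
  · refine (E.left i h').trans ((F.joined (j := 2 * a - 1 - i) (by omega)).trans ?_)
    rw [E.st h _ (by omega), if_neg (by omega)]
    exact congrArg _ (by omega)
  · exact E.joined (by omega)

theorem GenEqs.er {n i : ℕ} (hi : i + 2 ≤ n) {o : Hom (boundary (Col.box n)) N}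
    {w : Hom (boundary (Col.box (n + 1))) N} (E : ErEqs (n + 1) n o w)
    (F : GenEqs (n + 1) i w) : GenEqs n i o := by
  have h := E.st (by omega)
  refine ⟨?_, ?_, ?_⟩
  · rw [h _ (by omega), if_pos (by omega), h _ (by omega), if_pos (by omega)]
    exact F.cap
  · rw [h _ (by omega), if_neg (by omega), h _ (by omega), if_neg (by omega)]
    exact (congrArg _ (by omega)).trans (F.cup.trans (congrArg _ (by omega)))
  · intro j hj h₁ h₂
    rw [h _ (by omega), if_pos (by omega), h _ (by omega), if_neg (by omega)]
    exact F.through (by omega) (by omega)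

theorem GenEqs.incl {n i : ℕ} (hi : i + 2 ≤ n) {o : Hom (boundary (Col.box (n + 1))) N}
    {w : Hom (boundary (Col.box n)) N} (E : InclEqs n (n + 1) o w)
    (F : GenEqs n i w) : GenEqs (n + 1) i o := by
  have left := E.left
  have right : ∀ j, n ≤ j → j < 2 * n → o.st (j + 2) = w.st j := fun j hj hj' => by
    rw [E.st (by omega) _ hj', if_neg (by omega)]
    exact congrArg _ (by omega)
  refine ⟨?_, ?_, ?_⟩
  · exact (left i (by omega)).trans (F.cap.trans (left (i + 1) (by omega)).symm)
  · refine (congrArg _ (by omega)).trans ((right (2 * n - 2 - i) (by omega) (by omega)).trans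
      (F.cup.trans ((right (2 * n - 1 - i) (by omega) (by omega)).symm.trans
      (congrArg _ (by omega)))))
  · intro j hj h₁ h₂
    rcases Nat.lt_or_ge j n with h' | h'
    · refine (left j h').trans ((F.thru j h' h₁ h₂).trans
        ((right _ (by omega) (by omega)).symm.trans (congrArg _ (by omega))))
    · exact E.joined (by omega)

theorem GenEqs.mul {m : ℕ} (hm : 1 ≤ m) {o : Hom (boundary (Col.box (m + 1))) N}
    {a b : Hom (boundary (Col.box m)) N} (E : MulEqs m m (m + 1) o a b) (F : OneEqs m a)
    (G : OneEqs m b) : GenEqs (m + 1) (m - 1) o := by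
  have h := E.st (by omega) (by omega)
  refine ⟨?_, ?_, ?_⟩
  · rw [h _ (by omega), if_pos (by omega), h _ (by omega), if_pos (by omega)]
    exact F.joined (by omega)
  · rw [h _ (by omega), if_neg (by omega), h _ (by omega), if_neg (by omega)]
    exact G.joined (by omega)
  · intro j hj h₁ h₂
    rw [h _ (by omega), if_pos (by omega), h _ (by omega), if_neg (by omega)]
    exact (F.joined (j := 2 * m - 1 - j) (by omega)).trans
      ((E.joined (j := j) (by omega) (by omega)).trans (G.joined (by omega)))

/-- A cap at the points `i`, `i + 1` is moved one step to the right by a generator. -/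
theorem GenEqs.move {m i : ℕ} (hi : i + 3 ≤ m) {o e w e' q : Hom (boundary (Col.box m)) N}
    (E : MulEqs m m m o e w) (E' : MulEqs m m m w e' q) (F : GenEqs m i e)
    (F' : GenEqs m (i + 1) e') (cap : q.st i = q.st (i + 1)) :
    o.st i = o.st (i + 1) ∧ ∀ j < 2 * m, j ≠ i → j ≠ i + 1 → o.st j = q.st j := by
  have oe : ∀ j < m, o.st j = e.st j := fun j hj => E.st_left j (by omega)
  have ow : ∀ j, m ≤ j → j < 2 * m → o.st j = w.st j := fun j hj hj' =>
    (E.st_right (by omega) (by omega) j (by omega) hj').trans (congrArg _ (by omega))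
  have ew : ∀ j j', j + j' + 1 = 2 * m → m ≤ j → e.st j = w.st j' := fun j j' h h' =>
    E.joined (by omega) (by omega)
  have we : ∀ j < m, w.st j = e'.st j := fun j hj => E'.st_left j (by omega)
  have wq : ∀ j, m ≤ j → j < 2 * m → w.st j = q.st j := fun j hj hj' =>
    (E'.st_right (by omega) (by omega) j (by omega) hj').trans (congrArg _ (by omega))
  have eq : ∀ j j', j + j' + 1 = 2 * m → m ≤ j → e'.st j = q.st j' := fun j j' h h' =>
    E'.joined (by omega) (by omega)
  refine ⟨(oe i (by omega)).trans (F.cap.trans (oe (i + 1) (by omega)).symm), ?_⟩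
  intro j hj h₁ h₂
  rcases Nat.lt_or_ge j m with h | h
  · refine (oe j h).trans ((F.thru j h h₁ h₂).trans ((ew _ j (by omega) (by omega)).trans ?_))
    -- The strand at `i + 2` passes through the cap of `e'`, the cup of `e`, the cap of `q` and
    -- the cup of `e'`.
    by_cases h₃ : j = i + 2
    · subst h₃
      refine (we _ h).trans (F'.cap.symm.trans ((we _ (by omega)).symm.trans
        ((ew (2 * m - 2 - i) _ (by omega) (by omega)).symm.trans (F.cup.trans
        ((ew _ i (by omega) (by omega)).trans ((we i (by omega)).trans
        ((F'.thru i (by omega) (by omega) (by omega)).trans ((eq _ i (by omega) (by omega)).trans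
        (cap.trans ((eq (2 * m - 1 - (i + 1)) _ (by omega) (by omega)).symm.trans
        (F'.cup.symm.trans (eq _ _ (by omega) (by omega)))))))))))))
    · exact (we j h).trans ((F'.thru j h h₂ h₃).trans (eq _ j (by omega) (by omega)))
  · exact (ow j h hj).trans (wq j h hj)

/-- A cap at the last two top points is split off by a generator. -/
theorem GenEqs.split {n : ℕ} {o e l q : Hom (boundary (Col.box (n + 2))) N}
    {r : Hom (boundary (Col.box (n + 1))) N}
    (E : MulEqs (n + 2) (n + 2) (n + 2) o e l) (L : InclEqs (n + 1) (n + 2) l r)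
    (R : ErEqs (n + 2) (n + 1) r q) (F : GenEqs (n + 2) n e) (cap : q.st n = q.st (n + 1)) :
    o.st n = o.st (n + 1) ∧ ∀ j < 2 * (n + 2), j ≠ n → j ≠ n + 1 → o.st j = q.st j := by
  have oe : ∀ j < n + 2, o.st j = e.st j := fun j hj => E.st_left j (by omega)
  have ol : ∀ j, n + 2 ≤ j → j < 2 * (n + 2) → o.st j = l.st j := fun j hj hj' =>
    (E.st_right (by omega) (by omega) j (by omega) hj').trans (congrArg _ (by omega))
  have el : ∀ j j', j + j' + 1 = 2 * (n + 2) → n + 2 ≤ j → e.st j = l.st j' := fun j j' h h' =>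
    E.joined (by omega) (by omega)
  have lr : ∀ j < n + 1, l.st j = r.st j := L.left
  have rq : ∀ j < n + 1, r.st j = q.st j := R.left
  refine ⟨(oe n (by omega)).trans (F.cap.trans (oe (n + 1) (by omega)).symm), ?_⟩
  intro j hj h₁ h₂
  rcases (show j < n ∨ j = n + 2 ∨ n + 3 ≤ j by omega) with h | rfl | h
  · exact (oe j (by omega)).trans ((F.thru j (by omega) h₁ h₂).trans
      ((el _ j (by omega) (by omega)).trans ((lr j (by omega)).trans (rq j (by omega)))))
  · refine (ol _ le_rfl hj).trans ((L.joined (j := n + 1) (by omega)).trans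
      ((el (n + 2) _ (by omega) (by omega)).symm.trans ?_))
    refine (congrArg _ (by omega)).trans (F.cup.trans ((el _ n (by omega) (by omega)).trans
      ((lr n (by omega)).trans ((rq n (by omega)).trans (cap.trans (R.joined (by omega)))))))
  · refine (ol _ (by omega) hj).trans ((congrArg _ (by omega)).trans
      ((L.right (j - n - 3) (by omega)).trans ((R.right (j - n - 3) (by omega)).trans
      (congrArg _ (by omega)))))

end

/-! ### Noncrossing matchings -/

theorem Hom.st_eq_none {c : Col} {N : Net} (o : Hom (boundary c) N) {i : ℕ} (h : 2 * c.size ≤ i) :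
    o.st i = none := dif_neg (Nat.not_lt.2 h)

/-- If `a` and `b` are joined, then a strand that has one end between `a` and `b` has its other end
there as well, as the arc from `a` to `b` separates the regions. -/
theorem IsTangle.noncrossing {c : Col} {Q : Diagram c} [IsEmpty Q.Box] (hQ : Q.IsTangle)
    {a b u v : ℕ} (hb : b < 2 * c.size) (hab : Q.out.st a = Q.out.st b)
    (huv : Q.out.st u = Q.out.st v) (hau : a < u) (hub : u < b) : a < v ∧ v < b := by
  classical
  have ha : a < 2 * c.size := by omega
  have hu : u < 2 * c.size := by omega
  have hv : v < 2 * c.size := Hom.lt_of_st (huv.symm.trans (Hom.st_of_lt _ hu))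
  have par : a % 2 ≠ b % 2 := fun e => by have := hQ.eq_of_st_eq ha hab e; omega
  -- the arc meets the boundary exactly at `a` and `b`
  have two : ∀ p, p < 2 * c.size → (Q.out.st p = Q.out.st a ↔ p = a ∨ p = b) := by
    intro p hp
    refine ⟨fun e => ?_, ?_⟩
    · rcases (show p % 2 = a % 2 ∨ p % 2 = b % 2 by omega) with h | h
      · exact Or.inl (hQ.eq_of_st_eq hp e h)
      · exact Or.inr (hQ.eq_of_st_eq hp (e.trans hab) h)
    · rintro (rfl | rfl)
      · rfl
      · exact hab.symm
  let s := Q.out.strand ⟨a, ha⟩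
  have hs : ∀ p : Fin (2 * c.size), (if Q.out.strand p = s then (1 : ZMod 2) else 0) =
      (if p = ⟨a, ha⟩ then 1 else 0) + if p = ⟨b, hb⟩ then 1 else 0 := by
    intro p
    have := two p.val p.isLt
    rw [Hom.st_of_lt _ p.isLt, Hom.st_of_lt _ ha] at this
    have h₁ : Q.out.strand p = s ↔ p.val = a ∨ p.val = b :=
      ⟨fun e => this.1 (congrArg some e), fun e => Option.some.inj (this.2 e)⟩
    have h₂ : a ≠ b := by omega
    simp only [h₁, Fin.ext_iff]
    by_cases h : p.val = a
    · simp [h, h₂]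
    · simp [h]
  obtain ⟨g, hg⟩ := hQ.jordan (fun x => if x = s then (1 : ZMod 2) else 0) (by
    refine (Finset.sum_congr rfl fun p _ => hs p).trans ?_
    rw [Finset.sum_add_distrib, Finset.sum_ite_eq', Finset.sum_ite_eq']
    simp only [Finset.mem_univ, if_true]
    decide) (fun i => isEmptyElim i)
  have step : ∀ j, j < 2 * c.size → j ≠ a → j ≠ b → g (Q.out.rg j) = g (Q.out.rg (j + 1)) := by
    intro j hj h₁ h₂
    have := jump Q.out hg hj
    rw [if_neg] at this
    · have two : ∀ {a b : ZMod 2}, 0 = a + b → a = b := by decide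
      exact two this
    · intro e
      have h := (two j hj).1 ((Hom.st_of_lt _ hj).trans ((congrArg some e).trans
        (Hom.st_of_lt _ ha).symm))
      omega
  have one : g (Q.out.rg a) ≠ g (Q.out.rg (a + 1)) := by
    have := jump Q.out hg ha
    rw [if_pos rfl] at this
    have one_ne : ∀ {a b : ZMod 2}, 1 = a + b → a ≠ b := by decide
    exact one_ne this
  have before : ∀ j ≤ a, g (Q.out.rg j) = g (Q.out.rg 0) := by
    intro j
    induction j with
    | zero => exact fun _ => rfl
    | succ j ih =>
      intro hj
      exact (step j (by omega) (by omega) (by omega)).symm.trans (ih (by omega))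
  have inside : ∀ j, a + 1 ≤ j → j ≤ b → g (Q.out.rg j) = g (Q.out.rg (a + 1)) := by
    intro j hj
    induction j, hj using Nat.le_induction with
    | base => exact fun _ => rfl
    | succ j hj ih =>
      intro hj'
      exact (step j (by omega) (by omega) (by omega)).symm.trans (ih (by omega))
  have after : ∀ d j, j + d = 2 * c.size → b < j → g (Q.out.rg j) = g (Q.out.rg 0) := by
    intro d
    induction d with
    | zero =>
      rintro j rfl -
      exact congrArg g Q.out.rg_two_mul_size
    | succ d ih =>
      intro j hj hj'
      exact (step j (by omega) (by omega) (by omega)).trans (ih _ (by omega) (by omega))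
  have hne : g (Q.out.rg 0) ≠ g (Q.out.rg (a + 1)) := (before a le_rfl) ▸ one
  have gu : g (Q.out.rg u) = g (Q.out.rg (a + 1)) := inside u hau hub.le
  have gu' : g (Q.out.rg (u + 1)) = g (Q.out.rg (a + 1)) := inside (u + 1) (by omega) hub
  have gv : g (Q.out.rg v) = g (Q.out.rg (a + 1)) := by
    by_cases h : u % 2 = v % 2
    · rw [← (Hom.rg_of_st_eq huv hu h).1, gu]
    · rw [← (Hom.rg_of_st_eq' huv hu h).2, gu']
  have hva : ¬ v ≤ a := fun h => hne ((before v h).symm.trans gv)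
  have hvb : ¬ b < v := fun h => hne ((after (2 * c.size - v) v (by omega) h).symm.trans gv)
  have hvb' : v ≠ b := by
    rintro rfl
    have := (two u hu).1 (huv.trans hab.symm)
    omega
  omega

/-- If no two neighbouring points at the top are joined, then all strands are vertical. -/
theorem IsTangle.oneEqs_of_no_cap {m : ℕ} {Q : Diagram (Col.box m)} [IsEmpty Q.Box]
    (hQ : Q.IsTangle) (h : ∀ i, i + 2 ≤ m → Q.out.st i ≠ Q.out.st (i + 1)) :
    OneEqs m Q.out := by
  -- An innermost arc between points at the top would be a cap.
  have arc : ∀ d i, i + d < m → 0 < d → Q.out.st i ≠ Q.out.st (i + d) := by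
    intro d
    induction d using Nat.strong_induction_on with
    | _ d ih =>
      intro i hi hd e
      rcases (show d = 1 ∨ 2 ≤ d by omega) with rfl | hd'
      · exact h i (by omega) e
      obtain ⟨v, hv, e', hp⟩ := hQ.exists_mate (i := i + 1) (show i + 1 < 2 * m by omega)
      obtain ⟨h₁, h₂⟩ := hQ.noncrossing (show i + d < 2 * m by omega) e e' (by omega) (by omega)
      refine ih (v - (i + 1)) (by omega) (i + 1) (by omega) (by omega) (e'.trans ?_)
      exact congrArg _ (by omega)
  -- So the points at the top are joined to points at the bottom, in reverse order.
  have hm : ∀ i, ∃ j, i < m → m ≤ j ∧ j < 2 * m ∧ Q.out.st i = Q.out.st j := by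
    intro i
    by_cases hi : i < m
    · obtain ⟨j, hj, e, hp⟩ := hQ.exists_mate (i := i) (show i < 2 * m by omega)
      refine ⟨j, fun _ => ⟨?_, hj, e⟩⟩
      by_contra hj'
      rcases Nat.lt_or_gt_of_ne (show i ≠ j from fun e => hp (congrArg (· % 2) e)) with h' | h'
      · exact arc (j - i) i (by omega) (by omega) (e.trans (congrArg _ (by omega)))
      · exact arc (i - j) j (by omega) (by omega) (e.symm.trans (congrArg _ (by omega)))
    · exact ⟨0, fun h => absurd h hi⟩
  choose μ hμ using hm
  have anti : ∀ i, i + 1 < m → μ (i + 1) < μ i := by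
    intro i hi
    obtain ⟨h₁, h₂, h₃⟩ := hμ i (by omega)
    obtain ⟨h₁', h₂', h₃'⟩ := hμ (i + 1) hi
    exact (hQ.noncrossing (show μ i < 2 * m from h₂) h₃ h₃' (by omega) (by omega)).2
  have upper : ∀ i, i < m → μ i + i + 1 ≤ 2 * m := by
    intro i
    induction i with
    | zero => exact fun hi => by have := hμ 0 hi; omega
    | succ i ih => exact fun hi => by have := ih (by omega); have := anti i hi; omega
  have lower : ∀ d i, i + d + 1 = m → 2 * m ≤ μ i + i + 1 := by
    intro d
    induction d with
    | zero => exact fun i hi => by have := hμ i (by omega); omega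
    | succ d ih =>
      intro i hi
      have := ih (i + 1) (by omega)
      have := anti i (by omega)
      omega
  intro i hi
  have h₁ := upper i hi
  have h₂ := lower (m - 1 - i) i (by omega)
  exact (hμ i hi).2.2.trans (congrArg _ (by omega))

end Diagram

section

variable {k : ℕ}

theorem implies_of_matching_lt {c : Col} {Q Y : Diagram c} [IsEmpty Q.Box] [IsEmpty Y.Box]
    (hQ : Q.IsTangle) (hY : Y.IsTangle)
    (h : ∀ i j, i < 2 * c.size → j < 2 * c.size → Q.out.st i = Q.out.st j →
      Y.out.st i = Y.out.st j) : Implies k Q Y := by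
  refine implies_of_matching hQ hY fun i j e => ?_
  by_cases hi : i < 2 * c.size
  · exact h i j hi (Hom.lt_of_st (e.symm.trans (Hom.st_of_lt _ hi))) e
  by_cases hj : j < 2 * c.size
  · exact h i j (Hom.lt_of_st (e.trans (Hom.st_of_lt _ hj))) hj e
  · rw [Diagram.Hom.st_eq_none _ (Nat.not_lt.1 hi), Diagram.Hom.st_eq_none _ (Nat.not_lt.1 hj)]

/-- A map of nets that respects the external boundaries preserves the matching of the points. -/
theorem implies_of_hom {c : Col} {Q Y : Diagram c} [IsEmpty Q.Box] [IsEmpty Y.Box]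
    (hQ : Q.IsTangle) (hY : Y.IsTangle) (h : ∃ f : Hom Q.net Y.net, f.comp Q.out = Y.out) :
    Implies k Q Y ∧ Implies k Y Q := by
  obtain ⟨f, hf⟩ := h
  have key : ∀ i j, Q.out.st i = Q.out.st j → Y.out.st i = Y.out.st j := fun i j e => by
    rw [← hf]
    exact st_comp_eq f e
  exact ⟨implies_of_matching hQ hY key, implies_of_matching_lt hY hQ fun i j hi hj e =>
    hQ.matching_symm hY key hi hj e⟩

/-- If `Q` and `Y` have the same cap at the points `i`, `i + 1`, then only the other points have to be
compared. -/
theorem implies_of_cap {m i : ℕ} {Q Y : Diagram (Col.box m)} [IsEmpty Q.Box] [IsEmpty Y.Box]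
    (hQ : Q.IsTangle) (hY : Y.IsTangle) (hi : i + 2 ≤ m) (cap : Q.out.st i = Q.out.st (i + 1))
    (f : Hom Q.net Y.net) (h : Y.out.st i = Y.out.st (i + 1) ∧
      ∀ j < 2 * m, j ≠ i → j ≠ i + 1 → Y.out.st j = (f.comp Q.out).st j) : Implies k Q Y := by
  have joined : ∀ a b, a < 2 * m → b < 2 * m → Q.out.st a = Q.out.st b →
      (a = i ∨ a = i + 1) → (b = i ∨ b = i + 1) := by
    intro a b ha hb e h'
    have e' : Q.out.st b = Q.out.st i := by
      rcases h' with rfl | rfl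
      · exact e.symm
      · exact e.symm.trans cap.symm
    by_cases hp : b % 2 = i % 2
    · exact Or.inl (hQ.eq_of_st_eq hb e' hp)
    · exact Or.inr (hQ.eq_of_st_eq hb (e'.trans cap) (by omega))
  refine implies_of_matching_lt hQ hY fun a b ha hb e => ?_
  by_cases h₁ : a = i ∨ a = i + 1
  · rcases h₁ with rfl | rfl <;> rcases joined _ _ ha hb e (by omega) with rfl | rfl
    · rfl
    · exact h.1
    · exact h.1.symm
    · rfl
  · have h₂ : ¬ (b = i ∨ b = i + 1) := fun h' => h₁ (joined _ _ hb ha e.symm h')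
    rw [h.2 a ha (by omega) (by omega), h.2 b hb (by omega) (by omega)]
    exact st_comp_eq f e

end

end Skein

namespace Skein

open Net Diagram

section

variable {k : ℕ}

/-! ### Vertical strands -/

theorem erComp_isTangle {n : ℕ} {S : Diagram (Col.box (n + 1))} (hS : S.IsTangle) :
    ((er (Col.box (n + 1)) (Col.box n)).comp fun _ => S).IsTangle :=
  comp_isTangle (er_isTangle (by omega)) fun _ => hS

theorem inclComp_isTangle {a b : ℕ} (h : a ≤ b) {S : Diagram (Col.box a)} (hS : S.IsTangle) :
    ((incl (Col.box a) (Col.box b)).comp fun _ => S).IsTangle :=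
  comp_isTangle (incl_isTangle h) fun _ => hS

theorem one_implies_er (n : ℕ) : Implies k (one (Col.box n))
    ((er (Col.box (n + 1)) (Col.box n)).comp fun _ => one (Col.box (n + 1))) :=
  (implies_of_hom (one_isTangle n) (erComp_isTangle (one_isTangle _)) (exists_one_hom
    (OneEqs.er (erComp_eqs (by omega) _) ((one_eqs (n + 1)).comp _)))).1

theorem one_implies_incl {a b : ℕ} (h : a ≤ b) : Implies k (one (Col.box b))
    ((incl (Col.box a) (Col.box b)).comp fun _ => one (Col.box a)) :=
  (implies_of_hom (one_isTangle b) (inclComp_isTangle h (one_isTangle _)) (exists_one_hom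
    (OneEqs.incl h (inclComp_eqs h _) ((one_eqs a).comp _)))).1

theorem gen_implies_er {n i : ℕ} (hi : i + 2 ≤ n) : Implies k (gen n i)
    ((er (Col.box (n + 1)) (Col.box n)).comp fun _ => gen (n + 1) i) :=
  (implies_of_hom (gen_isTangle hi) (erComp_isTangle (gen_isTangle (by omega)))
    (exists_gen_hom hi (GenEqs.er hi (erComp_eqs (by omega) _)
      ((gen_eqs (by omega)).comp _)))).1

theorem gen_implies_incl {n i : ℕ} (hi : i + 2 ≤ n) : Implies k (gen (n + 1) i)
    ((incl (Col.box n) (Col.box (n + 1))).comp fun _ => gen n i) :=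
  (implies_of_hom (gen_isTangle (by omega)) (inclComp_isTangle (by omega) (gen_isTangle hi))
    (exists_gen_hom (by omega) (GenEqs.incl hi (inclComp_eqs (by omega) _)
      ((gen_eqs hi).comp _)))).1

theorem gen_implies_mul {m : ℕ} (hm : 1 ≤ m) : Implies k (gen (m + 1) (m - 1))
    (mulComp (Col.box (m + 1)) (one (Col.box m)) (one (Col.box m))) :=
  (implies_of_hom (gen_isTangle (by omega)) (mulComp_isTangle
    (mul_isTangle (by omega) (by omega) (by omega)) (one_isTangle m) (one_isTangle m))
    (exists_gen_hom (by omega) (GenEqs.mul hm (mulComp_eqs (by omega) (by omega) (by omega) _ _)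
      ((one_eqs m).comp _) ((one_eqs m).comp _)))).1

/-- The depth template, closed up on the right, gives a product of two `k`-boxes. -/
theorem one_implies_stack_self (hk : 1 ≤ k) : Implies k (one (Col.box k)) (stack k k) := by
  have t := stack_isTangle hk
  have f := stack_full hk
  refine (one_implies_er k).trans ((Implies.er (by omega) (Consequence.of Basic.depth)).trans ?_)
  show Implies k ((er (Col.box (k + 1)) (Col.box k)).comp fun _ => stack k (k + 1)) (stack k k)
  rw [stack_succ le_rfl]
  refine (implies_of_isotopy (erComp_isTangle (mulComp_isTangle (mul_isTangle (by omega) (by omega)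
    (by omega)) (t k) (t k))) (er_mul_isotopy (by omega) (t k) (t k) (f k) (f k))).trans
    (mul_implies_stack k)

/-- The first `k + 1` strands are replaced by a product of two `k`-boxes. The remaining ones are moved
between the two boxes, which makes `n - 2` strands there, so that induction applies. -/
theorem one_implies_stack_of_le (hk : 1 ≤ k) {n : ℕ} (hn : k ≤ n) :
    Implies k (one (Col.box n)) (stack k n) := by
  have t := stack_isTangle hk
  have f := stack_full hk
  induction n using Nat.strong_induction_on with
  | _ n ih =>
    rcases (show n = k ∨ n = k + 1 ∨ k + 2 ≤ n by omega) with rfl | rfl | h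
    · exact one_implies_stack_self hk
    · exact Consequence.of Basic.depth
    obtain ⟨m, rfl⟩ : ∃ m, n = m + 1 := ⟨n - 1, by omega⟩
    refine (one_implies_incl (show k + 1 ≤ m + 1 by omega)).trans
      ((Implies.incl (by omega) (Consequence.of Basic.depth)).trans ?_)
    show Implies k ((incl (Col.box (k + 1)) (Col.box (m + 1))).comp fun _ => stack k (k + 1)) _
    rw [stack_succ le_rfl, stack_succ (show k ≤ m by omega)]
    refine (implies_of_isotopy (inclComp_isTangle (by omega) (mulComp_isTangle (mul_isTangle
      (by omega) (by omega) (by omega)) (t k) (t k))) (incl_mul_isotopy hk (by omega) (t k) (t k)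
      (f k) (f k))).trans ?_
    refine Implies.mul (by omega) (by omega) (by omega) (Implies.rfl (t k)) ?_
    exact (Implies.mul (by omega) (by omega) (by omega) (ih (m - 1) (by omega) (by omega))
      (Implies.rfl (t k))).trans (mul_stack_stack hk (by omega) le_rfl (by omega)).1

/-! ### Expectations and inclusions of stacks -/

theorem incl_implies_stack (hk : 1 ≤ k) {n : ℕ} (hn : k ≤ n) :
    Implies k (incl (Col.box k) (Col.box n)) (stack k n) := by
  have t := stack_isTangle hk
  have f := stack_full hk
  refine (implies_of_isotopy_symm (incl_isTangle hn) (incl_stack_isotopy hn)).trans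
    ((implies_of_isotopy (inclComp_isTangle hn (t k)) (incl_isotopy_mul_one hn (t k) (f k))).trans
    ((Implies.mul (by omega) (by omega) (by omega) (Implies.rfl (t k))
      (one_implies_stack_of_le hk hn)).trans (mul_stack_implies hk hn)))

theorem inclComp_stack_implies_of_le (hk : 1 ≤ k) {n : ℕ} (hn : k ≤ n) :
    Implies k ((incl (Col.box n) (Col.box (n + 1))).comp fun _ => stack k n) (stack k (n + 1)) := by
  have t := stack_isTangle hk
  have f := stack_full hk
  exact (implies_of_isotopy (inclComp_isTangle (by omega) (t n)) (incl_isotopy_mul_one (by omega)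
    (t n) (f n))).trans ((Implies.mul (by omega) (by omega) (by omega) (Implies.rfl (t n))
    (one_implies_stack_of_le hk (show k ≤ n + 1 by omega))).trans
    (mul_stacks_implies hk hn (by omega) (by omega) (by omega) (by omega)))

/-- Below `k` the stacks are expectations of each other. -/
theorem er_stack_implies_of_lt (hk : 1 ≤ k) {n : ℕ} (hn : n < k) :
    Implies k ((er (Col.box (n + 1)) (Col.box n)).comp fun _ => stack k (n + 1)) (stack k n) ∧
      Implies k (stack k n) ((er (Col.box (n + 1)) (Col.box n)).comp fun _ => stack k (n + 1)) := by
  have t := stack_isTangle hk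
  have f := stack_full hk
  have tE := fun (m : ℕ) (hm : m ≤ k) => comp_isTangle (er_isTangle hm) fun _ => t k
  have iso := er_er_isotopy (d := k) (c := n + 1) (b := n) (by omega) (by omega) (t k) (f k)
  have iso₁ := er_stack_isotopy (k := k) (n := n + 1) (by omega)
  have iso₂ := er_stack_isotopy (k := k) (n := n) (by omega)
  constructor
  · exact (Implies.er (by omega) (implies_of_isotopy_symm (t _) iso₁)).trans
      ((implies_of_isotopy_symm (erComp_isTangle (tE _ (by omega))) iso).trans
      (implies_of_isotopy (tE n (by omega)) iso₂))
  · exact (implies_of_isotopy_symm (t n) iso₂).trans ((implies_of_isotopy (tE n (by omega)) iso).trans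
      (Implies.er (by omega) (implies_of_isotopy (tE _ (by omega)) iso₁)))

theorem er_stack_implies (hk : 1 ≤ k) (n : ℕ) :
    Implies k ((er (Col.box (n + 1)) (Col.box n)).comp fun _ => stack k (n + 1)) (stack k n) := by
  have t := stack_isTangle hk
  have f := stack_full hk
  rcases Nat.lt_or_ge n k with h | h
  · exact (er_stack_implies_of_lt hk h).1
  · exact (implies_of_isotopy (erComp_isTangle (t _)) (er_isotopy_mul_one (t _) (f _))).trans
      ((Implies.mul (by omega) (by omega) (by omega) (Implies.rfl (t _))
      (one_implies_stack_of_le hk (show k ≤ n + 1 by omega))).trans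
      (mul_stacks_implies hk (by omega) le_rfl h (by omega) (by omega)))

/-- Downward induction: a statement that holds from `k` on and passes from `n + 1` to `n`. -/
theorem of_le_of_succ {P : ℕ → Prop} (k : ℕ) (h : ∀ n, k ≤ n → P n)
    (h' : ∀ n, n < k → P (n + 1) → P n) (n : ℕ) : P n := by
  rcases Nat.lt_or_ge n k with hn | hn
  · exact Nat.decreasingInduction (motive := fun m _ => P m) (fun m hm ih => h' m hm ih)
      (h k le_rfl) hn.le
  · exact h n hn

theorem one_implies_stack (hk : 1 ≤ k) (n : ℕ) : Implies k (one (Col.box n)) (stack k n) :=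
  of_le_of_succ k (fun _ => one_implies_stack_of_le hk) (fun n _ ih =>
    (one_implies_er n).trans ((Implies.er (by omega) ih).trans (er_stack_implies hk n))) n

/-- From `k` strands on, a generator is an inclusion of a smaller one or, if it is the last one, a product
of two vertical tangles. -/
theorem gen_implies_stack_of_le (hk : 1 ≤ k) {n : ℕ} (hn : k ≤ n) :
    ∀ i, i + 2 ≤ n → Implies k (gen n i) (stack k n) := by
  induction n, hn using Nat.le_induction with
  | base =>
    intro i hi
    -- the generators of `k` strands are the images of the Jones projections
    have up : ∀ m, i + 2 ≤ m → m ≤ k → Implies k (gen m i)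
        ((incl (Col.box (i + 2)) (Col.box m)).comp fun _ => gen (i + 2) i) := by
      intro m hm _
      refine (implies_of_hom (gen_isTangle hm) (inclComp_isTangle hm (gen_isTangle le_rfl))
        (exists_gen_hom hm ?_)).1
      have E := inclComp_eqs hm (gen (i + 2) i)
      have F := (gen_eqs (n := i + 2) (i := i) le_rfl).comp
        (compR (incl (Col.box (i + 2)) (Col.box m)) (fun _ => gen (i + 2) i) (0 : Fin 1))
      have right : ∀ j j', j + 2 * (i + 2) = j' + 2 * m → i + 2 ≤ j' → j < 2 * m →
          ((incl (Col.box (i + 2)) (Col.box m)).comp fun _ => gen (i + 2) i).out.st j =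
          ((compR (incl (Col.box (i + 2)) (Col.box m)) (fun _ => gen (i + 2) i)
            (0 : Fin 1)).comp (gen (i + 2) i).out).st j' := fun j j' h₁ h₂ h₃ =>
        ((congrArg _ (by omega)).trans ((E.right (j' - (i + 2)) (by omega)).trans
          (congrArg _ (by omega))))
      refine ⟨?_, ?_, ?_⟩
      · exact (E.left i (by omega)).trans (F.cap.trans (E.left (i + 1) (by omega)).symm)
      · exact (right _ _ (by omega) (by omega) (by omega)).trans
          (F.cup.trans (right _ _ (by omega) (by omega) (by omega)).symm)
      · intro j hj h₁ h₂
        rcases Nat.lt_or_ge j i with h | h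
        · exact (E.left j (by omega)).trans ((F.thru j (by omega) h₁ h₂).trans
            (right _ _ (by omega) (by omega) (by omega)).symm)
        · exact E.joined (by omega)
    refine (up k hi le_rfl).trans ?_
    have := Consequence.of (Basic.jones (k := k) (i + 2) (by omega) hi)
    rw [jones_eq_gen (show 2 ≤ i + 2 by omega)] at this
    rw [stack_self]
    exact this
  | succ n hn ih =>
    intro i hi
    rcases Nat.lt_or_ge (i + 1) n with h | h
    · exact (gen_implies_incl (by omega)).trans ((Implies.incl (by omega) (ih i (by omega))).trans
        (inclComp_stack_implies_of_le hk hn))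
    · obtain rfl : i = n - 1 := by omega
      exact (gen_implies_mul (by omega)).trans ((Implies.mul (by omega) (by omega) (by omega)
        (one_implies_stack hk n) (one_implies_stack hk n)).trans
        (mul_stacks_implies hk hn le_rfl (by omega) (by omega) (by omega)))

theorem gen_implies_stack (hk : 1 ≤ k) (n : ℕ) :
    ∀ i, i + 2 ≤ n → Implies k (gen n i) (stack k n) :=
  of_le_of_succ (P := fun n => ∀ i, i + 2 ≤ n → Implies k (gen n i) (stack k n)) k
    (fun _ hn => gen_implies_stack_of_le hk hn) (fun n _ ih i hi =>
      (gen_implies_er hi).trans ((Implies.er (by omega) (ih i (by omega))).trans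
        (er_stack_implies hk n))) n

theorem jones_implies_stack (hk : 1 ≤ k) {n : ℕ} (hn : 2 ≤ n) :
    Implies k (jones n) (stack k n) := by
  rw [jones_eq_gen hn]
  exact gen_implies_stack hk n (n - 2) (by omega)

/-- Inclusions and products below `k` are reduced to those of the next colours. -/
theorem incl_mul_stack_implies (hk : 1 ≤ k) (n : ℕ) :
    Implies k ((incl (Col.box n) (Col.box (n + 1))).comp fun _ => stack k n) (stack k (n + 1)) ∧
      Implies k (mulComp (Col.box n) (stack k n) (stack k n)) (stack k n) := by
  have t := stack_isTangle hk
  have f := stack_full hk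
  have large : ∀ n, k ≤ n →
      Implies k ((incl (Col.box n) (Col.box (n + 1))).comp fun _ => stack k n) (stack k (n + 1)) ∧
        Implies k (mulComp (Col.box n) (stack k n) (stack k n)) (stack k n) := fun n hn =>
    ⟨inclComp_stack_implies_of_le hk hn,
      mul_stacks_implies hk hn le_rfl hn (by omega) (by omega)⟩
  refine (of_le_of_succ (P := fun n => (Implies k ((incl (Col.box n) (Col.box (n + 1))).comp
      fun _ => stack k n) (stack k (n + 1)) ∧
      Implies k (mulComp (Col.box n) (stack k n) (stack k n)) (stack k n)) ∧
      Implies k (mulComp (Col.box (n + 1)) (stack k (n + 1)) (stack k (n + 1)))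
        (stack k (n + 1))) k
    (fun n hn => ⟨large n hn, (large (n + 1) (by omega)).2⟩) ?_ n).1
  -- The basic construction from `n` to `n + 1` uses the product of colour `n + 2`, so two colours
  -- are carried along.
  rintro n hn ⟨⟨h₁, h₂⟩, h₃⟩
  obtain ⟨e₁, e₂⟩ := er_stack_implies_of_lt hk hn
  have hg := gen_implies_stack hk (n + 2) n le_rfl
  have tE := erComp_isTangle (t (n + 1))
  have hi : Implies k ((incl (Col.box n) (Col.box (n + 1))).comp fun _ => stack k n)
      (stack k (n + 1)) := by
    refine (Implies.incl (by omega) e₂).trans ((implies_of_isotopy (inclComp_isTangle (by omega) tE)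
      (incl_er_isotopy (t _) (f _))).trans ((Implies.er (by omega) (Implies.mul (by omega)
      (by omega) (by omega) hg ((Implies.mul (by omega) (by omega) (by omega) h₁ hg).trans
      h₃))).trans ((Implies.er (by omega) h₃).trans (er_stack_implies hk (n + 1)))))
  refine ⟨⟨hi, ?_⟩, h₂⟩
  refine (Implies.mul (by omega) (by omega) (by omega) e₂ (Implies.rfl (t n))).trans
    ((implies_of_isotopy (mulComp_isTangle (mul_isTangle (by omega) (by omega) (by omega)) tE (t n))
    (mul_er_isotopy (t _) (t _) (f _) (f _))).trans ((Implies.er (by omega)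
    ((Implies.mul (by omega) (by omega) (by omega) (Implies.rfl (t _)) hi).trans h₂)).trans e₁))

/-! ### Templates for Temperley–Lieb tangles -/

/-- A Temperley–Lieb tangle with a cap at the points `i`, `i + 1` is a product of generators and of an
inclusion of a smaller Temperley–Lieb tangle. The induction is on the number `d` of steps by
which the cap has to be moved to the right. -/
theorem cap_implies_stack (hk : 1 ≤ k) {n : ℕ}
    (ih : ∀ Q : Diagram (Col.box (n + 1)), Q.IsTangle → IsEmpty Q.Box →
      Implies k Q (stack k (n + 1))) (d : ℕ) : ∀ (i : ℕ), i + d = n →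
    ∀ Q : Diagram (Col.box (n + 2)), Q.IsTangle → IsEmpty Q.Box → Q.out.st i = Q.out.st (i + 1) →
      Implies k Q (stack k (n + 2)) := by
  have hm := (incl_mul_stack_implies hk (n + 2)).2
  have tm : (mul (Col.box (n + 2)) (Col.box (n + 2)) (Col.box (n + 2))).IsTangle :=
    mul_isTangle (by omega) (by omega) (by omega)
  induction d with
  | zero =>
    rintro i rfl Q hQ _ cap
    have tE := erComp_isTangle hQ
    have tI := inclComp_isTangle (show i + 1 ≤ i + 2 by omega) tE
    have tG : (gen (i + 2) i).IsTangle := gen_isTangle le_rfl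
    refine Implies.trans (implies_of_cap hQ (mulComp_isTangle tm tG tI) le_rfl cap
      (((mulR (Col.box (i + 2)) (gen (i + 2) i) _).comp (compR (incl (Col.box (i + 1))
        (Col.box (i + 2))) (fun _ => _) (0 : Fin 1))).comp (compR (er (Col.box (i + 2))
        (Col.box (i + 1))) (fun _ => Q) (0 : Fin 1)))
      (GenEqs.split (mulComp_eqs (by omega) (by omega) (by omega) _ _)
        ((inclComp_eqs (by omega) _).comp _) (((erComp_eqs (by omega) Q).comp _).comp _)
        ((gen_eqs le_rfl).comp _) (st_comp_eq _ cap))) ?_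
    exact (Implies.mul (by omega) (by omega) (by omega) (gen_implies_stack hk _ i le_rfl)
      ((Implies.incl (by omega) (ih _ tE inferInstance)).trans
        (incl_mul_stack_implies hk (i + 1)).1)).trans hm
  | succ d ihd =>
    intro i hi Q hQ _ cap
    have tG : (gen (n + 2) i).IsTangle := gen_isTangle (by omega)
    have tG' : (gen (n + 2) (i + 1)).IsTangle := gen_isTangle (by omega)
    have tW := mulComp_isTangle tm tG' hQ
    refine Implies.trans (implies_of_cap hQ (mulComp_isTangle tm tG tW) (by omega) cap
      ((mulR (Col.box (n + 2)) (gen (n + 2) i) _).comp (mulR _ _ Q))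
      (GenEqs.move (by omega) (mulComp_eqs (by omega) (by omega) (by omega) _ _)
        ((mulComp_eqs (by omega) (by omega) (by omega) (gen (n + 2) (i + 1)) Q).comp _)
        ((gen_eqs (by omega)).comp _) (((gen_eqs (by omega)).comp _).comp _)
        (st_comp_eq _ cap))) ?_
    have E := mulComp_eqs (a := n + 2) (b := n + 2) (e := n + 2) (by omega) (by omega) (by omega)
      (gen (n + 2) (i + 1)) Q
    have F := (gen_eqs (n := n + 2) (i := i + 1) (by omega)).comp
      (mulL (Col.box (n + 2)) (gen (n + 2) (i + 1)) Q)
    exact (Implies.mul (by omega) (by omega) (by omega) (gen_implies_stack hk _ i (by omega))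
      (ihd (i + 1) (by omega) _ tW inferInstance ((E.st_left _ (by omega)).trans
        (F.cap.trans (E.st_left _ (by omega)).symm)))).trans hm

/-- A Temperley–Lieb tangle has a cap or consists of vertical strands, up to closed loops. -/
theorem tl_implies_stack (hk : 1 ≤ k) (n : ℕ) :
    ∀ Q : Diagram (Col.box n), Q.IsTangle → IsEmpty Q.Box → Implies k Q (stack k n) := by
  induction n with
  | zero =>
    intro Q hQ _
    exact (implies_of_hom (one_isTangle 0) hQ (exists_one_hom fun i hi => by omega)).2.trans
      (one_implies_stack hk 0)
  | succ n ih =>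
    intro Q hQ _
    by_cases h : ∀ i, i + 2 ≤ n + 1 → Q.out.st i ≠ Q.out.st (i + 1)
    · exact (implies_of_hom (one_isTangle _) hQ (exists_one_hom
        (hQ.oneEqs_of_no_cap h))).2.trans (one_implies_stack hk _)
    · push Not at h
      obtain ⟨i, hi, e⟩ := h
      obtain ⟨m, rfl⟩ : ∃ m, n = m + 1 := ⟨n - 1, by omega⟩
      exact cap_implies_stack hk ih (m - i) i (by omega) Q hQ inferInstance e

/-! ### Shifts and left expectations -/

theorem shift_stack_implies (hk : 1 ≤ k) {n : ℕ} (hn : k ≤ n) :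
    Implies k ((shift n).comp fun _ => stack k n) (stack k (n + 2)) := by
  have t := stack_isTangle hk
  have f := stack_full hk
  have tS := fun n => comp_isTangle (shift_isTangle n) fun _ => t n
  have base : Implies k ((shift k).comp fun _ => stack k k) (stack k (k + 2)) :=
    (implies_of_isotopy (tS k) (shift_stack_isotopy k)).trans (Consequence.of Basic.shift)
  induction n, hn using Nat.le_induction with
  | base => exact base
  | succ n hn ih =>
    have tS' := tS (n + 1)
    rw [stack_succ hn] at tS' ⊢
    exact (implies_of_isotopy tS' (shift_mul_isotopy (by omega) (by omega) (by omega) (t k) (t n)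
      (f k) (f n))).trans ((Implies.mul (by omega) (by omega) (by omega) base ih).trans
      (mul_stacks_implies hk (by omega) (by omega) (by omega) (by omega) (by omega)))

theorem el_stack_implies (hk : 1 ≤ k) (n : ℕ) :
    1 ≤ n → Implies k ((el n).comp fun _ => stack k n) (stack k n) := by
  have t := stack_isTangle hk
  have f := stack_full hk
  refine of_le_of_succ (P := fun n => 1 ≤ n → Implies k ((el n).comp fun _ => stack k n)
    (stack k n)) k ?_ ?_ n
  · intro n hk' hn
    refine (implies_of_isotopy (comp_isTangle (el_isTangle hn) fun _ => t n)
      (el_isotopy hn (t n) (f n))).trans ?_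
    refine (Implies.mul (by omega) (by omega) (by omega) ((Implies.mul (by omega) (by omega)
      (by omega) (tl_implies_stack hk _ _ (arcRight_isTangle (by omega)) inferInstance)
      (shift_stack_implies hk hk')).trans (mul_stacks_implies hk (by omega) le_rfl (by omega)
        (by omega) (by omega)))
      (tl_implies_stack hk _ _ (arcLeft_isTangle (by omega)) inferInstance)).trans
      (mul_stacks_implies hk (by omega) le_rfl hk' (by omega) (by omega))
  · intro n hn ih hn'
    obtain ⟨e₁, e₂⟩ := er_stack_implies_of_lt hk hn
    exact (Implies.el hn' e₂).trans ((implies_of_isotopy (comp_isTangle (el_isTangle hn') fun _ =>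
      erComp_isTangle (t (n + 1))) (el_er_isotopy hn' (t _) (f _))).trans
      ((Implies.er (by omega) (ih (by omega))).trans e₁))

/-! ### Templates for the colour `0₋` -/

theorem tangleT_zeroMinus_isTangle (hk : 1 ≤ k) : (tangleT k Col.zeroMinus).IsTangle :=
  er_zeroMinus_isTangle hk

theorem tangleT_zeroMinus_full : (tangleT k Col.zeroMinus).Full := er_zeroMinus_full k

/-- `T^{0₋}` is the expectation of `T^1`. -/
theorem er_zeroMinus_stack_implies (hk : 1 ≤ k) :
    Implies k ((er (Col.box 1) Col.zeroMinus).comp fun _ => stack k 1) (tangleT k Col.zeroMinus) ∧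
      Implies k (tangleT k Col.zeroMinus)
        ((er (Col.box 1) Col.zeroMinus).comp fun _ => stack k 1) := by
  have t := stack_isTangle hk
  have f := stack_full hk
  have tE := comp_isTangle (er_zeroMinus_isTangle hk) fun _ => t k
  have tE₁ := comp_isTangle (er_isTangle hk) fun _ => t k
  have iso := er_zeroMinus_isotopy hk (t k) (f k)
  have iso₁ := er_stack_isotopy (k := k) (n := 1) hk
  have iso₂ : Nonempty (Isotopy ((er (Col.box k) Col.zeroMinus).comp fun _ => stack k k)
      (tangleT k Col.zeroMinus)) := by
    rw [stack_self]
    exact comp_incl_isotopy (er_zeroMinus_isTangle hk) draw_loopFree fun _ => incl_isTangle le_rfl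
  constructor
  · exact (Implies.er_zeroMinus le_rfl (implies_of_isotopy_symm (t _) iso₁)).trans
      ((implies_of_isotopy_symm (comp_isTangle (er_zeroMinus_isTangle le_rfl) fun _ => tE₁)
        iso).trans (implies_of_isotopy tE iso₂))
  · exact (implies_of_isotopy_symm (tangleT_zeroMinus_isTangle hk) iso₂).trans
      ((implies_of_isotopy tE iso).trans
        (Implies.er_zeroMinus le_rfl (implies_of_isotopy tE₁ iso₁)))

theorem one_zeroMinus_implies (hk : 1 ≤ k) :
    Implies k (one Col.zeroMinus) (tangleT k Col.zeroMinus) := by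
  refine Implies.trans (implies_of_matching_lt (one_isTangle_of_size_eq_zero _ (Eq.refl 0))
    (comp_isTangle (er_zeroMinus_isTangle le_rfl) fun _ => one_isTangle 1)
    fun i _ hi => absurd hi (Nat.not_lt_zero i)) ?_
  exact (Implies.er_zeroMinus le_rfl (one_implies_stack hk 1)).trans
    (er_zeroMinus_stack_implies hk).1

theorem incl_zeroMinus_implies (hk : 1 ≤ k) :
    Implies k ((incl Col.zeroMinus (Col.box 1)).comp fun _ => tangleT k Col.zeroMinus)
      (stack k 1) := by
  have t := stack_isTangle hk
  refine (Implies.incl_zeroMinus (er_zeroMinus_stack_implies hk).2).trans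
    ((implies_of_isotopy ?_ (incl_er_zeroMinus_isotopy (t 1) (stack_full hk 1))).trans
      (el_stack_implies hk 1 le_rfl))
  exact comp_isTangle incl_zeroMinus_isTangle fun _ =>
    comp_isTangle (er_zeroMinus_isTangle le_rfl) fun _ => t 1

theorem mul_zeroMinus_implies (hk : 1 ≤ k) :
    Implies k (mulComp Col.zeroMinus (tangleT k Col.zeroMinus) (tangleT k Col.zeroMinus))
      (tangleT k Col.zeroMinus) := by
  have t := stack_isTangle hk
  have t₀ := tangleT_zeroMinus_isTangle hk
  obtain ⟨e₁, e₂⟩ := er_zeroMinus_stack_implies hk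
  refine (Implies.mul_zeroMinus e₂ (Implies.rfl t₀)).trans ((implies_of_isotopy ?_
    (mul_er_zeroMinus_isotopy (t 1) t₀ (stack_full hk 1) tangleT_zeroMinus_full)).trans
    ((Implies.er_zeroMinus le_rfl ((Implies.mul (by omega) (by omega) (by omega)
      (Implies.rfl (t 1)) (incl_zeroMinus_implies hk)).trans
        (incl_mul_stack_implies hk 1).2)).trans e₁))
  exact mulComp_isTangle (mul_isTangle_of_size_eq_zero (Eq.refl 0))
    (comp_isTangle (er_zeroMinus_isTangle le_rfl) fun _ => t 1) t₀

end

end Skein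

open Skein Skein.Diagram in
theorem theorem3p2 (k : ℕ) (hk : 1 ≤ k) :
    Implies k (one (Col.box k)) (tangleT k (Col.box k)) ∧
    Implies k (incl (Col.box k) (Col.box (k + 1))) (tangleT k (Col.box (k + 1))) ∧
    (∀ c : Col, Implies k ((er c.succ c).comp fun _ => tangleT k c.succ) (tangleT k c)) ∧
    (∀ n : ℕ, k ≤ n →
      Implies k ((incl (Col.box n) (Col.box (n + 1))).comp fun _ => tangleT k (Col.box n))
        (tangleT k (Col.box (n + 1)))) ∧
    (∀ n : ℕ, k ≤ n →
      Implies k (incl (Col.box k) (Col.box n)) (tangleT k (Col.box n)) ∧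
      Implies k (one (Col.box n)) (tangleT k (Col.box n))) ∧
    (∀ n : ℕ, k ≤ n →
      Implies k (mulComp (Col.box n) (tangleT k (Col.box n)) (tangleT k (Col.box n)))
        (tangleT k (Col.box n))) ∧
    (Implies k (one (Col.box 0)) (tangleT k (Col.box 0)) ∧
      Implies k (one Col.zeroMinus) (tangleT k Col.zeroMinus) ∧
      ∀ n : ℕ, 2 ≤ n → Implies k (jones n) (tangleT k (Col.box n))) ∧
    (∀ n : ℕ, k ≤ n → ∀ Q : Diagram (Col.box n), Q.IsTangle → IsEmpty Q.Box →
      Implies k Q (tangleT k (Col.box n))) ∧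
    (∀ n : ℕ, k ≤ n →
      Implies k ((shift n).comp fun _ => tangleT k (Col.box n)) (tangleT k (Col.box (n + 2)))) ∧
    (∀ n : ℕ, 1 ≤ n →
      Implies k ((el n).comp fun _ => tangleT k (Col.box n)) (tangleT k (Col.box n))) ∧
    (∀ c : Col, Implies k ((incl c c.succ).comp fun _ => tangleT k c) (tangleT k c.succ)) ∧
    (∀ c : Col, Implies k (mulComp c (tangleT k c) (tangleT k c)) (tangleT k c)) := by
  refine ⟨one_implies_stack_self hk, incl_implies_stack hk (Nat.le_succ k), ?_,
    fun n hn => inclComp_stack_implies_of_le hk hn,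
    fun n hn => ⟨incl_implies_stack hk hn, one_implies_stack_of_le hk hn⟩,
    fun n _ => (incl_mul_stack_implies hk n).2,
    ⟨one_implies_stack hk 0, one_zeroMinus_implies hk, fun n hn => jones_implies_stack hk hn⟩,
    fun n _ => tl_implies_stack hk n, fun n hn => shift_stack_implies hk hn,
    fun n hn => el_stack_implies hk n hn, ?_, ?_⟩
  · rintro (n | _)
    · exact er_stack_implies hk n
    · exact (er_zeroMinus_stack_implies hk).1
  · rintro (n | _)
    · exact (incl_mul_stack_implies hk n).1
    · exact incl_zeroMinus_implies hk
  · rintro (n | _)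
    · exact (incl_mul_stack_implies hk n).2
    · exact mul_zeroMinus_implies hk
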